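/- Let $M$ be a smooth (Hausdorff) manifold with a smooth torsion-free connection $\nabla$, let $o\in M$, and let $\mathfrak g\subset\mathfrak{gl}(T_oM)$ be the holonomy algebra at $o$ (the Lie algebra of the restricted holonomy group). Suppose $T_oM=V_1\oplus V_2$ with $V_1,V_2$ invariant under $\mathfrak g$ and both faithful as representations of $\mathfrak g$. Fix bases $b_1=(b_1^i)_{i\le n_1}$ of $V_1$ and $b_2=(b_2^i)_{i\le n_2}$ of $V_2$. For an open set $U\ni o$, let $D_1,D_2$ be the distributions on $U$ obtained by transporting $V_1,V_2$ parallelly inside $U$, and let $\mathcal F_i(p)$ be the set of points of $U$ that can be joined to $p$ by a piecewise $C^1$ path in $U$ tangent to $D_i$. Call $U$ a product neighbourhood of $o$ if it is the domain of a smooth chart onto a product $B_1\times B_2$ of convex open sets $B_i\subset\mathbb R^{n_i}$ in which $D_1$ and $D_2$ are the tangent spaces of the slices $B_1\times\{b\}$ and $\{a\}\times B_2$. Flat coordinates on a leaf are coordinates with $\nabla_{\partial_i}\partial_j=0$ for all $i,j$. Let $x_o,y_o$ denote flat coordinates on $\mathcal F_1(o),\mathcal F_2(o)$ with $\partial_{x_o^i}(o)=b_1^i$,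 $\partial_{y_o^i}(o)=b_2^i$; for $r\in\mathcal F_2(o)$ let $x_r$ denote flat coordinates on $\mathcal F_1(r)$ such that $\partial_{x_r^i}(r)$ is the parallel transport of $b_1^i$ along $\mathcal F_2(o)$; for $q\in\mathcal F_1(o)$ let $y_q$ denote flat coordinates on $\mathcal F_2(q)$ such that $\partial_{y_q^i}(q)$ is the parallel transport of $b_2^i$ along $\mathcal F_1(o)$. (a) Every neighbourhood of $o$ contains a product neighbourhood of $o$ on which flat coordinates $x_o$, $y_o$, $x_r$, $y_q$ exist for all $r\in\mathcal F_2(o)$, $q\in\mathcal F_1(o)$. Now let $U$ be any product neighbourhood of $o$. (b) For each $p\in U$ there are a unique $q\in\mathcal F_1(o)\cap\mathcal F_2(p)$ and a unique $r\in\mathcal F_2(o)\cap\mathcal F_1(p)$. A rectangle with far corner $p$ is a piecewise $C^1$ loop $\gamma=\gamma_1\gamma_2\gamma_3\gamma_4$ (first $\gamma_1$) with $\gamma_1$ a path in $\mathcal F_1(o)$ from $o$ to $q$, $\gamma_2$ in $\mathcal F_2(p)$ from $q$ to $p$, $\gamma_3$ in $\mathcal F_1(p)$ from $p$ to $r$,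 and $\gamma_4$ in $\mathcal F_2(o)$ from $r$ to $o$. Such rectangles exist, and the parallel transport $\tau_\gamma$ depends only on $p$. (c) Given flat coordinates $x_o$ and $y_o$ as above, $p\mapsto(x_o(q),y_o(r))$ is a smooth coordinate system $(x_o,y_o)$ on $U$, with image the product of the images of $x_o$ and $y_o$. For every rectangle $\gamma$ with far corner $p$ and all flat coordinates $x_r,y_q$ as above, $$\tau_{\gamma_1\gamma_2}(b_1^i)=\partial_{x_o^i,p},\quad \tau_{\gamma_3\gamma_4}^{-1}(b_1^i)=\partial_{x_r^i,p},\quad \tau_{\gamma_1\gamma_2}(b_2^i)=\partial_{y_q^i,p},\quad \tau_{\gamma_3\gamma_4}^{-1}(b_2^i)=\partial_{y_o^i,p},$$ $$\tau_\gamma(b_1^i)=\sum_j\frac{\partial x_r^j}{\partial x_o^i}(p)\,b_1^j,\qquad \tau_\gamma(b_2^i)=\sum_j\frac{\partial y_o^j}{\partial y_q^i}(p)\,b_2^j .$$ (d) The holonomy group at $o$ of the restriction of $\nabla$ to $U$ coincides with its restricted holonomy group and is generated, as a group, by the transports $\tau_\gamma$ around rectangles $\gamma$ in $U$. -/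

import Mathlib

open Set Filter Topology Bundle
open scoped Manifold ContDiff

noncomputable section

namespace BiFoliation

section Connection

variable {E : Type*} [NormedAddCommGroup E] [NormedSpace ℝ E]
  {M : Type*} [TopologicalSpace M] [ChartedSpace E M]

/-- `c : ℝ → M` restricts to a piecewise `C^1` curve on `[a, b]`: away from a finite set of break
points, `c` is `C^1` (up to the end points) on every closed subinterval. In particular `c` is
continuous on `[a, b]` when `a < b`. -/
def PiecewiseC1On (c : ℝ → M) (a b : ℝ) : Prop :=
  ∃ S : Finset ℝ, ∀ s t : ℝ, a ≤ s → s < t → t ≤ b → (∀ u ∈ Ioo s t, u ∉ S) →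
    ContMDiffOn 𝓘(ℝ, ℝ) 𝓘(ℝ, E) 1 c (Icc s t)

/-- The velocity vector of a curve in `M`. -/
def velocity (c : ℝ → M) (t : ℝ) : TangentSpace 𝓘(ℝ, E) (c t) :=
  mfderiv 𝓘(ℝ, ℝ) 𝓘(ℝ, E) c t (1 : ℝ)

variable [IsManifold 𝓘(ℝ, E) ∞ M]
  (cov : CovariantDerivative 𝓘(ℝ, E) E (TangentSpace 𝓘(ℝ, E) : M → Type _))

/-- A curve `X : ℝ → TM` is a vector field along its base curve `c t = (X t).proj`.
`HasCovDerivAlongAt cov X t w` says that the covariant derivative of this field along `c` exists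
at the parameter `t` and is `w`: near `t` one can write `X = ∑ fᵢ · (σᵢ ∘ c)` with functions `fᵢ` of
the parameter and vector fields `σᵢ` on `M`, and `w = ∑ (fᵢ' σᵢ + fᵢ ∇_{c'} σᵢ)`. -/
def HasCovDerivAlongAt (X : ℝ → TangentBundle 𝓘(ℝ, E) M) (t : ℝ)
    (w : TangentSpace 𝓘(ℝ, E) (X t).proj) : Prop :=
  MDifferentiableAt 𝓘(ℝ, ℝ) 𝓘(ℝ, E) (fun s => (X s).proj) t ∧
  ∃ (k : ℕ) (f : Fin k → ℝ → ℝ) (f' : Fin k → ℝ)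
    (σ : Fin k → (x : M) → TangentSpace 𝓘(ℝ, E) x),
    (∀ i, HasDerivAt (f i) (f' i) t) ∧
    (∀ i, MDifferentiableAt 𝓘(ℝ, E) (𝓘(ℝ, E).prod 𝓘(ℝ, E))
      (fun x => (⟨x, σ i x⟩ : TangentBundle 𝓘(ℝ, E) M)) (X t).proj) ∧
    (∀ᶠ s in 𝓝 t, (X s).2 = ∑ i, f i s • σ i (X s).proj) ∧
    w = ∑ i, (f' i • σ i (X t).proj +
      f i t • cov (σ i) (X t).proj (velocity (fun s => (X s).proj) t))

/-- The vector field `X` along its base curve is parallel on `[a, b]`: it is continuous, and its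
covariant derivative exists and vanishes at all but finitely many parameters (the corners). -/
def IsParallelOn (X : ℝ → TangentBundle 𝓘(ℝ, E) M) (a b : ℝ) : Prop :=
  ContinuousOn X (Icc a b) ∧ {t ∈ Ioo a b | ¬ HasCovDerivAlongAt cov X t 0}.Finite

/-- Parallel transport along `c` restricted to `[a, b]` (from `c a` to `c b`) takes `v` to `w`. -/
def Transports (c : ℝ → M) (a b : ℝ) (v w : TangentBundle 𝓘(ℝ, E) M) : Prop :=
  ∃ X : ℝ → TangentBundle 𝓘(ℝ, E) M, (∀ t ∈ Icc a b, (X t).proj = c t) ∧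
    IsParallelOn cov X a b ∧ X a = v ∧ X b = w

/-- `c`, restricted to `[0, 1]`, is a piecewise `C^1` path from `p` to `q` inside `U`. -/
structure IsPathIn (U : Set M) (p q : M) (c : ℝ → M) : Prop where
  piecewise : PiecewiseC1On (E := E) c 0 1
  mem : ∀ t ∈ Icc (0 : ℝ) 1, c t ∈ U
  source : c 0 = p
  target : c 1 = q

/-- The loop `c` at `o` is contractible in `U` (with end points fixed). -/
def IsNullHomotopicIn (U : Set M) (o : M) (c : ℝ → M) : Prop :=
  ∃ H : ℝ × ℝ → M, ContinuousOn H (Icc 0 1 ×ˢ Icc 0 1) ∧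
    (∀ s ∈ Icc (0 : ℝ) 1, ∀ t ∈ Icc (0 : ℝ) 1, H (s, t) ∈ U) ∧
    (∀ t ∈ Icc (0 : ℝ) 1, H (0, t) = c t ∧ H (1, t) = o) ∧
    (∀ s ∈ Icc (0 : ℝ) 1, H (s, 0) = o ∧ H (s, 1) = o)

/-- The holonomy group at `o` of the connection restricted to `U`: the parallel transports along
piecewise `C^1` loops at `o` inside `U`. -/
def holonomy (U : Set M) (o : M) :
    Set (TangentSpace 𝓘(ℝ, E) o ≃ₗ[ℝ] TangentSpace 𝓘(ℝ, E) o) :=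
  {L | ∃ c : ℝ → M, IsPathIn (E := E) U o o c ∧
    ∀ v, Transports cov c 0 1 ⟨o, v⟩ ⟨o, L v⟩}

/-- The restricted holonomy group at `o` of the connection restricted to `U`: only loops that are
contractible in `U` are used. -/
def restrictedHolonomy (U : Set M) (o : M) :
    Set (TangentSpace 𝓘(ℝ, E) o ≃ₗ[ℝ] TangentSpace 𝓘(ℝ, E) o) :=
  {L | ∃ c : ℝ → M, IsPathIn (E := E) U o o c ∧ IsNullHomotopicIn U o c ∧
    ∀ v, Transports cov c 0 1 ⟨o, v⟩ ⟨o, L v⟩}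

/-- The holonomy algebra at `o`, i.e. the Lie algebra of the restricted holonomy group of `M`:
the endomorphisms `A` of `T_o M` such that `exp (t A)` lies in this group for every real `t`.
(The tangent space `T_o M` is, as a topological vector space, the model space `E`.) -/
def holonomyAlgebra (o : M) :
    Set (TangentSpace 𝓘(ℝ, E) o →L[ℝ] TangentSpace 𝓘(ℝ, E) o) :=
  {A | ∀ t : ℝ, ∃ L ∈ restrictedHolonomy cov univ o,
    ∀ v, L v = (NormedSpace.exp (t • (show E →L[ℝ] E from A)) : E →L[ℝ] E) v}

/-- `V` is a subrepresentation of the holonomy algebra at `o`, and it is faithful. -/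
structure IsFaithfulSubrep (o : M) (V : Submodule ℝ (TangentSpace 𝓘(ℝ, E) o)) : Prop where
  invariant : ∀ A ∈ holonomyAlgebra cov o, ∀ v ∈ V, A v ∈ V
  faithful : ∀ A ∈ holonomyAlgebra cov o, (∀ v ∈ V, A v = 0) → A = 0

/-- The distribution on `U` obtained from `V ⊆ T_o M` by parallel transport inside `U`
(at each point, the span of the transports of `V` along paths in `U`). -/
def parallelDistribution (U : Set M) (o : M) (V : Submodule ℝ (TangentSpace 𝓘(ℝ, E) o))
    (x : M) : Submodule ℝ (TangentSpace 𝓘(ℝ, E) x) :=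
  Submodule.span ℝ {w | ∃ c : ℝ → M, IsPathIn (E := E) U o x c ∧
    ∃ v ∈ V, Transports cov c 0 1 ⟨o, v⟩ ⟨x, w⟩}

/-- The leaf through `p` of the foliation of `U` obtained from `V ⊆ T_o M`: the points which can be
joined to `p` by a piecewise `C^1` path in `U` tangent to the parallel distribution. -/
def leaf (U : Set M) (o : M) (V : Submodule ℝ (TangentSpace 𝓘(ℝ, E) o)) (p : M) : Set M :=
  {x | ∃ c : ℝ → M, IsPathIn (E := E) U p x c ∧
    {t ∈ Ioo (0 : ℝ) 1 | velocity c t ∉ parallelDistribution cov U o V (c t)}.Finite}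

/-- `U` is a product neighbourhood of `o` for the two parallel foliations: it is the domain of a
smooth chart onto a product of two convex open sets, in which the distributions obtained
from `V₁` and `V₂` are the tangent spaces of the two families of slices. -/
def IsProductNeighbourhood (n₁ n₂ : ℕ) (o : M) (V₁ V₂ : Submodule ℝ (TangentSpace 𝓘(ℝ, E) o))
    (U : Set M) : Prop :=
  o ∈ U ∧
  ∃ (Φ : OpenPartialHomeomorph M ((Fin n₁ → ℝ) × (Fin n₂ → ℝ)))
    (B₁ : Set (Fin n₁ → ℝ)) (B₂ : Set (Fin n₂ → ℝ)),
    Convex ℝ B₁ ∧ Convex ℝ B₂ ∧ Φ.source = U ∧ Φ.target = B₁ ×ˢ B₂ ∧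
    ContMDiffOn 𝓘(ℝ, E) 𝓘(ℝ, (Fin n₁ → ℝ) × (Fin n₂ → ℝ)) ∞ Φ Φ.source ∧
    ContMDiffOn 𝓘(ℝ, (Fin n₁ → ℝ) × (Fin n₂ → ℝ)) 𝓘(ℝ, E) ∞ Φ.symm Φ.target ∧
    ∀ x ∈ U, ∀ v : TangentSpace 𝓘(ℝ, E) x,
      letI dΦ : (Fin n₁ → ℝ) × (Fin n₂ → ℝ) :=
        mfderiv 𝓘(ℝ, E) 𝓘(ℝ, (Fin n₁ → ℝ) × (Fin n₂ → ℝ)) Φ x v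
      (v ∈ parallelDistribution cov U o V₁ x ↔ dΦ.2 = 0) ∧
      (v ∈ parallelDistribution cov U o V₂ x ↔ dΦ.1 = 0)

/-- For a parametrization `φ` (the inverse of a coordinate system) by an open subset of `ℝⁿ`, the
`i`-th coordinate vector field at the point `φ a`, as an element of the tangent bundle. -/
def coordVec {n : ℕ} (φ : (Fin n → ℝ) → M) (a : Fin n → ℝ) (i : Fin n) :
    TangentBundle 𝓘(ℝ, E) M :=
  tangentMap 𝓘(ℝ, Fin n → ℝ) 𝓘(ℝ, E) φ ⟨a, (Pi.single i 1 : Fin n → ℝ)⟩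

/-- `x = (x¹, …, xⁿ)` is a flat coordinate system on the immersed submanifold `L` (a leaf):
a bijection of `L` onto an open subset of `ℝⁿ` whose inverse is a smooth immersion, with
`∇_{∂ᵢ} ∂ⱼ = 0` for all `i, j`. -/
structure IsFlatCoord {n : ℕ} (L : Set M) (x : PartialEquiv M (Fin n → ℝ)) : Prop where
  source_eq : x.source = L
  isOpen_target : IsOpen x.target
  smooth_symm : ContMDiffOn 𝓘(ℝ, Fin n → ℝ) 𝓘(ℝ, E) ∞ x.symm x.target
  immersion : ∀ a ∈ x.target,
    Function.Injective (mfderiv 𝓘(ℝ, Fin n → ℝ) 𝓘(ℝ, E) x.symm a)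
  flat : ∀ a ∈ x.target, ∀ i j : Fin n,
    HasCovDerivAlongAt cov (fun s : ℝ => coordVec (E := E) x.symm (a + s • Pi.single i 1) j) 0 0

/-- Flat coordinates on the leaf of `V` through `r`, where `r` lies on the leaf of `V'` through `o`,
normalized by the basis `b` of `V`: the coordinate vectors at `r` are the parallel transports
of the `b i` along a path from `o` to `r` in the leaf of `V'` through `o`. -/
def IsFlatCoordAt {n : ℕ} (U : Set M) (o : M) (V V' : Submodule ℝ (TangentSpace 𝓘(ℝ, E) o))
    (b : Module.Basis (Fin n) ℝ V) (r : M) (x : PartialEquiv M (Fin n → ℝ)) : Prop :=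
  IsFlatCoord cov (leaf cov U o V r) x ∧
  ∃ c : ℝ → M, IsPathIn (E := E) (leaf cov U o V' o) o r c ∧
    ∀ i, Transports cov c 0 1 ⟨o, b i⟩ (coordVec (E := E) x.symm (x r) i)

/-- Flat coordinates on the leaf of `V` through `o` whose coordinate vectors at `o` are the `b i`. -/
def IsFlatCoordOrigin {n : ℕ} (U : Set M) (o : M) (V : Submodule ℝ (TangentSpace 𝓘(ℝ, E) o))
    (b : Module.Basis (Fin n) ℝ V) (x : PartialEquiv M (Fin n → ℝ)) : Prop :=
  IsFlatCoord cov (leaf cov U o V o) x ∧ ∀ i, coordVec (E := E) x.symm (x o) i = ⟨o, b i⟩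

/-- The loop `γ = γ₁γ₂γ₃γ₄` at `o` (on `[0, 1]`, subdivided at `t₁ ≤ t₂ ≤ t₃`) is a "rectangle" in
`U` with far corner `p`: `γ₁` lies in the `V₁`-leaf of `o`, `γ₂` in the `V₂`-leaf of `p` and
ends at `p`, `γ₃` lies in the `V₁`-leaf of `p` and `γ₄` in the `V₂`-leaf of `o`. -/
structure IsRectangle (U : Set M) (o : M) (V₁ V₂ : Submodule ℝ (TangentSpace 𝓘(ℝ, E) o))
    (p : M) (γ : ℝ → M) (t₁ t₂ t₃ : ℝ) : Prop where
  zero_le : 0 ≤ t₁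
  le₁₂ : t₁ ≤ t₂
  le₂₃ : t₂ ≤ t₃
  le_one : t₃ ≤ 1
  loop : IsPathIn (E := E) U o o γ
  corner : γ t₂ = p
  side₁ : ∀ t ∈ Icc 0 t₁, γ t ∈ leaf cov U o V₁ o
  side₂ : ∀ t ∈ Icc t₁ t₂, γ t ∈ leaf cov U o V₂ p
  side₃ : ∀ t ∈ Icc t₂ t₃, γ t ∈ leaf cov U o V₁ p
  side₄ : ∀ t ∈ Icc t₃ 1, γ t ∈ leaf cov U o V₂ o

/-- The coordinate system `Θ = (x_o, y_o)` on `U` obtained from flat coordinates `xo`, `yo` on the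
two leaves through `o`: the coordinates of `p` are those of the intersection points `q` of the
`V₁`-leaf of `o` with the `V₂`-leaf of `p`, and `r` of the `V₂`-leaf of `o` with the
`V₁`-leaf of `p`. -/
structure IsProductCoord {n₁ n₂ : ℕ} (U : Set M) (o : M)
    (V₁ V₂ : Submodule ℝ (TangentSpace 𝓘(ℝ, E) o))
    (xo : PartialEquiv M (Fin n₁ → ℝ)) (yo : PartialEquiv M (Fin n₂ → ℝ))
    (Θ : OpenPartialHomeomorph M ((Fin n₁ → ℝ) × (Fin n₂ → ℝ))) : Prop where
  source_eq : Θ.source = U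
  target_eq : Θ.target = xo.target ×ˢ yo.target
  smooth : ContMDiffOn 𝓘(ℝ, E) 𝓘(ℝ, (Fin n₁ → ℝ) × (Fin n₂ → ℝ)) ∞ Θ Θ.source
  smooth_symm : ContMDiffOn 𝓘(ℝ, (Fin n₁ → ℝ) × (Fin n₂ → ℝ)) 𝓘(ℝ, E) ∞ Θ.symm Θ.target
  fst_eq : ∀ p ∈ U, ∀ q ∈ leaf cov U o V₁ o ∩ leaf cov U o V₂ p, (Θ p).1 = xo q
  snd_eq : ∀ p ∈ U, ∀ r ∈ leaf cov U o V₂ o ∩ leaf cov U o V₁ p, (Θ p).2 = yo r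

end Connection

end BiFoliation

end

open BiFoliation

/-! In a product chart the two distributions are constant complementary subspaces `W`, `W'`, and the
Christoffel symbols preserve both. Vanishing torsion gives Γ(u, w) = Γ(w, u), which for u in `W` and
w in `W'` lies in both subspaces and hence is zero (`IsBiparallel.mixed_eq_zero`). So, in the chart,
vectors of one factor are carried unchanged along the leaves of the other, and a loop inside a leaf
tangent to `W` acts trivially on `W'`. Apply this to shrinking triangles in the leaf: the velocity
of their transports belongs to the holonomy algebra and kills `W'`, so it vanishes by faithfulness.
The leaves are therefore flat (`IsBiparallel.fderiv_segmentTransport`): transport inside a leaf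
depends only on the end points, the transport around a rectangle only on its far corner, and flat
coordinate fields are the parallel ones.

The formulas follow. At `p` the field of x_o is the transport of b₁ through q, because its last leg
changes nothing in the chart, while the field of x_r is the transport of b₁ through r. The matrix
between the two frames is both the Jacobian and the matrix of the transport around the rectangle;
the second factor is symmetric (`exists_jacobian₁`, `exists_jacobian₂`).

For the generation of the holonomy group, let Q(y) be the transport from `o` to y through the lower
corner and τ(y) the transport around the rectangle. Q is parallel in the second direction, the
transport through the upper corner is parallel in the first, and they differ by τ. In the gauge Q
the frame along an arbitrary loop thus solves an equation whose coefficient is, up to sign, τ⁻¹ dτ,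
a velocity of curves in the group generated by rectangles; its solution cannot leave that group
(`IsBiparallel.coordHolonomy_subset`).

No Lie structure on holonomy groups is needed. For a mere group of operators, the velocities at 1 of
`C^2` curves form a vector space, and products of such curves give a slice. Picard–Lindelöf in this
slice shows that U' = A U stays in the group when all A are velocities
(`mem_of_deriv_eq_velocity_mul`). In particular exponentials of velocities lie in the group, which
is how the hypotheses on the holonomy algebra are brought to bear.

Existence of product neighbourhoods starts from any chart with convex image. Transport `W` and `W'`
along segments from `o`; since the holonomy algebra preserves both and torsion vanishes, the
resulting distributions are integrable. Their first integrals form a straightening chart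
(`exists_straightening`), and transport along any path respects the distributions
(`IsParallelCurve.mem_transported`). On a small ball the parallel coframe of a slice is closed by
torsion-freeness; integrating it gives flat coordinates, injective because their differential is
close to the identity (`IsBiparallel.exists_isFlatParam`).

Smooth dependence of transports on end points comes from the inverse function theorem in the Banach
space of continuous paths (`exists_smooth_flow`), and the Frobenius theorem from solving the
equation along rays. -/

noncomputable section

set_option linter.unusedSectionVars false

namespace BiFoliation

/-! ### Uniqueness for differential inequalities with exceptional parameters -/

section ODE

/-- Additivity in the interval reduces a statement about `[a, b]` to intervals without
break points in their interior. -/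
lemma interval_induction {Q : ℝ → ℝ → Prop}
    (trans : ∀ a b c, a < b → b < c → Q a b → Q b c → Q a c) (S : Finset ℝ) :
    ∀ a b, a < b →
      (∀ s t, a ≤ s → s < t → t ≤ b → (∀ u ∈ Ioo s t, u ∉ S) → Q s t) → Q a b := by
  induction S using Finset.induction_on with
  | empty => exact fun a b hab h => h a b le_rfl hab le_rfl (by simp)
  | insert x S _ ih =>
    intro a b hab h
    -- A break point outside the open interval imposes nothing; one inside splits the interval, and
    -- only the points of `S` remain relevant in each half.
    by_cases hx : x ∈ Ioo a b
    · refine trans a x b hx.1 hx.2 (ih a x hx.1 ?_) (ih x b hx.2 ?_)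
      · intro s t hs hst ht hu
        refine h s t hs hst (ht.trans hx.2.le) fun u hu' => ?_
        rw [Finset.mem_insert, not_or]
        exact ⟨(hu'.2.trans_le ht).ne, hu u hu'⟩
      · intro s t hs hst ht hu
        refine h s t (hx.1.le.trans hs) hst ht fun u hu' => ?_
        rw [Finset.mem_insert, not_or]
        exact ⟨(hs.trans_lt hu'.1).ne', hu u hu'⟩
    · refine ih a b hab fun s t hs hst ht hu => h s t hs hst ht fun u hu' => ?_
      rw [Finset.mem_insert, not_or]
      refine ⟨?_, hu u hu'⟩
      rintro rfl
      exact hx ⟨hs.trans_lt hu'.1, hu'.2.trans_le ht⟩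

variable {Y : Type*} [NormedAddCommGroup Y] [NormedSpace ℝ Y]

/-- Grönwall's inequality wants a right derivative at the initial point, which is not available at
`a`. It is applied from s > a instead, and s → a uses only continuity. -/
lemma eq_zero_of_norm_deriv_le_of_Ioo {Z : ℝ → Y} {C a b : ℝ} (hZ : ContinuousOn Z (Icc a b))
    (hd : ∀ t ∈ Ioo a b, ∃ z, HasDerivAt Z z t ∧ ‖z‖ ≤ C * ‖Z t‖) (h0 : Z a = 0) :
    ∀ t ∈ Icc a b, Z t = 0 := by
  intro u hu
  rcases hu.1.eq_or_lt with rfl | hau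
  · exact h0
  have key : ∀ s ∈ Ioo a u, ‖Z u‖ ≤ ‖Z s‖ * Real.exp (C * (u - s)) := by
    intro s hs
    have := norm_le_gronwallBound_of_norm_deriv_right_le (f := Z) (f' := fun t => deriv Z t)
      (δ := ‖Z s‖) (K := C) (ε := 0) (a := s) (b := u)
      (hZ.mono (Icc_subset_Icc hs.1.le hu.2)) ?_ le_rfl ?_ u ⟨hs.2.le, le_rfl⟩
    · rwa [gronwallBound_ε0] at this
    · intro x hx
      obtain ⟨z, hz, -⟩ := hd x ⟨hs.1.trans_le hx.1, hx.2.trans_le hu.2⟩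
      rw [hz.deriv]; exact hz.hasDerivWithinAt
    · intro x hx
      obtain ⟨z, hz, hz'⟩ := hd x ⟨hs.1.trans_le hx.1, hx.2.trans_le hu.2⟩
      simpa [hz.deriv] using hz'
  have hlim : Tendsto (fun s => ‖Z s‖ * Real.exp (C * (u - s))) (𝓝[>] a)
      (𝓝 (‖Z a‖ * Real.exp (C * (u - a)))) := by
    have h1 : Tendsto Z (𝓝[>] a) (𝓝 (Z a)) :=
      ((hZ a ⟨le_rfl, hu.1.trans hu.2⟩).mono_of_mem_nhdsWithin
        (Icc_mem_nhdsGE (hau.trans_le hu.2))).mono_left (nhdsWithin_mono _ Ioi_subset_Ici_self)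
    refine h1.norm.mul ?_
    have : Continuous fun s => Real.exp (C * (u - s)) := by fun_prop
    exact (this.tendsto a).mono_left nhdsWithin_le_nhds
  have : ‖Z u‖ ≤ ‖Z a‖ * Real.exp (C * (u - a)) :=
    ge_of_tendsto hlim (Filter.mem_of_superset (Ioo_mem_nhdsGT hau) key)
  simpa [h0] using this

/-- Uniqueness for linear differential inequalities with finitely many exceptional parameters. -/
lemma eq_zero_of_norm_deriv_le {Z : ℝ → Y} {C a b : ℝ} {S : Set ℝ} (hS : S.Finite)
    (hZ : ContinuousOn Z (Icc a b))
    (hd : ∀ t ∈ Ioo a b, t ∉ S → ∃ z, HasDerivAt Z z t ∧ ‖z‖ ≤ C * ‖Z t‖) (h0 : Z a = 0) :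
    ∀ t ∈ Icc a b, Z t = 0 := by
  intro u hu
  rcases (hu.1.trans hu.2).eq_or_lt with rfl | hab
  · rw [le_antisymm hu.2 hu.1, h0]
  refine interval_induction (Q := fun s t => Z s = 0 → ∀ u ∈ Icc s t, Z u = 0) ?_ hS.toFinset
    a b hab ?_ h0 u hu
  · intro a b c hab hbc h1 h2 h u hu
    have hb := h1 h b ⟨hab.le, le_rfl⟩
    rcases le_total u b with hub | hub
    · exact h1 h u ⟨hu.1, hub⟩
    · exact h2 hb u ⟨hub, hu.2⟩
  · intro s t hs hst ht hu h
    refine eq_zero_of_norm_deriv_le_of_Ioo (C := C) (hZ.mono (Icc_subset_Icc hs ht))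
      (fun x hx => ?_) h
    exact hd x ⟨hs.trans_lt hx.1, hx.2.trans_le ht⟩ (by simpa using hu x hx)

/-- A continuous function whose derivative vanishes off a finite set is constant. -/
lemma eq_of_deriv_eq_zero_off_finite {Z : ℝ → Y} {a b : ℝ} {S : Set ℝ} (hS : S.Finite)
    (hZ : ContinuousOn Z (Icc a b)) (hd : ∀ t ∈ Ioo a b, t ∉ S → HasDerivAt Z 0 t) :
    ∀ t ∈ Icc a b, Z t = Z a := by
  intro t ht
  have := eq_zero_of_norm_deriv_le (Z := fun t => Z t - Z a) (C := 0) hS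
    (hZ.sub continuousOn_const) (fun t ht hts => ⟨0, by simpa using (hd t ht hts).sub_const (Z a),
      by simp⟩) (by simp) t ht
  exact sub_eq_zero.1 this

end ODE

/-! ### Superposition operators on spaces of continuous functions -/

section Nemytskii

universe u
variable {Y Y' : Type u} [NormedAddCommGroup Y] [NormedSpace ℝ Y]
  [NormedAddCommGroup Y'] [NormedSpace ℝ Y']

set_option synthInstance.maxHeartbeats 200000

variable {K : Type*} [TopologicalSpace K] [CompactSpace K]

instance : NormedAddCommGroup C(K, Y) := ContinuousMap.instNormedAddCommGroup
instance : NormedSpace ℝ C(K, Y) := ContinuousMap.normedSpace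
instance : NormedAddCommGroup C(K, Y →L[ℝ] Y') := ContinuousMap.instNormedAddCommGroup
instance : NormedSpace ℝ C(K, Y →L[ℝ] Y') := ContinuousMap.normedSpace
instance : NormedAddCommGroup (C(K, Y) →L[ℝ] C(K, Y')) :=
  ContinuousLinearMap.toNormedAddCommGroup
instance : NormedSpace ℝ (C(K, Y) →L[ℝ] C(K, Y')) := ContinuousLinearMap.toNormedSpace

/-- Pointwise application of a continuous family of operators to a continuous function. -/
def applyLinearMap : C(K, Y →L[ℝ] Y') →ₗ[ℝ] C(K, Y) →ₗ[ℝ] C(K, Y') :=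
  LinearMap.mk₂ ℝ (fun (B : C(K, Y →L[ℝ] Y')) (y : C(K, Y)) =>
      (⟨fun t => B t (y t), by fun_prop⟩ : C(K, Y')))
    (fun _ _ _ => by ext; simp) (fun _ _ _ => by ext; simp)
    (fun _ _ _ => by ext; simp) (fun _ _ _ => by ext; simp)

lemma norm_applyLinearMap_le (B : C(K, Y →L[ℝ] Y')) (y : C(K, Y)) :
    ‖(applyLinearMap B y : C(K, Y'))‖ ≤ 1 * ‖B‖ * ‖y‖ := by
  rw [one_mul, ContinuousMap.norm_le _ (mul_nonneg (norm_nonneg B) (norm_nonneg y))]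
  intro t
  exact (B t).le_of_opNorm_le_of_le (B.norm_coe_le_norm t) (y.norm_coe_le_norm t)

/-- Pointwise application of a continuous family of operators to a continuous function. -/
def applyCLM : C(K, Y →L[ℝ] Y') →L[ℝ] C(K, Y) →L[ℝ] C(K, Y') :=
  LinearMap.mkContinuous₂ applyLinearMap 1 norm_applyLinearMap_le

@[simp] lemma applyCLM_apply (B : C(K, Y →L[ℝ] Y')) (y : C(K, Y)) (t : K) :
    applyCLM B y t = B t (y t) := rfl

open Classical in
/-- The superposition operator `y ↦ f ∘ y` on continuous functions. -/
def superpose (f : Y → Y') (y : C(K, Y)) : C(K, Y') :=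
  -- The value 0 plays no role: the operator is only used where `y` takes its values in a set on
  -- which `f` is continuous.
  if h : Continuous (f ∘ y) then ⟨f ∘ y, h⟩ else 0

lemma superpose_apply {f : Y → Y'} {Ω : Set Y} (hf : ContinuousOn f Ω) {y : C(K, Y)}
    (hy : ∀ t, y t ∈ Ω) (t : K) : superpose f y t = f (y t) := by
  have : Continuous (f ∘ y) := hf.comp_continuous y.continuous hy
  simp [superpose, this]

lemma isOpen_setOf_forall_mem {Ω : Set Y} (hΩ : IsOpen Ω) :
    IsOpen {y : C(K, Y) | ∀ t, y t ∈ Ω} := by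
  have := ContinuousMap.isOpen_setOfPred_mapsTo (X := K) (Y := Y) isCompact_univ hΩ
  simpa [MapsTo] using this

/-- The range of `y` is compact, so the continuity of `f` at its points is uniform, also against
nearby points outside the range. -/
lemma continuousOn_superpose {f : Y → Y'} {Ω : Set Y} (hΩ : IsOpen Ω) (hf : ContinuousOn f Ω) :
    ContinuousOn (superpose f) {y : C(K, Y) | ∀ t, y t ∈ Ω} := by
  intro y hy
  refine ContinuousAt.continuousWithinAt ?_
  have hR : IsCompact (range y) := isCompact_range y.continuous
  rw [Metric.continuousAt_iff]
  intro ε hε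
  have h1 := hR.uniformContinuousAt_of_continuousAt f
    (fun a ha => by
      obtain ⟨t, rfl⟩ := ha
      exact hf.continuousAt (hΩ.mem_nhds (hy t))) (Metric.dist_mem_uniformity (half_pos hε))
  obtain ⟨δ, hδ, h2⟩ := Metric.mem_uniformity_dist.1 h1
  obtain ⟨δ', hδ', h3⟩ := Metric.isOpen_iff.1 (isOpen_setOf_forall_mem (K := K) hΩ) y hy
  refine ⟨min δ δ', lt_min hδ hδ', fun {x} hx => ?_⟩
  have hx' : ∀ t, x t ∈ Ω := h3 (hx.trans_le (min_le_right _ _))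
  refine lt_of_le_of_lt ((ContinuousMap.dist_le (half_pos hε).le).2 fun t => ?_) (half_lt_self hε)
  rw [superpose_apply hf hx', superpose_apply hf hy, dist_comm]
  have h4 : dist (y t) (x t) < δ := by
    rw [dist_comm]
    exact (ContinuousMap.dist_apply_le_dist t).trans_lt (hx.trans_le (min_le_left _ _))
  exact (h2 h4 (mem_range_self t)).le

/-- The mean value inequality is applied for each parameter separately; the estimate is uniform
because `fderiv ℝ f` is uniformly continuous near the compact range of `y`. -/
lemma hasFDerivAt_superpose {f : Y → Y'} {Ω : Set Y} (hΩ : IsOpen Ω) (hf : ContDiffOn ℝ 1 f Ω)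
    {y : C(K, Y)} (hy : ∀ t, y t ∈ Ω) :
    HasFDerivAt (superpose f) (applyCLM (superpose (fderiv ℝ f) y)) y := by
  have hf' : ContinuousOn (fderiv ℝ f) Ω := hf.continuousOn_fderiv_of_isOpen hΩ le_rfl
  have hR : IsCompact (range y) := isCompact_range y.continuous
  have hRΩ : range y ⊆ Ω := by rintro _ ⟨t, rfl⟩; exact hy t
  rw [hasFDerivAt_iff_isLittleO_nhds_zero, Asymptotics.isLittleO_iff]
  intro ε hε
  have h1 := hR.uniformContinuousAt_of_continuousAt (fderiv ℝ f)
    (fun a ha => hf'.continuousAt (hΩ.mem_nhds (hRΩ ha))) (Metric.dist_mem_uniformity hε)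
  obtain ⟨δ, hδ, h2⟩ := Metric.mem_uniformity_dist.1 h1
  obtain ⟨δ', hδ', h3⟩ := hR.exists_thickening_subset_open hΩ hRΩ
  refine Metric.eventually_nhds_iff.2 ⟨min δ δ', lt_min hδ hδ', fun {h} hh => ?_⟩
  rw [dist_zero_right] at hh
  have hball : ∀ t, Metric.ball (y t) (min δ δ') ⊆ Ω := fun t => by
    refine Subset.trans ?_ h3
    intro z hz
    exact Metric.mem_thickening_iff.2 ⟨y t, mem_range_self t, (Metric.mem_ball.1 hz).trans_le
      (min_le_right _ _)⟩
  have hht : ∀ t, ‖h t‖ < min δ δ' := fun t => (h.norm_coe_le_norm t).trans_lt hh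
  have hyh : ∀ t, (y + h) t ∈ Ω := fun t => hball t (by simpa using hht t)
  refine (ContinuousMap.norm_le _ (by positivity)).2 fun t => ?_
  have e1 : (superpose f (y + h) - superpose f y - applyCLM (superpose (fderiv ℝ f) y) h) t
      = f (y t + h t) - f (y t) - fderiv ℝ f (y t) ((y t + h t) - y t) := by
    simp only [ContinuousMap.sub_apply, applyCLM_apply]
    rw [superpose_apply hf.continuousOn hyh, superpose_apply hf.continuousOn hy,
      superpose_apply hf' hy]
    simp
  rw [e1]
  have := (convex_ball (y t) (min δ δ')).norm_image_sub_le_of_norm_fderiv_le' (𝕜 := ℝ)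
    (f := f) (C := ε) (φ := fderiv ℝ f (y t)) (x := y t) (y := y t + h t)
    (fun z hz => ((hf.contDiffAt (hΩ.mem_nhds (hball t hz))).differentiableAt (by simp)))
    (fun z hz => ?_) (Metric.mem_ball_self (lt_min hδ hδ')) (by simpa using hht t)
  · refine this.trans ?_
    gcongr
    simpa using h.norm_coe_le_norm t
  · have h4 : dist (y t) z < δ := by
      rw [dist_comm]; exact (Metric.mem_ball.1 hz).trans_le (min_le_left _ _)
    have h5 : dist (fderiv ℝ f (y t)) (fderiv ℝ f z) < ε := h2 h4 (mem_range_self t)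
    rw [← dist_eq_norm, dist_comm]; exact h5.le

/-- The derivative of a superposition operator is again one, namely that of `fderiv ℝ f`, followed
by a continuous linear map. The target changes at each step of the induction, so it is quantified
inside. -/
lemma contDiffOn_superpose_nat {Ω : Set Y} (hΩ : IsOpen Ω) (n : ℕ) :
    ∀ {Y' : Type u} [NormedAddCommGroup Y'] [NormedSpace ℝ Y'] {f : Y → Y'},
      ContDiffOn ℝ n f Ω → ContDiffOn ℝ n (superpose f) {y : C(K, Y) | ∀ t, y t ∈ Ω} := by
  induction n with
  | zero =>
    intro Y' _ _ f hf
    simp only [CharP.cast_eq_zero, contDiffOn_zero] at hf ⊢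
    exact continuousOn_superpose hΩ hf
  | succ n ih =>
    intro Y' _ _ f hf
    have hf1 : ContDiffOn ℝ 1 f Ω := hf.of_le (by norm_cast; omega)
    have h2 := ((contDiffOn_succ_iff_fderiv_of_isOpen hΩ).1
      (by exact_mod_cast hf : ContDiffOn ℝ ((n : WithTop ℕ∞) + 1) f Ω)).2.2
    have : ContDiffOn ℝ ((n : WithTop ℕ∞) + 1) (superpose f)
        {y : C(K, Y) | ∀ t, y t ∈ Ω} := by
      rw [contDiffOn_succ_iff_fderiv_of_isOpen (isOpen_setOf_forall_mem hΩ)]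
      refine ⟨fun y hy => (hasFDerivAt_superpose hΩ hf1 hy).differentiableAt.differentiableWithinAt,
        by simp, ?_⟩
      refine ContDiffOn.congr (f := fun y => applyCLM (superpose (fderiv ℝ f) y)) ?_
        (fun y hy => (hasFDerivAt_superpose hΩ hf1 hy).fderiv)
      exact applyCLM.contDiff.comp_contDiffOn (ih h2)
    exact_mod_cast this

lemma contDiffOn_superpose {Ω : Set Y} (hΩ : IsOpen Ω) {f : Y → Y'} (hf : ContDiffOn ℝ ∞ f Ω) :
    ContDiffOn ℝ ∞ (superpose f) {y : C(K, Y) | ∀ t, y t ∈ Ω} :=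
  contDiffOn_infty.2 fun n => contDiffOn_superpose_nat hΩ n (contDiffOn_infty.1 hf n)

end Nemytskii

/-! ### Volterra operators and linear integral equations -/

section Volterra

open unitInterval

universe u
variable {Y : Type u} [NormedAddCommGroup Y] [NormedSpace ℝ Y] [CompleteSpace Y]

lemma continuous_primitive_IccExtend (y : C(I, Y)) :
    Continuous fun t : I => ∫ s in (0 : ℝ)..t, IccExtend zero_le_one y s :=
  (intervalIntegral.continuous_primitive
    (fun _ _ => (y.continuous.Icc_extend' (h := zero_le_one)).intervalIntegrable _ _) 0).comp
    continuous_subtype_val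

lemma norm_integral_IccExtend_le (y : C(I, Y)) (t : I) :
    ‖∫ s in (0 : ℝ)..t, IccExtend zero_le_one y s‖ ≤ ‖y‖ := by
  have := intervalIntegral.norm_integral_le_of_norm_le_const (a := 0) (b := (t : ℝ))
    (f := IccExtend zero_le_one y) (C := ‖y‖) (fun s _ => y.norm_coe_le_norm _)
  refine this.trans ?_
  rw [sub_zero, abs_of_nonneg t.2.1]
  exact mul_le_of_le_one_right (norm_nonneg _) t.2.2

/-- The primitive of a continuous function on `[0, 1]` which vanishes at `0`. -/
def primitiveCLM : C(I, Y) →L[ℝ] C(I, Y) :=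
  LinearMap.mkContinuous
    { toFun := fun y => ⟨fun t => ∫ s in (0 : ℝ)..t, IccExtend zero_le_one y s,
        continuous_primitive_IccExtend y⟩
      map_add' := fun y z => by
        ext t
        exact intervalIntegral.integral_add
          ((y.continuous.Icc_extend' (h := zero_le_one)).intervalIntegrable _ _)
          ((z.continuous.Icc_extend' (h := zero_le_one)).intervalIntegrable _ _)
      map_smul' := fun c y => by
        ext t
        exact intervalIntegral.integral_smul c _ } 1 (fun y => by
    rw [one_mul, ContinuousMap.norm_le _ (norm_nonneg y)]
    exact norm_integral_IccExtend_le y)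

lemma primitiveCLM_apply (y : C(I, Y)) (t : I) :
    primitiveCLM y t = ∫ s in (0 : ℝ)..t, IccExtend zero_le_one y s := rfl

lemma primitiveCLM_zero (y : C(I, Y)) : primitiveCLM y 0 = 0 := by
  rw [primitiveCLM_apply]; simp

lemma primitiveCLM_apply_zero (t : I) : primitiveCLM (0 : C(I, Y)) t = 0 := by
  rw [map_zero]; rfl

lemma hasDerivWithinAt_primitiveCLM (y : C(I, Y)) {t : ℝ} (ht : t ∈ Icc (0 : ℝ) 1) :
    HasDerivWithinAt (IccExtend zero_le_one (primitiveCLM y)) (y ⟨t, ht⟩) (Icc 0 1) t := by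
  have hc : Continuous (IccExtend (zero_le_one (α := ℝ)) y) := y.continuous.Icc_extend'
  have := (intervalIntegral.integral_hasDerivAt_right (hc.intervalIntegrable 0 t)
    (hc.stronglyMeasurableAtFilter _ _) hc.continuousAt).hasDerivWithinAt (s := Icc 0 1)
  rw [IccExtend_of_mem _ _ ht] at this
  refine this.congr (fun s hs => ?_) ?_
  · rw [IccExtend_of_mem _ _ hs]; rfl
  · rw [IccExtend_of_mem _ _ ht]; rfl

/-- The Volterra operator `y ↦ ∫₀ᵗ B(s) y(s) ds`. -/
def volterra (B : C(I, Y →L[ℝ] Y)) : C(I, Y) →L[ℝ] C(I, Y) := primitiveCLM ∘L applyCLM B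

/-- Keeping the dependence on `t` in the bound is what produces the factorial: each step integrates
the previous power of `t`. -/
lemma norm_volterra_pow_apply_le (B : C(I, Y →L[ℝ] Y)) (n : ℕ) (y : C(I, Y)) (t : I) :
    ‖(volterra B ^ n) y t‖ ≤ ‖B‖ ^ n * (t : ℝ) ^ n / n.factorial * ‖y‖ := by
  induction n generalizing t with
  | zero => simpa using y.norm_coe_le_norm t
  | succ n ih =>
    rw [pow_succ', mul_apply_eq_comp]
    set z := (volterra B ^ n) y
    have e : volterra B z t = ∫ s in (0 : ℝ)..t, IccExtend zero_le_one (applyCLM B z) s := rfl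
    rw [e]
    have hb : ∀ s ∈ Ioc (0 : ℝ) t, ‖IccExtend zero_le_one (applyCLM B z) s‖
        ≤ ‖B‖ ^ (n + 1) / n.factorial * ‖y‖ * s ^ n := by
      intro s hs
      have hs' : s ∈ Icc (0 : ℝ) 1 := ⟨hs.1.le, hs.2.trans t.2.2⟩
      rw [IccExtend_of_mem _ _ hs', applyCLM_apply]
      refine ((B ⟨s, hs'⟩).le_of_opNorm_le_of_le (B.norm_coe_le_norm _) (ih ⟨s, hs'⟩)).trans
        (le_of_eq ?_)
      simp only
      ring
    refine (intervalIntegral.norm_integral_le_of_norm_le t.2.1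
      (g := fun s => ‖B‖ ^ (n + 1) / n.factorial * ‖y‖ * s ^ n)
      (MeasureTheory.ae_of_all _ hb) (by
        apply Continuous.intervalIntegrable; fun_prop)).trans (le_of_eq ?_)
    rw [intervalIntegral.integral_const_mul, integral_pow, Nat.factorial_succ]
    push_cast
    field_simp
    simp

/-- The factorial makes some power of the operator small, so 1 minus this power is invertible; it
factors as 1 minus the operator times a commuting geometric sum. No smallness of `B` is needed, so
linear equations are solved on all of [0, 1]. -/
lemma isUnit_one_sub_volterra (B : C(I, Y →L[ℝ] Y)) : IsUnit (1 - volterra B) := by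
  have hlim := FloorSemiring.tendsto_pow_div_factorial_atTop ‖B‖
  obtain ⟨n, hn⟩ := ((tendsto_order.1 hlim).2 (1 / 2) (by norm_num)).exists
  have hn' : ‖volterra B ^ n‖ ≤ 1 / 2 := by
    refine ContinuousLinearMap.opNorm_le_bound _ (by norm_num) fun y => ?_
    rw [ContinuousMap.norm_le _ (by positivity)]
    intro t
    refine (norm_volterra_pow_apply_le B n y t).trans ?_
    refine mul_le_mul_of_nonneg_right (le_trans ?_ hn.le) (norm_nonneg y)
    gcongr
    exact mul_le_of_le_one_right (by positivity) (pow_le_one₀ t.2.1 t.2.2)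
  have h1 : IsUnit (1 - volterra B ^ n) :=
    isUnit_one_sub_of_norm_lt_one (x := volterra B ^ n) (hn'.trans_lt (by norm_num))
  rw [← mul_neg_geom_sum] at h1
  refine (Commute.isUnit_mul_iff ?_).1 h1 |>.1
  exact (Commute.one_left _).sub_left (Commute.sum_right _ _ _ fun i _ =>
    (Commute.refl (volterra B)).pow_right i)

end Volterra

/-! ### Smooth dependence on initial values -/

section Flow

universe u

/-- The inverse function theorem with a smooth inverse on an open set. -/
lemma exists_smooth_local_inverse {X Y : Type*} [NormedAddCommGroup X] [NormedSpace ℝ X]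
    [CompleteSpace X] [NormedAddCommGroup Y] [NormedSpace ℝ Y] {f : X → Y}
    {Ω : Set X} (hΩ : IsOpen Ω) (hf : ContDiffOn ℝ ∞ f Ω) {x : X} (hx : x ∈ Ω)
    {f' : X ≃L[ℝ] Y} (hf' : HasFDerivAt f (f' : X →L[ℝ] Y) x) :
    ∃ e : OpenPartialHomeomorph X Y, x ∈ e.source ∧ e.source ⊆ Ω ∧ (∀ z, e z = f z) ∧
      (∀ z ∈ e.source, ∃ g : X ≃L[ℝ] Y, fderiv ℝ f z = g) ∧ ContDiffOn ℝ ∞ e.symm e.target := by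
  have hfx : ContDiffAt ℝ ∞ f x := hf.contDiffAt (hΩ.mem_nhds hx)
  have hcont : ContinuousOn (fderiv ℝ f) Ω := hf.continuousOn_fderiv_of_isOpen hΩ (by simp)
  -- Shrinking to the open set where the derivative is invertible makes the inverse smooth on its
  -- whole domain and not just at one point.
  have hopen : IsOpen (Ω ∩ fderiv ℝ f ⁻¹' range ((↑) : (X ≃L[ℝ] Y) → X →L[ℝ] Y)) :=
    hcont.isOpen_inter_preimage hΩ (ContinuousLinearEquiv.isOpen)
  set Ω' := Ω ∩ fderiv ℝ f ⁻¹' range ((↑) : (X ≃L[ℝ] Y) → X →L[ℝ] Y)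
  have hxΩ' : x ∈ Ω' := ⟨hx, f', hf'.fderiv.symm⟩
  let e₀ := hfx.toOpenPartialHomeomorph f hf' (by simp)
  refine ⟨e₀.restrOpen Ω' hopen, ?_, ?_, fun z => rfl, ?_, ?_⟩
  · exact ⟨hfx.mem_toOpenPartialHomeomorph_source hf' (by simp), hxΩ'⟩
  · intro z hz
    exact hz.2.1
  · intro z hz
    obtain ⟨g, hg⟩ := hz.2.2
    exact ⟨g, hg.symm⟩
  · intro y hy
    set e := e₀.restrOpen Ω' hopen
    have hz : e.symm y ∈ e.source := e.map_target hy
    obtain ⟨g, hg⟩ := hz.2.2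
    have hd : ContDiffAt ℝ ∞ f (e.symm y) := hf.contDiffAt (hΩ.mem_nhds hz.2.1)
    refine (e.contDiffAt_symm hy (f₀' := g) ?_ hd).contDiffWithinAt
    have := (hd.differentiableAt (by simp)).hasFDerivAt
    rw [← hg] at this
    exact this

open unitInterval

variable {Y : Type u} [NormedAddCommGroup Y] [NormedSpace ℝ Y] [CompleteSpace Y]

/-- Smooth dependence on the initial value for autonomous differential equations: solutions close
to a given one on `[0, 1]` form a smooth family. -/
theorem exists_smooth_flow {g : Y → Y} {Ω : Set Y} (hΩ : IsOpen Ω) (hg : ContDiffOn ℝ ∞ g Ω)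
    (y : C(I, Y)) (hy : ∀ t, y t ∈ Ω)
    (hsol : ∀ t : I, y t = y 0 + primitiveCLM (superpose g y) t)
    {O : Set C(I, Y)} (hO : O ∈ 𝓝 y) :
    ∃ (N : Set Y) (S : Y → C(I, Y)), IsOpen N ∧ y 0 ∈ N ∧ ContDiffOn ℝ ∞ S N ∧
      S (y 0) = y ∧ ∀ z ∈ N, S z ∈ O ∧ (∀ t, S z t ∈ Ω) ∧ S z 0 = z ∧
        ∀ (t : ℝ) (ht : t ∈ Icc (0 : ℝ) 1), HasDerivWithinAt (IccExtend zero_le_one (S z))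
          (g (S z ⟨t, ht⟩)) (Icc 0 1) t := by
  let V : Set C(I, Y) := {y | ∀ t, y t ∈ Ω}
  have hV : IsOpen V := isOpen_setOf_forall_mem hΩ
  have hgV : ContDiffOn ℝ ∞ (superpose g : C(I, Y) → C(I, Y)) V := contDiffOn_superpose hΩ hg
  -- A path solves the equation with initial value z exactly when `G` sends it to the constant path
  -- z. The derivative of `G` at `y` is 1 minus a Volterra operator, so `G` is locally invertible.
  let G : C(I, Y) → C(I, Y) := fun y => y - primitiveCLM (superpose g y)
  have hG : ContDiffOn ℝ ∞ G V :=
    contDiffOn_id.sub ((primitiveCLM (Y := Y)).contDiff.comp_contDiffOn hgV)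
  obtain ⟨f', hf'⟩ := isUnit_one_sub_volterra (superpose (fderiv ℝ g) y)
  have hGd : HasFDerivAt G ((ContinuousLinearEquiv.unitsEquiv ℝ C(I, Y) f' :
      C(I, Y) ≃L[ℝ] C(I, Y)) : C(I, Y) →L[ℝ] C(I, Y)) y := by
    have e : ((ContinuousLinearEquiv.unitsEquiv ℝ C(I, Y) f' :
      C(I, Y) ≃L[ℝ] C(I, Y)) : C(I, Y) →L[ℝ] C(I, Y)) = f' := by ext; rfl
    rw [e, hf']
    exact (hasFDerivAt_id y).sub ((primitiveCLM (Y := Y)).hasFDerivAt.comp y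
      (hasFDerivAt_superpose hΩ (hg.of_le (by simp)) hy))
  obtain ⟨e, hye, heV, heG, -, hesymm⟩ := exists_smooth_local_inverse
    (hV.inter isOpen_interior) (hG.mono inter_subset_left)
    (⟨hy, mem_interior_iff_mem_nhds.2 hO⟩ : y ∈ V ∩ interior O) hGd
  -- Initial values enter as constant paths; the solution map is the local inverse of `G` composed
  -- with this embedding.
  let κ : Y →L[ℝ] C(I, Y) := LinearMap.mkContinuous
    { toFun := fun z => ContinuousMap.const I z
      map_add' := fun _ _ => rfl
      map_smul' := fun _ _ => rfl } 1 (fun z => by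
        rw [one_mul, ContinuousMap.norm_le _ (norm_nonneg z)]
        exact fun _ => le_rfl)
  have hκ : ∀ z t, κ z t = z := fun _ _ => rfl
  have hGy : G y = κ (y 0) := by
    ext t
    have := hsol t
    simp only [G, ContinuousMap.sub_apply, hκ]
    exact sub_eq_of_eq_add this
  refine ⟨κ ⁻¹' e.target, fun z => e.symm (κ z), e.open_target.preimage κ.continuous, ?_,
    hesymm.comp κ.contDiff.contDiffOn (fun _ h => h), ?_, ?_⟩
  · show κ (y 0) ∈ e.target
    rw [← hGy, ← heG]; exact e.map_source hye
  · show e.symm (κ (y 0)) = y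
    rw [← hGy, ← heG]; exact e.left_inv hye
  · intro z hz
    have hs : e.symm (κ z) ∈ e.source := e.map_target hz
    have hsV := heV hs
    have hGs : G (e.symm (κ z)) = κ z := by rw [← heG]; exact e.right_inv hz
    set w := e.symm (κ z)
    have hw : w = κ z + primitiveCLM (superpose g w) := by
      rw [← hGs]; simp only [G]; abel
    refine ⟨interior_subset hsV.2, hsV.1, ?_, ?_⟩
    · show w 0 = z
      rw [hw, ContinuousMap.add_apply, primitiveCLM_zero, add_zero]; rfl
    · intro t ht
      have h1 := (hasDerivWithinAt_primitiveCLM (superpose g w) ht).const_add z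
      rw [superpose_apply hg.continuousOn hsV.1] at h1
      change HasDerivWithinAt (IccExtend zero_le_one w) (g (w ⟨t, ht⟩)) (Icc 0 1) t
      refine h1.congr (fun s hs => ?_) ?_
      · conv_lhs => rw [hw]
        rw [IccExtend_of_mem _ _ hs, IccExtend_of_mem _ _ hs]; rfl
      · conv_lhs => rw [hw]
        rw [IccExtend_of_mem _ _ ht, IccExtend_of_mem _ _ ht]; rfl

lemma contDiffOn_eval_path {Z : Type*} [NormedAddCommGroup Z] [NormedSpace ℝ Z] {S : Z → C(I, Y)}
    {N : Set Z} (hS : ContDiffOn ℝ ∞ S N) (t : I) : ContDiffOn ℝ ∞ (fun z => S z t) N :=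
  (ContinuousMap.evalCLM (M := Y) ℝ t).contDiff.comp_contDiffOn hS

end Flow

/-! ### Parallel transport along straight segments -/

section SegmentTransport

open unitInterval

universe u
variable {F : Type u} [NormedAddCommGroup F] [NormedSpace ℝ F]

/-- `P` is the parallel frame along the segment `t ↦ x + t (y - x)` for the connection form `Γ`. -/
structure IsSegmentFrame (Γ : F → F →L[ℝ] F →L[ℝ] F) (x y : F) (P : ℝ → F →L[ℝ] F) : Prop where
  zero : P 0 = 1
  deriv : ∀ t ∈ Icc (0 : ℝ) 1,
    HasDerivWithinAt P (-(Γ (x + t • (y - x)) (y - x) ∘L P t)) (Icc 0 1) t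

open Classical in
/-- Parallel transport along the straight segment from `x` to `y`. -/
def segmentTransport (Γ : F → F →L[ℝ] F →L[ℝ] F) (x y : F) : F →L[ℝ] F :=
  -- The value 0 does not occur for end points in a convex set on which `Γ` is continuous, by
  -- `exists_isSegmentFrame`.
  if h : ∃ P, IsSegmentFrame Γ x y P then h.choose 1 else 0

variable {Γ : F → F →L[ℝ] F →L[ℝ] F} {x y : F} {P P' : ℝ → F →L[ℝ] F}

lemma segment_mem {B : Set F} (hB : Convex ℝ B) (hx : x ∈ B) (hy : y ∈ B) {t : ℝ}
    (ht : t ∈ Icc (0 : ℝ) 1) : x + t • (y - x) ∈ B :=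
  hB.add_smul_sub_mem hx hy ht

lemma continuousOn_segment_coeff {B : Set F} (hB : Convex ℝ B) (hΓ : ContinuousOn Γ B)
    (hx : x ∈ B) (hy : y ∈ B) :
    ContinuousOn (fun t : ℝ => Γ (x + t • (y - x)) (y - x)) (Icc 0 1) := by
  have : ContinuousOn (fun t : ℝ => Γ (x + t • (y - x))) (Icc 0 1) :=
    hΓ.comp (by fun_prop) fun t ht => segment_mem hB hx hy ht
  exact this.clm_apply continuousOn_const

lemma hasDerivAt_of_Icc {Y : Type*} [NormedAddCommGroup Y] [NormedSpace ℝ Y] {f : ℝ → Y} {f' : Y}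
    {a b t : ℝ} (h : HasDerivWithinAt f f' (Icc a b) t) (ht : t ∈ Ioo a b) : HasDerivAt f f' t :=
  h.hasDerivAt (Icc_mem_nhds ht.1 ht.2)

/-- Two solutions of a linear equation with continuous coefficients agree. -/
lemma eqOn_of_linear_ode {Y : Type*} [NormedAddCommGroup Y] [NormedSpace ℝ Y] {f g : ℝ → Y}
    {A : ℝ → Y →L[ℝ] Y} {a b : ℝ} (hA : ContinuousOn A (Icc a b)) (hf : ContinuousOn f (Icc a b))
    (hg : ContinuousOn g (Icc a b)) (hf' : ∀ t ∈ Ioo a b, HasDerivAt f (A t (f t)) t)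
    (hg' : ∀ t ∈ Ioo a b, HasDerivAt g (A t (g t)) t) (h0 : f a = g a) : EqOn f g (Icc a b) := by
  obtain ⟨C, hC⟩ := isCompact_Icc.exists_bound_of_continuousOn hA
  intro t ht
  have := eq_zero_of_norm_deriv_le (Z := fun t => f t - g t) (C := C) finite_empty
    (hf.sub hg) (fun t ht _ => ⟨A t (f t - g t), by
      simpa using (hf' t ht).fun_sub (hg' t ht),
      (A t).le_of_opNorm_le (hC t (Ioo_subset_Icc_self ht)) _⟩) (by simp [h0]) t ht
  exact sub_eq_zero.1 this

/-- Left multiplication by the coefficient. -/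
abbrev lmulNeg (A : F →L[ℝ] F) : (F →L[ℝ] F) →L[ℝ] (F →L[ℝ] F) :=
  -(ContinuousLinearMap.compL ℝ F F F A)

lemma IsSegmentFrame.continuousOn (h : IsSegmentFrame Γ x y P) : ContinuousOn P (Icc 0 1) :=
  fun t ht => (h.deriv t ht).continuousWithinAt

lemma IsSegmentFrame.hasDerivAt (h : IsSegmentFrame Γ x y P) {t : ℝ} (ht : t ∈ Ioo (0 : ℝ) 1) :
    HasDerivAt P (-(Γ (x + t • (y - x)) (y - x) ∘L P t)) t :=
  hasDerivAt_of_Icc (h.deriv t (Ioo_subset_Icc_self ht)) ht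

variable {B : Set F}

lemma IsSegmentFrame.eqOn (hB : Convex ℝ B) (hΓ : ContinuousOn Γ B) (hx : x ∈ B) (hy : y ∈ B)
    (h : IsSegmentFrame Γ x y P) (h' : IsSegmentFrame Γ x y P') : EqOn P P' (Icc 0 1) := by
  refine eqOn_of_linear_ode
    (A := fun t => lmulNeg (Γ (x + t • (y - x)) (y - x))) ?_ h.continuousOn h'.continuousOn
    (fun t ht => by simpa using! h.hasDerivAt ht) (fun t ht => by simpa using! h'.hasDerivAt ht)
    (by rw [h.zero, h'.zero])
  exact ((ContinuousLinearMap.compL ℝ F F F).continuous.comp_continuousOn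
    (continuousOn_segment_coeff hB hΓ hx hy)).neg

lemma IsSegmentFrame.segmentTransport_eq (hB : Convex ℝ B) (hΓ : ContinuousOn Γ B) (hx : x ∈ B)
    (hy : y ∈ B) (h : IsSegmentFrame Γ x y P) : segmentTransport Γ x y = P 1 := by
  have hex : ∃ P, IsSegmentFrame Γ x y P := ⟨P, h⟩
  rw [segmentTransport, dif_pos hex]
  exact hex.choose_spec.eqOn hB hΓ hx hy h ⟨zero_le_one, le_rfl⟩

/-- The frame along an initial piece of a segment is the old frame at a slower speed. This
identifies `P` at intermediate times with the transport to intermediate points. -/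
lemma IsSegmentFrame.scale (h : IsSegmentFrame Γ x y P) {s : ℝ} (hs : s ∈ Icc (0 : ℝ) 1) :
    IsSegmentFrame Γ x (x + s • (y - x)) (fun t => P (t * s)) := by
  refine ⟨by simp [h.zero], fun t ht => ?_⟩
  have hmaps : MapsTo (fun t : ℝ => t * s) (Icc 0 1) (Icc 0 1) := fun t ht =>
    ⟨mul_nonneg ht.1 hs.1, mul_le_one₀ ht.2 hs.1 hs.2⟩
  have := (h.deriv (t * s) (hmaps ht)).scomp t
    (((hasDerivAt_id t).mul_const s).hasDerivWithinAt) hmaps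
  simp only [one_mul] at this
  refine this.congr_deriv ?_
  simp only [add_sub_cancel_left, smul_smul, map_smul]
  rw [ContinuousLinearMap.smul_comp, smul_neg]

variable [CompleteSpace F]

/-- The frame equation with initial value 1 is the integral equation solved by inverting 1 minus the
Volterra operator of the coefficient. -/
lemma exists_isSegmentFrame (hB : Convex ℝ B) (hΓ : ContinuousOn Γ B) (hx : x ∈ B) (hy : y ∈ B) :
    ∃ P, IsSegmentFrame Γ x y P := by
  have hc := continuousOn_segment_coeff hB hΓ hx hy
  let A : C(I, (F →L[ℝ] F) →L[ℝ] (F →L[ℝ] F)) :=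
    ⟨fun t => lmulNeg (Γ (x + (t : ℝ) • (y - x)) (y - x)),
      ((ContinuousLinearMap.compL ℝ F F F).continuous.comp
        (continuousOn_iff_continuous_domRestrict.1 hc)).neg⟩
  obtain ⟨k, hk⟩ := (isUnit_one_sub_volterra A).exists_right_inv
  obtain ⟨w, hw⟩ : ∃ w : C(I, F →L[ℝ] F),
      w = ContinuousMap.const I 1 + primitiveCLM (applyCLM A w) := by
    refine ⟨k (ContinuousMap.const I 1), ?_⟩
    have h1 := congrArg (fun T : C(I, F →L[ℝ] F) →L[ℝ] C(I, F →L[ℝ] F) =>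
      T (ContinuousMap.const I 1)) hk
    change k (ContinuousMap.const I 1) - volterra A (k (ContinuousMap.const I 1)) =
      ContinuousMap.const I 1 at h1
    exact sub_eq_iff_eq_add.1 h1
  have hw' : ∀ t : I, w t = 1 + primitiveCLM (applyCLM A w) t := fun t =>
    congrArg (fun f : C(I, F →L[ℝ] F) => f t) hw
  refine ⟨IccExtend zero_le_one w, ?_, fun t ht => ?_⟩
  · rw [IccExtend_of_mem _ _ ⟨le_rfl, zero_le_one⟩, hw']
    exact (congrArg (1 + ·) (primitiveCLM_zero _)).trans (add_zero _)
  · have h1 := (hasDerivWithinAt_primitiveCLM (applyCLM A w) ht).const_add (1 : F →L[ℝ] F)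
    rw [IccExtend_of_mem _ _ ht]
    have e : applyCLM A w ⟨t, ht⟩ = -(Γ (x + t • (y - x)) (y - x) ∘L w ⟨t, ht⟩) := rfl
    rw [e] at h1
    refine h1.congr (fun s hs => ?_) ?_
    · rw [IccExtend_of_mem _ _ hs, IccExtend_of_mem _ _ hs, hw']
    · rw [IccExtend_of_mem _ _ ht, IccExtend_of_mem _ _ ht, hw']

lemma segmentTransport_self (hB : Convex ℝ B) (hΓ : ContinuousOn Γ B) (hx : x ∈ B) :
    segmentTransport Γ x x = 1 := by
  refine IsSegmentFrame.segmentTransport_eq (P := fun _ => 1) hB hΓ hx hx ⟨rfl, fun t _ => ?_⟩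
  refine (hasDerivWithinAt_const t _ _).congr_deriv ?_
  simp

/-- With `P` the frame of the segment and `Q` that of the reversed one, `Q t * P 1` and `P (1 - t)`
solve the same linear equation with the same initial value; compare them at t = 1. -/
lemma segmentTransport_mul_symm (hB : Convex ℝ B) (hΓ : ContinuousOn Γ B) (hx : x ∈ B)
    (hy : y ∈ B) : segmentTransport Γ y x * segmentTransport Γ x y = 1 := by
  obtain ⟨P, hP⟩ := exists_isSegmentFrame hB hΓ hx hy
  obtain ⟨Q, hQ⟩ := exists_isSegmentFrame hB hΓ hy hx
  rw [hP.segmentTransport_eq hB hΓ hx hy, hQ.segmentTransport_eq hB hΓ hy hx]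
  have hmaps : MapsTo (fun t : ℝ => 1 - t) (Icc 0 1) (Icc 0 1) := fun t ht =>
    ⟨by linarith [ht.2], by linarith [ht.1]⟩
  have key := eqOn_of_linear_ode (a := 0) (b := 1)
    (A := fun t => lmulNeg (Γ (y + t • (x - y)) (x - y)))
    (f := fun t => Q t * P 1) (g := fun t => P (1 - t))
    ((ContinuousLinearMap.compL ℝ F F F).continuous.comp_continuousOn
      (continuousOn_segment_coeff hB hΓ hy hx)).neg
    (hQ.continuousOn.mul continuousOn_const) (hP.continuousOn.comp (by fun_prop) hmaps)
    (fun t ht => ?_) (fun t ht => ?_) (by simp [hQ.zero])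
  · have := key (⟨zero_le_one, le_rfl⟩ : (1 : ℝ) ∈ Icc (0 : ℝ) 1)
    simpa [hP.zero] using this
  · refine ((hQ.hasDerivAt ht).mul_const (P 1)).congr_deriv ?_
    ext v; simp
  · have h1 : HasDerivAt (fun t : ℝ => 1 - t) (-1) t := by
      simpa using (hasDerivAt_id t).const_sub 1
    refine ((hP.hasDerivAt (t := 1 - t) ⟨by linarith [ht.2], by linarith [ht.1]⟩).scomp t
      h1).congr_deriv ?_
    have e1 : x + (1 - t) • (y - x) = y + t • (x - y) := by module
    have e2 : y - x = -(x - y) := by abel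
    rw [e1, e2]
    ext v; simp

/-- Position, velocity and frame together solve an autonomous equation, which turns the dependence
on the two end points into dependence on the initial value (x, y - x, 1). -/
lemma contDiffOn_segmentTransport [FiniteDimensional ℝ F] (hBo : IsOpen B) (hB : Convex ℝ B)
    (hΓ : ContDiffOn ℝ ∞ Γ B) :
    ContDiffOn ℝ ∞ (fun p : F × F => segmentTransport Γ p.1 p.2) (B ×ˢ B) := by
  rintro ⟨x, y⟩ ⟨hx, hy⟩
  simp only at hx hy
  have hΓc := hΓ.continuousOn
  obtain ⟨P, hP⟩ := exists_isSegmentFrame hB hΓc hx hy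
  let Ω : Set (F × F × (F →L[ℝ] F)) := B ×ˢ univ
  let g : F × F × (F →L[ℝ] F) → F × F × (F →L[ℝ] F) := fun p => (p.2.1, 0, -(Γ p.1 p.2.1 ∘L p.2.2))
  have hΩ : IsOpen Ω := hBo.prod isOpen_univ
  have hg : ContDiffOn ℝ ∞ g Ω := by
    have h1 : ContDiffOn ℝ ∞ (fun p : F × F × (F →L[ℝ] F) => Γ p.1) Ω :=
      hΓ.comp contDiff_fst.contDiffOn fun p hp => hp.1
    refine (contDiff_fst.comp contDiff_snd).contDiffOn.prodMk (contDiffOn_const.prodMk ?_)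
    exact ((h1.clm_apply (contDiff_fst.comp contDiff_snd).contDiffOn).clm_comp
      (contDiff_snd.comp contDiff_snd).contDiffOn).neg
  let w : C(I, F × F × (F →L[ℝ] F)) :=
    ⟨fun t => (x + (t : ℝ) • (y - x), y - x, P t), by
      have := continuousOn_iff_continuous_domRestrict.1 hP.continuousOn
      have h2 : Continuous fun t : I => P t := this
      exact (by fun_prop : Continuous fun t : I => x + (t : ℝ) • (y - x)).prodMk
        (continuous_const.prodMk h2)⟩
  have hwΩ : ∀ t, w t ∈ Ω := fun t => ⟨segment_mem hB hx hy t.2, mem_univ _⟩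
  have hwd : ∀ (t : ℝ) (ht : t ∈ Icc (0 : ℝ) 1), HasDerivWithinAt (IccExtend zero_le_one w)
      (g (w ⟨t, ht⟩)) (Icc 0 1) t := by
    intro t ht
    have h1 : HasDerivWithinAt (fun t : ℝ => x + t • (y - x)) (y - x) (Icc 0 1) t := by
      simpa using (((hasDerivAt_id t).smul_const (y - x)).const_add x).hasDerivWithinAt
    have h2 := h1.prodMk ((hasDerivWithinAt_const t (Icc (0 : ℝ) 1) (y - x)).prodMk
      (hP.deriv t ht))
    refine h2.congr (fun s hs => ?_) ?_
    · rw [IccExtend_of_mem _ _ hs]; rfl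
    · rw [IccExtend_of_mem _ _ ht]; rfl
  -- The difference between the path and the primitive of its velocity has zero derivative; this is
  -- the integral form required by `exists_smooth_flow`.
  have hsol : ∀ t : I, w t = w 0 + primitiveCLM (superpose g w) t := by
    intro t
    have key := eqOn_of_linear_ode (a := 0) (b := 1) (A := fun _ => 0)
      (f := fun t => IccExtend zero_le_one w t - IccExtend zero_le_one
        (primitiveCLM (superpose g w)) t) (g := fun _ => w 0) continuousOn_const
      (w.continuous.Icc_extend'.sub
        (primitiveCLM (superpose g w)).continuous.Icc_extend').continuousOn continuousOn_const
      (fun t ht => ?_) (fun t ht => by simpa using hasDerivAt_const t (w 0)) (by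
        rw [IccExtend_of_mem _ _ ⟨le_rfl, zero_le_one⟩, IccExtend_of_mem _ _ ⟨le_rfl, zero_le_one⟩]
        have := primitiveCLM_zero (superpose g w)
        show w 0 - primitiveCLM (superpose g w) 0 = _
        rw [this, sub_zero])
    · have := key t.2
      simp only [IccExtend_of_mem _ _ t.2] at this
      rw [← this]
      exact (sub_add_cancel _ _).symm
    · have ht' := Ioo_subset_Icc_self ht
      have h1 := hasDerivAt_of_Icc (hwd t ht') ht
      have h2 := hasDerivAt_of_Icc (hasDerivWithinAt_primitiveCLM (superpose g w) ht') ht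
      rw [superpose_apply hg.continuousOn hwΩ] at h2
      simpa using h1.fun_sub h2
  obtain ⟨N, S, hN, hwN, hS, hSw, hSN⟩ := exists_smooth_flow hΩ hg w hwΩ hsol univ_mem
  have hw0 : w 0 = (x, y - x, 1) := by
    show (x + (0 : ℝ) • (y - x), y - x, P 0) = _
    simp [hP.zero]
  rw [hw0] at hwN
  let ι : F × F → F × F × (F →L[ℝ] F) := fun p => (p.1, p.2 - p.1, 1)
  have hι : ContDiff ℝ ∞ ι := contDiff_fst.prodMk
    ((contDiff_snd.sub contDiff_fst).prodMk contDiff_const)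
  have hnhds : B ×ˢ B ∩ ι ⁻¹' N ∈ 𝓝 (x, y) :=
    (((hBo.prod hBo).inter (hN.preimage hι.continuous)).mem_nhds ⟨⟨hx, hy⟩, hwN⟩)
  have heval : ContDiffOn ℝ ∞ (fun p : F × F => (S (ι p) 1).2.2) (ι ⁻¹' N) :=
    (contDiff_snd.comp contDiff_snd).comp_contDiffOn
      ((contDiffOn_eval_path hS 1).comp hι.contDiffOn (mapsTo_preimage ι N))
  have hat : ContDiffAt ℝ ∞ (fun p : F × F => (S (ι p) 1).2.2) (x, y) :=
    heval.contDiffAt ((hN.preimage hι.continuous).mem_nhds hwN)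
  refine (hat.congr_of_eventuallyEq ?_).contDiffWithinAt
  refine Filter.eventually_of_mem hnhds ?_
  rintro ⟨a, b⟩ ⟨⟨ha, hb⟩, hab⟩
  simp only at ha hb
  obtain ⟨-, hΩ', h0, hd⟩ := hSN _ hab
  set ξ := S (ι (a, b))
  let f : ℝ → F × F × (F →L[ℝ] F) := IccExtend zero_le_one ξ
  have hfc : Continuous f := ξ.continuous.Icc_extend'
  have hf0 : f 0 = (a, b - a, 1) := by
    show IccExtend zero_le_one ξ 0 = _
    rw [IccExtend_of_mem _ _ ⟨le_rfl, zero_le_one⟩]; exact h0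
  have hfd : ∀ t ∈ Icc (0 : ℝ) 1, HasDerivWithinAt f (g (f t)) (Icc 0 1) t := by
    intro t ht
    have := hd t ht
    rwa [← IccExtend_of_mem zero_le_one ξ ht] at this
  have hf2 : ∀ t ∈ Icc (0 : ℝ) 1, (f t).2.1 = b - a := by
    intro t ht
    have := eq_of_deriv_eq_zero_off_finite (Z := fun t => (f t).2.1) finite_empty
      (by fun_prop : Continuous fun t => (f t).2.1).continuousOn
      (fun t ht _ => by
        have := hasDerivAt_of_Icc (hfd t (Ioo_subset_Icc_self ht)) ht
        exact this.snd.fst) t ht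
    simpa [hf0] using this
  have hf1 : ∀ t ∈ Icc (0 : ℝ) 1, (f t).1 = a + t • (b - a) := by
    intro t ht
    have := eq_of_deriv_eq_zero_off_finite (Z := fun t => (f t).1 - t • (b - a)) finite_empty
      (by fun_prop : Continuous fun t => (f t).1 - t • (b - a)).continuousOn
      (fun t ht _ => by
        have := hasDerivAt_of_Icc (hfd t (Ioo_subset_Icc_self ht)) ht
        have h3 : HasDerivAt (fun t => (f t).1) (f t).2.1 t := this.fst
        have h4 := h3.fun_sub ((hasDerivAt_id t).smul_const (b - a))
        rw [hf2 t (Ioo_subset_Icc_self ht)] at h4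
        simpa using h4) t ht
    simp only [hf0, zero_smul, sub_zero] at this
    exact sub_eq_iff_eq_add.1 this
  -- The velocity component of the nearby solution is constant and its position component is the
  -- segment, so its last component is the frame of the nearby segment.
  have hframe : IsSegmentFrame Γ a b (fun t => (f t).2.2) := by
    refine ⟨by simp [hf0], fun t ht => ?_⟩
    have h3 : HasDerivWithinAt (fun t => (f t).2.2) (-(Γ (f t).1 (f t).2.1 ∘L (f t).2.2))
      (Icc 0 1) t := (hfd t ht).snd.snd
    rwa [hf1 t ht, hf2 t ht] at h3
  refine (hframe.segmentTransport_eq hB hΓc ha hb).trans ?_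
  show (IccExtend zero_le_one ξ 1).2.2 = _
  rw [IccExtend_of_mem _ _ ⟨zero_le_one, le_rfl⟩]; rfl

end SegmentTransport

/-! ### Groups of operators and the velocities of their curves -/

section OperatorGroup

open scoped NNReal

/-- The Picard–Lindelöf theorem, with the information that the solution stays in the ball. -/
lemma exists_solution_mem_closedBall {E : Type*} [NormedAddCommGroup E] [NormedSpace ℝ E]
    [CompleteSpace E] {f : ℝ → E → E} {tmin tmax : ℝ} {t₀ : Icc tmin tmax} {x₀ : E} {a L K : ℝ≥0}
    (hf : IsPicardLindelof f t₀ x₀ a 0 L K) :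
    ∃ α : ℝ → E, α t₀ = x₀ ∧ (∀ t, α t ∈ Metric.closedBall x₀ a) ∧
      ∀ t ∈ Icc tmin tmax, HasDerivWithinAt α (f t (α t)) (Icc tmin tmax) t := by
  have hx : x₀ ∈ Metric.closedBall x₀ (0 : ℝ≥0) := Metric.mem_closedBall_self le_rfl
  obtain ⟨α, hα⟩ := ODE.FunSpace.exists_isFixedPt_next hf hx
  refine ⟨α.compProj, by rw [ODE.FunSpace.compProj_val, ← hα, ODE.FunSpace.next_apply₀],
    fun t => α.compProj_mem_closedBall hf.mul_max_le, fun t ht => ?_⟩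
  apply ODE.hasDerivWithinAt_picard_Icc t₀.2 hf.continuousOn_uncurry
    α.continuous_compProj.continuousOn (fun _ ht' => α.compProj_mem_closedBall hf.mul_max_le)
    x₀ ht |>.congr_of_mem _ ht
  intro t' ht'
  nth_rw 1 [← hα]
  rw [ODE.FunSpace.compProj_of_mem ht', ODE.FunSpace.next_apply]

lemma contDiffAt_mul_flip {R V : Type*} [NormedRing R] [NormedAlgebra ℝ R] [NormedAddCommGroup V]
    [NormedSpace ℝ V] {f : V → R} {x : V} {n : WithTop ℕ∞} (hf : ContDiffAt ℝ n f x) :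
    ContDiffAt ℝ n (fun u => (ContinuousLinearMap.mul ℝ R).flip (f u)) x :=
  (ContinuousLinearMap.mul ℝ R).flip.contDiff.contDiffAt.comp x hf

variable {Y : Type*} [NormedAddCommGroup Y] [NormedSpace ℝ Y]

/-- A set of invertible operators which is a group under composition. -/
structure IsOperatorGroup (H : Set (Y →L[ℝ] Y)) : Prop where
  one_mem : 1 ∈ H
  mul_mem : ∀ {g h}, g ∈ H → h ∈ H → g * h ∈ H
  exists_inv : ∀ {h}, h ∈ H → ∃ h' ∈ H, h * h' = 1 ∧ h' * h = 1

lemma IsOperatorGroup.isUnit {H : Set (Y →L[ℝ] Y)} (hH : IsOperatorGroup H) {h : Y →L[ℝ] Y}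
    (hh : h ∈ H) : IsUnit h := by
  obtain ⟨h', -, h1, h2⟩ := hH.exists_inv hh
  exact ⟨⟨h, h', h1, h2⟩, rfl⟩

lemma IsOperatorGroup.inverse_mem {H : Set (Y →L[ℝ] Y)} (hH : IsOperatorGroup H) {h : Y →L[ℝ] Y}
    (hh : h ∈ H) : Ring.inverse h ∈ H := by
  obtain ⟨h', hh', h1, h2⟩ := hH.exists_inv hh
  exact (Ring.inverse_unit (⟨h, h', h1, h2⟩ : (Y →L[ℝ] Y)ˣ)).symm ▸ hh'

/-- `A` is the velocity at the identity of a `C^2` curve in `H`. -/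
def IsVelocity (H : Set (Y →L[ℝ] Y)) (A : Y →L[ℝ] Y) : Prop :=
  ∃ c : ℝ → Y →L[ℝ] Y, ContDiffAt ℝ 2 c 0 ∧ (∀ᶠ t in 𝓝 0, c t ∈ H) ∧ c 0 = 1 ∧ HasDerivAt c A 0

variable {H : Set (Y →L[ℝ] Y)}

lemma isVelocity_zero (hH : IsOperatorGroup H) : IsVelocity H 0 :=
  ⟨fun _ => 1, contDiffAt_const, Eventually.of_forall fun _ => hH.one_mem, rfl,
    hasDerivAt_const _ _⟩

/-- The pointwise product of two curves through 1 has the sum of their velocities; this is where the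
group property enters. -/
lemma IsVelocity.add (hH : IsOperatorGroup H) {A A' : Y →L[ℝ] Y} (h : IsVelocity H A)
    (h' : IsVelocity H A') : IsVelocity H (A + A') := by
  obtain ⟨c, hc, hcH, hc0, hcd⟩ := h
  obtain ⟨c', hc', hcH', hc0', hcd'⟩ := h'
  refine ⟨fun t => c t * c' t, hc.clm_comp hc', ?_, by simp [hc0, hc0'], ?_⟩
  · filter_upwards [hcH, hcH'] with t h1 h2 using hH.mul_mem h1 h2
  · simpa [hc0, hc0'] using hcd.fun_mul hcd'

lemma IsVelocity.smul {A : Y →L[ℝ] Y} (h : IsVelocity H A) (r : ℝ) : IsVelocity H (r • A) := by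
  obtain ⟨c, hc, hcH, hc0, hcd⟩ := h
  have hr : Tendsto (fun t : ℝ => r * t) (𝓝 0) (𝓝 0) := by
    have : Continuous fun t : ℝ => r * t := by fun_prop
    simpa using this.tendsto 0
  refine ⟨fun t => c (r * t), ?_, hr.eventually hcH, by simp [hc0], ?_⟩
  · refine ContDiffAt.comp (g := c) (f := fun t => r * t) 0 (by simpa using hc) ?_
    exact contDiffAt_const.mul contDiffAt_id
  · have h1 : HasDerivAt (fun t : ℝ => r * t) r 0 := by
      simpa using (hasDerivAt_id (0 : ℝ)).const_mul r
    exact HasDerivAt.scomp (g₁ := c) (h := fun t => r * t) 0 (by simpa using hcd) h1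

/-- The velocities at the identity of curves in `H` form a vector space. -/
def velocitySubmodule (hH : IsOperatorGroup H) : Submodule ℝ (Y →L[ℝ] Y) where
  carrier := {A | IsVelocity H A}
  add_mem' := fun h h' => h.add hH h'
  zero_mem' := isVelocity_zero hH
  smul_mem' := fun r _ h => h.smul r

/-- Velocities of curves in `H`, translated to the identity on the right. -/
lemma isVelocity_mul_right (hH : IsOperatorGroup H) {c : ℝ → Y →L[ℝ] Y} {A h : Y →L[ℝ] Y} {t₀ : ℝ}
    (hc : ContDiffAt ℝ 2 c t₀) (hcH : ∀ᶠ t in 𝓝 t₀, c t ∈ H) (hd : HasDerivAt c A t₀)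
    (hh : h ∈ H) (h1 : c t₀ * h = 1) : IsVelocity H (A * h) := by
  have ht : Tendsto (fun t : ℝ => t₀ + t) (𝓝 0) (𝓝 t₀) := by
    have : Continuous fun t : ℝ => t₀ + t := by fun_prop
    simpa using this.tendsto 0
  refine ⟨fun t => c (t₀ + t) * h, ?_, ?_, by simpa using h1, ?_⟩
  · refine ContDiffAt.clm_comp (g := fun t => c (t₀ + t)) ?_ contDiffAt_const
    refine ContDiffAt.comp (g := c) (f := fun t => t₀ + t) 0 (by simpa using hc) ?_
    exact contDiffAt_const.add contDiffAt_id
  · filter_upwards [ht.eventually hcH] with t h2 using hH.mul_mem h2 hh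
  · refine HasDerivAt.mul_const (c := fun t => c (t₀ + t)) ?_ h
    exact HasDerivAt.comp_const_add (f := c) t₀ 0 (by simpa using hd)

/-- Velocities of curves in `H`, translated to the identity on the left. -/
lemma isVelocity_mul_left (hH : IsOperatorGroup H) {c : ℝ → Y →L[ℝ] Y} {A h : Y →L[ℝ] Y} {t₀ : ℝ}
    (hc : ContDiffAt ℝ 2 c t₀) (hcH : ∀ᶠ t in 𝓝 t₀, c t ∈ H) (hd : HasDerivAt c A t₀)
    (hh : h ∈ H) (h1 : h * c t₀ = 1) : IsVelocity H (h * A) := by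
  have ht : Tendsto (fun t : ℝ => t₀ + t) (𝓝 0) (𝓝 t₀) := by
    have : Continuous fun t : ℝ => t₀ + t := by fun_prop
    simpa using this.tendsto 0
  refine ⟨fun t => h * c (t₀ + t), ?_, ?_, by simpa using h1, ?_⟩
  · refine ContDiffAt.clm_comp (f := fun t => c (t₀ + t)) contDiffAt_const ?_
    refine ContDiffAt.comp (g := c) (f := fun t => t₀ + t) 0 (by simpa using hc) ?_
    exact contDiffAt_const.add contDiffAt_id
  · filter_upwards [ht.eventually hcH] with t h2 using hH.mul_mem hh h2
  · refine HasDerivAt.const_mul (d := fun t => c (t₀ + t)) h ?_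
    exact HasDerivAt.comp_const_add (f := c) t₀ 0 (by simpa using hd)

/-- Multiply the curves belonging to the individual velocities, each with its own parameter. The
result replaces coordinates of the second kind on a Lie group. -/
lemma exists_product_of_curves (hH : IsOperatorGroup H) (r : ℕ) (A : Fin r → Y →L[ℝ] Y)
    (hA : ∀ i, IsVelocity H (A i)) :
    ∃ G : (Fin r → ℝ) → Y →L[ℝ] Y, ContDiffAt ℝ 2 G 0 ∧ (∀ᶠ u in 𝓝 0, G u ∈ H) ∧ G 0 = 1 ∧
      HasFDerivAt G (∑ i, (ContinuousLinearMap.proj (R := ℝ) (φ := fun _ : Fin r => ℝ) i).smulRight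
        (A i)) 0 := by
  induction r with
  | zero =>
    refine ⟨fun _ => 1, contDiffAt_const, Eventually.of_forall fun _ => hH.one_mem, rfl, ?_⟩
    simpa using hasFDerivAt_const (1 : Y →L[ℝ] Y) (0 : Fin 0 → ℝ)
  | succ r ih =>
    obtain ⟨G, hG, hGH, hG0, hGd⟩ := ih (fun i => A i.succ) fun i => hA i.succ
    obtain ⟨c, hc, hcH, hc0, hcd⟩ := hA 0
    let p : (Fin (r + 1) → ℝ) →L[ℝ] (Fin r → ℝ) :=
      ContinuousLinearMap.pi fun i => ContinuousLinearMap.proj i.succ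
    let p₀ : (Fin (r + 1) → ℝ) →L[ℝ] ℝ := ContinuousLinearMap.proj 0
    have hp : Tendsto p (𝓝 0) (𝓝 0) := by simpa using p.continuous.tendsto 0
    have hp₀ : Tendsto p₀ (𝓝 0) (𝓝 0) := by simpa using p₀.continuous.tendsto 0
    refine ⟨fun u => c (p₀ u) * G (p u), ?_, ?_, by simp [hc0, hG0], ?_⟩
    · refine ContDiffAt.clm_comp ?_ ?_
      · exact ContDiffAt.comp (g := c) (f := p₀) 0 (by simpa using hc) p₀.contDiff.contDiffAt
      · exact ContDiffAt.comp (g := G) (f := p) 0 (by simpa using hG) p.contDiff.contDiffAt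
    · filter_upwards [hp₀.eventually hcH, hp.eventually hGH] with u h1 h2 using hH.mul_mem h1 h2
    · have h1 : HasFDerivAt (fun u => c (p₀ u)) (p₀.smulRight (A 0)) 0 := by
        have := HasFDerivAt.comp (g := c) (f := p₀) 0
          (by simpa using hcd.hasFDerivAt) p₀.hasFDerivAt
        refine this.congr_fderiv ?_
        ext u; simp
      have h2 : HasFDerivAt (fun u => G (p u)) _ 0 :=
        HasFDerivAt.comp (g := G) (f := p) 0 (by simpa using hGd) p.hasFDerivAt
      refine (h1.mul' h2).congr_fderiv ?_
      refine ContinuousLinearMap.ext fun u => ?_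
      have e1 : p₀ 0 = 0 := map_zero _
      have e2 : p 0 = 0 := map_zero _
      rw [e1, e2, hc0, hG0, Fin.sum_univ_succ]
      have e3 : ∀ v, (∑ i : Fin r, (ContinuousLinearMap.proj (R := ℝ) (φ := fun _ : Fin r => ℝ)
          i).smulRight (A i.succ)) v = ∑ i, v i • A i.succ := fun v => by
        rw [sum_apply]; rfl
      have e4 : (∑ i : Fin r, (ContinuousLinearMap.proj (R := ℝ) (φ := fun _ : Fin (r + 1) => ℝ)
          i.succ).smulRight (A i.succ)) u =
          ∑ i : Fin r, u i.succ • A i.succ := by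
        rw [sum_apply]; rfl
      rw [add_apply, add_apply, e4]
      refine (add_comm _ _).trans (congrArg₂ (· + ·) ?_ ?_)
      · exact mul_one (u 0 • A 0)
      · exact (one_mul _).trans (e3 (p u))

variable [FiniteDimensional ℝ Y]

/-- A `C^2` map into `H` which is tangent to the velocity space at the identity. -/
lemma exists_slice (hH : IsOperatorGroup H) :
    ∃ (n : ℕ) (ι : (Fin n → ℝ) →L[ℝ] (Y →L[ℝ] Y)) (pr : (Y →L[ℝ] Y) →L[ℝ] (Fin n → ℝ))
      (G : (Fin n → ℝ) → Y →L[ℝ] Y), (∀ u, pr (ι u) = u) ∧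
      (∀ A, IsVelocity H A → ι (pr A) = A) ∧ ContDiffAt ℝ 2 G 0 ∧ (∀ᶠ u in 𝓝 0, G u ∈ H) ∧
      G 0 = 1 ∧ HasFDerivAt G ι 0 := by
  let V := velocitySubmodule hH
  let b := Module.finBasis ℝ V
  obtain ⟨G, hG, hGH, hG0, hGd⟩ := exists_product_of_curves hH _
    (fun i => (b i : Y →L[ℝ] Y)) fun i => (b i).2
  -- Any linear projection onto the velocity space will do: `pr` reads off coordinates that
  -- determine a velocity, though not a general operator.
  obtain ⟨g, hg⟩ := V.subtype.exists_leftInverse_of_injective (by simp)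
  have hg' : ∀ v : V, g v = v := fun v => LinearMap.congr_fun hg v
  let pr : (Y →L[ℝ] Y) →L[ℝ] (Fin (Module.finrank ℝ V) → ℝ) :=
    LinearMap.toContinuousLinearMap ((b.equivFun : V →ₗ[ℝ] _) ∘ₗ g)
  have hι : ∀ u, (∑ i, (ContinuousLinearMap.proj (R := ℝ)
      (φ := fun _ : Fin (Module.finrank ℝ V) => ℝ) i).smulRight (b i : Y →L[ℝ] Y)) u =
      ((b.equivFun.symm u : V) : Y →L[ℝ] Y) := by
    intro u
    rw [sum_apply, b.equivFun_symm_apply, ← Submodule.subtype_apply, map_sum]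
    rfl
  refine ⟨_, _, pr, G, fun u => ?_, fun A hA => ?_, hG, hGH, hG0, hGd⟩
  · rw [hι]
    show b.equivFun (g _) = u
    rw [hg', LinearEquiv.apply_symm_apply]
  · rw [hι]
    show ((b.equivFun.symm (b.equivFun (g A)) : V) : Y →L[ℝ] Y) = A
    rw [LinearEquiv.symm_apply_apply, hg' ⟨A, hA⟩]

set_option synthInstance.maxHeartbeats 200000 in
/-- Solutions of `U' = A(t) U` with `A` tangent to `H` stay in `H`, for a short time which depends
only on a bound for `A`. -/
lemma exists_short_time_solution_of_slice (hH : IsOperatorGroup H) {V : Type*}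
    [NormedAddCommGroup V] [NormedSpace ℝ V] [CompleteSpace V] {ι : V →L[ℝ] (Y →L[ℝ] Y)}
    {pr : (Y →L[ℝ] Y) →L[ℝ] V} {G : V → Y →L[ℝ] Y} (hpr : ∀ u, pr (ι u) = u)
    (hpr' : ∀ A, IsVelocity H A → ι (pr A) = A) (hG : ContDiffAt ℝ 2 G 0)
    (hGH : ∀ᶠ u in 𝓝 0, G u ∈ H) (hG0 : G 0 = 1) (hGd : HasFDerivAt G ι 0) {C : ℝ} (hC : 0 ≤ C) :
    ∃ ε > 0, ∀ A : ℝ → Y →L[ℝ] Y, Continuous A → (∀ t, IsVelocity H (A t)) → (∀ t, ‖A t‖ ≤ C) →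
      ∀ t₀, ∃ U : ℝ → Y →L[ℝ] Y, U t₀ = 1 ∧ ContinuousOn U (Icc t₀ (t₀ + ε)) ∧
        (∀ t, U t ∈ H) ∧ ∀ t ∈ Ioo t₀ (t₀ + ε), HasDerivAt U (A t * U t) t := by
  let mulL : (Y →L[ℝ] Y) →L[ℝ] (Y →L[ℝ] Y) →L[ℝ] (Y →L[ℝ] Y) :=
    (ContinuousLinearMap.mul ℝ (Y →L[ℝ] Y)).flip
  have hmulL : ∀ A B, mulL A B = B * A := fun _ _ => rfl
  -- `Λ u v` gives the coordinates of the velocity of `G` at `u` in direction `v`, translated to the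
  -- identity. As `Λ 0 = 1`, it is invertible near 0, and U' = A U becomes u' = Λ(u)⁻¹ pr(A) under U
  -- = G(u).
  let Λ : V → V →L[ℝ] V := fun u => pr ∘L mulL (Ring.inverse (G u)) ∘L fderiv ℝ G u
  have hinv : ContDiffAt ℝ 1 (fun u => Ring.inverse (G u)) 0 := by
    have h1 : ContDiffAt ℝ 1 (Ring.inverse : (Y →L[ℝ] Y) → _) (G 0) := by
      have := contDiffAt_ringInverse ℝ (n := 1) (1 : (Y →L[ℝ] Y)ˣ)
      rwa [Units.val_one, ← hG0] at this
    exact h1.comp (0 : V) (hG.of_le (by norm_num))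
  have hΛ : ContDiffAt ℝ 1 Λ 0 := by
    refine contDiffAt_const.clm_comp (ContDiffAt.clm_comp ?_ (hG.fderiv_right (by norm_num)))
    exact contDiffAt_mul_flip hinv
  have hΛ0 : Λ 0 = 1 := by
    refine ContinuousLinearMap.ext fun u => ?_
    show pr (mulL (Ring.inverse (G 0)) (fderiv ℝ G 0 u)) = u
    rw [hG0, hGd.fderiv, hmulL, Ring.inverse_one, mul_one]
    exact hpr u
  have hΘ : ContDiffAt ℝ 1 (fun u => Ring.inverse (Λ u)) 0 := by
    have h1 : ContDiffAt ℝ 1 (Ring.inverse : (V →L[ℝ] V) → _) (Λ 0) := by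
      have := contDiffAt_ringInverse ℝ (n := 1) (1 : (V →L[ℝ] V)ˣ)
      rwa [Units.val_one, ← hΛ0] at this
    exact h1.comp (0 : V) hΛ
  -- Here two derivatives of `G` are needed: they make the inverse of `Λ` `C^1`, hence locally
  -- Lipschitz.
  obtain ⟨K, s, hs, hK⟩ := hΘ.exists_lipschitzOnWith
  have hunit : ∀ᶠ u in 𝓝 (0 : V), IsUnit (Λ u) := by
    have : {T : V →L[ℝ] V | IsUnit T} ∈ 𝓝 (Λ 0) :=
      Units.isOpen.mem_nhds (by simp [hΛ0])
    exact hΛ.continuousAt this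
  have hdiff : ∀ᶠ u in 𝓝 (0 : V), ContDiffAt ℝ 2 G u := hG.eventually (by norm_num)
  have hGH' : ∀ᶠ u in 𝓝 (0 : V), ∀ᶠ w in 𝓝 u, G w ∈ H := eventually_eventually_nhds.2 hGH
  obtain ⟨r, hr, hball⟩ := Metric.nhds_basis_closedBall.eventually_iff.1
    (hunit.and (hdiff.and (hGH'.and hs)))
  let r' : ℝ≥0 := ⟨r, hr.le⟩
  let C' : ℝ≥0 := ⟨C, hC⟩
  have h0r : (0 : V) ∈ Metric.closedBall (0 : V) r := Metric.mem_closedBall_self hr.le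
  let M : ℝ≥0 := K * r' + ‖Ring.inverse (Λ 0)‖₊
  have hM : ∀ u ∈ Metric.closedBall (0 : V) r, ‖Ring.inverse (Λ u)‖ ≤ M := by
    intro u hu
    have h1 := hK.norm_sub_le (hball hu).2.2.2 (hball h0r).2.2.2
    rw [sub_zero] at h1
    have h2 : ‖u‖ ≤ r := by simpa using hu
    calc ‖Ring.inverse (Λ u)‖ = ‖(Ring.inverse (Λ u) - Ring.inverse (Λ 0)) + Ring.inverse (Λ 0)‖ := by
          rw [sub_add_cancel]
      _ ≤ K * ‖u‖ + ‖Ring.inverse (Λ 0)‖ := (norm_add_le _ _).trans (by gcongr)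
      _ ≤ K * r + ‖Ring.inverse (Λ 0)‖ := by gcongr
  let L : ℝ≥0 := M * (‖pr‖₊ * C')
  -- `L` bounds the speed of u, so u stays in the ball of radius `r` during this time. Only `C` and
  -- the slice enter, not `A`.
  let ε : ℝ := r / (L + 1)
  have hε : 0 < ε := by positivity
  refine ⟨ε, hε, fun A hA hAV hAC t₀ => ?_⟩
  have hprA : ∀ t, ‖pr (A t)‖ ≤ ‖pr‖ * C := fun t => pr.le_opNorm_of_le (hAC t)
  let f : ℝ → V → V := fun t u => Ring.inverse (Λ u) (pr (A t))
  have hPL : IsPicardLindelof f (tmin := t₀) (tmax := t₀ + ε) ⟨t₀, le_rfl, by linarith⟩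
      0 r' 0 L (K * (‖pr‖₊ * C')) := by
    refine ⟨fun t _ => ?_, fun u _ => ?_, fun t _ u hu => ?_, ?_⟩
    · refine LipschitzOnWith.of_dist_le_mul fun u hu v hv => ?_
      rw [dist_eq_norm, dist_eq_norm]
      have h1 := hK.norm_sub_le (hball hu).2.2.2 (hball hv).2.2.2
      have h2 : f t u - f t v = (Ring.inverse (Λ u) - Ring.inverse (Λ v)) (pr (A t)) := rfl
      rw [h2]
      calc _ ≤ (K * ‖u - v‖) * (‖pr‖ * C) :=
            ContinuousLinearMap.le_of_opNorm_le_of_le _ h1 (hprA t)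
        _ = K * (‖pr‖ * C) * ‖u - v‖ := by ring
    · exact ((Ring.inverse (Λ u)).continuous.comp (pr.continuous.comp hA)).continuousOn
    · exact ContinuousLinearMap.le_of_opNorm_le_of_le _ (hM u hu) (hprA t)
    · simp only [add_sub_cancel_left, sub_self, NNReal.coe_zero, sub_zero]
      rw [max_eq_left hε.le]
      show (L : ℝ) * (r / (L + 1)) ≤ r
      rw [mul_div_assoc', div_le_iff₀ (by positivity)]
      nlinarith [L.2]
  obtain ⟨u, hu0, hur, hud⟩ := exists_solution_mem_closedBall hPL
  have huH : ∀ t, G (u t) ∈ H := fun t => (hball (hur t)).2.2.1.self_of_nhds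
  refine ⟨fun t => G (u t), (congrArg G hu0).trans hG0, ?_, huH, fun t ht => ?_⟩
  · intro t ht
    exact ((hball (hur t)).2.1.continuousAt).comp_continuousWithinAt (hud t ht).continuousWithinAt
  · have hb := hball (hur t)
    have hGt : HasFDerivAt G (fderiv ℝ G (u t)) (u t) :=
      (hb.2.1.differentiableAt (by norm_num)).hasFDerivAt
    have hut : HasDerivAt u (f t (u t)) t :=
      hasDerivAt_of_Icc (hud t (Ioo_subset_Icc_self ht)) ht
    have hd := hGt.comp_hasDerivAt t hut
    refine hd.congr_deriv ?_
    set v := f t (u t)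
    have hv : Λ (u t) v = pr (A t) := by
      show (Λ (u t) * Ring.inverse (Λ (u t))) (pr (A t)) = _
      rw [Ring.mul_inverse_cancel _ hb.1]; rfl
    have hGu := hH.isUnit (huH t)
    -- Moving `u t` in direction `v` gives a curve in `H`, so the translated derivative is a
    -- velocity. The equation prescribes only its coordinates, but on velocities these determine the
    -- operator.
    have hvel : IsVelocity H (fderiv ℝ G (u t) v * Ring.inverse (G (u t))) := by
      have hline : HasDerivAt (fun s : ℝ => u t + s • v) v 0 := by
        simpa using ((hasDerivAt_id (0 : ℝ)).smul_const v).const_add (u t)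
      have hlt : Tendsto (fun s : ℝ => u t + s • v) (𝓝 0) (𝓝 (u t)) := by
        simpa using hline.continuousAt.tendsto
      refine isVelocity_mul_right hH (c := fun s : ℝ => G (u t + s • v)) (t₀ := 0) ?_ ?_ ?_
        (hH.inverse_mem (huH t)) ?_
      · refine ContDiffAt.comp (g := G) (f := fun s : ℝ => u t + s • v) 0
          (by simpa using hb.2.1) ?_
        exact contDiffAt_const.add (contDiffAt_id.smul contDiffAt_const)
      · exact hlt.eventually hb.2.2.1
      · exact HasFDerivAt.comp_hasDerivAt (l := G) (f := fun s : ℝ => u t + s • v) 0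
          (by simpa using hGt) hline
      · simpa using Ring.mul_inverse_cancel _ hGu
    have h3 : fderiv ℝ G (u t) v * Ring.inverse (G (u t)) = A t := by
      have h4 : pr (fderiv ℝ G (u t) v * Ring.inverse (G (u t))) = pr (A t) := hv
      have := congrArg ι h4
      rwa [hpr' _ hvel, hpr' _ (hAV t)] at this
    rw [← h3, mul_assoc, Ring.inverse_mul_cancel _ hGu, mul_one]

lemma exists_short_time_solution (hH : IsOperatorGroup H) {C : ℝ} (hC : 0 ≤ C) :
    ∃ ε > 0, ∀ A : ℝ → Y →L[ℝ] Y, Continuous A → (∀ t, IsVelocity H (A t)) → (∀ t, ‖A t‖ ≤ C) →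
      ∀ t₀, ∃ U : ℝ → Y →L[ℝ] Y, U t₀ = 1 ∧ ContinuousOn U (Icc t₀ (t₀ + ε)) ∧
        (∀ t, U t ∈ H) ∧ ∀ t ∈ Ioo t₀ (t₀ + ε), HasDerivAt U (A t * U t) t := by
  obtain ⟨n, ι, pr, G, h1, h2, h3, h4, h5, h6⟩ := exists_slice hH
  exact exists_short_time_solution_of_slice hH h1 h2 h3 h4 h5 h6 hC

/-- A solution of `W' = A(t) W` which starts in the group `H` stays in it, if all `A(t)` are
velocities of curves in `H`. -/
theorem mem_of_deriv_eq_velocity_mul (hH : IsOperatorGroup H) {A W : ℝ → Y →L[ℝ] Y} {a b : ℝ}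
    (hab : a ≤ b) (hA : ContinuousOn A (Icc a b)) (hAV : ∀ t ∈ Icc a b, IsVelocity H (A t))
    (hW : ContinuousOn W (Icc a b)) (hWd : ∀ t ∈ Ioo a b, HasDerivAt W (A t * W t) t)
    (hWa : W a ∈ H) : W b ∈ H := by
  obtain ⟨C, hC⟩ := isCompact_Icc.exists_bound_of_continuousOn hA
  have hC0 : 0 ≤ C := (norm_nonneg _).trans (hC a ⟨le_rfl, hab⟩)
  obtain ⟨ε, hε, hstep⟩ := exists_short_time_solution hH hC0
  have hmem : ∀ t, (projIcc a b hab t : ℝ) ∈ Icc a b := fun t => (projIcc a b hab t).2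
  -- Freezing `A` outside the interval makes it continuous on the whole line with the same bound.
  have hstep' := hstep (fun t => A (projIcc a b hab t))
    (hA.comp_continuous (continuous_subtype_val.comp continuous_projIcc) hmem)
    (fun t => hAV _ (hmem t)) (fun t => hC _ (hmem t))
  -- Advance in steps of fixed length `ε`; on each step `W` is the short-time solution in `H` times
  -- the value already known to lie in `H`, by uniqueness.
  have key : ∀ n : ℕ, ∀ t ∈ Icc a b, t ≤ a + n * ε → W t ∈ H := by
    intro n
    induction n with
    | zero =>
      intro t ht htn
      have : t = a := le_antisymm (by simpa using htn) ht.1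
      rwa [this]
    | succ n ih =>
      intro t ht htn
      rcases le_total t (a + n * ε) with h | h
      · exact ih t ht h
      set s := a + n * ε
      have hs : s ∈ Icc a b := ⟨le_add_of_nonneg_right (by positivity), h.trans ht.2⟩
      obtain ⟨U, hU0, hUc, hUH, hUd⟩ := hstep' s
      have hts : t ≤ s + ε := by push_cast at htn; linarith
      have heq := eqOn_of_linear_ode (f := W) (g := fun t => U t * W s) (a := s) (b := t)
        (A := fun t => ContinuousLinearMap.compL ℝ Y Y Y (A t))
        ((ContinuousLinearMap.compL ℝ Y Y Y).continuous.comp_continuousOn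
          (hA.mono (Icc_subset_Icc hs.1 ht.2)))
        (hW.mono (Icc_subset_Icc hs.1 ht.2))
        ((hUc.mono (Icc_subset_Icc le_rfl hts)).mul continuousOn_const)
        (fun x hx => hWd x ⟨hs.1.trans_lt hx.1, hx.2.trans_le ht.2⟩)
        (fun x hx => ?_) (by simp [hU0])
      · have := heq (⟨h, le_rfl⟩ : t ∈ Icc s t)
        rw [this]
        exact hH.mul_mem (hUH t) (ih s hs le_rfl)
      · have h1 := (hUd x ⟨hx.1, hx.2.trans_le hts⟩).mul_const (W s)
        have h2 : (projIcc a b hab x : ℝ) = x := by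
          rw [projIcc_of_mem hab ⟨hs.1.trans hx.1.le, hx.2.le.trans ht.2⟩]
        rw [h2, mul_assoc] at h1
        exact h1
  obtain ⟨n, hn⟩ := exists_nat_ge ((b - a) / ε)
  refine key n b ⟨hab, le_rfl⟩ ?_
  rw [div_le_iff₀ hε] at hn
  linarith

/-- The exponentials of velocities of curves in `H` belong to `H`. -/
lemma exp_smul_mem (hH : IsOperatorGroup H) {A : Y →L[ℝ] Y} (hA : IsVelocity H A) (t : ℝ) :
    NormedSpace.exp (t • A) ∈ H := by
  have h1 : ∀ B : Y →L[ℝ] Y, IsVelocity H B → NormedSpace.exp B ∈ H := by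
    intro B hB
    have hd : ∀ s : ℝ, HasDerivAt (fun s : ℝ => NormedSpace.exp (s • B))
        (B * NormedSpace.exp (s • B)) s := fun s => hasDerivAt_exp_smul_const' B s
    have := mem_of_deriv_eq_velocity_mul hH (A := fun _ => B)
      (W := fun s => NormedSpace.exp (s • B)) zero_le_one continuousOn_const (fun _ _ => hB)
      (fun s _ => (hd s).continuousAt.continuousWithinAt) (fun s _ => hd s)
      (by simpa using hH.one_mem)
    simpa using this
  exact h1 _ (hA.smul t)

end OperatorGroup

/-! ### The Frobenius theorem by integration along rays -/

section Frobenius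

open unitInterval

universe u
variable {X Y : Type u} [NormedAddCommGroup X] [NormedSpace ℝ X] [CompleteSpace X]
  [NormedAddCommGroup Y] [NormedSpace ℝ Y] [CompleteSpace Y]

/-- Solutions of `x' = L(x, y) w` along the rays `y = t w` depend smoothly on the initial value
and on `w`. -/
lemma exists_ray_solution {L : X × Y → Y →L[ℝ] X} {Ω : Set (X × Y)} (hΩ : IsOpen Ω) (h0 : 0 ∈ Ω)
    (hL : ContDiffOn ℝ ∞ L Ω) :
    ∃ (φ : X × Y → X) (r : ℝ), 0 < r ∧ ContDiffOn ℝ ∞ φ (Metric.ball 0 r) ∧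
      ∀ p ∈ Metric.ball (0 : X × Y) r, (φ p, p.2) ∈ Ω ∧ φ (p.1, 0) = p.1 ∧
        fderiv ℝ φ p (0, p.2) = L (φ p, p.2) p.2 := by
  -- The state is (x, y, w) with x' = L(x, y) w, y' = w, w' = 0, so the direction of the ray becomes
  -- part of the initial value (x, 0, w).
  let Ω' : Set (X × Y × Y) := {p | (p.1, p.2.1) ∈ Ω}
  let g : X × Y × Y → X × Y × Y := fun p => (L (p.1, p.2.1) p.2.2, p.2.2, 0)
  have hpr : ContDiff ℝ ∞ (fun p : X × Y × Y => (p.1, p.2.1)) :=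
    contDiff_fst.prodMk (contDiff_fst.comp contDiff_snd)
  have hΩ' : IsOpen Ω' := hΩ.preimage hpr.continuous
  have hg : ContDiffOn ℝ ∞ g Ω' := by
    have h1 : ContDiffOn ℝ ∞ (fun p : X × Y × Y => L (p.1, p.2.1)) Ω' :=
      hL.comp hpr.contDiffOn fun p hp => hp
    have h2 : ContDiff ℝ ∞ (fun p : X × Y × Y => p.2.2) := contDiff_snd.comp contDiff_snd
    exact (h1.clm_apply h2.contDiffOn).prodMk (h2.contDiffOn.prodMk contDiffOn_const)
  have h0' : (0 : X × Y × Y) ∈ Ω' := h0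
  have hgat : ContDiffAt ℝ 1 g 0 := (hg.contDiffAt (hΩ'.mem_nhds h0')).of_le (by simp)
  obtain ⟨K, s, hs, hK⟩ := hgat.exists_lipschitzOnWith
  obtain ⟨ρ, hρ, hρs⟩ := Metric.mem_nhds_iff.1 hs
  let w₀ : C(I, X × Y × Y) := ContinuousMap.const I 0
  have hsol : ∀ t : I, w₀ t = w₀ 0 + primitiveCLM (superpose g w₀) t := by
    intro t
    have : superpose g w₀ = 0 := by
      ext1 t
      rw [superpose_apply hg.continuousOn fun _ => h0']
      show (L (0, 0) 0, (0 : Y), (0 : Y)) = 0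
      simp
    rw [this, primitiveCLM_apply_zero]; simp [w₀]
  -- Nearby solutions are kept in a ball where `g` is Lipschitz, so that uniqueness applies to them
  -- below.
  have hO : {y : C(I, X × Y × Y) | ∀ t, y t ∈ Metric.ball (0 : X × Y × Y) ρ} ∈ 𝓝 w₀ :=
    (isOpen_setOf_forall_mem Metric.isOpen_ball).mem_nhds fun t => Metric.mem_ball_self hρ
  obtain ⟨N, S, hN, hwN, hS, -, hSN⟩ := exists_smooth_flow hΩ' hg w₀ (fun _ => h0') hsol hO
  let ι : X × Y → X × Y × Y := fun p => (p.1, 0, p.2)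
  have hι : ContDiff ℝ ∞ ι := contDiff_fst.prodMk (contDiff_const.prodMk contDiff_snd)
  obtain ⟨r, hr, hrN⟩ := Metric.isOpen_iff.1 (hN.preimage hι.continuous) 0 hwN
  let σ' : X × Y → ℝ → X × Y × Y := fun p => IccExtend zero_le_one (S (ι p))
  have hσ0 : ∀ p ∈ Metric.ball (0 : X × Y) r, σ' p 0 = ι p := fun p hp => by
    show IccExtend zero_le_one (S (ι p)) 0 = _
    rw [IccExtend_of_mem _ _ ⟨le_rfl, zero_le_one⟩]
    exact (hSN _ (hrN hp)).2.2.1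
  have hσc : ∀ p, Continuous (σ' p) := fun p => (S (ι p)).continuous.Icc_extend'
  have hσρ : ∀ p ∈ Metric.ball (0 : X × Y) r, ∀ t, σ' p t ∈ Metric.ball (0 : X × Y × Y) ρ :=
    fun p hp t => (hSN _ (hrN hp)).1 _
  have hσΩ : ∀ p ∈ Metric.ball (0 : X × Y) r, ∀ t, σ' p t ∈ Ω' :=
    fun p hp t => (hSN _ (hrN hp)).2.1 _
  have hσd : ∀ p ∈ Metric.ball (0 : X × Y) r, ∀ t ∈ Icc (0 : ℝ) 1,
      HasDerivWithinAt (σ' p) (g (σ' p t)) (Icc 0 1) t := by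
    intro p hp t ht
    have := (hSN _ (hrN hp)).2.2.2 t ht
    rwa [← IccExtend_of_mem zero_le_one (S (ι p)) ht] at this
  have hσ3 : ∀ p ∈ Metric.ball (0 : X × Y) r, ∀ t ∈ Icc (0 : ℝ) 1, (σ' p t).2.2 = p.2 := by
    intro p hp t ht
    have hc := hσc p
    have := eq_of_deriv_eq_zero_off_finite (Z := fun t => (σ' p t).2.2) finite_empty
      (by fun_prop : Continuous fun t => (σ' p t).2.2).continuousOn
      (fun t ht _ => (hasDerivAt_of_Icc (hσd p hp t (Ioo_subset_Icc_self ht)) ht).snd.snd) t ht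
    simpa [hσ0 p hp, ι] using this
  have hσ2 : ∀ p ∈ Metric.ball (0 : X × Y) r, ∀ t ∈ Icc (0 : ℝ) 1, (σ' p t).2.1 = t • p.2 := by
    intro p hp t ht
    have hc := hσc p
    have := eq_of_deriv_eq_zero_off_finite (Z := fun t => (σ' p t).2.1 - t • p.2) finite_empty
      (by fun_prop : Continuous fun t => (σ' p t).2.1 - t • p.2).continuousOn
      (fun t ht _ => by
        have h3 : HasDerivAt (fun t => (σ' p t).2.1) (σ' p t).2.2 t :=
          (hasDerivAt_of_Icc (hσd p hp t (Ioo_subset_Icc_self ht)) ht).snd.fst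
        have h4 := h3.fun_sub ((hasDerivAt_id t).smul_const p.2)
        rw [hσ3 p hp t (Ioo_subset_Icc_self ht)] at h4
        simpa using h4) t ht
    simp only [hσ0 p hp, ι, zero_smul, sub_zero] at this
    exact sub_eq_zero.1 this
  let φ : X × Y → X := fun p => (S (ι p) 1).1
  have hφσ : ∀ p, φ p = (σ' p 1).1 := fun p => by
    show _ = (IccExtend zero_le_one (S (ι p)) 1).1
    rw [IccExtend_of_mem _ _ ⟨zero_le_one, le_rfl⟩]; rfl
  have hφ : ContDiffOn ℝ ∞ φ (Metric.ball 0 r) :=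
    contDiff_fst.comp_contDiffOn ((contDiffOn_eval_path hS 1).comp hι.contDiffOn hrN)
  -- scaling
  have hscale_mem : ∀ p ∈ Metric.ball (0 : X × Y) r, ∀ t ∈ Icc (0 : ℝ) 1,
      (p.1, t • p.2) ∈ Metric.ball (0 : X × Y) r := by
    intro p hp t ht
    rw [mem_ball_zero_iff] at hp ⊢
    refine lt_of_le_of_lt ?_ hp
    rw [Prod.norm_def, Prod.norm_def]
    refine max_le_max le_rfl ?_
    rw [norm_smul, Real.norm_of_nonneg ht.1]
    exact mul_le_of_le_one_left (norm_nonneg _) ht.2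
  -- The ray in direction t w is the ray in direction w run at speed t; so moving along the ray in
  -- the argument of `φ` follows a single solution, whose derivative is known.
  have hscale : ∀ p ∈ Metric.ball (0 : X × Y) r, ∀ t ∈ Icc (0 : ℝ) 1,
      φ (p.1, t • p.2) = (σ' p t).1 := by
    intro p hp t ht
    let β : ℝ → X × Y × Y := fun x => ((σ' p (x * t)).1, (σ' p (x * t)).2.1, t • p.2)
    have hmaps : MapsTo (fun x : ℝ => x * t) (Icc 0 1) (Icc 0 1) := fun x hx =>
      ⟨mul_nonneg hx.1 ht.1, mul_le_one₀ hx.2 ht.1 ht.2⟩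
    have hβρ : ∀ x ∈ Icc (0 : ℝ) 1, β x ∈ Metric.ball (0 : X × Y × Y) ρ := by
      intro x hx
      have h1 := hσρ p hp (x * t)
      have h2 : ‖p.2‖ ≤ ‖(σ' p (x * t)).2‖ := by
        rw [← hσ3 p hp _ (hmaps hx)]; exact norm_snd_le _
      rw [mem_ball_zero_iff] at h1 ⊢
      refine lt_of_le_of_lt ?_ h1
      refine max_le (norm_fst_le (σ' p (x * t))) (max_le
        ((norm_fst_le (σ' p (x * t)).2).trans (norm_snd_le (σ' p (x * t)))) ?_)
      refine le_trans ?_ (h2.trans (norm_snd_le _))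
      rw [norm_smul, Real.norm_of_nonneg ht.1]
      exact mul_le_of_le_one_left (norm_nonneg _) ht.2
    have hβd : ∀ x ∈ Icc (0 : ℝ) 1, HasDerivWithinAt β (g (β x)) (Icc 0 1) x := by
      intro x hx
      have h1 := (hσd p hp (x * t) (hmaps hx)).scomp x
        (((hasDerivAt_id x).mul_const t).hasDerivWithinAt) hmaps
      have h2 : HasDerivWithinAt (fun x => (σ' p (x * t)).1) _ (Icc 0 1) x := h1.fst
      have h2' : HasDerivWithinAt (fun x => (σ' p (x * t)).2.1) _ (Icc 0 1) x := h1.snd.fst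
      have h3 : HasDerivWithinAt β _ (Icc 0 1) x := h2.prodMk (h2'.prodMk
        (hasDerivWithinAt_const x (Icc (0 : ℝ) 1) (t • p.2)))
      refine h3.congr_deriv ?_
      simp only [one_mul, g, β, hσ3 p hp _ (hmaps hx), map_smul]
      rfl
    have hp' := hscale_mem p hp t ht
    have heq : EqOn (σ' (p.1, t • p.2)) β (Icc 0 1) := by
      refine ODE_solution_unique_of_mem_Icc_right (v := fun _ => g)
        (s := fun _ => Metric.ball 0 ρ) (K := K) (fun _ _ => hK.mono hρs)
        (hσc _).continuousOn (fun x hx => ?_) (fun x hx => hσρ _ hp' x)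
        (fun x hx => (hβd x hx).continuousWithinAt) (fun x hx => ?_)
        (fun x hx => hβρ x (Ico_subset_Icc_self hx)) ?_
      · exact (hσd _ hp' x (Ico_subset_Icc_self hx)).mono_of_mem_nhdsWithin
          (Icc_mem_nhdsGE_of_mem hx)
      · exact (hβd x (Ico_subset_Icc_self hx)).mono_of_mem_nhdsWithin (Icc_mem_nhdsGE_of_mem hx)
      · rw [hσ0 _ hp']
        simp [β, hσ0 p hp, ι]
    rw [hφσ, heq ⟨zero_le_one, le_rfl⟩]
    simp [β]
  refine ⟨φ, r, hr, hφ, fun p hp => ⟨?_, ?_, ?_⟩⟩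
  · have := hσΩ p hp 1
    have h2 := hσ2 p hp 1 ⟨zero_le_one, le_rfl⟩
    rw [one_smul] at h2
    rw [hφσ, ← h2]
    exact this
  · have := hscale p hp 0 ⟨le_rfl, zero_le_one⟩
    rw [zero_smul, hσ0 p hp] at this
    exact this
  · have hone : (1 : ℝ) ∈ Icc (0 : ℝ) 1 := ⟨zero_le_one, le_rfl⟩
    have hφp : HasFDerivAt φ (fderiv ℝ φ p) p :=
      ((hφ.contDiffAt (Metric.isOpen_ball.mem_nhds hp)).differentiableAt (by simp)).hasFDerivAt
    have hline : HasDerivAt (fun t : ℝ => (p.1, t • p.2)) (0, p.2) 1 := by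
      simpa using (hasDerivAt_const (1 : ℝ) p.1).prodMk ((hasDerivAt_id (1 : ℝ)).smul_const p.2)
    have h1 : HasDerivAt (fun t : ℝ => φ (p.1, t • p.2)) (fderiv ℝ φ p (0, p.2)) 1 :=
      HasFDerivAt.comp_hasDerivAt (l := φ) (f := fun t : ℝ => (p.1, t • p.2)) 1
        (by simpa using hφp) hline
    have h2' : HasDerivWithinAt (fun t : ℝ => (σ' p t).1) (g (σ' p 1)).1 (Icc 0 1) 1 :=
      (hσd p hp 1 hone).fst
    have h2 : HasDerivWithinAt (fun t : ℝ => φ (p.1, t • p.2)) (g (σ' p 1)).1 (Icc 0 1) 1 :=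
      h2'.congr (fun t ht => hscale p hp t ht) (hscale p hp 1 hone)
    have h3 := (uniqueDiffOn_Icc_zero_one 1 hone).eq_deriv _ h1.hasDerivWithinAt h2
    rw [h3]
    show L ((σ' p 1).1, (σ' p 1).2.1) (σ' p 1).2.2 = _
    rw [hσ3 p hp 1 hone, hσ2 p hp 1 hone, one_smul, hφσ]

/-- The solutions of `exists_ray_solution` solve the total differential equation
`dφ/dy = L(φ, y)`, if `L` satisfies the integrability condition. -/
lemma fderiv_ray_solution {L : X × Y → Y →L[ℝ] X} {Ω : Set (X × Y)} (hΩ : IsOpen Ω)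
    (hL : ContDiffOn ℝ ∞ L Ω)
    (hint : ∀ z ∈ Ω, ∀ v w, fderiv ℝ L z (L z v, v) w = fderiv ℝ L z (L z w, w) v)
    {φ : X × Y → X} {r : ℝ} (hφ : ContDiffOn ℝ ∞ φ (Metric.ball 0 r))
    (hφΩ : ∀ p ∈ Metric.ball (0 : X × Y) r, (φ p, p.2) ∈ Ω)
    (hφd : ∀ p ∈ Metric.ball (0 : X × Y) r, fderiv ℝ φ p (0, p.2) = L (φ p, p.2) p.2) :
    ∀ p ∈ Metric.ball (0 : X × Y) r, ∀ v, fderiv ℝ φ p (0, v) = L (φ p, p.2) v := by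
  intro p hp v
  set D := Metric.ball (0 : X × Y) r
  have hD : IsOpen D := Metric.isOpen_ball
  have hφat : ∀ q ∈ D, ContDiffAt ℝ ∞ φ q := fun q hq => hφ.contDiffAt (hD.mem_nhds hq)
  have hφ1 : ∀ q ∈ D, HasFDerivAt φ (fderiv ℝ φ q) q := fun q hq =>
    ((hφat q hq).differentiableAt (by simp)).hasFDerivAt
  have hφ2 : ∀ q ∈ D, HasFDerivAt (fderiv ℝ φ) (fderiv ℝ (fderiv ℝ φ) q) q := fun q hq =>
    (((hφat q hq).fderiv_right (m := 1) (by norm_cast)).differentiableAt (by simp)).hasFDerivAt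
  have hL1 : ∀ z ∈ Ω, HasFDerivAt L (fderiv ℝ L z) z := fun z hz =>
    ((hL.contDiffAt (hΩ.mem_nhds hz)).differentiableAt (by simp)).hasFDerivAt
  let M : X × Y → Y →L[ℝ] X := fun q => L (φ q, q.2)
  have hM : ∀ q ∈ D, HasFDerivAt M (fderiv ℝ L (φ q, q.2) ∘L
      ((fderiv ℝ φ q).prod (ContinuousLinearMap.snd ℝ X Y))) q := fun q hq =>
    HasFDerivAt.comp (g := L) q (hL1 _ (hφΩ q hq)) ((hφ1 q hq).prodMk hasFDerivAt_snd)
  -- differentiate the radial equation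
  have hI : ∀ q ∈ D, ∀ v, fderiv ℝ (fderiv ℝ φ) q (0, v) (0, q.2) + fderiv ℝ φ q (0, v) =
      fderiv ℝ L (φ q, q.2) (fderiv ℝ φ q (0, v), v) q.2 + L (φ q, q.2) v := by
    intro q hq v
    have h1 := (hφ2 q hq).clm_apply
      ((ContinuousLinearMap.inr ℝ X Y ∘L ContinuousLinearMap.snd ℝ X Y).hasFDerivAt (x := q))
    have h2 := (hM q hq).clm_apply (hasFDerivAt_snd (𝕜 := ℝ) (p := q))
    have h3 : (fun q : X × Y => fderiv ℝ φ q
        ((ContinuousLinearMap.inr ℝ X Y ∘L ContinuousLinearMap.snd ℝ X Y) q)) =ᶠ[𝓝 q]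
        fun q => M q q.2 :=
      Filter.eventually_of_mem (hD.mem_nhds hq) fun q hq => hφd q hq
    have h4 := congrArg (fun T : X × Y →L[ℝ] X => T (0, v))
      ((h1.congr_of_eventuallyEq h3.symm).unique h2)
    simp only [add_apply, ContinuousLinearMap.comp_apply, ContinuousLinearMap.flip_apply] at h4
    rw [add_comm (fderiv ℝ φ q _)] at h4
    rw [add_comm (M q _)] at h4
    exact h4
  have hmem : ∀ t ∈ Icc (0 : ℝ) 1, (p.1, t • p.2) ∈ D := by
    intro t ht
    simp only [D, mem_ball_zero_iff] at hp ⊢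
    refine lt_of_le_of_lt ?_ hp
    rw [Prod.norm_def, Prod.norm_def]
    refine max_le_max le_rfl ?_
    rw [norm_smul, Real.norm_of_nonneg ht.1]
    exact mul_le_of_le_one_left (norm_nonneg _) ht.2
  let q : ℝ → X × Y := fun t => (p.1, t • p.2)
  have hq : ∀ t, HasDerivAt q (0, p.2) t := fun t => by
    simpa using (hasDerivAt_const t p.1).prodMk ((hasDerivAt_id t).smul_const p.2)
  have hqc : Continuous q := continuous_iff_continuousAt.2 fun t => (hq t).continuousAt
  -- The factor t makes the defect of the total equation solve a homogeneous linear equation along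
  -- the ray. Differentiating the radial equation, symmetry of second derivatives and integrability
  -- cancel all other terms; at t = 0 the factor vanishes.
  let ζ : ℝ → X := fun t => t • (fderiv ℝ φ (q t) (0, v) - M (q t) v)
  let A : ℝ → X →L[ℝ] X := fun t => ((fderiv ℝ L (φ (q t), (q t).2)).flip p.2) ∘L
    ContinuousLinearMap.inl ℝ X Y
  have hζd : ∀ t ∈ Icc (0 : ℝ) 1, HasDerivAt ζ (A t (ζ t)) t := by
    intro t ht
    have hqt : q t ∈ D := hmem t ht
    have h1 : HasDerivAt (fun t => fderiv ℝ φ (q t) (0, v))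
        (fderiv ℝ (fderiv ℝ φ) (q t) (0, p.2) (0, v)) t := by
      have := ((hφ2 _ hqt).comp_hasDerivAt t (hq t)).clm_apply (hasDerivAt_const t ((0 : X), v))
      simpa using this
    have h2 : HasDerivAt (fun t => M (q t) v)
        (fderiv ℝ L (φ (q t), (q t).2) (fderiv ℝ φ (q t) (0, p.2), p.2) v) t := by
      have := ((hM _ hqt).comp_hasDerivAt t (hq t)).clm_apply (hasDerivAt_const t v)
      simpa using this
    have h3 := (hasDerivAt_id t).smul (h1.fun_sub h2)
    refine h3.congr_deriv ?_
    have hsymm : IsSymmSndFDerivAt ℝ φ (q t) :=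
      (hφat _ hqt).isSymmSndFDerivAt (by simp; norm_cast)
    have e1 := hI _ hqt v
    have e2 := hint _ (hφΩ _ hqt) v (q t).2
    have e3 := hφd _ hqt
    have e4 := hsymm.eq (0, v) (0, (q t).2)
    have hq2 : (q t).2 = t • p.2 := rfl
    have e5 : ((0 : X), t • p.2) = t • ((0 : X), p.2) := by simp
    rw [e4] at e1
    rw [← e3] at e2
    have e9 : fderiv ℝ φ (q t) (0, (q t).2) = t • fderiv ℝ φ (q t) (0, p.2) := by
      rw [hq2, e5, map_smul]
    have e10 : fderiv ℝ (fderiv ℝ φ) (q t) (0, (q t).2) (0, v) =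
        t • fderiv ℝ (fderiv ℝ φ) (q t) (0, p.2) (0, v) := by
      rw [hq2, e5, map_smul, smul_apply]
    have e6 : ((fderiv ℝ φ (q t) (0, (q t).2), (q t).2) : X × Y) =
        t • (fderiv ℝ φ (q t) (0, p.2), p.2) := by rw [e9, hq2]; rfl
    rw [e10] at e1
    have e13 : fderiv ℝ L (φ (q t), (q t).2) (fderiv ℝ φ (q t) (0, (q t).2), (q t).2) v =
        t • fderiv ℝ L (φ (q t), (q t).2) (fderiv ℝ φ (q t) (0, p.2), p.2) v := by
      rw [e6, map_smul, smul_apply]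
    rw [e13] at e2
    have e11 : fderiv ℝ L (φ (q t), (q t).2) (fderiv ℝ φ (q t) (0, v), v) (q t).2 =
      t • fderiv ℝ L (φ (q t), (q t).2) (fderiv ℝ φ (q t) (0, v), v) p.2 := by
      rw [hq2, map_smul]
    have e12 : fderiv ℝ L (φ (q t), (q t).2) (L (φ (q t), (q t).2) v, v) (q t).2 =
      t • fderiv ℝ L (φ (q t), (q t).2) (L (φ (q t), (q t).2) v, v) p.2 := by
      rw [hq2, map_smul]
    rw [e11] at e1
    rw [e12] at e2
    show t • (fderiv ℝ (fderiv ℝ φ) (q t) (0, p.2) (0, v) -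
      fderiv ℝ L (φ (q t), (q t).2) (fderiv ℝ φ (q t) (0, p.2), p.2) v) +
      (1 : ℝ) • (fderiv ℝ φ (q t) (0, v) - L (φ (q t), (q t).2) v) =
      fderiv ℝ L (φ (q t), (q t).2)
        (t • (fderiv ℝ φ (q t) (0, v) - L (φ (q t), (q t).2) v), 0) p.2
    have e7 : ((t • (fderiv ℝ φ (q t) (0, v) - L (φ (q t), (q t).2) v), 0) : X × Y) =
      t • ((fderiv ℝ φ (q t) (0, v), v) - (L (φ (q t), (q t).2) v, v)) := by simp
    rw [e7, map_smul, map_sub, smul_apply, sub_apply]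
    linear_combination (norm := module) e1 + e2
  have hAc : ContinuousOn A (Icc 0 1) := by
    have h1 : ContinuousOn (fun z => fderiv ℝ L z) Ω :=
      hL.continuousOn_fderiv_of_isOpen hΩ (by simp)
    have h2 : ContinuousOn (fun t => fderiv ℝ L (φ (q t), (q t).2)) (Icc 0 1) := by
      refine h1.comp ?_ fun t ht => hφΩ _ (hmem t ht)
      exact (hφ.continuousOn.comp hqc.continuousOn fun t ht => hmem t ht).prodMk
        (continuous_snd.comp hqc).continuousOn
    have h3 : ContinuousOn (fun t => (fderiv ℝ L (φ (q t), (q t).2)).flip) (Icc 0 1) :=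
      (ContinuousLinearMap.flipₗᵢ ℝ (X × Y) Y X).continuous.comp_continuousOn h2
    exact (h3.clm_apply continuousOn_const).clm_comp continuousOn_const
  have hζ := eqOn_of_linear_ode (f := ζ) (g := fun _ => 0) hAc
    (fun t ht => (hζd t ht).continuousAt.continuousWithinAt) continuousOn_const
    (fun t ht => hζd t (Ioo_subset_Icc_self ht))
    (fun t _ => by simpa using hasDerivAt_const t (0 : X)) (by simp [ζ])
    (⟨zero_le_one, le_rfl⟩ : (1 : ℝ) ∈ Icc (0 : ℝ) 1)
  have hq1 : q 1 = p := by simp [q]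
  simp only [ζ, one_smul, hq1] at hζ
  exact sub_eq_zero.1 hζ

/-- The Frobenius theorem: a distribution which is the graph `{(L w, w)}` of an integrable `L` is
the kernel of the differential of a submersion near the origin. -/
theorem exists_first_integral {L : X × Y → Y →L[ℝ] X} {Ω : Set (X × Y)} (hΩ : IsOpen Ω)
    (h0 : 0 ∈ Ω) (hL : ContDiffOn ℝ ∞ L Ω)
    (hint : ∀ z ∈ Ω, ∀ v w, fderiv ℝ L z (L z v, v) w = fderiv ℝ L z (L z w, w) v) :
    ∃ (u : X × Y → X) (N : Set (X × Y)), IsOpen N ∧ 0 ∈ N ∧ N ⊆ Ω ∧ ContDiffOn ℝ ∞ u N ∧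
      (∀ z ∈ N, ∀ w, fderiv ℝ u z (L z w, w) = 0) ∧ ∀ x, fderiv ℝ u 0 (x, 0) = x := by
  obtain ⟨φ, r, hr, hφ, hφp⟩ := exists_ray_solution hΩ h0 hL
  have hφd := fderiv_ray_solution hΩ hL hint hφ (fun p hp => (hφp p hp).1)
    (fun p hp => (hφp p hp).2.2)
  set D := Metric.ball (0 : X × Y) r
  have hD : IsOpen D := Metric.isOpen_ball
  have h0D : (0 : X × Y) ∈ D := Metric.mem_ball_self hr
  have hφ1 : ∀ q ∈ D, HasFDerivAt φ (fderiv ℝ φ q) q := fun q hq =>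
    ((hφ.contDiffAt (hD.mem_nhds hq)).differentiableAt (by simp)).hasFDerivAt
  have hφ0 : φ 0 = 0 := (hφp 0 h0D).2.1
  -- `Ψ` maps the slices on which the first variable is constant onto integral manifolds, so the
  -- first component of its inverse is a first integral.
  let Ψ : X × Y → X × Y := fun p => (φ p, p.2)
  have hΨ : ContDiffOn ℝ ∞ Ψ D := hφ.prodMk contDiff_snd.contDiffOn
  have hΨ1 : ∀ q ∈ D, HasFDerivAt Ψ ((fderiv ℝ φ q).prod (ContinuousLinearMap.snd ℝ X Y)) q :=
    fun q hq => (hφ1 q hq).prodMk hasFDerivAt_snd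
  have hφx : ∀ x, fderiv ℝ φ 0 (x, 0) = x := by
    intro x
    have hline : HasDerivAt (fun t : ℝ => (t • x, (0 : Y))) (x, 0) 0 := by
      simpa using ((hasDerivAt_id (0 : ℝ)).smul_const x).prodMk (hasDerivAt_const (0 : ℝ) (0 : Y))
    have h1 : HasDerivAt (fun t : ℝ => φ (t • x, 0)) (fderiv ℝ φ 0 (x, 0)) 0 :=
      HasFDerivAt.comp_hasDerivAt (l := φ) (f := fun t : ℝ => (t • x, (0 : Y))) 0
        (by simpa using! hφ1 0 h0D) hline
    have h2 : (fun t : ℝ => φ (t • x, 0)) =ᶠ[𝓝 0] fun t => t • x := by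
      have : Tendsto (fun t : ℝ => (t • x, (0 : Y))) (𝓝 0) (𝓝 0) := by
        simpa using! hline.continuousAt.tendsto
      filter_upwards [this (hD.mem_nhds h0D)] with t ht
      exact (hφp _ ht).2.1
    have h3 : HasDerivAt (fun t : ℝ => t • x) x 0 := by
      simpa using (hasDerivAt_id (0 : ℝ)).smul_const x
    exact h1.unique (h3.congr_of_eventuallyEq h2)
  let L₀ := L 0
  have hφ0d : ∀ p : X × Y, fderiv ℝ φ 0 p = p.1 + L₀ p.2 := by
    intro p
    have e : p = (p.1, 0) + (0, p.2) := by simp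
    conv_lhs => rw [e, map_add, hφx, hφd 0 h0D]
    rw [hφ0]; rfl
  -- The differential of `Ψ` at 0 is the shear by `L 0`, whose inverse is the shear by its negative.
  let Ψ' : (X × Y) ≃L[ℝ] (X × Y) := ContinuousLinearEquiv.equivOfInverse
    ((ContinuousLinearMap.fst ℝ X Y + L₀ ∘L ContinuousLinearMap.snd ℝ X Y).prod
      (ContinuousLinearMap.snd ℝ X Y))
    ((ContinuousLinearMap.fst ℝ X Y - L₀ ∘L ContinuousLinearMap.snd ℝ X Y).prod
      (ContinuousLinearMap.snd ℝ X Y))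
    (fun p => by simp) (fun p => by simp)
  have hΨ' : HasFDerivAt Ψ (Ψ' : X × Y →L[ℝ] X × Y) 0 := by
    refine (hΨ1 0 h0D).congr_fderiv (ContinuousLinearMap.ext fun p => ?_)
    show (fderiv ℝ φ 0 p, p.2) = (p.1 + L₀ p.2, p.2)
    rw [hφ0d]
  obtain ⟨e, h0e, heD, heΨ, -, hesymm⟩ := exists_smooth_local_inverse hD hΨ h0D hΨ'
  have hu : ContDiffOn ℝ ∞ (fun z => (e.symm z).1) e.target := contDiff_fst.comp_contDiffOn hesymm
  have hcomp : ∀ p ∈ e.source, ∀ δ, fderiv ℝ (fun z => (e.symm z).1) (Ψ p)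
      (fderiv ℝ φ p δ, δ.2) = δ.1 := by
    intro p hp δ
    have hΨp : Ψ p ∈ e.target := by rw [← heΨ]; exact e.map_source hp
    have h1 : HasFDerivAt (fun z => (e.symm z).1) _ (Ψ p) :=
      ((hu.contDiffAt (e.open_target.mem_nhds hΨp)).differentiableAt (by simp)).hasFDerivAt
    have h2 := h1.comp p (hΨ1 p (heD hp))
    have h3 : ((fun z => (e.symm z).1) ∘ Ψ) =ᶠ[𝓝 p] Prod.fst := by
      filter_upwards [e.open_source.mem_nhds hp] with q hq
      show (e.symm (Ψ q)).1 = q.1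
      rw [← heΨ, e.left_inv hq]
    have h4 := h2.unique ((hasFDerivAt_fst (𝕜 := ℝ) (p := p)).congr_of_eventuallyEq h3)
    exact congrArg (fun T : X × Y →L[ℝ] X => T δ) h4
  have hΨ0 : Ψ 0 = 0 := by simp [Ψ, hφ0]
  refine ⟨fun z => (e.symm z).1, e.target, e.open_target, ?_, ?_, hu, ?_, ?_⟩
  · rw [← hΨ0, ← heΨ]; exact e.map_source h0e
  · intro z hz
    have := (hφp _ (heD (e.map_target hz))).1
    have h2 : Ψ (e.symm z) = z := by rw [← heΨ, e.right_inv hz]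
    rw [← h2]; exact this
  · intro z hz w
    have hs := e.map_target hz
    have h2 : Ψ (e.symm z) = z := by rw [← heΨ, e.right_inv hz]
    have := hcomp _ hs (0, w)
    rw [hφd _ (heD hs)] at this
    change fderiv ℝ (fun z => (e.symm z).1) (Ψ (e.symm z)) (L (Ψ (e.symm z)) w, w) = 0 at this
    rwa [h2] at this
  · intro x
    have := hcomp 0 h0e (x, 0)
    rwa [hφx, hΨ0] at this

end Frobenius

/-! ### Smooth charts, coordinate fields and Christoffel symbols -/

section Chart

variable {E : Type*} [NormedAddCommGroup E] [NormedSpace ℝ E]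
  {M : Type*} [TopologicalSpace M] [ChartedSpace E M]
  {F : Type*} [NormedAddCommGroup F] [NormedSpace ℝ F]

/-- `Φ` is a smooth chart with values in the normed space `F`. -/
structure IsSmoothChart (Φ : OpenPartialHomeomorph M F) : Prop where
  smooth : ContMDiffOn 𝓘(ℝ, E) 𝓘(ℝ, F) ∞ Φ Φ.source
  smooth_symm : ContMDiffOn 𝓘(ℝ, F) 𝓘(ℝ, E) ∞ Φ.symm Φ.target

/-- The differential of a chart. -/
def dchart (Φ : OpenPartialHomeomorph M F) (x : M) : E →L[ℝ] F :=
  (mfderiv 𝓘(ℝ, E) 𝓘(ℝ, F) Φ x : TangentSpace 𝓘(ℝ, E) x →L[ℝ] TangentSpace 𝓘(ℝ, F) (Φ x))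

/-- The differential of the inverse of a chart. -/
def dchartSymm (Φ : OpenPartialHomeomorph M F) (y : F) : F →L[ℝ] E :=
  (mfderiv 𝓘(ℝ, F) 𝓘(ℝ, E) Φ.symm y :
    TangentSpace 𝓘(ℝ, F) y →L[ℝ] TangentSpace 𝓘(ℝ, E) (Φ.symm y))

variable {Φ : OpenPartialHomeomorph M F}

namespace IsSmoothChart

variable (hΦ : IsSmoothChart (E := E) Φ)
include hΦ

lemma mdifferentiableAt {x : M} (hx : x ∈ Φ.source) :
    MDifferentiableAt 𝓘(ℝ, E) 𝓘(ℝ, F) Φ x :=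
  ((hΦ.smooth x hx).contMDiffAt (Φ.open_source.mem_nhds hx)).mdifferentiableAt (by simp)

lemma mdifferentiableAt_symm {y : F} (hy : y ∈ Φ.target) :
    MDifferentiableAt 𝓘(ℝ, F) 𝓘(ℝ, E) Φ.symm y :=
  ((hΦ.smooth_symm y hy).contMDiffAt (Φ.open_target.mem_nhds hy)).mdifferentiableAt (by simp)

lemma dchartSymm_dchart {x : M} (hx : x ∈ Φ.source) (v : E) :
    dchartSymm Φ (Φ x) (dchart Φ x v) = v := by
  have h1 : HasMFDerivAt 𝓘(ℝ, E) 𝓘(ℝ, E) (Φ.symm ∘ Φ) x _ :=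
    HasMFDerivAt.comp x (hΦ.mdifferentiableAt_symm (Φ.map_source hx)).hasMFDerivAt
      (hΦ.mdifferentiableAt hx).hasMFDerivAt
  have h2 : HasMFDerivAt 𝓘(ℝ, E) 𝓘(ℝ, E) (Φ.symm ∘ Φ) x
      (ContinuousLinearMap.id ℝ (TangentSpace 𝓘(ℝ, E) x)) :=
    (hasMFDerivAt_id x).congr_of_eventuallyEq
      (Filter.eventually_of_mem (Φ.open_source.mem_nhds hx) fun z hz => Φ.left_inv hz)
  exact congrArg (fun T : E →L[ℝ] E => T v) (hasMFDerivAt_unique h1 h2)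

lemma dchart_dchartSymm {y : F} (hy : y ∈ Φ.target) (v : F) :
    dchart (E := E) Φ (Φ.symm y) (dchartSymm Φ y v) = v := by
  have h1 : HasMFDerivAt 𝓘(ℝ, F) 𝓘(ℝ, F) (Φ ∘ Φ.symm) y _ :=
    HasMFDerivAt.comp y (hΦ.mdifferentiableAt (Φ.map_target hy)).hasMFDerivAt
      (hΦ.mdifferentiableAt_symm hy).hasMFDerivAt
  have h2 : HasMFDerivAt 𝓘(ℝ, F) 𝓘(ℝ, F) (Φ ∘ Φ.symm) y
      (ContinuousLinearMap.id ℝ (TangentSpace 𝓘(ℝ, F) y)) :=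
    (hasMFDerivAt_id y).congr_of_eventuallyEq
      (Filter.eventually_of_mem (Φ.open_target.mem_nhds hy) fun z hz => Φ.right_inv hz)
  exact congrArg (fun T : F →L[ℝ] F => T v) (hasMFDerivAt_unique h1 h2)

lemma dchart_dchartSymm' {x : M} (hx : x ∈ Φ.source) (v : F) :
    dchart (E := E) Φ x (dchartSymm Φ (Φ x) v) = v := by
  have := hΦ.dchart_dchartSymm (Φ.map_source hx) v
  rwa [Φ.left_inv hx] at this

lemma dchartSymm_dchart' {y : F} (hy : y ∈ Φ.target) (v : E) :
    dchartSymm Φ y (dchart (E := E) Φ (Φ.symm y) v) = v := by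
  have := hΦ.dchartSymm_dchart (Φ.map_target hy) v
  rwa [Φ.right_inv hy] at this

/-- The isomorphism between a tangent space and the model space of a chart. -/
def tangentEquiv {x : M} (hx : x ∈ Φ.source) : E ≃L[ℝ] F :=
  ContinuousLinearEquiv.equivOfInverse (dchart Φ x) (dchartSymm Φ (Φ x))
    (hΦ.dchartSymm_dchart hx) (hΦ.dchart_dchartSymm' hx)

variable [IsManifold 𝓘(ℝ, E) ∞ M]

lemma contMDiffOn_tangentMap :
    ContMDiffOn 𝓘(ℝ, E).tangent 𝓘(ℝ, F).tangent ∞ (tangentMap 𝓘(ℝ, E) 𝓘(ℝ, F) Φ)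
      (TotalSpace.proj ⁻¹' Φ.source) := by
  refine (hΦ.smooth.contMDiffOn_tangentMapWithin (m := ∞) (by simp)
    Φ.open_source.uniqueMDiffOn).congr fun p hp => ?_
  exact (tangentMapWithin_eq_tangentMap (Φ.open_source.uniqueMDiffOn _ hp)
    (hΦ.mdifferentiableAt hp)).symm

lemma contMDiffOn_tangentMap_symm :
    ContMDiffOn 𝓘(ℝ, F).tangent 𝓘(ℝ, E).tangent ∞ (tangentMap 𝓘(ℝ, F) 𝓘(ℝ, E) Φ.symm)
      (TotalSpace.proj ⁻¹' Φ.target) := by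
  refine (hΦ.smooth_symm.contMDiffOn_tangentMapWithin (m := ∞) (by simp)
    Φ.open_target.uniqueMDiffOn).congr fun p hp => ?_
  exact (tangentMapWithin_eq_tangentMap (Φ.open_target.uniqueMDiffOn _ hp)
    (hΦ.mdifferentiableAt_symm hp)).symm

end IsSmoothChart

/-- The coordinate vector field of a chart in the direction `w`. -/
def chartField (Φ : OpenPartialHomeomorph M F) (w : F) (x : M) : TangentSpace 𝓘(ℝ, E) x :=
  (dchartSymm Φ (Φ x) w : E)

variable [IsManifold 𝓘(ℝ, E) ∞ M]

lemma IsSmoothChart.contMDiffOn_chartField (hΦ : IsSmoothChart (E := E) Φ) (w : F) :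
    ContMDiffOn 𝓘(ℝ, E) 𝓘(ℝ, E).tangent ∞
      (fun x => (⟨x, chartField Φ w x⟩ : TangentBundle 𝓘(ℝ, E) M)) Φ.source := by
  have h1 : ContMDiff 𝓘(ℝ, F) 𝓘(ℝ, F).tangent ∞
      (fun y : F => (⟨y, w⟩ : TangentBundle 𝓘(ℝ, F) F)) :=
    contMDiff_vectorSpace_iff_contDiff.2 contDiff_const
  have h2 := hΦ.contMDiffOn_tangentMap_symm.comp (h1.comp_contMDiffOn hΦ.smooth)
    fun x hx => Φ.map_source hx
  refine h2.congr fun x hx => ?_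
  have : Φ.symm (Φ x) = x := Φ.left_inv hx
  show (⟨x, _⟩ : TangentBundle 𝓘(ℝ, E) M) = ⟨Φ.symm (Φ x), _⟩
  exact congrArg₂ (fun (a : M) (b : E) => (⟨a, b⟩ : TangentBundle 𝓘(ℝ, E) M)) this.symm rfl

lemma IsSmoothChart.mdifferentiableAt_chartField (hΦ : IsSmoothChart (E := E) Φ) (w : F) {x : M}
    (hx : x ∈ Φ.source) : MDifferentiableAt 𝓘(ℝ, E) 𝓘(ℝ, E).tangent
      (fun x => (⟨x, chartField Φ w x⟩ : TangentBundle 𝓘(ℝ, E) M)) x :=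
  ((hΦ.contMDiffOn_chartField w).contMDiffAt (Φ.open_source.mem_nhds hx)).mdifferentiableAt
    (by simp)

variable (cov : CovariantDerivative 𝓘(ℝ, E) E (TangentSpace 𝓘(ℝ, E) : M → Type _))

/-- The covariant derivative of a vector field at a point, as an endomorphism of the model space. -/
def covAt (s : (x : M) → TangentSpace 𝓘(ℝ, E) x) (x : M) : E →L[ℝ] E :=
  (cov s x : TangentSpace 𝓘(ℝ, E) x →L[ℝ] TangentSpace 𝓘(ℝ, E) x)

/-- The covariant derivatives of coordinate fields in a chart. -/
def christoffelAux (Φ : OpenPartialHomeomorph M F) (y : F) (w : F) : F →L[ℝ] F :=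
  dchart (E := E) Φ (Φ.symm y) ∘L covAt cov (chartField Φ w) (Φ.symm y) ∘L dchartSymm Φ y

variable [FiniteDimensional ℝ F]

/-- The Christoffel symbols `Γ(y)(u, w) = ∇_u ∂_w` of a connection in a chart. -/
def christoffel (Φ : OpenPartialHomeomorph M F) (y : F) : F →L[ℝ] F →L[ℝ] F :=
  ∑ i, ContinuousLinearMap.smulRightL ℝ F F
      (LinearMap.toContinuousLinearMap ((Module.finBasis ℝ F).coord i)) ∘L
    christoffelAux cov Φ y (Module.finBasis ℝ F i)

lemma christoffel_apply' (y u w : F) : christoffel cov Φ y u w =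
    ∑ i, (Module.finBasis ℝ F).coord i w • christoffelAux cov Φ y (Module.finBasis ℝ F i) u := by
  simp only [christoffel, sum_apply, ContinuousLinearMap.comp_apply]
  rfl

lemma chartField_eq_sum (w : F) : chartField (E := E) Φ w =
    ∑ i, (Module.finBasis ℝ F).coord i w • chartField Φ (Module.finBasis ℝ F i) := by
  funext x
  rw [Finset.sum_apply]
  show (dchartSymm (E := E) Φ (Φ x) w : E) = ∑ i, ((Module.finBasis ℝ F).coord i w •
    (dchartSymm (E := E) Φ (Φ x) (Module.finBasis ℝ F i) : E) : E)
  conv_lhs => rw [← (Module.finBasis ℝ F).sum_repr w, map_sum]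
  refine Finset.sum_congr rfl fun i _ => ?_
  rw [map_smul]; rfl

/-- The Leibniz rule for finite sums. Differentiability is carried along because each step of the
induction needs it for the remaining sum. -/
lemma cov_sum_smul {x : M} {n : ℕ} (s : Fin n → (x : M) → TangentSpace 𝓘(ℝ, E) x)
    (g : Fin n → M → ℝ)
    (hs : ∀ i, MDifferentiableAt 𝓘(ℝ, E) 𝓘(ℝ, E).tangent
      (fun x => (⟨x, s i x⟩ : TangentBundle 𝓘(ℝ, E) M)) x)
    (hg : ∀ i, MDifferentiableAt 𝓘(ℝ, E) 𝓘(ℝ, ℝ) (g i) x) :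
    MDifferentiableAt 𝓘(ℝ, E) 𝓘(ℝ, E).tangent
      (fun x => (⟨x, (∑ i, g i • s i) x⟩ : TangentBundle 𝓘(ℝ, E) M)) x ∧
    ∀ v : E, covAt cov (∑ i, g i • s i) x v =
      ∑ i, ((show E →L[ℝ] ℝ from mfderiv 𝓘(ℝ, E) 𝓘(ℝ, ℝ) (g i) x) v • (show E from s i x) +
        g i x • covAt cov (s i) x v) := by
  induction n with
  | zero =>
    refine ⟨by simpa using! mdifferentiableAt_zeroSection .., fun v => ?_⟩
    simp only [Finset.univ_eq_empty, Finset.sum_empty]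
    have h0 := cov.isCovariantDerivativeOn.zero (x := x)
    exact congrArg (fun T : E →L[ℝ] E => T v) h0
  | succ n ih =>
    obtain ⟨h1, h2⟩ := ih (fun i => s i.succ) (fun i => g i.succ) (fun i => hs _) fun i => hg _
    have h3 := (hg 0).smul_section (hs 0)
    simp only [Fin.sum_univ_succ]
    refine ⟨mdifferentiableAt_add_section h3 h1, fun v => ?_⟩
    rw [← h2 v]
    have h4 := cov.isCovariantDerivativeOn.add h3 h1
    have h5 := cov.isCovariantDerivativeOn.leibniz (hs 0) (hg 0)
    have h6 := congrArg (fun T : E →L[ℝ] E => T v) (h4.trans (congrArg (· + _) h5))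
    refine h6.trans ?_
    show (g 0 x • covAt cov (s 0) x v + _ : E) + covAt cov _ x v = (_ + g 0 x • covAt cov (s 0) x v : E) + _
    congr 1
    exact add_comm _ _

variable {cov}

/-- The definition goes through a basis to have linearity in the second argument at hand; coordinate
fields with constant coefficients produce no derivative term, so the basis drops out. -/
lemma IsSmoothChart.christoffel_apply (hΦ : IsSmoothChart (E := E) Φ) {y : F} (hy : y ∈ Φ.target)
    (u w : F) : christoffel cov Φ y u w =
      dchart (E := E) Φ (Φ.symm y) (covAt cov (chartField Φ w) (Φ.symm y) (dchartSymm Φ y u)) := by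
  rw [christoffel_apply']
  have h1 := (cov_sum_smul cov (x := Φ.symm y)
    (fun i => chartField (E := E) Φ (Module.finBasis ℝ F i))
    (fun i _ => (Module.finBasis ℝ F).coord i w)
    (fun i => hΦ.mdifferentiableAt_chartField _ (Φ.map_target hy))
    fun i => mdifferentiableAt_const).2 (dchartSymm Φ y u)
  rw [chartField_eq_sum]
  refine Eq.trans ?_ (congrArg (dchart (E := E) Φ (Φ.symm y)) h1).symm
  rw [map_sum]
  refine Finset.sum_congr rfl fun i _ => ?_
  rw [mfderiv_const]
  show _ = dchart (E := E) Φ (Φ.symm y) ((0 : ℝ) • _ + (Module.finBasis ℝ F).coord i w • _)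
  rw [zero_smul, zero_add, map_smul]
  rfl

end Chart

/-! ### The connection in a chart: coordinate formula, smoothness, symmetry -/

section ChartConnection

variable {E : Type*} [NormedAddCommGroup E] [NormedSpace ℝ E]
  {M : Type*} [TopologicalSpace M] [ChartedSpace E M] [IsManifold 𝓘(ℝ, E) ∞ M]
  {F : Type*} [NormedAddCommGroup F] [NormedSpace ℝ F]
  {Φ : OpenPartialHomeomorph M F}

/-- The coordinate expression of a vector field. -/
def coordField (Φ : OpenPartialHomeomorph M F) (s : (x : M) → TangentSpace 𝓘(ℝ, E) x) (y : F) : F :=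
  dchart (E := E) Φ (Φ.symm y) (s (Φ.symm y) : E)

lemma IsSmoothChart.differentiableAt_coordField (hΦ : IsSmoothChart (E := E) Φ) {y : F}
    (hy : y ∈ Φ.target) {s : (x : M) → TangentSpace 𝓘(ℝ, E) x}
    (hs : MDifferentiableAt 𝓘(ℝ, E) 𝓘(ℝ, E).tangent
      (fun x => (⟨x, s x⟩ : TangentBundle 𝓘(ℝ, E) M)) (Φ.symm y)) :
    DifferentiableAt ℝ (coordField Φ s) y := by
  have hx := Φ.map_target hy
  have h1 : MDifferentiableAt 𝓘(ℝ, E).tangent 𝓘(ℝ, F).tangent (tangentMap 𝓘(ℝ, E) 𝓘(ℝ, F) Φ)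
      (⟨Φ.symm y, s (Φ.symm y)⟩ : TangentBundle 𝓘(ℝ, E) M) :=
    (hΦ.contMDiffOn_tangentMap.contMDiffAt ((Φ.open_source.preimage
      (FiberBundle.continuous_proj E _)).mem_nhds hx)).mdifferentiableAt (by simp)
  have h2 := (h1.comp (Φ.symm y) hs).comp y (hΦ.mdifferentiableAt_symm hy)
  have h3 := MDifferentiableAt.comp y
    ((contMDiff_snd_tangentBundle_modelSpace F 𝓘(ℝ, F)).contMDiffAt.mdifferentiableAt
      one_ne_zero) h2
  exact mdifferentiableAt_iff_differentiableAt.1 h3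

lemma IsSmoothChart.contDiffOn_coordField (hΦ : IsSmoothChart (E := E) Φ)
    {s : (x : M) → TangentSpace 𝓘(ℝ, E) x}
    (hs : ContMDiffOn 𝓘(ℝ, E) 𝓘(ℝ, E).tangent ∞
      (fun x => (⟨x, s x⟩ : TangentBundle 𝓘(ℝ, E) M)) Φ.source) :
    ContDiffOn ℝ ∞ (coordField Φ s) Φ.target := by
  have h2 := hΦ.contMDiffOn_tangentMap.comp (hs.comp hΦ.smooth_symm fun y hy => Φ.map_target hy)
    fun y hy => Φ.map_target hy
  have h3 := ((contMDiff_snd_tangentBundle_modelSpace F 𝓘(ℝ, F)).comp_contMDiffOn h2)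
  exact contMDiffOn_iff_contDiffOn.1 h3

variable {cov : CovariantDerivative 𝓘(ℝ, E) E (TangentSpace 𝓘(ℝ, E) : M → Type _)}
  [FiniteDimensional ℝ F]

lemma covAt_congr {s s' : (x : M) → TangentSpace 𝓘(ℝ, E) x} {x : M}
    (hs : MDifferentiableAt 𝓘(ℝ, E) 𝓘(ℝ, E).tangent
      (fun x => (⟨x, s x⟩ : TangentBundle 𝓘(ℝ, E) M)) x)
    (hs' : MDifferentiableAt 𝓘(ℝ, E) 𝓘(ℝ, E).tangent
      (fun x => (⟨x, s' x⟩ : TangentBundle 𝓘(ℝ, E) M)) x)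
    (h : ∀ᶠ x in 𝓝 x, s x = s' x) : covAt cov s x = covAt cov s' x :=
  cov.isCovariantDerivativeOn.congr_of_eventuallyEq hs hs' univ_mem h

/-- The coordinate expression of a covariant derivative. -/
lemma IsSmoothChart.dchart_covAt (hΦ : IsSmoothChart (E := E) Φ) {y : F}
    (hy : y ∈ Φ.target) {s : (x : M) → TangentSpace 𝓘(ℝ, E) x}
    (hs : MDifferentiableAt 𝓘(ℝ, E) 𝓘(ℝ, E).tangent
      (fun x => (⟨x, s x⟩ : TangentBundle 𝓘(ℝ, E) M)) (Φ.symm y)) (u : F) :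
    dchart (E := E) Φ (Φ.symm y) (covAt cov s (Φ.symm y) (dchartSymm Φ y u)) =
      fderiv ℝ (coordField Φ s) y u + christoffel cov Φ y u (coordField Φ s y) := by
  have hx := Φ.map_target hy
  let b := Module.finBasis ℝ F
  let ψ : Fin (Module.finrank ℝ F) → F →L[ℝ] ℝ := fun i =>
    LinearMap.toContinuousLinearMap (b.coord i)
  let g : Fin (Module.finrank ℝ F) → M → ℝ := fun i x => ψ i (coordField Φ s (Φ x))
  have hd := hΦ.differentiableAt_coordField hy hs
  have hg' : ∀ i, HasMFDerivAt 𝓘(ℝ, E) 𝓘(ℝ, ℝ) (g i) (Φ.symm y)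
      (((ψ i ∘L fderiv ℝ (coordField Φ s) y) ∘L dchart (E := E) Φ (Φ.symm y) : E →L[ℝ] ℝ)) := by
    intro i
    have h1 : HasFDerivAt (fun y => ψ i (coordField Φ s y)) (ψ i ∘L fderiv ℝ (coordField Φ s) y)
        (Φ (Φ.symm y)) := by
      rw [Φ.right_inv hy]
      exact (ψ i).hasFDerivAt.comp y hd.hasFDerivAt
    exact HasMFDerivAt.comp (g := fun y => ψ i (coordField Φ s y)) (f := Φ) (Φ.symm y)
      h1.hasMFDerivAt (hΦ.mdifferentiableAt hx).hasMFDerivAt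
  obtain ⟨h1, h2⟩ := cov_sum_smul cov (x := Φ.symm y) (fun i => chartField (E := E) Φ (b i)) g
    (fun i => hΦ.mdifferentiableAt_chartField _ hx) fun i => (hg' i).mdifferentiableAt
  -- Near the point the field is the combination of coordinate fields whose coefficients are its
  -- components; locality of the connection permits the replacement.
  have heq : ∀ᶠ x in 𝓝 (Φ.symm y),
      s x = (∑ i, g i • fun x => chartField (E := E) Φ (b i) x) x := by
    filter_upwards [Φ.open_source.mem_nhds hx] with x hx
    rw [Finset.sum_apply]
    show (s x : E) = ∑ i, (b.coord i (coordField Φ s (Φ x)) • dchartSymm (E := E) Φ (Φ x) (b i) : E)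
    have e1 : coordField Φ s (Φ x) = dchart (E := E) Φ x (s x : E) := by
      rw [coordField, Φ.left_inv hx]
    have e2 : (∑ i, b.coord i (coordField Φ s (Φ x)) • dchartSymm (E := E) Φ (Φ x) (b i) : E) =
        dchartSymm (E := E) Φ (Φ x) (∑ i, b.repr (coordField Φ s (Φ x)) i • b i) := by
      rw [map_sum]
      exact Finset.sum_congr rfl fun i _ => (map_smul _ _ _).symm
    rw [e2, b.sum_repr, e1]
    exact (hΦ.dchartSymm_dchart hx _).symm
  rw [covAt_congr hs h1 heq, h2, map_sum, christoffel_apply']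
  have e3 : fderiv ℝ (coordField Φ s) y u = ∑ i, b.repr (fderiv ℝ (coordField Φ s) y u) i • b i :=
    (b.sum_repr _).symm
  rw [e3, ← Finset.sum_add_distrib]
  refine Finset.sum_congr rfl fun i _ => ?_
  rw [(hg' i).mfderiv, map_add]
  congr 1
  · show dchart (E := E) Φ (Φ.symm y) (ψ i (fderiv ℝ (coordField Φ s) y
      (dchart (E := E) Φ (Φ.symm y) (dchartSymm Φ y u))) •
        dchartSymm (E := E) Φ (Φ (Φ.symm y)) (b i)) = _
    rw [map_smul, hΦ.dchart_dchartSymm hy, Φ.right_inv hy, hΦ.dchart_dchartSymm hy]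
    rfl
  · rw [map_smul]
    show ψ i (coordField Φ s (Φ (Φ.symm y))) • _ = _
    rw [Φ.right_inv hy]
    rfl

variable [FiniteDimensional ℝ E] [T2Space M]

/-- Smoothness of the connection concerns fields defined on all of `M`, so the coordinate field is
cut off by a bump function that is 1 near the point; the covariant derivative there does not change.
-/
lemma IsSmoothChart.contMDiffOn_cov_chartField [hcov : CovariantDerivative.ContMDiffCovariantDerivative cov ∞]
    (hΦ : IsSmoothChart (E := E) Φ) (u w : F) :
    ContMDiffOn 𝓘(ℝ, E) 𝓘(ℝ, E).tangent ∞ (fun x => (⟨x, covAt cov (chartField Φ w) x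
      (chartField Φ u x : E)⟩ : TangentBundle 𝓘(ℝ, E) M)) Φ.source := by
  intro x hx
  refine ContMDiffAt.contMDiffWithinAt ?_
  obtain ⟨χ, hχ⟩ := ((SmoothBumpFunction.nhds_basis_tsupport (I := 𝓘(ℝ, E)) x).mem_iff).1
    (Φ.open_source.mem_nhds hx)
  have h1 : ContMDiff 𝓘(ℝ, E) 𝓘(ℝ, E).tangent ∞
      (fun x => (⟨x, ((χ : M → ℝ) • chartField (E := E) Φ w) x⟩ : TangentBundle 𝓘(ℝ, E) M)) :=
    ContMDiffOn.smul_section_of_tsupport χ.contMDiff.contMDiffOn Φ.open_source hχ.2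
      (hΦ.contMDiffOn_chartField w)
  have h0 : ContMDiffCovariantDerivativeOn E ∞ cov.toFun univ := hcov.contMDiff
  have h2 := h0.contMDiff (σ := (χ : M → ℝ) • chartField (E := E) Φ w) h1.contMDiffOn
  have h3 := (h2.contMDiffAt univ_mem).clm_bundle_apply (((hΦ.contMDiffOn_chartField u).contMDiffAt
    (Φ.open_source.mem_nhds hx)))
  refine h3.congr_of_eventuallyEq ?_
  filter_upwards [eventually_eventually_nhds.2 χ.eventuallyEq_one, Φ.open_source.mem_nhds hx]
    with z hz hzs
  have h4 : covAt cov (chartField Φ w) z = covAt cov ((χ : M → ℝ) • chartField (E := E) Φ w) z := by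
    refine covAt_congr (hΦ.mdifferentiableAt_chartField w hzs)
      (h1.contMDiffAt.mdifferentiableAt (by simp)) ?_
    filter_upwards [hz] with z' hz'
    show chartField (E := E) Φ w z' = χ z' • chartField (E := E) Φ w z'
    rw [hz']
    exact (one_smul ℝ _).symm
  rw [h4]
  rfl

lemma IsSmoothChart.contDiffOn_christoffel [CovariantDerivative.ContMDiffCovariantDerivative cov ∞]
    (hΦ : IsSmoothChart (E := E) Φ) : ContDiffOn ℝ ∞ (christoffel cov Φ) Φ.target := by
  have h1 : ∀ w, ContDiffOn ℝ ∞ (fun y => christoffelAux cov Φ y w) Φ.target := by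
    intro w
    refine contDiffOn_clm_apply.2 fun u => ?_
    refine (hΦ.contDiffOn_coordField (hΦ.contMDiffOn_cov_chartField (cov := cov) u w)).congr fun y hy => ?_
    show _ = dchart (E := E) Φ (Φ.symm y) (covAt cov (chartField Φ w) (Φ.symm y)
      (dchartSymm Φ (Φ (Φ.symm y)) u))
    rw [Φ.right_inv hy]
    rfl
  unfold christoffel
  exact ContDiffOn.sum fun i _ => contDiffOn_const.clm_comp (h1 _)

/-- Coordinate fields are pullbacks of constant fields, so their bracket vanishes and zero torsion
leaves the symmetry. -/
lemma IsSmoothChart.christoffel_symm [CompleteSpace E] (hΦ : IsSmoothChart (E := E) Φ)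
    (htorsion : cov.torsion = 0) {y : F} (hy : y ∈ Φ.target) (u w : F) :
    christoffel cov Φ y u w = christoffel cov Φ y w u := by
  have hx := Φ.map_target hy
  have h1 := CovariantDerivative.torsion_eq_zero_iff cov |>.1 htorsion
    (hΦ.mdifferentiableAt_chartField (E := E) u hx) (hΦ.mdifferentiableAt_chartField (E := E) w hx)
  have hW : ∀ w : F, chartField (E := E) Φ w =ᶠ[𝓝 (Φ.symm y)]
      VectorField.mpullback 𝓘(ℝ, E) 𝓘(ℝ, F) Φ (fun _ => w) := by
    intro w
    filter_upwards [Φ.open_source.mem_nhds hx] with x hx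
    show dchartSymm Φ (Φ x) w = (dchart (E := E) Φ x).inverse w
    have : dchart (E := E) Φ x = (hΦ.tangentEquiv hx : E →L[ℝ] F) := rfl
    rw [this, ContinuousLinearMap.inverse_equiv]
    rfl
  have hc : ∀ w : F, MDifferentiableAt 𝓘(ℝ, F) 𝓘(ℝ, F).tangent
      (fun y : F => (⟨y, w⟩ : TangentBundle 𝓘(ℝ, F) F)) (Φ (Φ.symm y)) := fun w =>
    (contMDiff_vectorSpace_iff_contDiff.2 contDiff_const).contMDiffAt.mdifferentiableAt
      (n := ∞) (by simp)
  have h2 := (hW u).mlieBracket_vectorField_eq (hW w)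
  have : CompleteSpace F := FiniteDimensional.complete ℝ F
  have : IsManifold 𝓘(ℝ, E) (minSmoothness ℝ 2) M := by
    rw [minSmoothness_of_isRCLikeNormedField]; infer_instance
  rw [← VectorField.mpullback_mlieBracket (hc u) (hc w)
    ((hΦ.smooth.contMDiffAt (Φ.open_source.mem_nhds hx))) (by simp; norm_cast)] at h2
  rw [h2] at h1
  have h3 : VectorField.mlieBracket 𝓘(ℝ, F) (fun _ : F => u) (fun _ => w) = 0 := by
    funext z
    refine (congrFun (VectorField.mlieBracketWithin_eq_lieBracketWithin (𝕜 := ℝ) (E := F)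
      (V := fun _ => u) (W := fun _ => w) (s := univ)) z).trans ?_
    show VectorField.lieBracketWithin ℝ (fun _ : F => u) (fun _ => w) univ z = 0
    simp [VectorField.lieBracketWithin]
  rw [h3, VectorField.mpullback_zero] at h1
  rw [hΦ.christoffel_apply hy, hΦ.christoffel_apply hy]
  have h4 : covAt cov (chartField Φ w) (Φ.symm y) (dchartSymm (E := E) Φ (Φ (Φ.symm y)) u) =
      covAt cov (chartField Φ u) (Φ.symm y) (dchartSymm (E := E) Φ (Φ (Φ.symm y)) w) :=
    sub_eq_zero.1 h1
  rw [Φ.right_inv hy] at h4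
  rw [h4]

end ChartConnection

/-! ### The equation of parallel transport in a chart -/

section ParallelInChart

variable {E : Type*} [NormedAddCommGroup E] [NormedSpace ℝ E]
  {M : Type*} [TopologicalSpace M] [ChartedSpace E M] [IsManifold 𝓘(ℝ, E) ∞ M]
  {F : Type*} [NormedAddCommGroup F] [NormedSpace ℝ F] [FiniteDimensional ℝ F]
  {Φ : OpenPartialHomeomorph M F}
  {cov : CovariantDerivative 𝓘(ℝ, E) E (TangentSpace 𝓘(ℝ, E) : M → Type _)}

/-- The components of a tangent vector in a chart. -/
def components (Φ : OpenPartialHomeomorph M F) (X : TangentBundle 𝓘(ℝ, E) M) : F :=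
  dchart (E := E) Φ X.proj (X.2 : E)

/-- The tangent vector with given base point and components in a chart. -/
def ofComponents (Φ : OpenPartialHomeomorph M F) (y ξ : F) : TangentBundle 𝓘(ℝ, E) M :=
  ⟨Φ.symm y, (dchartSymm (E := E) Φ y ξ : E)⟩

lemma IsSmoothChart.components_ofComponents (hΦ : IsSmoothChart (E := E) Φ) {y : F}
    (hy : y ∈ Φ.target) (ξ : F) : components Φ (ofComponents (E := E) Φ y ξ) = ξ :=
  hΦ.dchart_dchartSymm hy ξ

lemma IsSmoothChart.ofComponents_components (hΦ : IsSmoothChart (E := E) Φ)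
    {X : TangentBundle 𝓘(ℝ, E) M} (hX : X.proj ∈ Φ.source) :
    ofComponents Φ (Φ X.proj) (components Φ X) = X := by
  obtain ⟨x, v⟩ := X
  exact congrArg₂ (fun (a : M) (b : E) => (⟨a, b⟩ : TangentBundle 𝓘(ℝ, E) M)) (Φ.left_inv hX)
    (hΦ.dchartSymm_dchart hX v)

lemma IsSmoothChart.dchart_covAt' (hΦ : IsSmoothChart (E := E) Φ) {x : M}
    (hx : x ∈ Φ.source) {s : (x : M) → TangentSpace 𝓘(ℝ, E) x}
    (hs : MDifferentiableAt 𝓘(ℝ, E) 𝓘(ℝ, E).tangent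
      (fun x => (⟨x, s x⟩ : TangentBundle 𝓘(ℝ, E) M)) x) (v : E) :
    dchart (E := E) Φ x (covAt cov s x v) = fderiv ℝ (coordField Φ s) (Φ x) (dchart Φ x v) +
      christoffel cov Φ (Φ x) (dchart Φ x v) (coordField Φ s (Φ x)) := by
  have h := hΦ.dchart_covAt (cov := cov) (Φ.map_source hx) (s := s)
    (by rwa [Φ.left_inv hx]) (dchart Φ x v)
  rwa [Φ.left_inv hx, hΦ.dchartSymm_dchart hx] at h

lemma IsSmoothChart.hasDerivAt_comp (hΦ : IsSmoothChart (E := E) Φ) {c : ℝ → M} {t : ℝ}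
    (hc : MDifferentiableAt 𝓘(ℝ, ℝ) 𝓘(ℝ, E) c t) (ht : c t ∈ Φ.source) :
    HasDerivAt (fun s => Φ (c s)) (dchart (E := E) Φ (c t) (velocity (E := E) c t : E)) t := by
  have h1 := HasMFDerivAt.comp t (hΦ.mdifferentiableAt ht).hasMFDerivAt hc.hasMFDerivAt
  have h2 : HasFDerivAt (fun s => Φ (c s)) (dchart (E := E) Φ (c t) ∘L
      (mfderiv 𝓘(ℝ, ℝ) 𝓘(ℝ, E) c t : ℝ →L[ℝ] E)) t := hasMFDerivAt_iff_hasFDerivAt.1 h1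
  exact h2.hasDerivAt

lemma IsSmoothChart.mdifferentiableAt_symm_comp (hΦ : IsSmoothChart (E := E) Φ) {c : ℝ → F} {t : ℝ}
    {c' : F} (hc : HasDerivAt c c' t) (ht : c t ∈ Φ.target) :
    MDifferentiableAt 𝓘(ℝ, ℝ) 𝓘(ℝ, E) (fun s => Φ.symm (c s)) t ∧
    (velocity (E := E) (fun s => Φ.symm (c s)) t : E) = dchartSymm (E := E) Φ (c t) c' := by
  have h1 := HasMFDerivAt.comp t (hΦ.mdifferentiableAt_symm ht).hasMFDerivAt
    hc.hasFDerivAt.hasMFDerivAt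
  refine ⟨h1.mdifferentiableAt, ?_⟩
  show (mfderiv 𝓘(ℝ, ℝ) 𝓘(ℝ, E) (Φ.symm ∘ c) t (1 : ℝ) : E) = _
  rw [h1.mfderiv]
  show dchartSymm (E := E) Φ (c t) ((1 : ℝ) • c') = _
  rw [one_smul]

/-- The equation of parallel transport in a chart. -/
lemma IsSmoothChart.hasDerivAt_of_hasCovDerivAlongAt (hΦ : IsSmoothChart (E := E) Φ)
    {X : ℝ → TangentBundle 𝓘(ℝ, E) M} {t : ℝ} (hX : HasCovDerivAlongAt cov X t 0)
    (ht : (X t).proj ∈ Φ.source) :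
    ∃ c', HasDerivAt (fun s => Φ (X s).proj) c' t ∧ HasDerivAt (fun s => components Φ (X s))
      (-(christoffel cov Φ (Φ (X t).proj) c' (components Φ (X t)))) t := by
  obtain ⟨hm, k, f, f', s, hf, hs, hXs, hw⟩ := hX
  let s' : Fin k → M → E := fun i x => s i x
  have hc := hΦ.hasDerivAt_comp hm ht
  set v : E := (velocity (E := E) (fun s => (X s).proj) t : E)
  set x := (X t).proj with hx
  refine ⟨_, hc, ?_⟩
  have hcont : ∀ᶠ r in 𝓝 t, (X r).proj ∈ Φ.source :=
    hm.continuousAt.eventually (Φ.open_source.mem_nhds ht)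
  -- The fields in the expansion of `X` are arbitrary; in components their derivatives and
  -- Christoffel terms combine to ξ' + Γ(c', ξ), whatever the expansion.
  have heq : (fun r => components Φ (X r)) =ᶠ[𝓝 t]
      fun r => ∑ i, f i r • coordField Φ (s i) (Φ (X r).proj) := by
    filter_upwards [hXs, hcont] with r hr hr'
    have h1 : ((X r).2 : E) = ∑ i, f i r • s' i (X r).proj := hr
    refine (congrArg (dchart (E := E) Φ (X r).proj) h1).trans ?_
    rw [map_sum]
    refine Finset.sum_congr rfl fun i _ => ?_
    rw [map_smul, coordField, Φ.left_inv hr']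
  have hd : ∀ i, HasDerivAt (fun r => f i r • coordField Φ (s i) (Φ (X r).proj))
      (f i t • fderiv ℝ (coordField Φ (s i)) (Φ x) (dchart (E := E) Φ x v) +
        f' i • coordField Φ (s i) (Φ x)) t := by
    intro i
    have h1 := hΦ.differentiableAt_coordField (Φ.map_source ht) (s := s i)
      (by rw [Φ.left_inv ht]; exact hs i)
    have h2 := h1.hasFDerivAt.comp_hasDerivAt t hc
    exact (hf i).smul h2
  have h2 := (HasDerivAt.fun_sum (u := Finset.univ) fun i _ => hd i).congr_of_eventuallyEq heq
  refine h2.congr_deriv ?_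
  have hw' : (0 : E) = ∑ i, (f' i • s' i x + f i t • covAt cov (s i) x v) := hw
  have hw2 := congrArg (dchart (E := E) Φ x) hw'
  rw [map_zero, map_sum] at hw2
  have h3 : components Φ (X t) = ∑ i, f i t • coordField Φ (s i) (Φ x) := heq.self_of_nhds
  rw [h3, map_sum, eq_neg_iff_add_eq_zero, hw2, ← Finset.sum_add_distrib]
  refine Finset.sum_congr rfl fun i _ => ?_
  rw [map_add, map_smul, map_smul, map_smul, hΦ.dchart_covAt' ht (hs i)]
  have h4 : coordField Φ (s i) (Φ x) = dchart (E := E) Φ x (s' i x) := by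
    rw [coordField, Φ.left_inv ht]
  rw [h4, smul_add]
  abel

/-- The converse translation: expand in the coordinate fields of a basis, with the components of ξ
as coefficients. -/
lemma IsSmoothChart.hasCovDerivAlongAt_of_hasDerivAt (hΦ : IsSmoothChart (E := E) Φ)
    {X : ℝ → TangentBundle 𝓘(ℝ, E) M} {t : ℝ} {c ξ : ℝ → F} {c' : F}
    (hc : HasDerivAt c c' t) (ht : c t ∈ Φ.target)
    (hξ : HasDerivAt ξ (-(christoffel cov Φ (c t) c' (ξ t))) t)
    (hX : ∀ᶠ s in 𝓝 t, X s = ofComponents Φ (c s) (ξ s)) : HasCovDerivAlongAt cov X t 0 := by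
  have hXp : (fun s => (X s).proj) =ᶠ[𝓝 t] fun s => Φ.symm (c s) := by
    filter_upwards [hX] with s hs
    rw [hs]; rfl
  obtain ⟨h1, h2⟩ := hΦ.mdifferentiableAt_symm_comp hc ht
  have hXt : (X t).proj = Φ.symm (c t) := hXp.self_of_nhds
  have hv : (velocity (E := E) (fun s => (X s).proj) t : E) = dchartSymm (E := E) Φ (c t) c' := by
    rw [← h2]
    have := hXp.mfderiv_eq (I := 𝓘(ℝ, ℝ)) (I' := 𝓘(ℝ, E))
    exact congrArg (fun T : ℝ →L[ℝ] E => T 1) this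
  let b := Module.finBasis ℝ F
  let ψ : Fin (Module.finrank ℝ F) → F →L[ℝ] ℝ := fun i =>
    LinearMap.toContinuousLinearMap (b.coord i)
  set ξ' := -(christoffel cov Φ (c t) c' (ξ t)) with hξ'
  refine ⟨h1.congr_of_eventuallyEq hXp, Module.finrank ℝ F, fun i s => ψ i (ξ s), fun i => ψ i ξ',
    fun i => chartField Φ (b i), fun i => (ψ i).hasFDerivAt.comp_hasDerivAt t hξ, fun i => ?_, ?_, ?_⟩
  · exact hΦ.mdifferentiableAt_chartField _ (by rw [hXt]; exact Φ.map_target ht)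
  · filter_upwards [hX, hc.continuousAt.eventually (Φ.open_target.mem_nhds ht)] with s hs hs'
    rw [hs]
    show (dchartSymm (E := E) Φ (c s) (ξ s) : E) =
      (∑ i, b.repr (ξ s) i • (dchartSymm (E := E) Φ (Φ (Φ.symm (c s))) (b i) : E) : E)
    rw [Φ.right_inv hs']
    conv_lhs => rw [← b.sum_repr (ξ s), map_sum]
    exact Finset.sum_congr rfl fun i _ => map_smul _ _ _
  · have key : (0 : E) = ∑ i, (ψ i ξ' • (dchartSymm (E := E) Φ (Φ (X t).proj) (b i) : E) +
        ψ i (ξ t) • covAt cov (chartField Φ (b i)) (X t).proj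
          (velocity (E := E) (fun s => (X s).proj) t : E)) := by
      rw [hv, hXt, Φ.right_inv ht]
      rw [← hΦ.dchartSymm_dchart' ht (∑ i, _), map_sum]
      symm
      have : ∑ i, dchart (E := E) Φ (Φ.symm (c t)) (ψ i ξ' • dchartSymm (E := E) Φ (c t) (b i) +
          ψ i (ξ t) • covAt cov (chartField Φ (b i)) (Φ.symm (c t))
            (dchartSymm (E := E) Φ (c t) c')) = 0 := by
        have h3 : ξ' = ∑ i, b.repr ξ' i • b i := (b.sum_repr _).symm
        have h4 := christoffel_apply' cov (Φ := Φ) (c t) c' (ξ t)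
        have h5 : ξ' + christoffel cov Φ (c t) c' (ξ t) = 0 := by rw [hξ']; exact neg_add_cancel _
        rw [h4, h3, ← Finset.sum_add_distrib] at h5
        rw [← h5]
        refine Finset.sum_congr rfl fun i _ => ?_
        rw [map_add, map_smul, map_smul, hΦ.dchart_dchartSymm ht]
        rfl
      rw [this, map_zero]
    exact key

end ParallelInChart

/-! ### Parallel curves in coordinates and operations on piecewise paths -/

section CoordinateTransport

variable {F : Type*} [NormedAddCommGroup F] [NormedSpace ℝ F]

lemma interval_propagation {p : ℝ → Prop} {a b : ℝ} (hab : a ≤ b) {S : Set ℝ} (hS : S.Finite)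
    (h0 : p a) (step : ∀ s t, a ≤ s → s < t → t ≤ b → (∀ u ∈ Ioo s t, u ∉ S) → p s → p t) :
    p b := by
  rcases hab.eq_or_lt with rfl | hab
  · exact h0
  · exact interval_induction (Q := fun s t => p s → p t) (fun _ _ _ _ _ h1 h2 h => h2 (h1 h))
      hS.toFinset a b hab (fun s t h1 h2 h3 h4 => step s t h1 h2 h3 (by simpa using h4)) h0

lemma PiecewiseC1On.continuousOn {E : Type*} [NormedAddCommGroup E] [NormedSpace ℝ E]
    {M : Type*} [TopologicalSpace M] [ChartedSpace E M] {c : ℝ → M} {a b : ℝ}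
    (hc : PiecewiseC1On (E := E) c a b) : ContinuousOn c (Icc a b) := by
  rcases le_or_gt b a with hab | hab
  · rcases hab.eq_or_lt with rfl | hab
    · simp
    · simp [Icc_eq_empty hab.not_ge]
  · obtain ⟨S, hS⟩ := hc
    refine interval_induction (Q := fun s t => ContinuousOn c (Icc s t)) ?_ S a b hab
      fun s t h1 h2 h3 h4 => (hS s t h1 h2 h3 h4).continuousOn
    intro a b c hab hbc h1 h2
    rw [← Icc_union_Icc_eq_Icc hab.le hbc.le]
    exact h1.union_of_isClosed h2 isClosed_Icc isClosed_Icc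

lemma PiecewiseC1On.mono {E : Type*} [NormedAddCommGroup E] [NormedSpace ℝ E]
    {M : Type*} [TopologicalSpace M] [ChartedSpace E M] {c : ℝ → M} {a b a' b' : ℝ}
    (hc : PiecewiseC1On (E := E) c a b) (ha : a ≤ a') (hb : b' ≤ b) :
    PiecewiseC1On (E := E) c a' b' := by
  obtain ⟨S, hS⟩ := hc
  exact ⟨S, fun s t h1 h2 h3 => hS s t (ha.trans h1) h2 (h3.trans hb)⟩

/-- A property propagates along a piecewise `C^1` curve if it propagates along its `C^1` pieces. -/
lemma PiecewiseC1On.propagation {c : ℝ → F} {a b : ℝ} (hc : PiecewiseC1On (E := F) c a b)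
    (hab : a ≤ b) {S : Set ℝ} (hS : S.Finite) {p : ℝ → Prop} (h0 : p a)
    (step : ∀ s t c', a ≤ s → s < t → t ≤ b → (∀ u ∈ Ioo s t, u ∉ S) → ContinuousOn c (Icc s t) →
      ContinuousOn c' (Icc s t) → (∀ u ∈ Ioo s t, HasDerivAt c (c' u) u) → p s → p t) : p b := by
  obtain ⟨S', hS'⟩ := hc
  refine interval_propagation hab (hS.union S'.finite_toSet) h0 fun s t h1 h2 h3 h4 hp => ?_
  have h5 := contMDiffOn_iff_contDiffOn.1
    (hS' s t h1 h2 h3 fun u hu hu' => h4 u hu (Or.inr hu'))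
  refine step s t (derivWithin c (Icc s t)) h1 h2 h3 (fun u hu hu' => h4 u hu (Or.inl hu'))
    h5.continuousOn (h5.continuousOn_derivWithin (uniqueDiffOn_Icc h2) le_rfl) (fun u hu => ?_) hp
  exact hasDerivAt_of_Icc ((h5.differentiableOn one_ne_zero u
    (Ioo_subset_Icc_self hu)).hasDerivWithinAt) hu

/-- The derivative of a piecewise `C^1` curve exists off a finite set. -/
lemma PiecewiseC1On.finite_not_hasDerivAt {c : ℝ → F} {a b : ℝ}
    (hc : PiecewiseC1On (E := F) c a b) : {t ∈ Ioo a b | ¬ ∃ c', HasDerivAt c c' t}.Finite := by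
  obtain ⟨S, hS⟩ := hc
  refine S.finite_toSet.subset fun t ht => ?_
  by_contra htS
  -- A parameter that is not a break point has a neighbourhood free of break points, on which the
  -- curve is `C^1`.
  have h1 : ∀ᶠ u in 𝓝 t, u ∈ Ioo a b ∧ (u ∈ S → u = t) := by
    have : IsClosed ((S : Set ℝ) \ {t}) := (S.finite_toSet.sdiff).isClosed
    filter_upwards [this.isOpen_compl.mem_nhds (by simp : t ∈ ((S : Set ℝ) \ {t})ᶜ),
      Ioo_mem_nhds ht.1.1 ht.1.2] with u hu hu1
    refine ⟨hu1, fun hu' => ?_⟩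
    by_contra h
    exact hu ⟨hu', h⟩
  obtain ⟨ε, hε, hball⟩ := Metric.eventually_nhds_iff_ball.1 h1
  have hmem : ∀ u ∈ Icc (t - ε / 2) (t + ε / 2), u ∈ Metric.ball t ε := by
    intro u hu
    rw [Real.ball_eq_Ioo]
    exact ⟨by linarith [hu.1], by linarith [hu.2]⟩
  have h2 := contMDiffOn_iff_contDiffOn.1 (hS (t - ε / 2) (t + ε / 2)
    (hball _ (hmem _ ⟨le_rfl, by linarith⟩)).1.1.le (by linarith)
    (hball _ (hmem _ ⟨by linarith, le_rfl⟩)).1.2.le (fun u hu hu' => by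
      have := (hball u (hmem u (Ioo_subset_Icc_self hu))).2 hu'
      exact htS (this ▸ hu')))
  have h3 : t ∈ Ioo (t - ε / 2) (t + ε / 2) := ⟨by linarith, by linarith⟩
  exact ht.2 ⟨_, hasDerivAt_of_Icc ((h2.differentiableOn one_ne_zero t
    (Ioo_subset_Icc_self h3)).hasDerivWithinAt) h3⟩

/-- A curve of vectors `ξ` is parallel along `c` for the connection with Christoffel symbols `Γ`. -/
def IsParallelCurve (Γ : F → F →L[ℝ] F →L[ℝ] F) (c ξ : ℝ → F) (a b : ℝ) : Prop :=
  ContinuousOn ξ (Icc a b) ∧ {t ∈ Ioo a b | ¬ ∃ c', HasDerivAt c c' t ∧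
    HasDerivAt ξ (-(Γ (c t) c' (ξ t))) t}.Finite

variable {Γ : F → F →L[ℝ] F →L[ℝ] F} {B : Set F}

/-- Between exceptional parameters both curves solve the same linear equation with continuous
coefficients; continuity of the curves carries equality across the exceptions. -/
lemma IsParallelCurve.eq (hΓ : ContinuousOn Γ B) {c ξ η : ℝ → F} {a b : ℝ} (hab : a ≤ b)
    (hc : PiecewiseC1On (E := F) c a b) (hcB : ∀ t ∈ Icc a b, c t ∈ B)
    (hξ : IsParallelCurve Γ c ξ a b) (hη : IsParallelCurve Γ c η a b) (h0 : ξ a = η a) :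
    ξ b = η b := by
  refine hc.propagation hab (hξ.2.union hη.2) (p := fun t => ξ t = η t) h0
    fun s t c' h1 h2 h3 h4 hcc hc'c hc' hp => ?_
  have hsub : Icc s t ⊆ Icc a b := Icc_subset_Icc h1 h3
  have hsub' : ∀ u ∈ Ioo s t, u ∈ Ioo a b := fun u hu =>
    ⟨h1.trans_lt hu.1, hu.2.trans_le h3⟩
  have hA : ContinuousOn (fun u => -(Γ (c u) (c' u))) (Icc s t) :=
    ((hΓ.comp hcc fun u hu => hcB u (hsub hu)).clm_apply hc'c).neg
  have hd : ∀ ζ : ℝ → F, ∀ u ∈ Ioo s t, (∃ c', HasDerivAt c c' u ∧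
      HasDerivAt ζ (-(Γ (c u) c' (ζ u))) u) → HasDerivAt ζ ((-(Γ (c u) (c' u))) (ζ u)) u := by
    rintro ζ u hu ⟨v, hv, hζ⟩
    rw [(hc' u hu).unique hv]
    exact hζ
  refine eqOn_of_linear_ode hA (hξ.1.mono hsub) (hη.1.mono hsub) (fun u hu => hd _ u hu ?_)
    (fun u hu => hd _ u hu ?_) hp ⟨h2.le, le_rfl⟩
  · by_contra h
    exact h4 u hu (Or.inl ⟨hsub' u hu, h⟩)
  · by_contra h
    exact h4 u hu (Or.inr ⟨hsub' u hu, h⟩)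

/-- Parallel curves are obtained from frames which are parallel in the direction of the curve. -/
lemma isParallelCurve_frame (hB : IsOpen B) {P : F → F →L[ℝ] F} (hP : DifferentiableOn ℝ P B)
    {c : ℝ → F} {a b : ℝ} (hc : PiecewiseC1On (E := F) c a b) (hcB : ∀ t ∈ Icc a b, c t ∈ B)
    {W : Submodule ℝ F} (hPW : ∀ y ∈ c '' Icc a b, ∀ u ∈ W, fderiv ℝ P y u + Γ y u ∘L P y = 0)
    (hW : {t ∈ Ioo a b | deriv c t ∉ W}.Finite) (v : F) :
    IsParallelCurve Γ c (fun t => P (c t) v) a b := by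
  refine ⟨(hP.continuousOn.comp hc.continuousOn hcB).clm_apply continuousOn_const,
    (hc.finite_not_hasDerivAt.union hW).subset fun t ht => ?_⟩
  by_contra h
  simp only [mem_union, mem_ofPred_eq, not_or, not_and, not_not] at h
  obtain ⟨c', hc'⟩ := h.1 ht.1
  have h2 := h.2 ht.1
  rw [hc'.deriv] at h2
  have hct := hcB t (Ioo_subset_Icc_self ht.1)
  have h3 := ((hP.differentiableAt (hB.mem_nhds hct)).hasFDerivAt.comp_hasDerivAt t hc').clm_apply
    (hasDerivAt_const t v)
  refine ht.2 ⟨c', hc', h3.congr_deriv ?_⟩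
  have h4 := congrArg (fun T : F →L[ℝ] F => T v)
    (hPW _ ⟨t, Ioo_subset_Icc_self ht.1, rfl⟩ c' h2)
  simp only [add_apply, ContinuousLinearMap.comp_apply, zero_apply] at h4
  simp only [map_zero, add_zero]
  exact eq_neg_of_add_eq_zero_left h4

/-- The junction joins the exceptional parameters, so one-sided derivatives need not match there. -/
lemma IsParallelCurve.glue {c ξ η : ℝ → F} {a b d : ℝ} (hab : a ≤ b) (hbd : b ≤ d)
    (hξ : IsParallelCurve Γ c ξ a b) (hη : IsParallelCurve Γ c η b d) (h : ξ b = η b) :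
    ∃ ζ, IsParallelCurve Γ c ζ a d ∧ ζ a = ξ a ∧ ζ d = η d := by
  classical
  let ζ : ℝ → F := fun t => if t ≤ b then ξ t else η t
  have h1 : EqOn ζ ξ (Icc a b) := fun t ht => if_pos ht.2
  have h2 : EqOn ζ η (Icc b d) := fun t ht => by
    rcases ht.1.eq_or_lt with rfl | hlt
    · simp [ζ, h]
    · exact if_neg hlt.not_ge
  refine ⟨ζ, ⟨?_, ((hξ.2.union hη.2).insert b).subset ?_⟩, h1 ⟨le_rfl, hab⟩, h2 ⟨hbd, le_rfl⟩⟩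
  · rw [← Icc_union_Icc_eq_Icc hab hbd]
    exact (hξ.1.congr h1).union_of_isClosed (hη.1.congr h2) isClosed_Icc isClosed_Icc
  · rintro t ⟨ht, hn⟩
    rcases lt_trichotomy t b with hlt | rfl | hlt
    · right; left
      refine ⟨⟨ht.1, hlt⟩, fun ⟨c', hc', hd⟩ => hn ⟨c', hc', ?_⟩⟩
      have : ζ =ᶠ[𝓝 t] ξ := by
        filter_upwards [Iio_mem_nhds hlt] with u hu using if_pos (le_of_lt hu)
      rw [this.self_of_nhds]
      exact hd.congr_of_eventuallyEq this
    · left; rfl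
    · right; right
      refine ⟨⟨hlt, ht.2⟩, fun ⟨c', hc', hd⟩ => hn ⟨c', hc', ?_⟩⟩
      have : ζ =ᶠ[𝓝 t] η := by
        filter_upwards [Ioi_mem_nhds hlt] with u hu using if_neg (not_le.2 hu)
      rw [this.self_of_nhds]
      exact hd.congr_of_eventuallyEq this

/-- Affine reparametrizations. -/
lemma IsParallelCurve.comp_affine {c ξ : ℝ → F} {a b : ℝ} (h : IsParallelCurve Γ c ξ a b)
    {k l a' b' : ℝ} (hk : k ≠ 0) (hmaps : MapsTo (fun t => k * t + l) (Icc a' b') (Icc a b))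
    (hmaps' : MapsTo (fun t => k * t + l) (Ioo a' b') (Ioo a b)) :
    IsParallelCurve Γ (fun t => c (k * t + l)) (fun t => ξ (k * t + l)) a' b' := by
  refine ⟨h.1.comp (by fun_prop) hmaps, (h.2.preimage (f := fun t => k * t + l) ?_).subset ?_⟩
  · intro x _ y _ hxy
    have : k * x + l = k * y + l := hxy
    exact mul_left_cancel₀ hk (add_right_cancel this)
  · rintro t ⟨ht, hn⟩
    refine ⟨hmaps' ht, fun ⟨c', hc', hd⟩ => hn ⟨k • c', ?_, ?_⟩⟩
    · have := hc'.scomp t (((hasDerivAt_id t).const_mul k).add_const l)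
      simpa using! this
    · have := hd.scomp t (((hasDerivAt_id t).const_mul k).add_const l)
      refine this.congr_deriv ?_
      rw [mul_one, map_smul, smul_apply, smul_neg]

lemma IsParallelCurve.congr {c c₂ ξ ξ₂ : ℝ → F} {a b : ℝ} (h : IsParallelCurve Γ c ξ a b)
    (hc : EqOn c₂ c (Icc a b)) (hξ : EqOn ξ₂ ξ (Icc a b)) : IsParallelCurve Γ c₂ ξ₂ a b := by
  refine ⟨h.1.congr hξ, h.2.subset ?_⟩
  rintro t ⟨ht, hn⟩
  have hm : Icc a b ∈ 𝓝 t := Icc_mem_nhds ht.1 ht.2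
  have h1 : c₂ =ᶠ[𝓝 t] c := Filter.eventually_of_mem hm hc
  have h2 : ξ₂ =ᶠ[𝓝 t] ξ := Filter.eventually_of_mem hm hξ
  refine ⟨ht, fun ⟨c', hc', hd⟩ => hn ⟨c', hc'.congr_of_eventuallyEq h1, ?_⟩⟩
  rw [h1.self_of_nhds, h2.self_of_nhds]
  exact hd.congr_of_eventuallyEq h2

section Paths

variable {E : Type*} [NormedAddCommGroup E] [NormedSpace ℝ E]
  {M : Type*} [TopologicalSpace M] [ChartedSpace E M]

/-- Positive slopes serve the halves of a concatenation, negative ones the reversal of a path. -/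
lemma PiecewiseC1On.comp_affine {c : ℝ → M} {a b : ℝ} (h : PiecewiseC1On (E := E) c a b)
    {k l a' b' : ℝ} (hk : k ≠ 0) (hmaps : MapsTo (fun t => k * t + l) (Icc a' b') (Icc a b)) :
    PiecewiseC1On (E := E) (fun t => c (k * t + l)) a' b' := by
  classical
  obtain ⟨S, hS⟩ := h
  have haff : ContMDiff 𝓘(ℝ, ℝ) 𝓘(ℝ, ℝ) 1 (fun t : ℝ => k * t + l) :=
    contMDiff_iff_contDiff.2 (by fun_prop)
  refine ⟨S.image fun u => (u - l) / k, fun s t hs hst ht hu => ?_⟩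
  have hs' := hmaps ⟨hs, hst.le.trans ht⟩
  have ht' := hmaps ⟨hs.trans hst.le, ht⟩
  have hmem : ∀ u, u ∈ Ioo s t → k * u + l ∉ S := fun u hu1 hu2 => hu u hu1
    (Finset.mem_image.2 ⟨_, hu2, by field_simp; ring⟩)
  rcases lt_or_gt_of_ne hk with hneg | hpos
  · have hlt : k * t + l < k * s + l := by nlinarith
    refine (hS _ _ ht'.1 hlt hs'.2 fun u hu1 hu2 => ?_).comp haff.contMDiffOn fun u hu1 => ?_
    · refine hmem ((u - l) / k) ⟨?_, ?_⟩ (by convert hu2 using 1; field_simp; ring)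
      · rw [lt_div_iff_of_neg hneg]; linarith [hu1.2]
      · rw [div_lt_iff_of_neg hneg]; linarith [hu1.1]
    · exact ⟨by nlinarith [hu1.2], by nlinarith [hu1.1]⟩
  · have hlt : k * s + l < k * t + l := by nlinarith
    refine (hS _ _ hs'.1 hlt ht'.2 fun u hu1 hu2 => ?_).comp haff.contMDiffOn fun u hu1 => ?_
    · refine hmem ((u - l) / k) ⟨?_, ?_⟩ (by convert hu2 using 1; field_simp; ring)
      · rw [lt_div_iff₀ hpos]; linarith [hu1.1]
      · rw [div_lt_iff₀ hpos]; linarith [hu1.2]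
    · exact ⟨by nlinarith [hu1.1], by nlinarith [hu1.2]⟩

lemma PiecewiseC1On.glue {c c₁ c₂ : ℝ → M} {a b d : ℝ}
    (h₁ : PiecewiseC1On (E := E) c₁ a b) (h₂ : PiecewiseC1On (E := E) c₂ b d)
    (hc₁ : EqOn c c₁ (Icc a b)) (hc₂ : EqOn c c₂ (Icc b d)) : PiecewiseC1On (E := E) c a d := by
  classical
  obtain ⟨S₁, hS₁⟩ := h₁
  obtain ⟨S₂, hS₂⟩ := h₂
  refine ⟨insert b (S₁ ∪ S₂), fun s t hs hst ht hu => ?_⟩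
  have hb : b ∉ Ioo s t := fun hb => hu b hb (by simp)
  rcases le_or_gt t b with htb | htb
  · exact (hS₁ s t hs hst htb fun u hu1 hu2 => hu u hu1 (by simp [hu2])).congr fun u hu =>
      hc₁ ⟨hs.trans hu.1, hu.2.trans htb⟩
  · have hbs : b ≤ s := by
      by_contra h
      exact hb ⟨not_le.1 h, htb⟩
    exact (hS₂ s t hbs hst ht fun u hu1 hu2 => hu u hu1 (by simp [hu2])).congr fun u hu =>
      hc₂ ⟨hbs.trans hu.1, hu.2.trans ht⟩

open Classical in
/-- Concatenation of two paths on `[0, 1]`. -/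
def pathConcat {X : Type*} (c₁ c₂ : ℝ → X) (t : ℝ) : X :=
  if t ≤ 1 / 2 then c₁ (2 * t) else c₂ (2 * t - 1)

lemma pathConcat_left {X : Type*} (c₁ c₂ : ℝ → X) {t : ℝ} (ht : t ≤ 1 / 2) :
    pathConcat c₁ c₂ t = c₁ (2 * t + 0) := by rw [pathConcat, if_pos ht, add_zero]

/-- The definition takes the first path at the midpoint, hence the matching condition. The summand
-1 is written so that `comp_affine` applies literally. -/
lemma pathConcat_right {X : Type*} {c₁ c₂ : ℝ → X} (h : c₁ 1 = c₂ 0) {t : ℝ} (ht : 1 / 2 ≤ t) :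
    pathConcat c₁ c₂ t = c₂ (2 * t + (-1)) := by
  rcases ht.eq_or_lt with rfl | ht
  · rw [pathConcat, if_pos le_rfl]; norm_num [h]
  · rw [pathConcat, if_neg ht.not_ge]; rfl

lemma mapsTo_left : MapsTo (fun t : ℝ => 2 * t + 0) (Icc 0 (1 / 2)) (Icc 0 1) := fun t ht =>
  ⟨by linarith [ht.1], by linarith [ht.2]⟩

lemma mapsTo_right : MapsTo (fun t : ℝ => 2 * t + (-1)) (Icc (1 / 2) 1) (Icc 0 1) := fun t ht =>
  ⟨by linarith [ht.1], by linarith [ht.2]⟩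

lemma IsPathIn.concat {U : Set M} {p q r : M} {c₁ c₂ : ℝ → M} (h₁ : IsPathIn (E := E) U p q c₁)
    (h₂ : IsPathIn (E := E) U q r c₂) : IsPathIn (E := E) U p r (pathConcat c₁ c₂) := by
  have h12 : c₁ 1 = c₂ 0 := by rw [h₁.target, h₂.source]
  refine ⟨?_, fun t ht => ?_, ?_, ?_⟩
  · exact (h₁.piecewise.comp_affine (by norm_num) mapsTo_left).glue
      (h₂.piecewise.comp_affine (by norm_num) mapsTo_right)
      (fun t ht => pathConcat_left _ _ ht.2) (fun t ht => pathConcat_right h12 ht.1)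
  · rcases le_total t (1 / 2) with h | h
    · rw [pathConcat_left _ _ h]; exact h₁.mem _ (mapsTo_left ⟨ht.1, h⟩)
    · rw [pathConcat_right h12 h]; exact h₂.mem _ (mapsTo_right ⟨h, ht.2⟩)
  · rw [pathConcat_left _ _ (by norm_num), ← h₁.source]; norm_num
  · rw [pathConcat_right h12 (by norm_num), ← h₂.target]; norm_num

lemma IsPathIn.reverse {U : Set M} {p q : M} {c : ℝ → M} (h : IsPathIn (E := E) U p q c) :
    IsPathIn (E := E) U q p (fun t => c (-1 * t + 1)) := by
  have hmaps : MapsTo (fun t : ℝ => -1 * t + 1) (Icc 0 1) (Icc 0 1) := fun t ht =>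
    ⟨by linarith [ht.2], by linarith [ht.1]⟩
  refine ⟨h.piecewise.comp_affine (by norm_num) hmaps, fun t ht => h.mem _ (hmaps ht), ?_, ?_⟩
  · rw [← h.target]; norm_num
  · rw [← h.source]; norm_num

end Paths

end CoordinateTransport

/-! ### Translation between transport on the manifold and in a chart -/

section TransportBridge

variable {E : Type*} [NormedAddCommGroup E] [NormedSpace ℝ E]
  {M : Type*} [TopologicalSpace M] [ChartedSpace E M]
  {F : Type*} [NormedAddCommGroup F] [NormedSpace ℝ F]
  {Φ : OpenPartialHomeomorph M F}

lemma IsSmoothChart.piecewiseC1On (hΦ : IsSmoothChart (E := E) Φ) {c : ℝ → M} {a b : ℝ}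
    (hc : PiecewiseC1On (E := E) c a b) (h : ∀ t ∈ Icc a b, c t ∈ Φ.source) :
    PiecewiseC1On (E := F) (fun t => Φ (c t)) a b := by
  obtain ⟨S, hS⟩ := hc
  refine ⟨S, fun s t h1 h2 h3 h4 => ?_⟩
  exact (hΦ.smooth.of_le (by norm_cast)).comp (hS s t h1 h2 h3 h4)
    fun u hu => h u ⟨h1.trans hu.1, hu.2.trans h3⟩

lemma IsSmoothChart.piecewiseC1On_symm (hΦ : IsSmoothChart (E := E) Φ) {c : ℝ → F} {a b : ℝ}
    (hc : PiecewiseC1On (E := F) c a b) (h : ∀ t ∈ Icc a b, c t ∈ Φ.target) :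
    PiecewiseC1On (E := E) (fun t => Φ.symm (c t)) a b := by
  obtain ⟨S, hS⟩ := hc
  refine ⟨S, fun s t h1 h2 h3 h4 => ?_⟩
  exact (hΦ.smooth_symm.of_le (by norm_cast)).comp (hS s t h1 h2 h3 h4)
    fun u hu => h u ⟨h1.trans hu.1, hu.2.trans h3⟩

lemma IsSmoothChart.isPathIn (hΦ : IsSmoothChart (E := E) Φ) {U : Set M} (hU : U ⊆ Φ.source)
    {p q : M} {c : ℝ → M} (h : IsPathIn (E := E) U p q c) :
    IsPathIn (E := F) (Φ '' U) (Φ p) (Φ q) (fun t => Φ (c t)) :=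
  ⟨hΦ.piecewiseC1On h.piecewise fun t ht => hU (h.mem t ht), fun t ht => ⟨_, h.mem t ht, rfl⟩,
    by rw [h.source], by rw [h.target]⟩

lemma IsSmoothChart.isPathIn_symm (hΦ : IsSmoothChart (E := E) Φ) {U : Set F} (hU : U ⊆ Φ.target)
    {p q : F} {c : ℝ → F} (h : IsPathIn (E := F) U p q c) :
    IsPathIn (E := E) (Φ.symm '' U) (Φ.symm p) (Φ.symm q) (fun t => Φ.symm (c t)) :=
  ⟨hΦ.piecewiseC1On_symm h.piecewise fun t ht => hU (h.mem t ht), fun t ht => ⟨_, h.mem t ht, rfl⟩,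
    by rw [h.source], by rw [h.target]⟩

lemma IsPathIn.subset {U U' : Set M} {p q : M} {c : ℝ → M} (h : IsPathIn (E := E) U p q c)
    (hU : U ⊆ U') : IsPathIn (E := E) U' p q c :=
  ⟨h.piecewise, fun t ht => hU (h.mem t ht), h.source, h.target⟩

lemma IsPathIn.continuousOn {U : Set M} {p q : M} {c : ℝ → M} (h : IsPathIn (E := E) U p q c) :
    ContinuousOn c (Icc 0 1) := h.piecewise.continuousOn

variable [IsManifold 𝓘(ℝ, E) ∞ M] [FiniteDimensional ℝ F]
  {cov : CovariantDerivative 𝓘(ℝ, E) E (TangentSpace 𝓘(ℝ, E) : M → Type _)}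

lemma IsSmoothChart.continuousOn_components (hΦ : IsSmoothChart (E := E) Φ) :
    ContinuousOn (components (E := E) Φ) (TotalSpace.proj ⁻¹' Φ.source) :=
  (contMDiff_snd_tangentBundle_modelSpace F 𝓘(ℝ, F) (n := 0)).continuous.comp_continuousOn
    hΦ.contMDiffOn_tangentMap.continuousOn

lemma IsSmoothChart.continuousOn_ofComponents (hΦ : IsSmoothChart (E := E) Φ) :
    ContinuousOn (fun p : F × F => ofComponents (E := E) Φ p.1 p.2) (Φ.target ×ˢ univ) :=
  hΦ.contMDiffOn_tangentMap_symm.continuousOn.comp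
    (tangentBundleModelSpaceHomeomorph 𝓘(ℝ, F)).symm.continuous.continuousOn
    fun _ hp => hp.1

/-- Together with `IsSmoothChart.parallel_of_transports` this allows transports along curves in a
chart to be computed in coordinates. -/
lemma IsSmoothChart.transports_of_parallel (hΦ : IsSmoothChart (E := E) Φ) {γ : ℝ → M}
    {ξ : ℝ → F} {a b : ℝ} (hab : a ≤ b) (hγc : ContinuousOn γ (Icc a b))
    (hγ : ∀ t ∈ Icc a b, γ t ∈ Φ.source)
    (hξ : IsParallelCurve (christoffel cov Φ) (fun t => Φ (γ t)) ξ a b)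
    {p q : TangentBundle 𝓘(ℝ, E) M} (hp : p.proj = γ a) (hq : q.proj = γ b)
    (hp' : components Φ p = ξ a) (hq' : components Φ q = ξ b) : Transports cov γ a b p q := by
  have ha : γ a ∈ Φ.source := hγ a ⟨le_rfl, hab⟩
  have hb : γ b ∈ Φ.source := hγ b ⟨hab, le_rfl⟩
  refine ⟨fun t => ofComponents Φ (Φ (γ t)) (ξ t), fun t ht => Φ.left_inv (hγ t ht),
    ⟨?_, hξ.2.subset ?_⟩, ?_, ?_⟩
  · exact hΦ.continuousOn_ofComponents.comp
      ((Φ.continuousOn.comp hγc hγ).prodMk hξ.1) fun t ht => ⟨Φ.map_source (hγ t ht), mem_univ _⟩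
  · rintro t ⟨ht, hn⟩
    refine ⟨ht, fun ⟨c', hc', hd⟩ => hn ?_⟩
    exact hΦ.hasCovDerivAlongAt_of_hasDerivAt hc'
      (Φ.map_source (hγ t (Ioo_subset_Icc_self ht))) hd (Eventually.of_forall fun _ => rfl)
  · show ofComponents Φ (Φ (γ a)) (ξ a) = p
    rw [← hp', ← hp]
    exact hΦ.ofComponents_components (hp ▸ ha)
  · show ofComponents Φ (Φ (γ b)) (ξ b) = q
    rw [← hq', ← hq]
    exact hΦ.ofComponents_components (hq ▸ hb)

/-- The field witnessing the transport covers `γ` only on the interval, so the coordinate curves are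
compared near interior parameters. -/
lemma IsSmoothChart.parallel_of_transports (hΦ : IsSmoothChart (E := E) Φ) {γ : ℝ → M}
    {a b : ℝ} (hab : a ≤ b) (hγ : ∀ t ∈ Icc a b, γ t ∈ Φ.source)
    {p q : TangentBundle 𝓘(ℝ, E) M} (h : Transports cov γ a b p q) :
    p.proj = γ a ∧ q.proj = γ b ∧
    ∃ ξ, IsParallelCurve (christoffel cov Φ) (fun t => Φ (γ t)) ξ a b ∧
      ξ a = components Φ p ∧ ξ b = components Φ q := by
  obtain ⟨X, hX, ⟨hXc, hXf⟩, rfl, rfl⟩ := h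
  refine ⟨hX a ⟨le_rfl, hab⟩, hX b ⟨hab, le_rfl⟩, fun t => components Φ (X t), ⟨?_, ?_⟩, rfl, rfl⟩
  · exact hΦ.continuousOn_components.comp hXc fun t ht => by
      show (X t).proj ∈ Φ.source
      rw [hX t ht]; exact hγ t ht
  · refine hXf.subset ?_
    rintro t ⟨ht, hn⟩
    refine ⟨ht, fun hcd => hn ?_⟩
    have htI := Ioo_subset_Icc_self ht
    have heq : (fun s => Φ (γ s)) =ᶠ[𝓝 t] fun s => Φ (X s).proj := by
      filter_upwards [Icc_mem_nhds ht.1 ht.2] with s hs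
      rw [hX s hs]
    obtain ⟨c', hc', hd⟩ := hΦ.hasDerivAt_of_hasCovDerivAlongAt hcd
      (by rw [hX t htI]; exact hγ t htI)
    refine ⟨c', hc'.congr_of_eventuallyEq heq, ?_⟩
    rw [heq.self_of_nhds]
    exact hd

end TransportBridge

/-! ### Operators of parallel transport and the local holonomy group -/

section TransportPath

variable {F : Type*} [NormedAddCommGroup F] [NormedSpace ℝ F] [FiniteDimensional ℝ F]
  {Γ : F → F →L[ℝ] F →L[ℝ] F} {B : Set F}

lemma IsParallelCurve.concat {c c' ξ η : ℝ → F} (hξ : IsParallelCurve Γ c ξ 0 1)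
    (hη : IsParallelCurve Γ c' η 0 1) (hc : c 1 = c' 0) (h : ξ 1 = η 0) :
    ∃ ζ, IsParallelCurve Γ (pathConcat c c') ζ 0 1 ∧ ζ 0 = ξ 0 ∧ ζ 1 = η 1 := by
  have h1 := (hξ.comp_affine (by norm_num) mapsTo_left (fun t ht =>
    ⟨by linarith [ht.1], by linarith [ht.2]⟩)).congr
    (c₂ := pathConcat c c') (fun t ht => pathConcat_left _ _ ht.2) fun _ _ => rfl
  have h2 := (hη.comp_affine (by norm_num) mapsTo_right (fun t ht =>
    ⟨by linarith [ht.1], by linarith [ht.2]⟩)).congr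
    (c₂ := pathConcat c c') (fun t ht => pathConcat_right hc ht.1) fun _ _ => rfl
  obtain ⟨ζ, hζ, hζ0, hζ1⟩ := h1.glue (by norm_num) (by norm_num) h2 (by norm_num [h])
  refine ⟨ζ, hζ, ?_, ?_⟩
  · rw [hζ0]; norm_num
  · rw [hζ1]; norm_num

/-- `A` is the parallel transport along the path `c` in `B` from `x` to `y`. -/
structure IsTransportPath (Γ : F → F →L[ℝ] F →L[ℝ] F) (B : Set F) (x y : F) (c : ℝ → F)
    (A : F →L[ℝ] F) : Prop where
  path : IsPathIn (E := F) B x y c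
  transport : ∀ v, ∃ ξ, IsParallelCurve Γ c ξ 0 1 ∧ ξ 0 = v ∧ ξ 1 = A v

lemma IsTransportPath.concat {x y z : F} {c c' : ℝ → F} {A A' : F →L[ℝ] F}
    (h : IsTransportPath Γ B x y c A) (h' : IsTransportPath Γ B y z c' A') :
    IsTransportPath Γ B x z (pathConcat c c') (A' * A) := by
  refine ⟨h.path.concat h'.path, fun v => ?_⟩
  obtain ⟨ξ, hξ, hξ0, hξ1⟩ := h.transport v
  obtain ⟨η, hη, hη0, hη1⟩ := h'.transport (A v)
  obtain ⟨ζ, hζ, hζ0, hζ1⟩ := hξ.concat hη (by rw [h.path.target, h'.path.source])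
    (by rw [hξ1, hη0])
  exact ⟨ζ, hζ, hζ0.trans hξ0, hζ1.trans hη1⟩

/-- Run the parallel curve that starts at `A' v` backwards: it starts at `A (A' v) = v` and ends at
`A' v`, so a right inverse suffices. -/
lemma IsTransportPath.reverse {x y : F} {c : ℝ → F} {A A' : F →L[ℝ] F}
    (h : IsTransportPath Γ B x y c A) (hA : A * A' = 1) :
    IsTransportPath Γ B y x (fun t => c (-1 * t + 1)) A' := by
  refine ⟨h.path.reverse, fun v => ?_⟩
  obtain ⟨ξ, hξ, hξ0, hξ1⟩ := h.transport (A' v)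
  refine ⟨_, hξ.comp_affine (k := -1) (l := 1) (by norm_num) (fun t ht => ?_) (fun t ht => ?_), ?_, ?_⟩
  · exact ⟨by linarith [ht.2], by linarith [ht.1]⟩
  · exact ⟨by linarith [ht.2], by linarith [ht.1]⟩
  · have := congrArg (fun T : F →L[ℝ] F => T v) hA
    simp only [mul_apply_eq_comp] at this
    norm_num [hξ1]
    simpa using! this
  · norm_num [hξ0]

lemma IsTransportPath.unique (hΓ : ContinuousOn Γ B) {x y : F} {c ξ : ℝ → F}
    {A : F →L[ℝ] F} (h : IsTransportPath Γ B x y c A) (hξ : IsParallelCurve Γ c ξ 0 1) :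
    ξ 1 = A (ξ 0) := by
  obtain ⟨η, hη, hη0, hη1⟩ := h.transport (ξ 0)
  rw [← hη1]
  exact hξ.eq hΓ zero_le_one h.path.piecewise h.path.mem hη hη0.symm

lemma isTransportPath_segment (hB : Convex ℝ B) (hΓ : ContinuousOn Γ B) {x y : F} (hx : x ∈ B)
    (hy : y ∈ B) : IsTransportPath Γ B x y (fun t => x + t • (y - x)) (segmentTransport Γ x y) := by
  obtain ⟨P, hP⟩ := exists_isSegmentFrame hB hΓ hx hy
  refine ⟨⟨⟨∅, fun s t _ _ _ _ => ?_⟩, fun t ht => segment_mem hB hx hy ht, by simp, by simp⟩,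
    fun v => ⟨fun t => P t v, ⟨?_, ?_⟩, ?_, ?_⟩⟩
  · exact (contMDiff_iff_contDiff.2 (by fun_prop)).contMDiffOn
  · exact hP.continuousOn.clm_apply continuousOn_const
  · refine finite_empty.subset ?_
    rintro t ⟨ht, hn⟩
    refine hn ⟨y - x, ?_, ?_⟩
    · simpa using ((hasDerivAt_id t).smul_const (y - x)).const_add x
    · have := (hP.hasDerivAt ht).clm_apply (hasDerivAt_const t v)
      simpa using! this
  · simp [hP.zero]
  · rw [hP.segmentTransport_eq hB hΓ hx hy]

/-- The holonomy group of the connection on `B` with Christoffel symbols `Γ`. -/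
def coordHolonomy (Γ : F → F →L[ℝ] F →L[ℝ] F) (B : Set F) (o : F) : Set (F →L[ℝ] F) :=
  {A | IsUnit A ∧ ∃ c, IsTransportPath Γ B o o c A}

lemma isOperatorGroup_coordHolonomy (hB : Convex ℝ B) (hΓ : ContinuousOn Γ B) {o : F}
    (ho : o ∈ B) : IsOperatorGroup (coordHolonomy Γ B o) where
  one_mem := by
    have := isTransportPath_segment hB hΓ ho ho
    rw [segmentTransport_self hB hΓ ho] at this
    exact ⟨isUnit_one, _, this⟩
  mul_mem := by
    rintro g h ⟨hg, c, hc⟩ ⟨hh, c', hc'⟩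
    exact ⟨hg.mul hh, _, hc'.concat hc⟩
  exists_inv := by
    rintro h ⟨⟨u, rfl⟩, c, hc⟩
    exact ⟨_, ⟨⟨u⁻¹, rfl⟩, _, hc.reverse u.mul_inv⟩, u.mul_inv, u.inv_mul⟩

end TransportPath

/-! ### Local holonomy, restricted holonomy and the holonomy algebra -/

section HolonomyBridge

variable {E : Type*} [NormedAddCommGroup E] [NormedSpace ℝ E]
  {M : Type*} [TopologicalSpace M] [ChartedSpace E M] [IsManifold 𝓘(ℝ, E) ∞ M]
  {F : Type*} [NormedAddCommGroup F] [NormedSpace ℝ F] [FiniteDimensional ℝ F]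
  {Φ : OpenPartialHomeomorph M F}
  {cov : CovariantDerivative 𝓘(ℝ, E) E (TangentSpace 𝓘(ℝ, E) : M → Type _)}

lemma restrictedHolonomy_mono {U U' : Set M} (h : U ⊆ U') (o : M) :
    restrictedHolonomy cov U o ⊆ restrictedHolonomy cov U' o := by
  rintro L ⟨c, hc, ⟨H, hH, hHU, hH0⟩, hL⟩
  exact ⟨c, hc.subset h, ⟨H, hH, fun s hs t ht => h (hHU s hs t ht), hH0⟩, hL⟩

lemma restrictedHolonomy_subset {U : Set M} (o : M) :
    restrictedHolonomy cov U o ⊆ holonomy cov U o := by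
  rintro L ⟨c, hc, -, hL⟩
  exact ⟨c, hc, hL⟩

/-- In a chart with convex image every loop contracts, so local holonomy is automatically restricted
holonomy. -/
lemma IsSmoothChart.mem_restrictedHolonomy (hΦ : IsSmoothChart (E := E) Φ)
    (hconv : Convex ℝ Φ.target) {o : M} (ho : o ∈ Φ.source) {A : F →L[ℝ] F}
    (hA : A ∈ coordHolonomy (christoffel cov Φ) Φ.target (Φ o))
    {L : TangentSpace 𝓘(ℝ, E) o ≃ₗ[ℝ] TangentSpace 𝓘(ℝ, E) o}
    (hL : ∀ v : TangentSpace 𝓘(ℝ, E) o, dchart (E := E) Φ o (L v) = A (dchart (E := E) Φ o v)) :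
    L ∈ restrictedHolonomy cov Φ.source o := by
  obtain ⟨-, c, hc⟩ := hA
  have hp := hΦ.isPathIn_symm subset_rfl hc.path
  rw [Φ.left_inv ho, Φ.symm_image_target_eq_source] at hp
  -- The contraction moves each point of the loop to the base point along a straight line; it is
  -- fixed where the loop is at the base point.
  refine ⟨_, hp, ⟨fun p => Φ.symm (c p.2 + p.1 • (Φ o - c p.2)), ?_, ?_, ?_, ?_⟩, fun v => ?_⟩
  · have hcc := hc.path.continuousOn
    refine Φ.continuousOn_symm.comp ?_ ?_
    · have : ContinuousOn (fun p : ℝ × ℝ => c p.2) (Icc 0 1 ×ˢ Icc 0 1) :=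
        hcc.comp continuousOn_snd fun p hp => hp.2
      exact this.add (continuousOn_fst.smul (continuousOn_const.sub this))
    · rintro ⟨s, t⟩ ⟨hs, ht⟩
      exact segment_mem hconv (hc.path.mem t ht) (Φ.map_source ho) hs
  · intro s hs t ht
    exact Φ.map_target (segment_mem hconv (hc.path.mem t ht) (Φ.map_source ho) hs)
  · intro t _
    simp [Φ.left_inv ho]
  · intro s _
    simp [hc.path.source, hc.path.target, Φ.left_inv ho]
  · obtain ⟨ξ, hξ, hξ0, hξ1⟩ := hc.transport (dchart (E := E) Φ o (v : E))
    refine hΦ.transports_of_parallel (ξ := ξ) zero_le_one hp.continuousOn hp.mem ?_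
      hp.source.symm hp.target.symm hξ0.symm ?_
    · exact hξ.congr (fun t ht => Φ.right_inv (hc.path.mem t ht)) fun _ _ => rfl
    · rw [hξ1]; exact hL v

/-- Conjugation by the differential of the chart at `o` turns a holonomy transformation into an
operator on the model space. -/
lemma IsSmoothChart.coordHolonomy_of_mem (hΦ : IsSmoothChart (E := E) Φ) {o : M}
    (ho : o ∈ Φ.source)
    {L : TangentSpace 𝓘(ℝ, E) o ≃ₗ[ℝ] TangentSpace 𝓘(ℝ, E) o}
    (hL : L ∈ holonomy cov Φ.source o) :
    ∃ A ∈ coordHolonomy (christoffel cov Φ) Φ.target (Φ o),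
      ∀ v : TangentSpace 𝓘(ℝ, E) o, dchart (E := E) Φ o (L v) = A (dchart (E := E) Φ o v) := by
  obtain ⟨c, hc, hcL⟩ := hL
  let e : E ≃ₗ[ℝ] F := (hΦ.tangentEquiv ho).toLinearEquiv
  let L' : E ≃ₗ[ℝ] E := L
  let A : F ≃ₗ[ℝ] F := (e.symm.trans L').trans e
  have he : ∀ v : E, e v = dchart (E := E) Φ o v := fun _ => rfl
  have hp := hΦ.isPathIn subset_rfl hc
  rw [Φ.image_source_eq_target] at hp
  refine ⟨LinearMap.toContinuousLinearMap A, ⟨?_, _, hp, fun v => ?_⟩, fun v => ?_⟩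
  · refine ⟨⟨LinearMap.toContinuousLinearMap A, LinearMap.toContinuousLinearMap A.symm, ?_, ?_⟩, rfl⟩
    · ext v; exact A.apply_symm_apply v
    · ext v; exact A.symm_apply_apply v
  · obtain ⟨-, -, ξ, hξ, hξ0, hξ1⟩ := hΦ.parallel_of_transports zero_le_one hc.mem (hcL (e.symm v))
    refine ⟨ξ, hξ, ?_, ?_⟩
    · rw [hξ0]; exact e.apply_symm_apply v
    · rw [hξ1]; rfl
  · exact congrArg (fun w : E => e (L' w)) (e.symm_apply_apply (v : E)).symm

/-- The exponentials of a velocity stay in the local holonomy group, which consists of restricted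
holonomy transformations. The assumptions on the holonomy algebra enter the local computations
through this membership. -/
lemma IsSmoothChart.mem_holonomyAlgebra [FiniteDimensional ℝ E] (hΦ : IsSmoothChart (E := E) Φ)
    (hconv : Convex ℝ Φ.target) (hΓ : ContinuousOn (christoffel cov Φ) Φ.target) {o : M}
    (ho : o ∈ Φ.source) {A : F →L[ℝ] F}
    (hA : IsVelocity (coordHolonomy (christoffel cov Φ) Φ.target (Φ o)) A) :
    ((hΦ.tangentEquiv ho).symm.conjContinuousAlgEquiv A : E →L[ℝ] E) ∈ holonomyAlgebra cov o := by
  intro t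
  have hG := isOperatorGroup_coordHolonomy hconv hΓ (Φ.map_source ho)
  have hexp := exp_smul_mem hG hA t
  set e := hΦ.tangentEquiv ho
  have h1 : e.symm.conjContinuousAlgEquiv (NormedSpace.exp (t • A)) =
      NormedSpace.exp (t • e.symm.conjContinuousAlgEquiv A) := by
    rw [← map_smul]
    let : NormedAlgebra ℚ (F →L[ℝ] F) := NormedAlgebra.restrictScalars ℚ ℝ _
    let : NormedAlgebra ℚ (E →L[ℝ] E) := NormedAlgebra.restrictScalars ℚ ℝ _
    exact NormedSpace.map_exp _ (ContinuousAlgEquiv.continuous _) _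
  obtain ⟨u, hu⟩ := hG.isUnit hexp
  let L : E ≃ₗ[ℝ] E := LinearEquiv.ofLinearMap
    (e.symm.conjContinuousAlgEquiv (u : F →L[ℝ] F) : E →L[ℝ] E)
    (e.symm.conjContinuousAlgEquiv ((u⁻¹ : (F →L[ℝ] F)ˣ) : F →L[ℝ] F) : E →L[ℝ] E)
    (by
      ext v
      show e.symm (u.1 (e (e.symm ((u⁻¹).1 (e v))))) = v
      rw [e.apply_symm_apply]
      have := congrArg (fun T : F →L[ℝ] F => T (e v)) u.mul_inv
      exact (congrArg e.symm this).trans (e.symm_apply_apply v))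
    (by
      ext v
      show e.symm ((u⁻¹).1 (e (e.symm (u.1 (e v))))) = v
      rw [e.apply_symm_apply]
      have := congrArg (fun T : F →L[ℝ] F => T (e v)) u.inv_mul
      exact (congrArg e.symm this).trans (e.symm_apply_apply v))
  refine ⟨L, restrictedHolonomy_mono (subset_univ _) o
    (hΦ.mem_restrictedHolonomy hconv ho hexp fun v => ?_), fun v => ?_⟩
  · show e (e.symm (u.1 (e v))) = _
    rw [e.apply_symm_apply, hu]
    rfl
  · show (e.symm.conjContinuousAlgEquiv u.1) v = _
    rw [hu, h1]

end HolonomyBridge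

/-! ### Flatness of the leaves of two complementary parallel distributions -/

section Biparallel

variable {F : Type*} [NormedAddCommGroup F] [NormedSpace ℝ F] [FiniteDimensional ℝ F]
  {Γ : F → F →L[ℝ] F →L[ℝ] F} {B : Set F} {W W' : Submodule ℝ F}

/-- A projection with kernel `W` turns membership in `W` into an equation, to which uniqueness and
differentiation apply. -/
lemma exists_projection_along (W : Submodule ℝ F) :
    ∃ q : F →L[ℝ] F, (∀ w, q w = 0 ↔ w ∈ W) ∧ ∀ w, w - q w ∈ W := by
  obtain ⟨W', hW'⟩ := W.exists_isCompl
  refine ⟨LinearMap.toContinuousLinearMap (W'.subtype ∘ₗ W'.projectionOnto W hW'.symm),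
    fun w => ?_, fun w => ?_⟩
  · show ((W'.projectionOnto W hW'.symm w : W') : F) = 0 ↔ w ∈ W
    rw [ZeroMemClass.coe_eq_zero]
    exact Submodule.projectionOnto_apply_eq_zero_iff hW'.symm
  · rw [← Submodule.projectionOnto_apply_eq_zero_iff hW'.symm, map_sub, sub_eq_zero]
    exact (Submodule.projectionOnto_apply_left hW'.symm _).symm

/-- Parallel transport preserves a submodule which is preserved by the Christoffel symbols. -/
lemma IsParallelCurve.mem_submodule (hΓ : ContinuousOn Γ B)
    (hW : ∀ y ∈ B, ∀ u, ∀ w ∈ W, Γ y u w ∈ W) {c ξ : ℝ → F} {a b : ℝ} (hab : a ≤ b)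
    (hc : PiecewiseC1On (E := F) c a b) (hcB : ∀ t ∈ Icc a b, c t ∈ B)
    (hξ : IsParallelCurve Γ c ξ a b) (h0 : ξ a ∈ W) : ξ b ∈ W := by
  obtain ⟨q, hq, hq'⟩ := exists_projection_along W
  -- Since `Γ` preserves `W`, the component q ξ transversal to `W` satisfies a linear equation of
  -- its own, with coefficient q ∘ Γ; it vanishes if it starts at 0.
  let Γ' : F → F →L[ℝ] F →L[ℝ] F := fun y => (ContinuousLinearMap.compL ℝ F F F q) ∘L Γ y
  have hΓ' : ContinuousOn Γ' B := continuousOn_const.clm_comp hΓ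
  have h1 : IsParallelCurve Γ' c (fun t => q (ξ t)) a b := by
    refine ⟨q.continuous.comp_continuousOn hξ.1, hξ.2.subset ?_⟩
    rintro t ⟨ht, hn⟩
    refine ⟨ht, fun ⟨c', hc', hd⟩ => hn ⟨c', hc', ?_⟩⟩
    refine (q.hasFDerivAt.comp_hasDerivAt t hd).congr_deriv ?_
    show q (-(Γ (c t) c' (ξ t))) = -(q (Γ (c t) c' (q (ξ t))))
    have := (hq _).2 (hW _ (hcB t (Ioo_subset_Icc_self ht)) c' _ (hq' (ξ t)))
    rw [map_sub, map_sub, sub_eq_zero] at this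
    rw [map_neg, this]
  have h2 : IsParallelCurve Γ' c (fun _ => 0) a b := by
    refine ⟨continuousOn_const, hc.finite_not_hasDerivAt.subset ?_⟩
    rintro t ⟨ht, hn⟩
    refine ⟨ht, fun ⟨c', hc'⟩ => hn ⟨c', hc', ?_⟩⟩
    simpa using hasDerivAt_const t (0 : F)
  exact (hq _).1 (h1.eq hΓ' hab hc hcB h2 ((hq _).2 h0))

lemma segmentTransport_mem_submodule (hB : Convex ℝ B) (hΓ : ContinuousOn Γ B)
    (hW : ∀ y ∈ B, ∀ u, ∀ w ∈ W, Γ y u w ∈ W) {x y : F} (hx : x ∈ B) (hy : y ∈ B) {w : F}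
    (hw : w ∈ W) : segmentTransport Γ x y w ∈ W := by
  have h := isTransportPath_segment hB hΓ hx hy
  obtain ⟨ξ, hξ, hξ0, hξ1⟩ := h.transport w
  rw [← hξ1]
  exact hξ.mem_submodule hΓ hW zero_le_one h.path.piecewise h.path.mem (hξ0 ▸ hw)

lemma segmentTransport_apply_symm (hB : Convex ℝ B) (hΓ : ContinuousOn Γ B) {x y : F}
    (hx : x ∈ B) (hy : y ∈ B) (v : F) :
    segmentTransport Γ y x (segmentTransport Γ x y v) = v :=
  congrArg (fun T : F →L[ℝ] F => T v) (segmentTransport_mul_symm hB hΓ hx hy)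

lemma isUnit_segmentTransport (hB : Convex ℝ B) (hΓ : ContinuousOn Γ B) {x y : F}
    (hx : x ∈ B) (hy : y ∈ B) : IsUnit (segmentTransport Γ x y) :=
  ⟨⟨_, _, segmentTransport_mul_symm hB hΓ hy hx, segmentTransport_mul_symm hB hΓ hx hy⟩, rfl⟩

lemma segmentTransport_eq_of_parallel (hB : Convex ℝ B) (hΓ : ContinuousOn Γ B) {x y : F}
    (hx : x ∈ B) (hy : y ∈ B) {ξ : ℝ → F}
    (hξ : IsParallelCurve Γ (fun t : ℝ => x + t • (y - x)) ξ 0 1) :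
    segmentTransport Γ x y (ξ 0) = ξ 1 :=
  ((isTransportPath_segment hB hΓ hx hy).unique hΓ hξ).symm

section Derivative

variable (hBo : IsOpen B) (hB : Convex ℝ B) (hΓ : ContDiffOn ℝ ∞ Γ B)
include hBo hB hΓ

lemma contDiffAt_segmentTransport {x y : F} (hx : x ∈ B) (hy : y ∈ B) :
    ContDiffAt ℝ ∞ (fun p : F × F => segmentTransport Γ p.1 p.2) (x, y) :=
  (contDiffOn_segmentTransport hBo hB hΓ).contDiffAt ((hBo.prod hBo).mem_nhds ⟨hx, hy⟩)

lemma differentiableAt_segmentTransport_right {x y : F} (hx : x ∈ B) (hy : y ∈ B) :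
    DifferentiableAt ℝ (segmentTransport Γ x) y :=
  (ContDiffAt.comp (g := fun p : F × F => segmentTransport Γ p.1 p.2) y
    (contDiffAt_segmentTransport hBo hB hΓ hx hy)
    (contDiffAt_const.prodMk contDiffAt_id)).differentiableAt (by simp)

/-- Along the segment towards x + v this is the defining equation at time 0; by linearity it is
enough to have it for a nonzero multiple of v small enough to stay in `B`. -/
lemma fderiv_segmentTransport_self {x : F} (hx : x ∈ B) (v : F) :
    fderiv ℝ (segmentTransport Γ x) x v = -Γ x v := by
  have hsmall : ∀ v, x + v ∈ B → fderiv ℝ (segmentTransport Γ x) x v = -Γ x v := by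
    intro v hv
    have hd := (differentiableAt_segmentTransport_right hBo hB hΓ hx hx).hasFDerivAt
    have hline : HasDerivAt (fun t : ℝ => x + t • v) v 0 := by
      simpa using ((hasDerivAt_id (0 : ℝ)).smul_const v).const_add x
    have h1 : HasDerivAt (fun t : ℝ => segmentTransport Γ x (x + t • v))
        (fderiv ℝ (segmentTransport Γ x) x v) 0 :=
      HasFDerivAt.comp_hasDerivAt (l := segmentTransport Γ x) (f := fun t : ℝ => x + t • v) 0
        (by simpa using! hd) hline
    obtain ⟨P, hP⟩ := exists_isSegmentFrame hB hΓ.continuousOn hx hv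
    have h2 := hP.deriv 0 ⟨le_rfl, zero_le_one⟩
    have h3 : ∀ t ∈ Icc (0 : ℝ) 1, segmentTransport Γ x (x + t • v) = P t := by
      intro t ht
      have h4 := hP.scale ht
      have e : x + t • (x + v - x) = x + t • v := by congr 2; abel
      rw [e] at h4
      rw [h4.segmentTransport_eq hB hΓ.continuousOn hx (by rw [← e]; exact segment_mem hB hx hv ht),
        one_mul]
    have h5 := h2.congr h3 (h3 0 ⟨le_rfl, zero_le_one⟩)
    rw [(uniqueDiffOn_Icc_zero_one 0 ⟨le_rfl, zero_le_one⟩).eq_deriv _ h1.hasDerivWithinAt h5,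
      hP.zero]
    have e : x + v - x = v := by abel
    rw [e, zero_smul, add_zero]
    rfl
  obtain ⟨ε, hε, hεB⟩ := Metric.isOpen_iff.1 hBo x hx
  have hk : ∃ k : ℝ, k ≠ 0 ∧ x + k • v ∈ B := by
    refine ⟨ε / 2 / (‖v‖ + 1), by positivity, hεB ?_⟩
    rw [mem_ball_iff_norm, add_sub_cancel_left, norm_smul, Real.norm_of_nonneg (by positivity)]
    have : ε / 2 / (‖v‖ + 1) * ‖v‖ ≤ ε / 2 := by
      rw [div_mul_eq_mul_div, div_le_iff₀ (by positivity)]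
      nlinarith [norm_nonneg v]
    linarith
  obtain ⟨k, hk0, hkB⟩ := hk
  have h := hsmall _ hkB
  rw [map_smul, map_smul, ← smul_neg] at h
  exact smul_right_injective _ hk0 h

end Derivative

/-- The transport along the loop which runs from `o` to `b`, around the triangle `b`, `x`, `y`, and
back. -/
def triangleTransport (Γ : F → F →L[ℝ] F →L[ℝ] F) (o b x y : F) : F →L[ℝ] F :=
  segmentTransport Γ b o * (segmentTransport Γ y b * segmentTransport Γ x y *
    segmentTransport Γ b x) * segmentTransport Γ o b

lemma triangleTransport_mem (hB : Convex ℝ B) (hΓ : ContinuousOn Γ B) {o b x y : F} (ho : o ∈ B)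
    (hb : b ∈ B) (hx : x ∈ B) (hy : y ∈ B) :
    triangleTransport Γ o b x y ∈ coordHolonomy Γ B o := by
  refine ⟨?_, _, (isTransportPath_segment hB hΓ ho hb).concat
    ((((isTransportPath_segment hB hΓ hb hx).concat (isTransportPath_segment hB hΓ hx hy)).concat
    (isTransportPath_segment hB hΓ hy hb)).concat (isTransportPath_segment hB hΓ hb ho))⟩
  exact (isUnit_segmentTransport hB hΓ hb ho).mul
    (((isUnit_segmentTransport hB hΓ hy hb).mul (isUnit_segmentTransport hB hΓ hx hy)).mul
      (isUnit_segmentTransport hB hΓ hb hx)) |>.mul (isUnit_segmentTransport hB hΓ ho hb)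

/-- The velocity of a shrinking triangle measures the failure of `segmentTransport Γ b` to be
parallel. -/
lemma exists_velocity_triangle (hBo : IsOpen B) (hB : Convex ℝ B) (hΓ : ContDiffOn ℝ ∞ Γ B)
    {o b x : F} (ho : o ∈ B) (hb : b ∈ B) (hx : x ∈ B) (v : F) :
    ∃ A, IsVelocity (coordHolonomy Γ B o) A ∧
      HasDerivAt (fun s : ℝ => triangleTransport Γ o b x (x + s • v)) A 0 ∧
      fderiv ℝ (segmentTransport Γ b) x v + Γ x v * segmentTransport Γ b x =
        -(segmentTransport Γ b x * segmentTransport Γ o b * A * segmentTransport Γ b o) := by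
  have hΓc := hΓ.continuousOn
  have hlinec : ContDiff ℝ ∞ (fun s : ℝ => x + s • v) := by fun_prop
  have hline0 : x + (0 : ℝ) • v = x := by simp
  have hev : ∀ᶠ s : ℝ in 𝓝 0, x + s • v ∈ B :=
    hlinec.continuous.continuousAt.eventually (hBo.mem_nhds (by simpa using hx))
  have hline : HasDerivAt (fun t : ℝ => x + t • v) v 0 := by
    simpa using ((hasDerivAt_id (0 : ℝ)).smul_const v).const_add x
  have hN : ContDiffAt ℝ ∞ (fun s : ℝ => segmentTransport Γ (x + s • v) b) 0 :=
    ContDiffAt.comp (g := fun p : F × F => segmentTransport Γ p.1 p.2)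
      (f := fun s : ℝ => (x + s • v, b)) 0
      (by simpa only [hline0] using contDiffAt_segmentTransport hBo hB hΓ hx hb)
      (hlinec.contDiffAt.prodMk contDiffAt_const)
  have hK : ContDiffAt ℝ ∞ (fun s : ℝ => segmentTransport Γ x (x + s • v)) 0 :=
    ContDiffAt.comp (g := fun p : F × F => segmentTransport Γ p.1 p.2)
      (f := fun s : ℝ => (x, x + s • v)) 0
      (by simpa only [hline0] using contDiffAt_segmentTransport hBo hB hΓ hx hx)
      (contDiffAt_const.prodMk hlinec.contDiffAt)
  have hc : ContDiffAt ℝ ∞ (fun s : ℝ => triangleTransport Γ o b x (x + s • v)) 0 :=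
    (contDiffAt_const.clm_comp ((hN.clm_comp hK).clm_comp contDiffAt_const)).clm_comp
      contDiffAt_const
  obtain ⟨A, hA⟩ : ∃ A, HasDerivAt (fun s : ℝ => triangleTransport Γ o b x (x + s • v)) A 0 :=
    ⟨_, (hc.differentiableAt (by simp)).hasDerivAt⟩
  -- At s = 0 the triangle degenerates to a path run forth and back.
  have hc0 : triangleTransport Γ o b x (x + (0 : ℝ) • v) = 1 := by
    rw [hline0, triangleTransport, segmentTransport_self hB hΓc hx, mul_one,
      segmentTransport_mul_symm hB hΓc hb hx, mul_one, segmentTransport_mul_symm hB hΓc ho hb]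
  refine ⟨A, ⟨_, hc.of_le (by norm_cast), ?_, hc0, hA⟩, hA, ?_⟩
  · filter_upwards [hev] with s hs using triangleTransport_mem hB hΓc ho hb hx hs
  have hG : HasDerivAt (fun s : ℝ => segmentTransport Γ b (x + s • v))
      (fderiv ℝ (segmentTransport Γ b) x v) 0 :=
    HasFDerivAt.comp_hasDerivAt (l := segmentTransport Γ b) (f := fun t : ℝ => x + t • v) 0
      (by simpa using! (differentiableAt_segmentTransport_right hBo hB hΓ hb hx).hasFDerivAt) hline
  have hK' : HasDerivAt (fun s : ℝ => segmentTransport Γ x (x + s • v)) (-Γ x v) 0 := by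
    rw [← fderiv_segmentTransport_self hBo hB hΓ hx v]
    exact HasFDerivAt.comp_hasDerivAt (l := segmentTransport Γ x) (f := fun t : ℝ => x + t • v) 0
      (by simpa using! (differentiableAt_segmentTransport_right hBo hB hΓ hx hx).hasFDerivAt) hline
  have h1 : HasDerivAt (fun s : ℝ => segmentTransport Γ b (x + s • v) * segmentTransport Γ o b *
      triangleTransport Γ o b x (x + s • v)) _ 0 :=
    (hG.clm_comp (hasDerivAt_const (0 : ℝ) (segmentTransport Γ o b))).clm_comp hA
  have h2 : HasDerivAt (fun s : ℝ => segmentTransport Γ x (x + s • v) * segmentTransport Γ b x *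
      segmentTransport Γ o b) _ 0 :=
    (hK'.clm_comp (hasDerivAt_const (0 : ℝ) (segmentTransport Γ b x))).clm_comp
      (hasDerivAt_const (0 : ℝ) (segmentTransport Γ o b))
  -- Closing the triangle and then going directly to x + s v is the same as going through x. Both
  -- sides are differentiated at s = 0; the right side contributes the connection form.
  have h3 : (fun s : ℝ => segmentTransport Γ b (x + s • v) * segmentTransport Γ o b *
      triangleTransport Γ o b x (x + s • v)) =ᶠ[𝓝 0] (fun s : ℝ => segmentTransport Γ x (x + s • v) *
        segmentTransport Γ b x * segmentTransport Γ o b) := by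
    filter_upwards [hev] with s hs
    have e1 := segmentTransport_mul_symm hB hΓc hb ho
    have e2 := segmentTransport_mul_symm hB hΓc hs hb
    simp only [triangleTransport, mul_assoc]
    rw [← mul_assoc (segmentTransport Γ o b) (segmentTransport Γ b o), e1, one_mul,
      ← mul_assoc (segmentTransport Γ b _) (segmentTransport Γ _ b), e2, one_mul]
  have h4 := (h1.congr_of_eventuallyEq h3.symm).unique h2
  rw [hc0] at h4
  simp only [ContinuousLinearMap.comp_zero, add_zero, hline0] at h4
  have h5 : fderiv ℝ (segmentTransport Γ b) x v * segmentTransport Γ o b * 1 +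
      segmentTransport Γ b x * segmentTransport Γ o b * A =
      -Γ x v * segmentTransport Γ b x * segmentTransport Γ o b := by
    simpa using! h4
  have e1 := segmentTransport_mul_symm hB hΓc hb ho
  have h6 := congrArg (· * segmentTransport Γ b o) h5
  simp only [add_mul, mul_one, mul_assoc, e1] at h6
  rw [eq_neg_iff_add_eq_zero, mul_assoc, mul_assoc]
  have h7 := eq_sub_of_add_eq h6
  rw [h7, neg_mul]
  abel

/-- Two complementary parallel distributions on `B`, with constant tangent spaces `W` and `W'`, on
each of which the holonomy algebra acts faithfully. -/
structure IsBiparallel (Γ : F → F →L[ℝ] F →L[ℝ] F) (B : Set F) (o : F) (W W' : Submodule ℝ F) :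
    Prop where
  isOpen : IsOpen B
  convex : Convex ℝ B
  mem : o ∈ B
  smooth : ContDiffOn ℝ ∞ Γ B
  torsion : ∀ y ∈ B, ∀ u w, Γ y u w = Γ y w u
  disjoint : Disjoint W W'
  invariant : ∀ y ∈ B, ∀ u, ∀ w ∈ W, Γ y u w ∈ W
  invariant' : ∀ y ∈ B, ∀ u, ∀ w ∈ W', Γ y u w ∈ W'
  faithful : ∀ A, IsVelocity (coordHolonomy Γ B o) A → (∀ w ∈ W, A w = 0) → A = 0
  faithful' : ∀ A, IsVelocity (coordHolonomy Γ B o) A → (∀ w ∈ W', A w = 0) → A = 0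

namespace IsBiparallel

variable {o : F}

lemma swap (h : IsBiparallel Γ B o W W') : IsBiparallel Γ B o W' W :=
  ⟨h.isOpen, h.convex, h.mem, h.smooth, h.torsion, h.disjoint.symm, h.invariant', h.invariant,
    h.faithful', h.faithful⟩

variable (h : IsBiparallel Γ B o W W')
include h

lemma continuousOn : ContinuousOn Γ B := h.smooth.continuousOn

/-- By symmetry of the Christoffel symbols the value lies in both invariant subspaces. This is where
vanishing torsion links the two distributions. -/
lemma mixed_eq_zero {y : F} (hy : y ∈ B) {u w : F} (hu : u ∈ W) (hw : w ∈ W') : Γ y u w = 0 := by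
  refine (Submodule.disjoint_def.1 h.disjoint) _ ?_ (h.invariant' y hy u w hw)
  rw [h.torsion y hy]
  exact h.invariant y hy w u hu

/-- Mixed Christoffel symbols vanish, so a constant field in `W'` is parallel along a segment in
direction `W`. -/
lemma segmentTransport_transversal {x y : F} (hx : x ∈ B) (hy : y ∈ B) (hxy : y - x ∈ W) {w : F}
    (hw : w ∈ W') : segmentTransport Γ x y w = w := by
  refine segmentTransport_eq_of_parallel h.convex h.continuousOn hx hy (ξ := fun _ => w)
    ⟨continuousOn_const, finite_empty.subset ?_⟩
  rintro t ⟨ht, hn⟩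
  refine hn ⟨y - x, ?_, ?_⟩
  · simpa using ((hasDerivAt_id t).smul_const (y - x)).const_add x
  · rw [h.mixed_eq_zero (segment_mem h.convex hx hy (Ioo_subset_Icc_self ht)) hxy hw, neg_zero]
    exact hasDerivAt_const t w

/-- The leaves are flat. -/
lemma fderiv_segmentTransport {b x : F} (hb : b ∈ B) (hx : x ∈ B) (hbx : x - b ∈ W) {v : F}
    (hv : v ∈ W) : fderiv ℝ (segmentTransport Γ b) x v + Γ x v ∘L segmentTransport Γ b x = 0 := by
  obtain ⟨A, hA, hAd, hA'⟩ := exists_velocity_triangle h.isOpen h.convex h.smooth h.mem hb hx v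
  -- All sides of the triangle lie in one leaf of `W`, hence fix `W'`. The legs between `o` and `b`
  -- are arbitrary but cancel, so the velocity kills `W'` and faithfulness on `W'` makes it zero.
  have hA0 : A = 0 := by
    refine h.faithful' A hA fun w hw => ?_
    have h1 := hAd.clm_apply (hasDerivAt_const (0 : ℝ) w)
    have hlinec : Continuous (fun s : ℝ => x + s • v) := by fun_prop
    have hev : ∀ᶠ s : ℝ in 𝓝 0, x + s • v ∈ B :=
      hlinec.continuousAt.eventually (h.isOpen.mem_nhds (by simpa using hx))
    have h2 : (fun s : ℝ => triangleTransport Γ o b x (x + s • v) w) =ᶠ[𝓝 0] fun _ => w := by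
      filter_upwards [hev] with s hs
      have hw' := segmentTransport_mem_submodule h.convex h.continuousOn h.invariant' h.mem hb hw
      show segmentTransport Γ b o (segmentTransport Γ (x + s • v) b (segmentTransport Γ x
        (x + s • v) (segmentTransport Γ b x (segmentTransport Γ o b w)))) = w
      rw [h.segmentTransport_transversal hb hx hbx hw', h.segmentTransport_transversal hx hs
        (by simpa using W.smul_mem s hv) hw', h.segmentTransport_transversal hs hb ?_ hw',
        segmentTransport_apply_symm h.convex h.continuousOn h.mem hb]
      have : b - (x + s • v) = -((x - b) + s • v) := by abel
      rw [this]
      exact W.neg_mem (W.add_mem hbx (W.smul_mem s hv))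
    have h3 := h1.unique ((hasDerivAt_const (0 : ℝ) w).congr_of_eventuallyEq h2)
    simpa using h3
  rw [hA0] at hA'
  simpa using! hA'

/-- Transport along an arbitrary path in a leaf. -/
lemma isParallelCurve_leaf {c : ℝ → F} {a b : ℝ} (hab : a ≤ b)
    (hc : PiecewiseC1On (E := F) c a b) (hcB : ∀ t ∈ Icc a b, c t ∈ B)
    (hcW : ∀ t ∈ Icc a b, c t - c a ∈ W) (v : F) :
    IsParallelCurve Γ c (fun t => segmentTransport Γ (c a) (c t) v) a b := by
  have ha := hcB a ⟨le_rfl, hab⟩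
  refine isParallelCurve_frame h.isOpen (P := segmentTransport Γ (c a)) (W := W)
    (fun y hy => (differentiableAt_segmentTransport_right h.isOpen h.convex h.smooth ha
      hy).differentiableWithinAt) hc hcB ?_ ?_ v
  · rintro _ ⟨t, ht, rfl⟩ u hu
    exact h.fderiv_segmentTransport ha (hcB t ht) (hcW t ht) hu
  · refine finite_empty.subset ?_
    rintro t ⟨ht, hn⟩
    refine hn ?_
    -- Where the derivative fails to exist its default value 0 belongs to `W`, so no exceptional
    -- parameter arises here.
    by_cases hd : DifferentiableAt ℝ c t
    · obtain ⟨q, hq, -⟩ := exists_projection_along W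
      rw [← hq]
      have h1 := q.hasFDerivAt.comp_hasDerivAt t hd.hasDerivAt
      have h2 : (fun s => q (c s)) =ᶠ[𝓝 t] fun _ => q (c a) := by
        filter_upwards [Icc_mem_nhds ht.1 ht.2] with s hs
        have := (hq _).2 (hcW s hs)
        rwa [map_sub, sub_eq_zero] at this
      exact h1.unique ((hasDerivAt_const t _).congr_of_eventuallyEq h2)
    · rw [deriv_zero_of_not_differentiableAt hd]
      exact W.zero_mem

end IsBiparallel

end Biparallel

/-! ### Operator-valued parallel frames along a path -/

section Generation

variable {F : Type*} [NormedAddCommGroup F] [NormedSpace ℝ F] [FiniteDimensional ℝ F]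
  {Γ : F → F →L[ℝ] F →L[ℝ] F} {B : Set F}

lemma hasDerivAt_comp_line {Y : Type*} [NormedAddCommGroup Y] [NormedSpace ℝ Y] {f : F → Y}
    {y u : F} (hf : DifferentiableAt ℝ f y) :
    HasDerivAt (fun s : ℝ => f (y + s • u)) (fderiv ℝ f y u) 0 := by
  have hline : HasDerivAt (fun t : ℝ => y + t • u) u 0 := by
    simpa using ((hasDerivAt_id (0 : ℝ)).smul_const u).const_add y
  exact HasFDerivAt.comp_hasDerivAt (l := f) (f := fun t : ℝ => y + t • u) 0
    (by simpa using! hf.hasFDerivAt) hline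

/-- The transports of the basis vectors are assembled into one operator; finite dimension keeps the
union of the exceptional sets finite. -/
lemma IsTransportPath.exists_frame {x y : F} {c : ℝ → F} {A : F →L[ℝ] F}
    (h : IsTransportPath Γ B x y c A) : ∃ X : ℝ → F →L[ℝ] F, ContinuousOn X (Icc 0 1) ∧
      {t ∈ Ioo (0 : ℝ) 1 | ¬ ∃ c', HasDerivAt c c' t ∧ HasDerivAt X (-(Γ (c t) c' * X t)) t}.Finite ∧
      X 0 = 1 ∧ X 1 = A := by
  let b := Module.finBasis ℝ F
  let ψ : Fin (Module.finrank ℝ F) → F →L[ℝ] ℝ := fun i =>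
    LinearMap.toContinuousLinearMap (b.coord i)
  choose ξ hξ hξ0 hξ1 using fun i => h.transport (b i)
  let L : Fin (Module.finrank ℝ F) → F →L[ℝ] F →L[ℝ] F := fun i =>
    ContinuousLinearMap.smulRightL ℝ F F (ψ i)
  have hL : ∀ i w v, L i w v = b.repr v i • w := fun _ _ _ => rfl
  refine ⟨fun t => ∑ i, L i (ξ i t), ?_, ?_, ?_, ?_⟩
  · exact continuousOn_finsetSum _ fun i _ => (L i).continuous.comp_continuousOn (hξ i).1
  · refine ((finite_iUnion fun i => (hξ i).2).union h.path.piecewise.finite_not_hasDerivAt).subset ?_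
    rintro t ⟨ht, hn⟩
    by_contra hcon
    simp only [mem_union, mem_iUnion, mem_ofPred_eq, not_or, not_exists, not_and] at hcon
    obtain ⟨h1, h2⟩ := hcon
    obtain ⟨c', hc'⟩ := not_forall_not.1 (h2 ht)
    refine hn ⟨c', hc', ?_⟩
    have h3 : ∀ i, HasDerivAt (fun t => L i (ξ i t)) (L i (-(Γ (c t) c' (ξ i t)))) t := by
      intro i
      obtain ⟨c'', hc'', hd⟩ : ∃ c'', HasDerivAt c c'' t ∧
          HasDerivAt (ξ i) (-(Γ (c t) c'' (ξ i t))) t := by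
        by_contra hno
        exact h1 i ht fun c'' h h' => hno ⟨c'', h, h'⟩
      rw [hc''.unique hc'] at hd
      exact (L i).hasFDerivAt.comp_hasDerivAt t hd
    refine (HasDerivAt.fun_sum (u := Finset.univ) fun i _ => h3 i).congr_deriv ?_
    refine ContinuousLinearMap.ext fun v => ?_
    show _ = -(Γ (c t) c' ((∑ i, L i (ξ i t)) v))
    rw [sum_apply, sum_apply, map_sum, ← Finset.sum_neg_distrib]
    refine Finset.sum_congr rfl fun i _ => ?_
    rw [hL, hL, map_smul, smul_neg]
  · refine ContinuousLinearMap.ext fun v => ?_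
    rw [sum_apply]
    simp only [hL, hξ0, b.sum_repr]
    rfl
  · refine ContinuousLinearMap.ext fun v => ?_
    rw [sum_apply]
    simp only [hL, hξ1]
    conv_rhs => rw [← b.sum_repr v, map_sum]
    exact Finset.sum_congr rfl fun i _ => (map_smul _ _ _).symm

end Generation

/-! ### Transports around rectangles generate the local holonomy group -/

section Product

variable {X₁ X₂ : Type*} [NormedAddCommGroup X₁] [NormedSpace ℝ X₁] [FiniteDimensional ℝ X₁]
  [NormedAddCommGroup X₂] [NormedSpace ℝ X₂] [FiniteDimensional ℝ X₂]

/-- The first factor of a product, as a subspace. -/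
def factorOne (X₁ X₂ : Type*) [NormedAddCommGroup X₁] [NormedSpace ℝ X₁]
    [NormedAddCommGroup X₂] [NormedSpace ℝ X₂] : Submodule ℝ (X₁ × X₂) :=
  LinearMap.ker (LinearMap.snd ℝ X₁ X₂)

/-- The second factor of a product, as a subspace. -/
def factorTwo (X₁ X₂ : Type*) [NormedAddCommGroup X₁] [NormedSpace ℝ X₁]
    [NormedAddCommGroup X₂] [NormedSpace ℝ X₂] : Submodule ℝ (X₁ × X₂) :=
  LinearMap.ker (LinearMap.fst ℝ X₁ X₂)

lemma mem_factorOne {v : X₁ × X₂} : v ∈ factorOne X₁ X₂ ↔ v.2 = 0 := Iff.rfl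

lemma mem_factorTwo {v : X₁ × X₂} : v ∈ factorTwo X₁ X₂ ↔ v.1 = 0 := Iff.rfl

variable {Γ : X₁ × X₂ → X₁ × X₂ →L[ℝ] X₁ × X₂ →L[ℝ] X₁ × X₂} {B₁ : Set X₁} {B₂ : Set X₂}
  {o : X₁ × X₂}

/-- The transport from `o` to `y` via the corner `(y.1, o.2)`. -/
def lowerTransport (Γ : X₁ × X₂ → X₁ × X₂ →L[ℝ] X₁ × X₂ →L[ℝ] X₁ × X₂) (o y : X₁ × X₂) :
    X₁ × X₂ →L[ℝ] X₁ × X₂ :=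
  segmentTransport Γ (y.1, o.2) y * segmentTransport Γ o (y.1, o.2)

/-- The transport from `y` to `o` via the corner `(y.1, o.2)`. -/
def lowerTransportInv (Γ : X₁ × X₂ → X₁ × X₂ →L[ℝ] X₁ × X₂ →L[ℝ] X₁ × X₂) (o y : X₁ × X₂) :
    X₁ × X₂ →L[ℝ] X₁ × X₂ :=
  segmentTransport Γ (y.1, o.2) o * segmentTransport Γ y (y.1, o.2)

/-- The transport from `o` to `y` via the corner `(o.1, y.2)`. -/
def upperTransport (Γ : X₁ × X₂ → X₁ × X₂ →L[ℝ] X₁ × X₂ →L[ℝ] X₁ × X₂) (o y : X₁ × X₂) :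
    X₁ × X₂ →L[ℝ] X₁ × X₂ :=
  segmentTransport Γ (o.1, y.2) y * segmentTransport Γ o (o.1, y.2)

/-- The transport from `y` to `o` via the corner `(o.1, y.2)`. -/
def upperTransportInv (Γ : X₁ × X₂ → X₁ × X₂ →L[ℝ] X₁ × X₂ →L[ℝ] X₁ × X₂) (o y : X₁ × X₂) :
    X₁ × X₂ →L[ℝ] X₁ × X₂ :=
  segmentTransport Γ (o.1, y.2) o * segmentTransport Γ y (o.1, y.2)

/-- The transport around the rectangle with far corner `y`. -/
def rectangleTransport (Γ : X₁ × X₂ → X₁ × X₂ →L[ℝ] X₁ × X₂ →L[ℝ] X₁ × X₂) (o y : X₁ × X₂) :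
    X₁ × X₂ →L[ℝ] X₁ × X₂ :=
  upperTransportInv Γ o y * lowerTransport Γ o y

/-- The algebra of the gauge change: `Q` is the frame with derivative -GQ + UD, `Qi` its inverse and
`X` the parallel frame; the connection terms `G` cancel. -/
lemma conjugate_eq_of_mul_eq_one {R : Type*} [Ring R] {Q Qi G U D X : R} (h : Q * Qi = 1) :
    -(Qi * (-(G * Q) + U * D) * Qi) * X + Qi * -(G * X) = -(Qi * U * D) * (Qi * X) := by
  have h' : Qi * (G * X) = Qi * (G * (Q * (Qi * X))) := by rw [← mul_assoc Q, h, one_mul]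
  rw [mul_neg, h']
  noncomm_ring

namespace IsBiparallel

variable (h : IsBiparallel Γ (B₁ ×ˢ B₂) o (factorOne X₁ X₂) (factorTwo X₁ X₂))
include h

lemma corner_mem {y : X₁ × X₂} (hy : y ∈ B₁ ×ˢ B₂) : (y.1, o.2) ∈ B₁ ×ˢ B₂ := ⟨hy.1, h.mem.2⟩

lemma corner_mem' {y : X₁ × X₂} (hy : y ∈ B₁ ×ˢ B₂) : (o.1, y.2) ∈ B₁ ×ˢ B₂ := ⟨h.mem.1, hy.2⟩

lemma symm_mul {x y : X₁ × X₂} (hx : x ∈ B₁ ×ˢ B₂) (hy : y ∈ B₁ ×ˢ B₂) :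
    segmentTransport Γ y x * segmentTransport Γ x y = 1 :=
  segmentTransport_mul_symm h.convex h.continuousOn hx hy

lemma lowerTransport_mul_inv {y : X₁ × X₂} (hy : y ∈ B₁ ×ˢ B₂) :
    lowerTransport Γ o y * lowerTransportInv Γ o y = 1 := by
  rw [lowerTransport, lowerTransportInv, mul_assoc, ← mul_assoc (segmentTransport Γ o _),
    h.symm_mul (h.corner_mem hy) h.mem, one_mul, h.symm_mul hy (h.corner_mem hy)]

lemma lowerTransportInv_mul {y : X₁ × X₂} (hy : y ∈ B₁ ×ˢ B₂) :
    lowerTransportInv Γ o y * lowerTransport Γ o y = 1 := by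
  rw [lowerTransport, lowerTransportInv, mul_assoc, ← mul_assoc (segmentTransport Γ y _),
    h.symm_mul (h.corner_mem hy) hy, one_mul, h.symm_mul h.mem (h.corner_mem hy)]

lemma upperTransport_mul_inv {y : X₁ × X₂} (hy : y ∈ B₁ ×ˢ B₂) :
    upperTransport Γ o y * upperTransportInv Γ o y = 1 := by
  rw [upperTransport, upperTransportInv, mul_assoc, ← mul_assoc (segmentTransport Γ o _),
    h.symm_mul (h.corner_mem' hy) h.mem, one_mul, h.symm_mul hy (h.corner_mem' hy)]

lemma upperTransportInv_mul {y : X₁ × X₂} (hy : y ∈ B₁ ×ˢ B₂) :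
    upperTransportInv Γ o y * upperTransport Γ o y = 1 := by
  rw [upperTransport, upperTransportInv, mul_assoc, ← mul_assoc (segmentTransport Γ y _),
    h.symm_mul (h.corner_mem' hy) hy, one_mul, h.symm_mul h.mem (h.corner_mem' hy)]

lemma isUnit_rectangleTransport {y : X₁ × X₂} (hy : y ∈ B₁ ×ˢ B₂) :
    IsUnit (rectangleTransport Γ o y) :=
  IsUnit.mul ⟨⟨_, _, h.upperTransportInv_mul hy, h.upperTransport_mul_inv hy⟩, rfl⟩
    ⟨⟨_, _, h.lowerTransport_mul_inv hy, h.lowerTransportInv_mul hy⟩, rfl⟩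

lemma contDiffOn_comp_segmentTransport {f g : X₁ × X₂ → X₁ × X₂} (hf : ContDiff ℝ ∞ f)
    (hg : ContDiff ℝ ∞ g) (hfB : MapsTo f (B₁ ×ˢ B₂) (B₁ ×ˢ B₂))
    (hgB : MapsTo g (B₁ ×ˢ B₂) (B₁ ×ˢ B₂)) :
    ContDiffOn ℝ ∞ (fun y => segmentTransport Γ (f y) (g y)) (B₁ ×ˢ B₂) :=
  (contDiffOn_segmentTransport h.isOpen h.convex h.smooth).comp
    (hf.prodMk hg).contDiffOn fun _ hy => ⟨hfB hy, hgB hy⟩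

lemma contDiffOn_lowerTransport : ContDiffOn ℝ ∞ (lowerTransport Γ o) (B₁ ×ˢ B₂) :=
  (h.contDiffOn_comp_segmentTransport (by fun_prop) contDiff_id (fun _ hy => h.corner_mem hy)
    fun _ hy => hy).clm_comp (h.contDiffOn_comp_segmentTransport contDiff_const (by fun_prop)
    (fun _ _ => h.mem) fun _ hy => h.corner_mem hy)

lemma contDiffOn_lowerTransportInv : ContDiffOn ℝ ∞ (lowerTransportInv Γ o) (B₁ ×ˢ B₂) :=
  (h.contDiffOn_comp_segmentTransport (by fun_prop) contDiff_const (fun _ hy => h.corner_mem hy)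
    fun _ _ => h.mem).clm_comp (h.contDiffOn_comp_segmentTransport contDiff_id (by fun_prop)
    (fun _ hy => hy) fun _ hy => h.corner_mem hy)

lemma contDiffOn_upperTransport : ContDiffOn ℝ ∞ (upperTransport Γ o) (B₁ ×ˢ B₂) :=
  (h.contDiffOn_comp_segmentTransport (by fun_prop) contDiff_id (fun _ hy => h.corner_mem' hy)
    fun _ hy => hy).clm_comp (h.contDiffOn_comp_segmentTransport contDiff_const (by fun_prop)
    (fun _ _ => h.mem) fun _ hy => h.corner_mem' hy)

lemma contDiffOn_upperTransportInv : ContDiffOn ℝ ∞ (upperTransportInv Γ o) (B₁ ×ˢ B₂) :=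
  (h.contDiffOn_comp_segmentTransport (by fun_prop) contDiff_const (fun _ hy => h.corner_mem' hy)
    fun _ _ => h.mem).clm_comp (h.contDiffOn_comp_segmentTransport contDiff_id (by fun_prop)
    (fun _ hy => hy) fun _ hy => h.corner_mem' hy)

lemma contDiffOn_rectangleTransport : ContDiffOn ℝ ∞ (rectangleTransport Γ o) (B₁ ×ˢ B₂) :=
  h.contDiffOn_upperTransportInv.clm_comp h.contDiffOn_lowerTransport

/-- In the second direction only the last leg of the lower path varies, and it lies in a flat leaf
of the second factor. -/
lemma fderiv_lowerTransport_snd {y : X₁ × X₂} (hy : y ∈ B₁ ×ˢ B₂) (u : X₂) :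
    fderiv ℝ (lowerTransport Γ o) y (0, u) = -(Γ y (0, u) * lowerTransport Γ o y) := by
  have h1 := hasDerivAt_comp_line (u := ((0 : X₁), u))
    ((h.contDiffOn_lowerTransport.contDiffAt (h.isOpen.mem_nhds hy)).differentiableAt (by simp))
  have h2 := (hasDerivAt_comp_line (u := ((0 : X₁), u)) (differentiableAt_segmentTransport_right h.isOpen
    h.convex h.smooth (h.corner_mem hy) hy)).clm_comp
    (hasDerivAt_const (0 : ℝ) (segmentTransport Γ o (y.1, o.2)))
  have h3 : (fun s : ℝ => lowerTransport Γ o (y + s • ((0 : X₁), u))) =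
      fun s : ℝ => segmentTransport Γ (y.1, o.2) (y + s • ((0 : X₁), u)) ∘L
        segmentTransport Γ o (y.1, o.2) := by
    funext s
    simp only [lowerTransport, Prod.fst_add, Prod.smul_fst, smul_zero, add_zero]
    rfl
  rw [h3] at h1
  rw [h1.unique h2, ContinuousLinearMap.comp_zero, add_zero, eq_neg_of_add_eq_zero_left
    (h.swap.fderiv_segmentTransport (h.corner_mem hy) hy (by simp [mem_factorTwo])
      (by simp [mem_factorTwo]))]
  rfl

/-- In the first direction only the last leg of the upper path varies, and it lies in a flat leaf of
the first factor. -/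
lemma fderiv_upperTransport_fst {y : X₁ × X₂} (hy : y ∈ B₁ ×ˢ B₂) (u : X₁) :
    fderiv ℝ (upperTransport Γ o) y (u, 0) = -(Γ y (u, 0) * upperTransport Γ o y) := by
  have h1 := hasDerivAt_comp_line (u := (u, (0 : X₂)))
    ((h.contDiffOn_upperTransport.contDiffAt (h.isOpen.mem_nhds hy)).differentiableAt (by simp))
  have h2 := (hasDerivAt_comp_line (u := (u, (0 : X₂))) (differentiableAt_segmentTransport_right h.isOpen
    h.convex h.smooth (h.corner_mem' hy) hy)).clm_comp
    (hasDerivAt_const (0 : ℝ) (segmentTransport Γ o (o.1, y.2)))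
  have h3 : (fun s : ℝ => upperTransport Γ o (y + s • (u, (0 : X₂)))) =
      fun s : ℝ => segmentTransport Γ (o.1, y.2) (y + s • (u, (0 : X₂))) ∘L
        segmentTransport Γ o (o.1, y.2) := by
    funext s
    simp only [upperTransport, Prod.snd_add, Prod.smul_snd, smul_zero, add_zero]
    rfl
  rw [h3] at h1
  rw [h1.unique h2, ContinuousLinearMap.comp_zero, add_zero, eq_neg_of_add_eq_zero_left
    (h.fderiv_segmentTransport (h.corner_mem' hy) hy (by simp [mem_factorOne])
      (by simp [mem_factorOne]))]
  rfl

/-- The frame `lowerTransport` is parallel up to the derivative of `rectangleTransport`. -/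
lemma fderiv_lowerTransport {y : X₁ × X₂} (hy : y ∈ B₁ ×ˢ B₂) (u : X₁ × X₂) :
    fderiv ℝ (lowerTransport Γ o) y u = -(Γ y u * lowerTransport Γ o y) +
      upperTransport Γ o y * fderiv ℝ (rectangleTransport Γ o) y (u.1, 0) := by
  have hU := h.isOpen.mem_nhds hy
  have h1 := hasDerivAt_comp_line (u := (u.1, (0 : X₂)))
    ((h.contDiffOn_lowerTransport.contDiffAt hU).differentiableAt (by simp))
  have h2 := (hasDerivAt_comp_line (u := (u.1, (0 : X₂)))
    ((h.contDiffOn_upperTransport.contDiffAt hU).differentiableAt (by simp))).clm_comp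
    (hasDerivAt_comp_line (u := (u.1, (0 : X₂)))
      ((h.contDiffOn_rectangleTransport.contDiffAt hU).differentiableAt (by simp)))
  have hcont : Continuous fun s : ℝ => y + s • (u.1, (0 : X₂)) := by fun_prop
  -- The derivative in the first direction is computed from lower = upper ∘ rectangle, as the upper
  -- frame is parallel in that direction.
  have h3 : (fun s : ℝ => lowerTransport Γ o (y + s • (u.1, (0 : X₂)))) =ᶠ[𝓝 0]
      fun s : ℝ => upperTransport Γ o (y + s • (u.1, (0 : X₂))) ∘L
        rectangleTransport Γ o (y + s • (u.1, (0 : X₂))) := by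
    filter_upwards [hcont.continuousAt.eventually (h.isOpen.mem_nhds (by simpa using hy))] with s hs
    show _ = upperTransport Γ o _ * (upperTransportInv Γ o _ * lowerTransport Γ o _)
    rw [← mul_assoc, h.upperTransport_mul_inv hs, one_mul]
  have h4 := h1.unique (h2.congr_of_eventuallyEq h3)
  simp only [zero_smul, add_zero] at h4
  have e : u = (u.1, 0) + (0, u.2) := by simp
  have h5 : fderiv ℝ (lowerTransport Γ o) y u = fderiv ℝ (lowerTransport Γ o) y (u.1, 0) +
      fderiv ℝ (lowerTransport Γ o) y (0, u.2) := by rw [← map_add, ← e]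
  have h6 : Γ y u = Γ y (u.1, 0) + Γ y (0, u.2) := by rw [← map_add, ← e]
  have h7 : upperTransport Γ o y * rectangleTransport Γ o y = lowerTransport Γ o y := by
    rw [rectangleTransport, ← mul_assoc, h.upperTransport_mul_inv hy, one_mul]
  rw [h5, h4, h.fderiv_lowerTransport_snd hy, h.fderiv_upperTransport_fst hy, h6, add_mul]
  have h8 : (-(Γ y (u.1, 0) * upperTransport Γ o y)) ∘L rectangleTransport Γ o y =
      -(Γ y (u.1, 0) * lowerTransport Γ o y) := by
    rw [← h7]; rfl
  rw [h8, neg_add]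
  show _ + upperTransport Γ o y * _ + _ = _
  abel

/-- The holonomy group is generated by the transports around rectangles. -/
theorem coordHolonomy_subset {G : Set (X₁ × X₂ →L[ℝ] X₁ × X₂)} (hG : IsOperatorGroup G)
    (hτ : ∀ y ∈ B₁ ×ˢ B₂, rectangleTransport Γ o y ∈ G) :
    coordHolonomy Γ (B₁ ×ˢ B₂) o ⊆ G := by
  rintro A ⟨-, c, hc⟩
  obtain ⟨X, hX, hXf, hX0, hX1⟩ := hc.exists_frame
  let Q := lowerTransport Γ o
  let Qi := lowerTransportInv Γ o
  let τ := rectangleTransport Γ o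
  let τi := fun y => lowerTransportInv Γ o y * upperTransport Γ o y
  have hτi : ∀ y ∈ B₁ ×ˢ B₂, τi y * τ y = 1 := by
    intro y hy
    show lowerTransportInv Γ o y * upperTransport Γ o y *
      (upperTransportInv Γ o y * lowerTransport Γ o y) = 1
    rw [mul_assoc, ← mul_assoc (upperTransport Γ o y), h.upperTransport_mul_inv hy, one_mul,
      h.lowerTransportInv_mul hy]
  have hτi' : ∀ y ∈ B₁ ×ˢ B₂, τ y * τi y = 1 := by
    intro y hy
    show upperTransportInv Γ o y * lowerTransport Γ o y *
      (lowerTransportInv Γ o y * upperTransport Γ o y) = 1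
    rw [mul_assoc, ← mul_assoc (lowerTransport Γ o y), h.lowerTransport_mul_inv hy, one_mul,
      h.upperTransportInv_mul hy]
  have hτiG : ∀ y ∈ B₁ ×ˢ B₂, τi y ∈ G := by
    intro y hy
    obtain ⟨g, hg, h1, h2⟩ := hG.exists_inv (hτ y hy)
    have : τi y = g := by
      rw [← mul_one (τi y), ← h1, ← mul_assoc, hτi y hy, one_mul]
    rw [this]; exact hg
  -- Moving the far corner along a line gives a smooth curve in `G`; translating its derivative to
  -- the identity gives a velocity.
  have hvel : ∀ y ∈ B₁ ×ˢ B₂, ∀ u, IsVelocity G (τi y * fderiv ℝ τ y u) := by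
    intro y hy u
    have hU := h.isOpen.mem_nhds hy
    have hcont : ContDiff ℝ ∞ fun s : ℝ => y + s • u := by fun_prop
    refine isVelocity_mul_left hG (c := fun s : ℝ => τ (y + s • u)) (t₀ := 0) ?_ ?_
      (hasDerivAt_comp_line ((h.contDiffOn_rectangleTransport.contDiffAt hU).differentiableAt (by simp)))
      (hτiG y hy) ?_
    · refine ContDiffAt.of_le ?_ (n := ∞) (by norm_cast)
      exact ContDiffAt.comp (g := τ) (f := fun s : ℝ => y + s • u) 0
        (by simpa using h.contDiffOn_rectangleTransport.contDiffAt hU) hcont.contDiffAt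
    · filter_upwards [hcont.continuous.continuousAt.eventually
        (h.isOpen.mem_nhds (by simpa using hy))] with s hs using hτ _ hs
    · simpa using hτi y hy
  have hQi : ∀ y ∈ B₁ ×ˢ B₂, ∀ u, fderiv ℝ Qi y u = -(Qi y * fderiv ℝ Q y u * Qi y) := by
    intro y hy u
    have hU := h.isOpen.mem_nhds hy
    have h1 := hasDerivAt_comp_line (u := u)
      ((h.contDiffOn_lowerTransport.contDiffAt hU).differentiableAt (by simp))
    have h2 := hasDerivAt_comp_line (u := u)
      ((h.contDiffOn_lowerTransportInv.contDiffAt hU).differentiableAt (by simp))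
    have hcont : Continuous fun s : ℝ => y + s • u := by fun_prop
    have h3 : (fun s : ℝ => Qi (y + s • u) ∘L Q (y + s • u)) =ᶠ[𝓝 0] fun _ => 1 := by
      filter_upwards [hcont.continuousAt.eventually (h.isOpen.mem_nhds (by simpa using hy))]
        with s hs using h.lowerTransportInv_mul hs
    have h4 := (h2.clm_comp h1).unique ((hasDerivAt_const (0 : ℝ) _).congr_of_eventuallyEq h3)
    simp only [zero_smul, add_zero] at h4
    have h5 : fderiv ℝ Qi y u * Q y + Qi y * fderiv ℝ Q y u = 0 := h4
    have h6 := congrArg (· * Qi y) h5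
    simp only [add_mul, zero_mul] at h6
    have h7 : fderiv ℝ Qi y u * Q y * Qi y = fderiv ℝ Qi y u := by
      rw [mul_assoc, h.lowerTransport_mul_inv hy, mul_one]
    rw [h7] at h6
    exact eq_neg_of_add_eq_zero_left h6
  -- At the base point the frame `Q` is the identity, so this gauge-transformed frame ends at the
  -- holonomy transformation itself.
  suffices hkey : Qi (c 1) * X 1 ∈ G by
    have : Qi o = 1 := by
      show segmentTransport Γ (o.1, o.2) o * segmentTransport Γ o (o.1, o.2) = 1
      rw [Prod.mk.eta, segmentTransport_self h.convex h.continuousOn h.mem, one_mul]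
    rw [hc.path.target, this, one_mul, hX1] at hkey
    exact hkey
  refine hc.path.piecewise.propagation zero_le_one hXf (p := fun t => Qi (c t) * X t ∈ G) ?_ ?_
  · have : Qi o = 1 := by
      show segmentTransport Γ (o.1, o.2) o * segmentTransport Γ o (o.1, o.2) = 1
      rw [Prod.mk.eta, segmentTransport_self h.convex h.continuousOn h.mem, one_mul]
    rw [hc.path.source, this, one_mul, hX0]
    exact hG.one_mem
  intro s t c' hs hst ht hu hcc hcc' hcd hp
  have hsub : Icc s t ⊆ Icc 0 1 := Icc_subset_Icc hs ht
  have hcB : ∀ u ∈ Icc s t, c u ∈ B₁ ×ˢ B₂ := fun u hu => hc.path.mem u (hsub hu)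
  -- On a `C^1` piece the gauge-transformed frame solves an equation whose coefficient involves only
  -- the first component of the velocity and is a velocity of `G`.
  refine mem_of_deriv_eq_velocity_mul hG hst.le
    (A := fun u => -(τi (c u) * fderiv ℝ τ (c u) ((c' u).1, 0))) (W := fun u => Qi (c u) * X u)
    ?_ ?_ ?_ ?_ hp
  · have h1 : ContinuousOn (fun u => fderiv ℝ τ (c u)) (Icc s t) :=
      (h.contDiffOn_rectangleTransport.continuousOn_fderiv_of_isOpen h.isOpen (by simp)).comp hcc hcB
    have h2 : ContinuousOn (fun u => τi (c u)) (Icc s t) :=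
      (h.contDiffOn_lowerTransportInv.continuousOn.comp hcc hcB).clm_comp
        (h.contDiffOn_upperTransport.continuousOn.comp hcc hcB)
    have h3 : ContinuousOn (fun u => ((c' u).1, (0 : X₂))) (Icc s t) :=
      (continuous_fst.comp_continuousOn hcc').prodMk continuousOn_const
    exact (h2.clm_comp (h1.clm_apply h3)).neg
  · intro u hu
    have := (hvel _ (hcB u hu) ((c' u).1, 0)).smul (-1)
    rwa [neg_one_smul] at this
  · exact (h.contDiffOn_lowerTransportInv.continuousOn.comp hcc hcB).clm_comp (hX.mono hsub)
  · intro u hu'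
    have huI := Ioo_subset_Icc_self hu'
    have hB := hcB u huI
    have hcu := hcd u hu'
    have hXd : HasDerivAt X (-(Γ (c u) (c' u) * X u)) u := by
      by_contra hcon
      refine hu u hu' ⟨⟨hs.trans_lt hu'.1, hu'.2.trans_le ht⟩, fun ⟨v, hv, hd⟩ => hcon ?_⟩
      rwa [hv.unique hcu] at hd
    have hQd := ((h.contDiffOn_lowerTransportInv.contDiffAt (h.isOpen.mem_nhds hB)).differentiableAt
      (by simp)).hasFDerivAt.comp_hasDerivAt u hcu
    refine (hQd.clm_comp hXd).congr_deriv ?_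
    show fderiv ℝ Qi (c u) (c' u) * X u + Qi (c u) * -(Γ (c u) (c' u) * X u) =
      -(Qi (c u) * upperTransport Γ o (c u) * fderiv ℝ τ (c u) ((c' u).1, 0)) * (Qi (c u) * X u)
    have e1 := h.fderiv_lowerTransport hB (c' u)
    have e2 := h.lowerTransport_mul_inv hB
    rw [hQi _ hB, e1]
    exact conjugate_eq_of_mul_eq_one e2

end IsBiparallel

end Product

/-! ### Charts in which a parallel distribution is constant -/

section AdaptedChart

variable {E : Type*} [NormedAddCommGroup E] [NormedSpace ℝ E]
  {M : Type*} [TopologicalSpace M] [ChartedSpace E M] [IsManifold 𝓘(ℝ, E) ∞ M]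
  {F : Type*} [NormedAddCommGroup F] [NormedSpace ℝ F] [FiniteDimensional ℝ F]
  {Φ : OpenPartialHomeomorph M F}

/-- A smooth chart with convex image in which the parallel distribution of `V` is the constant
distribution `W`. -/
structure IsAdaptedChart
    (cov : CovariantDerivative 𝓘(ℝ, E) E (TangentSpace 𝓘(ℝ, E) : M → Type _)) (o : M)
    (V : Submodule ℝ (TangentSpace 𝓘(ℝ, E) o)) (Φ : OpenPartialHomeomorph M F)
    (W : Submodule ℝ F) : Prop where
  chart : IsSmoothChart (E := E) Φ
  convex : Convex ℝ Φ.target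
  mem : o ∈ Φ.source
  distribution : ∀ x ∈ Φ.source, ∀ v : TangentSpace 𝓘(ℝ, E) x,
    v ∈ parallelDistribution cov Φ.source o V x ↔ dchart (E := E) Φ x v ∈ W

variable {cov : CovariantDerivative 𝓘(ℝ, E) E (TangentSpace 𝓘(ℝ, E) : M → Type _)} {o : M}
  {V V' : Submodule ℝ (TangentSpace 𝓘(ℝ, E) o)} {W W' : Submodule ℝ F}

lemma isPathIn_segment {B : Set F} (hB : Convex ℝ B) {x y : F} (hx : x ∈ B) (hy : y ∈ B) :
    IsPathIn (E := F) B x y (fun t => x + t • (y - x)) :=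
  ⟨⟨∅, fun _ _ _ _ _ _ => (contMDiff_iff_contDiff.2 (by fun_prop)).contMDiffOn⟩,
    fun _ ht => segment_mem hB hx hy ht, by simp, by simp⟩

lemma isParallelCurve_const (Γ : F → F →L[ℝ] F →L[ℝ] F) (x v : F) (a b : ℝ) :
    IsParallelCurve Γ (fun _ => x) (fun _ => v) a b :=
  ⟨continuousOn_const, finite_empty.subset fun t ht => ht.2 ⟨0, hasDerivAt_const t x, by
    simpa using hasDerivAt_const t v⟩⟩

namespace IsAdaptedChart

/-- Vectors of `V` belong to the distribution at `o` by transport along the constant path. -/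
lemma dchart_mem (h : IsAdaptedChart cov o V Φ W) {v : TangentSpace 𝓘(ℝ, E) o} (hv : v ∈ V) :
    dchart (E := E) Φ o v ∈ W := by
  refine (h.distribution o h.mem v).1 (Submodule.subset_span ⟨fun _ => o,
    ⟨⟨∅, fun _ _ _ _ _ _ => contMDiffOn_const⟩, fun _ _ => h.mem, rfl, rfl⟩, v, hv, ?_⟩)
  exact h.chart.transports_of_parallel zero_le_one continuousOn_const (fun _ _ => h.mem)
    (isParallelCurve_const _ _ (dchart (E := E) Φ o v) 0 1) rfl rfl rfl rfl

/-- Along a tangent path the projection along `W` has zero derivative off a finite set and is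
constant; conversely the straight segment in the convex image is a tangent path. -/
lemma mem_leaf_iff (h : IsAdaptedChart cov o V Φ W) {p : M} (hp : p ∈ Φ.source) {x : M} :
    x ∈ leaf cov Φ.source o V p ↔ x ∈ Φ.source ∧ Φ x - Φ p ∈ W := by
  constructor
  · rintro ⟨c, hc, hcV⟩
    have hx : x ∈ Φ.source := hc.target ▸ hc.mem 1 ⟨zero_le_one, le_rfl⟩
    refine ⟨hx, ?_⟩
    obtain ⟨q, hq, -⟩ := exists_projection_along W
    have hpath := h.chart.isPathIn subset_rfl hc
    have h1 := eq_of_deriv_eq_zero_off_finite (Z := fun t => q (Φ (c t)))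
      (hpath.piecewise.finite_not_hasDerivAt.union hcV)
      (q.continuous.comp_continuousOn hpath.continuousOn) (a := 0) (b := 1) (fun t ht hts => by
        simp only [mem_union, mem_ofPred_eq, ht, true_and, not_or, not_not] at hts
        obtain ⟨⟨c', hc'⟩, hv⟩ := hts
        have htI := Ioo_subset_Icc_self ht
        have hcm : MDifferentiableAt 𝓘(ℝ, ℝ) 𝓘(ℝ, E) c t := by
          refine (h.chart.mdifferentiableAt_symm_comp hc'
            (Φ.map_source (hc.mem t htI))).1.congr_of_eventuallyEq ?_
          filter_upwards [Icc_mem_nhds ht.1 ht.2] with s hs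
          exact (Φ.left_inv (hc.mem s hs)).symm
        have h2 := h.chart.hasDerivAt_comp hcm (hc.mem t htI)
        refine (q.hasFDerivAt.comp_hasDerivAt t h2).congr_deriv ?_
        exact (hq _).2 ((h.distribution _ (hc.mem t htI) _).1 hv)) 1 ⟨zero_le_one, le_rfl⟩
    rw [← hq, map_sub, sub_eq_zero]
    simpa only [hc.source, hc.target] using h1
  · rintro ⟨hx, hxp⟩
    have hy := Φ.map_source hp
    have hz := Φ.map_source hx
    have hc := h.chart.isPathIn_symm subset_rfl (isPathIn_segment h.convex hy hz)
    rw [Φ.left_inv hp, Φ.left_inv hx, Φ.symm_image_target_eq_source] at hc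
    refine ⟨_, hc, finite_empty.subset fun t ht => ht.2 ?_⟩
    have htI := segment_mem h.convex hy hz (Ioo_subset_Icc_self ht.1)
    have hd : HasDerivAt (fun t : ℝ => Φ p + t • (Φ x - Φ p)) (Φ x - Φ p) t := by
      simpa using ((hasDerivAt_id t).smul_const (Φ x - Φ p)).const_add (Φ p)
    refine (h.distribution _ (Φ.map_target htI) _).2 ?_
    have e := (h.chart.mdifferentiableAt_symm_comp hd htI).2
    have e2 : dchart (E := E) Φ _ (velocity (E := E)
        (fun s : ℝ => Φ.symm (Φ p + s • (Φ x - Φ p))) t) = Φ x - Φ p :=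
      (congrArg (dchart (E := E) Φ _) e).trans (h.chart.dchart_dchartSymm htI _)
    rw [e2]
    exact hxp

/-- The distribution is spanned by transports of `V` along paths from `o`, and appending the segment
to such a path yields another one. -/
lemma segmentTransport_mem (h : IsAdaptedChart cov o V Φ W)
    (hΓ : ContinuousOn (christoffel cov Φ) Φ.target) {x y : F} (hx : x ∈ Φ.target)
    (hy : y ∈ Φ.target) {w : F} (hw : w ∈ W) :
    segmentTransport (christoffel cov Φ) x y w ∈ W := by
  have hxs := Φ.map_target hx
  have hys := Φ.map_target hy
  let T := segmentTransport (christoffel cov Φ) x y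
  suffices ∀ v ∈ parallelDistribution cov Φ.source o V (Φ.symm x),
      T (dchart (E := E) Φ (Φ.symm x) v) ∈ W by
    have h1 := this (dchartSymm (E := E) Φ x w : E)
      ((h.distribution _ hxs _).2 (by rwa [h.chart.dchart_dchartSymm hx]))
    rwa [h.chart.dchart_dchartSymm hx] at h1
  intro v hv
  refine Submodule.span_induction (p := fun v _ => T (dchart (E := E) Φ (Φ.symm x) v) ∈ W)
    ?_ ?_ ?_ ?_ hv
  · rintro v ⟨c, hc, v₀, hv₀, ht⟩
    have hsp := isTransportPath_segment h.convex hΓ hx hy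
    have hsM := h.chart.isPathIn_symm subset_rfl hsp.path
    rw [Φ.symm_image_target_eq_source] at hsM
    obtain ⟨-, -, ξ, hξ, hξ0, hξ1⟩ := h.chart.parallel_of_transports zero_le_one hc.mem ht
    obtain ⟨η, hη, hη0, hη1⟩ := hsp.transport (dchart (E := E) Φ (Φ.symm x) v)
    have hc1 : Φ (c 1) = x := by rw [hc.target, Φ.right_inv hx]
    obtain ⟨ζ, hζ, hζ0, hζ1⟩ := hξ.concat hη (by rw [hc1, hsp.path.source])
      (by rw [hξ1, hη0]; rfl)
    have hcc := hc.concat hsM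
    have h2 : Transports cov (pathConcat c fun t => Φ.symm (x + t • (y - x))) 0 1
        ⟨o, v₀⟩ (ofComponents (E := E) Φ y (T (dchart (E := E) Φ (Φ.symm x) v))) := by
      refine h.chart.transports_of_parallel (ξ := ζ) zero_le_one hcc.continuousOn hcc.mem ?_
        hcc.source.symm hcc.target.symm ?_ ?_
      · refine hζ.congr (fun t ht => ?_) fun _ _ => rfl
        show Φ (pathConcat _ _ t) = _
        simp only [pathConcat]
        split_ifs with h3
        · rfl
        · exact Φ.right_inv (segment_mem h.convex hx hy
            ⟨by linarith, by linarith [ht.2]⟩)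
      · rw [hζ0, hξ0]
      · rw [hζ1, hη1, h.chart.components_ofComponents hy]
    have h3 := (h.distribution _ hys (dchartSymm (E := E) Φ y
      (T (dchart (E := E) Φ (Φ.symm x) v)) : E)).1 (Submodule.subset_span ⟨_, hcc, v₀, hv₀, h2⟩)
    rwa [h.chart.dchart_dchartSymm hy] at h3
  · have : dchart (E := E) Φ (Φ.symm x) (0 : TangentSpace 𝓘(ℝ, E) (Φ.symm x)) = 0 :=
      map_zero (dchart (E := E) Φ (Φ.symm x))
    exact (congrArg (fun w => T w ∈ W) this).mpr (by rw [map_zero]; exact W.zero_mem)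
  · intro v v' _ _ hv hv'
    have : dchart (E := E) Φ (Φ.symm x) (v + v') =
      dchart (E := E) Φ (Φ.symm x) v + dchart (E := E) Φ (Φ.symm x) v' :=
      map_add (dchart (E := E) Φ (Φ.symm x)) v v'
    rw [this, map_add]; exact W.add_mem hv hv'
  · intro r v _ hv
    exact (congrArg (fun w => T w ∈ W) (map_smul (dchart (E := E) Φ (Φ.symm x)) r v)).mpr
      (by rw [map_smul]; exact W.smul_mem _ hv)

/-- Differentiate `segmentTransport_mem` at a segment of length zero, where the derivative of the
transport is the negative connection form. -/
lemma christoffel_mem (h : IsAdaptedChart cov o V Φ W)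
    (hΓ : ContDiffOn ℝ ∞ (christoffel cov Φ) Φ.target) {y : F} (hy : y ∈ Φ.target) (u : F) {w : F}
    (hw : w ∈ W) : christoffel cov Φ y u w ∈ W := by
  obtain ⟨q, hq, -⟩ := exists_projection_along W
  have h1 := hasDerivAt_comp_line (u := u)
    (differentiableAt_segmentTransport_right Φ.open_target h.convex hΓ hy hy)
  rw [fderiv_segmentTransport_self Φ.open_target h.convex hΓ hy] at h1
  have h2 := q.hasFDerivAt.comp_hasDerivAt (0 : ℝ) (h1.clm_apply (hasDerivAt_const (0 : ℝ) w))
  have hcont : Continuous fun s : ℝ => y + s • u := by fun_prop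
  have h3 : (q ∘ fun s : ℝ => segmentTransport (christoffel cov Φ) y (y + s • u) w) =ᶠ[𝓝 0]
      fun _ => (0 : F) := by
    filter_upwards [hcont.continuousAt.eventually
      (Φ.open_target.mem_nhds (by simpa using hy))] with s hs
    exact (hq _).2 (h.segmentTransport_mem hΓ.continuousOn hy hs hw)
  have h4 := h2.unique ((hasDerivAt_const (0 : ℝ) (0 : F)).congr_of_eventuallyEq h3)
  rw [← hq, ← neg_eq_zero, ← map_neg]
  simpa using h4

/-- The velocity, moved back to `T_o M` by the chart, is in the holonomy algebra and annihilates
`V`. -/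
lemma faithful [FiniteDimensional ℝ E] (h : IsAdaptedChart cov o V Φ W)
    (hΓ : ContinuousOn (christoffel cov Φ) Φ.target) (hV : IsFaithfulSubrep cov o V)
    {A : F →L[ℝ] F} (hA : IsVelocity (coordHolonomy (christoffel cov Φ) Φ.target (Φ o)) A)
    (hAW : ∀ w ∈ W, A w = 0) : A = 0 := by
  have h1 := h.chart.mem_holonomyAlgebra h.convex hΓ h.mem hA
  have h2 := hV.faithful _ h1 fun v hv => by
    show (h.chart.tangentEquiv h.mem).symm (A (dchart (E := E) Φ o v)) = 0
    rw [hAW _ (h.dchart_mem hv), map_zero]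
  exact (h.chart.tangentEquiv h.mem).symm.conjContinuousAlgEquiv.injective
    (h2.trans (map_zero _).symm)

lemma isBiparallel [FiniteDimensional ℝ E] [CompleteSpace E] [T2Space M]
    [CovariantDerivative.ContMDiffCovariantDerivative cov ∞] (htorsion : cov.torsion = 0)
    (h : IsAdaptedChart cov o V Φ W) (h' : IsAdaptedChart cov o V' Φ W') (hW : Disjoint W W')
    (hV : IsFaithfulSubrep cov o V) (hV' : IsFaithfulSubrep cov o V') :
    IsBiparallel (christoffel cov Φ) Φ.target (Φ o) W W' := by
  have hΓ : ContDiffOn ℝ ∞ (christoffel cov Φ) Φ.target :=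
    h.chart.contDiffOn_christoffel (cov := cov)
  exact ⟨Φ.open_target, h.convex, Φ.map_source h.mem, hΓ,
    fun y hy => h.chart.christoffel_symm htorsion hy, hW,
    fun y hy u w hw => h.christoffel_mem hΓ hy u hw,
    fun y hy u w hw => h'.christoffel_mem hΓ hy u hw,
    fun A hA => h.faithful hΓ.continuousOn hV hA, fun A hA => h'.faithful hΓ.continuousOn hV' hA⟩

end IsAdaptedChart

end AdaptedChart

/-! ### Rectangles, corners and holonomy in a product chart -/

section ProductChart

variable {E : Type*} [NormedAddCommGroup E] [NormedSpace ℝ E]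
  {M : Type*} [TopologicalSpace M] [ChartedSpace E M] [IsManifold 𝓘(ℝ, E) ∞ M]
  {X₁ X₂ : Type*} [NormedAddCommGroup X₁] [NormedSpace ℝ X₁] [FiniteDimensional ℝ X₁]
  [NormedAddCommGroup X₂] [NormedSpace ℝ X₂] [FiniteDimensional ℝ X₂]
  {cov : CovariantDerivative 𝓘(ℝ, E) E (TangentSpace 𝓘(ℝ, E) : M → Type _)} {o : M}
  {V₁ V₂ : Submodule ℝ (TangentSpace 𝓘(ℝ, E) o)}
  {Φ : OpenPartialHomeomorph M (X₁ × X₂)} {B₁ : Set X₁} {B₂ : Set X₂}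

/-- A smooth chart with values in a product, in which two parallel distributions are tangent to the
slices, together with the resulting properties of its Christoffel symbols. -/
structure IsProductChart
    (cov : CovariantDerivative 𝓘(ℝ, E) E (TangentSpace 𝓘(ℝ, E) : M → Type _)) (o : M)
    (V₁ V₂ : Submodule ℝ (TangentSpace 𝓘(ℝ, E) o)) (Φ : OpenPartialHomeomorph M (X₁ × X₂))
    (B₁ : Set X₁) (B₂ : Set X₂) : Prop where
  target_eq : Φ.target = B₁ ×ˢ B₂
  adapted₁ : IsAdaptedChart cov o V₁ Φ (factorOne X₁ X₂)
  adapted₂ : IsAdaptedChart cov o V₂ Φ (factorTwo X₁ X₂)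
  biparallel : IsBiparallel (christoffel cov Φ) (B₁ ×ˢ B₂) (Φ o) (factorOne X₁ X₂) (factorTwo X₁ X₂)

lemma disjoint_factors : Disjoint (factorOne X₁ X₂) (factorTwo X₁ X₂) :=
  Submodule.disjoint_def.2 fun _ h₁ h₂ => Prod.ext (mem_factorTwo.1 h₂) (mem_factorOne.1 h₁)

/-- The generated group consists of linear equivalences of `T_o M`, the local holonomy of operators
on the model space; intertwining by `e` passes from generators to the group. -/
lemma exists_operator_of_mem_closure {L : TangentSpace 𝓘(ℝ, E) o ≃ₗ[ℝ] TangentSpace 𝓘(ℝ, E) o}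
    {S : Set (TangentSpace 𝓘(ℝ, E) o ≃ₗ[ℝ] TangentSpace 𝓘(ℝ, E) o)} {F : Type*}
    [NormedAddCommGroup F] [NormedSpace ℝ F] {G : Set (F →L[ℝ] F)} (hG : IsOperatorGroup G)
    (e : E → F) (hS : ∀ L ∈ S, ∃ A ∈ G, ∀ v : TangentSpace 𝓘(ℝ, E) o, e (L v) = A (e v))
    (hL : L ∈ Subgroup.closure S) : ∃ A ∈ G, ∀ v : TangentSpace 𝓘(ℝ, E) o, e (L v) = A (e v) := by
  induction hL using Subgroup.closure_induction with
  | mem L hL => exact hS L hL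
  | one => exact ⟨1, hG.one_mem, fun v => rfl⟩
  | mul L L' _ _ h h' =>
    obtain ⟨A, hA, h⟩ := h
    obtain ⟨A', hA', h'⟩ := h'
    exact ⟨A * A', hG.mul_mem hA hA', fun v => (h (L' v)).trans (congrArg A (h' v))⟩
  | inv L _ h =>
    obtain ⟨A, hA, h⟩ := h
    obtain ⟨A', hA', -, h2⟩ := hG.exists_inv hA
    refine ⟨A', hA', fun v => ?_⟩
    have h3 : e v = A (e (L⁻¹ v)) := by rw [← h]; exact congrArg e (L.apply_symm_apply v).symm
    have h4 := congrArg (fun T : F →L[ℝ] F => T (e (L⁻¹ v))) h2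
    rw [h3]
    exact h4.symm

namespace IsProductChart

variable (h : IsProductChart cov o V₁ V₂ Φ B₁ B₂)
include h

lemma chart : IsSmoothChart (E := E) Φ := h.adapted₁.chart

lemma mem : o ∈ Φ.source := h.adapted₁.mem

lemma map_mem {p : M} (hp : p ∈ Φ.source) : Φ p ∈ B₁ ×ˢ B₂ := h.target_eq ▸ Φ.map_source hp

lemma symm_mem {y : X₁ × X₂} (hy : y ∈ B₁ ×ˢ B₂) : Φ.symm y ∈ Φ.source :=
  Φ.map_target (h.target_eq ▸ hy)

lemma right_inv {y : X₁ × X₂} (hy : y ∈ B₁ ×ˢ B₂) : Φ (Φ.symm y) = y :=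
  Φ.right_inv (h.target_eq ▸ hy)

lemma mem_leaf₁ {p : M} (hp : p ∈ Φ.source) {x : M} :
    x ∈ leaf cov Φ.source o V₁ p ↔ x ∈ Φ.source ∧ (Φ x).2 = (Φ p).2 := by
  rw [h.adapted₁.mem_leaf_iff hp, mem_factorOne, Prod.snd_sub, sub_eq_zero]

lemma mem_leaf₂ {p : M} (hp : p ∈ Φ.source) {x : M} :
    x ∈ leaf cov Φ.source o V₂ p ↔ x ∈ Φ.source ∧ (Φ x).1 = (Φ p).1 := by
  rw [h.adapted₂.mem_leaf_iff hp, mem_factorTwo, Prod.fst_sub, sub_eq_zero]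

/-- In the product chart leaves are slices, so the two leaves meet exactly in the point with the
mixed coordinates. -/
lemma mem_corner₁_iff {p q : M} (hp : p ∈ Φ.source) :
    q ∈ leaf cov Φ.source o V₁ o ∩ leaf cov Φ.source o V₂ p ↔ q = Φ.symm ((Φ p).1, (Φ o).2) := by
  have hc : ((Φ p).1, (Φ o).2) ∈ B₁ ×ˢ B₂ := h.biparallel.corner_mem (h.map_mem hp)
  rw [mem_inter_iff, h.mem_leaf₁ h.mem, h.mem_leaf₂ hp]
  constructor
  · rintro ⟨⟨hq, h1⟩, -, h2⟩
    rw [← h1, ← h2, Prod.mk.eta, Φ.left_inv hq]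
  · rintro rfl
    rw [h.right_inv hc]
    exact ⟨⟨h.symm_mem hc, rfl⟩, h.symm_mem hc, rfl⟩

lemma mem_corner₂_iff {p r : M} (hp : p ∈ Φ.source) :
    r ∈ leaf cov Φ.source o V₂ o ∩ leaf cov Φ.source o V₁ p ↔ r = Φ.symm ((Φ o).1, (Φ p).2) := by
  have hc : ((Φ o).1, (Φ p).2) ∈ B₁ ×ˢ B₂ := h.biparallel.corner_mem' (h.map_mem hp)
  rw [mem_inter_iff, h.mem_leaf₂ h.mem, h.mem_leaf₁ hp]
  constructor
  · rintro ⟨⟨hq, h1⟩, -, h2⟩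
    rw [← h1, ← h2, Prod.mk.eta, Φ.left_inv hq]
  · rintro rfl
    rw [h.right_inv hc]
    exact ⟨⟨h.symm_mem hc, rfl⟩, h.symm_mem hc, rfl⟩

lemma exists_transport {p : M} (hp : p ∈ Φ.source) :
    ∃ L : TangentSpace 𝓘(ℝ, E) o ≃ₗ[ℝ] TangentSpace 𝓘(ℝ, E) o,
      ∀ v : TangentSpace 𝓘(ℝ, E) o, dchart (E := E) Φ o (L v) =
        rectangleTransport (christoffel cov Φ) (Φ o) (Φ p) (dchart (E := E) Φ o v) := by
  let e := (h.chart.tangentEquiv h.mem).toLinearEquiv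
  obtain ⟨u, hu⟩ := h.biparallel.isUnit_rectangleTransport (h.map_mem hp)
  let A := (ContinuousLinearEquiv.unitsEquiv ℝ (X₁ × X₂) u).toLinearEquiv
  refine ⟨(e.trans A).trans e.symm, fun v => ?_⟩
  rw [← hu]
  exact e.apply_symm_apply (A (e v))

lemma exists_rectangle {p : M} (hp : p ∈ Φ.source) :
    ∃ γ t₁ t₂ t₃, IsRectangle cov Φ.source o V₁ V₂ p γ t₁ t₂ t₃ := by
  have hB := h.adapted₁.convex
  have ho' := h.map_mem h.mem
  have hp' := h.map_mem hp
  have ho := Φ.map_source h.mem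
  have hpt := Φ.map_source hp
  have hq : ((Φ p).1, (Φ o).2) ∈ Φ.target := h.target_eq ▸ h.biparallel.corner_mem hp'
  have hr : ((Φ o).1, (Φ p).2) ∈ Φ.target := h.target_eq ▸ h.biparallel.corner_mem' hp'
  have key := ((isPathIn_segment hB ho hq).concat (isPathIn_segment hB hq hpt)).concat
    ((isPathIn_segment hB hpt hr).concat (isPathIn_segment hB hr ho))
  set c := pathConcat (pathConcat (fun t : ℝ => Φ o + t • (((Φ p).1, (Φ o).2) - Φ o))
    fun t : ℝ => ((Φ p).1, (Φ o).2) + t • (Φ p - ((Φ p).1, (Φ o).2)))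
    (pathConcat (fun t : ℝ => Φ p + t • (((Φ o).1, (Φ p).2) - Φ p))
    fun t : ℝ => ((Φ o).1, (Φ p).2) + t • (Φ o - ((Φ o).1, (Φ p).2))) with hc
  have hloop := h.chart.isPathIn_symm subset_rfl key
  rw [Φ.left_inv h.mem, Φ.symm_image_target_eq_source] at hloop
  have hcI : ∀ t ∈ Icc (0 : ℝ) 1, Φ (Φ.symm (c t)) = c t := fun t ht => Φ.right_inv (key.mem t ht)
  have h2 : c (1 / 2) = Φ p := by
    rw [hc]; norm_num [pathConcat]
  have hs : ∀ t ∈ Icc (0 : ℝ) 1, Φ.symm (c t) ∈ Φ.source := hloop.mem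
  -- A concatenation of two concatenations spends a quarter of the time on each side.
  refine ⟨fun t => Φ.symm (c t), 1 / 4, 1 / 2, 3 / 4, by norm_num, by norm_num, by norm_num,
    by norm_num, hloop, by rw [h2, Φ.left_inv hp], fun t ht => ?_, fun t ht => ?_, fun t ht => ?_,
    fun t ht => ?_⟩
  · have htI : t ∈ Icc (0 : ℝ) 1 := ⟨ht.1, by linarith [ht.2]⟩
    refine (h.mem_leaf₁ h.mem).2 ⟨hs t htI, ?_⟩
    rw [hcI t htI, hc, pathConcat_left _ _ (by linarith [ht.2]),
      pathConcat_left _ _ (by linarith [ht.2])]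
    simp
  · have htI : t ∈ Icc (0 : ℝ) 1 := ⟨by linarith [ht.1], by linarith [ht.2]⟩
    refine (h.mem_leaf₂ hp).2 ⟨hs t htI, ?_⟩
    rw [hcI t htI, hc, pathConcat_left _ _ (by linarith [ht.2]),
      pathConcat_right (by simp) (by linarith [ht.1])]
    simp
  · have htI : t ∈ Icc (0 : ℝ) 1 := ⟨by linarith [ht.1], by linarith [ht.2]⟩
    refine (h.mem_leaf₁ hp).2 ⟨hs t htI, ?_⟩
    rw [hcI t htI, hc, pathConcat_right (by norm_num [pathConcat]) (by linarith [ht.1]),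
      pathConcat_left _ _ (by linarith [ht.2])]
    simp
  · have htI : t ∈ Icc (0 : ℝ) 1 := ⟨by linarith [ht.1], by linarith [ht.2]⟩
    refine (h.mem_leaf₂ h.mem).2 ⟨hs t htI, ?_⟩
    rw [hcI t htI, hc, pathConcat_right (by norm_num [pathConcat]) (by linarith [ht.1]),
      pathConcat_right (by simp) (by linarith [ht.1])]
    simp

section Rectangle

variable {p : M} {γ : ℝ → M} {t₁ t₂ t₃ : ℝ}
  (hγ : IsRectangle cov Φ.source o V₁ V₂ p γ t₁ t₂ t₃)
include hγ

lemma rectangle_mem : p ∈ Φ.source :=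
  hγ.corner ▸ hγ.loop.mem t₂ ⟨hγ.zero_le.trans hγ.le₁₂, hγ.le₂₃.trans hγ.le_one⟩

lemma rectangle_corner₁ : Φ (γ t₁) = ((Φ p).1, (Φ o).2) := by
  have hp := h.rectangle_mem hγ
  exact Prod.ext ((h.mem_leaf₂ hp).1 (hγ.side₂ t₁ ⟨le_rfl, hγ.le₁₂⟩)).2
    ((h.mem_leaf₁ h.mem).1 (hγ.side₁ t₁ ⟨hγ.zero_le, le_rfl⟩)).2

lemma rectangle_corner₃ : Φ (γ t₃) = ((Φ o).1, (Φ p).2) := by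
  have hp := h.rectangle_mem hγ
  exact Prod.ext ((h.mem_leaf₂ h.mem).1 (hγ.side₄ t₃ ⟨le_rfl, hγ.le_one⟩)).2
    ((h.mem_leaf₁ hp).1 (hγ.side₃ t₃ ⟨hγ.le₂₃, le_rfl⟩)).2

lemma rectangle_piecewise : PiecewiseC1On (E := X₁ × X₂) (fun t => Φ (γ t)) 0 1 :=
  h.chart.piecewiseC1On hγ.loop.piecewise hγ.loop.mem

/-- The sides are arbitrary paths in leaves; flatness replaces each by the transport along the
straight segment with the same end points. -/
lemma rectangle_lower (v : X₁ × X₂) : ∃ ξ, IsParallelCurve (christoffel cov Φ)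
    (fun t => Φ (γ t)) ξ 0 t₂ ∧ ξ 0 = v ∧
    ξ t₂ = lowerTransport (christoffel cov Φ) (Φ o) (Φ p) v := by
  have hp := h.rectangle_mem hγ
  have hc := h.rectangle_piecewise hγ
  have hcB : ∀ t ∈ Icc (0 : ℝ) 1, Φ (γ t) ∈ B₁ ×ˢ B₂ := fun t ht => h.map_mem (hγ.loop.mem t ht)
  have h12 := hγ.le₁₂
  have h01 := hγ.zero_le
  have h23 := hγ.le₂₃.trans hγ.le_one
  have hs1 : ∀ t ∈ Icc 0 t₁, (Φ (γ t)).2 = (Φ o).2 := fun t ht =>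
    ((h.mem_leaf₁ h.mem).1 (hγ.side₁ t ht)).2
  have hs2 : ∀ t ∈ Icc t₁ t₂, (Φ (γ t)).1 = (Φ p).1 := fun t ht =>
    ((h.mem_leaf₂ hp).1 (hγ.side₂ t ht)).2
  have e1 := h.biparallel.isParallelCurve_leaf h01 (hc.mono le_rfl (h12.trans h23))
    (fun t ht => hcB t ⟨ht.1, ht.2.trans (h12.trans h23)⟩) (fun t ht => by
      rw [mem_factorOne, Prod.snd_sub, hs1 t ht, hs1 0 ⟨le_rfl, h01⟩, sub_self]) v
  have e2 := h.biparallel.swap.isParallelCurve_leaf h12 (hc.mono h01 h23)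
    (fun t ht => hcB t ⟨h01.trans ht.1, ht.2.trans h23⟩) (fun t ht => by
      rw [mem_factorTwo, Prod.fst_sub, hs2 t ht, hs2 t₁ ⟨le_rfl, h12⟩, sub_self])
    (segmentTransport (christoffel cov Φ) (Φ (γ 0)) (Φ (γ t₁)) v)
  have hself : ∀ t ∈ Icc (0 : ℝ) 1, ∀ w,
      segmentTransport (christoffel cov Φ) (Φ (γ t)) (Φ (γ t)) w = w := fun t ht w => by
    rw [segmentTransport_self h.biparallel.convex h.biparallel.continuousOn (hcB t ht)]; rfl
  obtain ⟨ξ, hξ, hξ0, hξ1⟩ := e1.glue h01 h12 e2 (hself t₁ ⟨h01, h12.trans h23⟩ _).symm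
  refine ⟨ξ, hξ, hξ0.trans (hself 0 ⟨le_rfl, zero_le_one⟩ _), hξ1.trans ?_⟩
  rw [h.rectangle_corner₁ hγ, hγ.corner, hγ.loop.source]
  rfl

/-- The third and fourth sides are treated like the first two, now returning to `o` through the
corner with the second coordinate of `p`. -/
lemma rectangle_upper (v : X₁ × X₂) : ∃ ξ, IsParallelCurve (christoffel cov Φ)
    (fun t => Φ (γ t)) ξ t₂ 1 ∧ ξ t₂ = v ∧
    ξ 1 = upperTransportInv (christoffel cov Φ) (Φ o) (Φ p) v := by
  have hp := h.rectangle_mem hγ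
  have hc := h.rectangle_piecewise hγ
  have hcB : ∀ t ∈ Icc (0 : ℝ) 1, Φ (γ t) ∈ B₁ ×ˢ B₂ := fun t ht => h.map_mem (hγ.loop.mem t ht)
  have h23 := hγ.le₂₃
  have h31 := hγ.le_one
  have h02 := hγ.zero_le.trans hγ.le₁₂
  have hs1 : ∀ t ∈ Icc t₂ t₃, (Φ (γ t)).2 = (Φ p).2 := fun t ht =>
    ((h.mem_leaf₁ hp).1 (hγ.side₃ t ht)).2
  have hs2 : ∀ t ∈ Icc t₃ 1, (Φ (γ t)).1 = (Φ o).1 := fun t ht =>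
    ((h.mem_leaf₂ h.mem).1 (hγ.side₄ t ht)).2
  have e1 := h.biparallel.isParallelCurve_leaf h23 (hc.mono h02 h31)
    (fun t ht => hcB t ⟨h02.trans ht.1, ht.2.trans h31⟩) (fun t ht => by
      rw [mem_factorOne, Prod.snd_sub, hs1 t ht, hs1 t₂ ⟨le_rfl, h23⟩, sub_self]) v
  have e2 := h.biparallel.swap.isParallelCurve_leaf h31 (hc.mono (h02.trans h23) le_rfl)
    (fun t ht => hcB t ⟨(h02.trans h23).trans ht.1, ht.2⟩) (fun t ht => by
      rw [mem_factorTwo, Prod.fst_sub, hs2 t ht, hs2 t₃ ⟨le_rfl, h31⟩, sub_self])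
    (segmentTransport (christoffel cov Φ) (Φ (γ t₂)) (Φ (γ t₃)) v)
  have hself : ∀ t ∈ Icc (0 : ℝ) 1, ∀ w,
      segmentTransport (christoffel cov Φ) (Φ (γ t)) (Φ (γ t)) w = w := fun t ht w => by
    rw [segmentTransport_self h.biparallel.convex h.biparallel.continuousOn (hcB t ht)]; rfl
  obtain ⟨ξ, hξ, hξ0, hξ1⟩ := e1.glue h23 h31 e2 (hself t₃ ⟨h02.trans h23, h31⟩ _).symm
  refine ⟨ξ, hξ, hξ0.trans (hself t₂ ⟨h02, h23.trans h31⟩ _), hξ1.trans ?_⟩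
  rw [h.rectangle_corner₃ hγ, hγ.corner, hγ.loop.target]
  rfl

lemma transports_lower {X Y : TangentBundle 𝓘(ℝ, E) M} (hX : X.proj = o) (hY : Y.proj = p)
    (hXY : components Φ Y = lowerTransport (christoffel cov Φ) (Φ o) (Φ p) (components Φ X)) :
    Transports cov γ 0 t₂ X Y := by
  obtain ⟨ξ, hξ, hξ0, hξ1⟩ := h.rectangle_lower hγ (components Φ X)
  have h2 := hγ.le₂₃.trans hγ.le_one
  have hsub : Icc 0 t₂ ⊆ Icc 0 1 := Icc_subset_Icc le_rfl h2
  exact h.chart.transports_of_parallel (hγ.zero_le.trans hγ.le₁₂)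
    (hγ.loop.continuousOn.mono hsub) (fun t ht => hγ.loop.mem t (hsub ht)) hξ
    (hX.trans hγ.loop.source.symm) (hY.trans hγ.corner.symm) hξ0.symm (hXY.trans hξ1.symm)

lemma transports_upper {X Y : TangentBundle 𝓘(ℝ, E) M} (hX : X.proj = p) (hY : Y.proj = o)
    (hXY : components Φ Y = upperTransportInv (christoffel cov Φ) (Φ o) (Φ p) (components Φ X)) :
    Transports cov γ t₂ 1 X Y := by
  obtain ⟨ξ, hξ, hξ0, hξ1⟩ := h.rectangle_upper hγ (components Φ X)
  have h2 := hγ.le₂₃.trans hγ.le_one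
  have hsub : Icc t₂ 1 ⊆ Icc 0 1 := Icc_subset_Icc (hγ.zero_le.trans hγ.le₁₂) le_rfl
  exact h.chart.transports_of_parallel h2
    (hγ.loop.continuousOn.mono hsub) (fun t ht => hγ.loop.mem t (hsub ht)) hξ
    (hX.trans hγ.corner.symm) (hY.trans hγ.loop.target.symm) hξ0.symm (hXY.trans hξ1.symm)

/-- Parallel transport around a rectangle depends only on the far corner. -/
lemma transports_rectangle_iff {L : TangentSpace 𝓘(ℝ, E) o ≃ₗ[ℝ] TangentSpace 𝓘(ℝ, E) o}
    (hL : ∀ v : TangentSpace 𝓘(ℝ, E) o, dchart (E := E) Φ o (L v) =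
        rectangleTransport (christoffel cov Φ) (Φ o) (Φ p) (dchart (E := E) Φ o v))
    (v w : TangentSpace 𝓘(ℝ, E) o) : Transports cov γ 0 1 ⟨o, v⟩ ⟨o, w⟩ ↔ w = L v := by
  obtain ⟨ξ, hξ, hξ0, hξ1⟩ := h.rectangle_lower hγ (dchart (E := E) Φ o v)
  obtain ⟨η, hη, hη0, hη1⟩ := h.rectangle_upper hγ (ξ t₂)
  obtain ⟨ζ, hζ, hζ0, hζ1⟩ := hξ.glue (hγ.zero_le.trans hγ.le₁₂) (hγ.le₂₃.trans hγ.le_one) hη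
    hη0.symm
  have hζ1' : ζ 1 = dchart (E := E) Φ o (L v) := by rw [hL, hζ1, hη1, hξ1]; rfl
  constructor
  · intro ht
    obtain ⟨-, -, θ, hθ, hθ0, hθ1⟩ := h.chart.parallel_of_transports zero_le_one hγ.loop.mem ht
    have e := hθ.eq h.biparallel.continuousOn zero_le_one (h.rectangle_piecewise hγ)
      (fun t ht => h.map_mem (hγ.loop.mem t ht)) hζ (by rw [hθ0, hζ0, hξ0]; rfl)
    rw [hθ1, hζ1'] at e
    exact (h.chart.tangentEquiv h.mem).injective e
  · rintro rfl
    exact h.chart.transports_of_parallel zero_le_one hγ.loop.continuousOn hγ.loop.mem hζ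
      hγ.loop.source.symm hγ.loop.target.symm (by rw [hζ0, hξ0]; rfl) hζ1'.symm

end Rectangle

lemma rectangleTransport_mem {y : X₁ × X₂} (hy : y ∈ B₁ ×ˢ B₂) :
    rectangleTransport (christoffel cov Φ) (Φ o) y ∈
      coordHolonomy (christoffel cov Φ) (B₁ ×ˢ B₂) (Φ o) := by
  have hB := h.biparallel
  refine ⟨hB.isUnit_rectangleTransport hy, _,
    ((isTransportPath_segment hB.convex hB.continuousOn hB.mem (hB.corner_mem hy)).concat
    (isTransportPath_segment hB.convex hB.continuousOn (hB.corner_mem hy) hy)).concat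
    ((isTransportPath_segment hB.convex hB.continuousOn hy (hB.corner_mem' hy)).concat
    (isTransportPath_segment hB.convex hB.continuousOn (hB.corner_mem' hy) hB.mem))⟩

/-- The transports around rectangles generate the holonomy group. -/
theorem closure_eq {τ : M → (TangentSpace 𝓘(ℝ, E) o ≃ₗ[ℝ] TangentSpace 𝓘(ℝ, E) o)}
    (hτ : ∀ p ∈ Φ.source, ∀ v : TangentSpace 𝓘(ℝ, E) o, dchart (E := E) Φ o (τ p v) =
      rectangleTransport (christoffel cov Φ) (Φ o) (Φ p) (dchart (E := E) Φ o v)) :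
    (Subgroup.closure (τ '' Φ.source) : Set _) = restrictedHolonomy cov Φ.source o ∧
    (Subgroup.closure (τ '' Φ.source) : Set _) = holonomy cov Φ.source o := by
  have hB := h.biparallel
  have hG := isOperatorGroup_coordHolonomy hB.convex hB.continuousOn hB.mem
  have h1 : (Subgroup.closure (τ '' Φ.source) : Set _) ⊆ restrictedHolonomy cov Φ.source o := by
    intro L hL
    obtain ⟨A, hA, hLA⟩ := exists_operator_of_mem_closure hG (dchart (E := E) Φ o) (by
      rintro _ ⟨p, hp, rfl⟩
      exact ⟨_, h.rectangleTransport_mem (h.map_mem hp), hτ p hp⟩) hL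
    exact h.chart.mem_restrictedHolonomy h.adapted₁.convex h.mem (h.target_eq ▸ hA) hLA
  have h2 : holonomy cov Φ.source o ⊆ (Subgroup.closure (τ '' Φ.source) : Set _) := by
    intro L hL
    obtain ⟨A, hA, hLA⟩ := h.chart.coordHolonomy_of_mem h.mem hL
    rw [h.target_eq] at hA
    -- The operators that represent elements of the closure in the chart form a group, so
    -- `coordHolonomy_subset` can be applied to it.
    have hgroup : IsOperatorGroup {A : X₁ × X₂ →L[ℝ] X₁ × X₂ | ∃ L ∈ Subgroup.closure (τ '' Φ.source),
        ∀ v : TangentSpace 𝓘(ℝ, E) o, dchart (E := E) Φ o (L v) = A (dchart (E := E) Φ o v)} := by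
      let e := h.chart.tangentEquiv h.mem
      refine ⟨⟨1, one_mem _, fun v => rfl⟩, ?_, ?_⟩
      · rintro A A' ⟨L, hL, h⟩ ⟨L', hL', h'⟩
        exact ⟨L * L', mul_mem hL hL', fun v => (h (L' v)).trans (congrArg A (h' v))⟩
      · rintro A ⟨L, hL, h⟩
        let L' : E ≃ₗ[ℝ] E := L
        let A' : X₁ × X₂ →L[ℝ] X₁ × X₂ := LinearMap.toContinuousLinearMap
          ((e.toLinearEquiv.symm.trans L'.symm).trans e.toLinearEquiv).toLinearMap
        refine ⟨A', ⟨L⁻¹, inv_mem hL, fun v => ?_⟩, ContinuousLinearMap.ext fun w => ?_,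
          ContinuousLinearMap.ext fun w => ?_⟩
        · exact congrArg (fun z : E => e (L'.symm z)) (e.symm_apply_apply (v : E)).symm
        · show A (e (L'.symm (e.symm w))) = w
          refine (h (L'.symm (e.symm w))).symm.trans ?_
          exact (congrArg e (L'.apply_symm_apply _)).trans (e.apply_symm_apply w)
        · show e (L'.symm (e.symm (A w))) = w
          have h3 : A w = e (L' (e.symm w)) :=
            (congrArg A (e.apply_symm_apply w).symm).trans (h (e.symm w)).symm
          rw [h3, e.symm_apply_apply, L'.symm_apply_apply, e.apply_symm_apply]
    obtain ⟨L', hL', hLA'⟩ := hB.coordHolonomy_subset hgroup (by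
      intro y hy
      refine ⟨τ (Φ.symm y), Subgroup.subset_closure ⟨_, h.symm_mem hy, rfl⟩, fun v => ?_⟩
      have := hτ _ (h.symm_mem hy) v
      rwa [h.right_inv hy] at this) hA
    have : L = L' := LinearEquiv.ext fun v =>
      (h.chart.tangentEquiv h.mem).injective ((hLA v).trans (hLA' v).symm)
    exact this ▸ hL'
  have h3 := restrictedHolonomy_subset (cov := cov) (U := Φ.source) o
  exact ⟨h1.antisymm (h3.trans h2), (h1.trans h3).antisymm h2⟩

end IsProductChart

end ProductChart

/-! ### Flat parametrizations of slices in coordinates -/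

section FlatParam

variable {F : Type*} [NormedAddCommGroup F] [NormedSpace ℝ F] [FiniteDimensional ℝ F]
  {X : Type*} [NormedAddCommGroup X] [NormedSpace ℝ X] [FiniteDimensional ℝ X]
  {Γ : F → F →L[ℝ] F →L[ℝ] F} {B : Set F} {W : Submodule ℝ F} {y₀ : F} {φ : X → F} {D : Set X}

/-- A smooth injective map with invertible derivatives is a diffeomorphism onto an open set. -/
lemma exists_openPartialHomeomorph_of_injOn {f : X → X} {D : Set X} (hD : IsOpen D)
    (hf : ContDiffOn ℝ ∞ f D) (hinj : InjOn f D)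
    (hd : ∀ a ∈ D, Function.Injective (fderiv ℝ f a)) :
    ∃ G : OpenPartialHomeomorph X X, G.source = D ∧ G.target = f '' D ∧ (∀ a, G a = f a) ∧
      ContDiffOn ℝ ∞ G.symm G.target := by
  have hlocal : ∀ a ∈ D, ∃ e : OpenPartialHomeomorph X X, a ∈ e.source ∧ e.source ⊆ D ∧
      (∀ z, e z = f z) ∧ ContDiffOn ℝ ∞ e.symm e.target := by
    intro a ha
    have hfa := ((hf.contDiffAt (hD.mem_nhds ha)).differentiableAt (by simp)).hasFDerivAt
    let e' : X ≃L[ℝ] X :=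
      (LinearEquiv.ofInjectiveEndo (fderiv ℝ f a).toLinearMap (hd a ha)).toContinuousLinearEquiv
    have he' : (e' : X →L[ℝ] X) = fderiv ℝ f a := by ext; rfl
    obtain ⟨e, he1, he2, he3, -, he4⟩ := exists_smooth_local_inverse hD hf ha
      (f' := e') (by rw [he']; exact hfa)
    exact ⟨e, he1, he2, he3, he4⟩
  let P := hinj.toPartialEquiv f D
  have hg : ∀ a ∈ D, P.symm (f a) = a := fun a ha => P.left_inv ha
  have hnhds : ∀ u ∈ P.target, P.target ∈ 𝓝 u ∧ ContDiffAt ℝ ∞ P.symm u := by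
    rintro u ⟨a, ha, rfl⟩
    obtain ⟨e, he1, he2, he3, he4⟩ := hlocal a ha
    have hu : f a ∈ e.target := he3 a ▸ e.map_source he1
    have hsub : ∀ z ∈ e.target, z = f (e.symm z) := fun z hz => by rw [← he3, e.right_inv hz]
    refine ⟨Filter.mem_of_superset (e.open_target.mem_nhds hu) fun z hz =>
      ⟨e.symm z, he2 (e.map_target hz), (hsub z hz).symm⟩, ?_⟩
    refine (he4.contDiffAt (e.open_target.mem_nhds hu)).congr_of_eventuallyEq ?_
    filter_upwards [e.open_target.mem_nhds hu] with z hz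
    conv_lhs => rw [hsub z hz]
    exact hg _ (he2 (e.map_target hz))
  let G : OpenPartialHomeomorph X X :=
    { P with
      open_source := hD
      open_target := isOpen_iff_mem_nhds.2 fun u hu => (hnhds u hu).1
      continuousOn_toFun := hf.continuousOn
      continuousOn_invFun := fun u hu => (hnhds u hu).2.continuousAt.continuousWithinAt }
  exact ⟨G, rfl, rfl, fun _ => rfl, fun u hu => (hnhds u hu).2.contDiffWithinAt⟩

/-- `A` parametrizes the subspace `W`, and `R` is a linear extension of the inverse of `A`. -/
structure IsSplitting (W : Submodule ℝ F) (R : F →L[ℝ] X) (A : X →L[ℝ] F) : Prop where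
  mem : ∀ u, A u ∈ W
  left_inv : ∀ w ∈ W, A (R w) = w
  right_inv : ∀ u, R (A u) = u

/-- `φ` is a smooth injective parametrization, by the open set `D`, of the slice of `B` through `y₀`
parallel to `W`, whose coordinate fields are parallel. -/
structure IsFlatParam (Γ : F → F →L[ℝ] F →L[ℝ] F) (B : Set F) (W : Submodule ℝ F) (y₀ : F)
    (φ : X → F) (D : Set X) : Prop where
  isOpen : IsOpen D
  smooth : ContDiffOn ℝ ∞ φ D
  injOn : InjOn φ D
  image : φ '' D = {y ∈ B | y - y₀ ∈ W}
  immersion : ∀ a ∈ D, Function.Injective (fderiv ℝ φ a)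
  flat : ∀ a ∈ D, ∀ u w, fderiv ℝ (fun b => fderiv ℝ φ b w) a u +
    Γ (φ a) (fderiv ℝ φ a u) (fderiv ℝ φ a w) = 0

/-- `G` is the coordinate expression of the inverse of the parametrization `φ` of a slice. -/
structure IsSliceChart (B : Set F) (R : F →L[ℝ] X) (A : X →L[ℝ] F) (y₀ : F) (φ : X → F) (D : Set X)
    (G : OpenPartialHomeomorph X X) : Prop where
  source_eq : G.source = {u | y₀ + A (u - R y₀) ∈ B}
  target_eq : G.target = D
  symm_apply : ∀ a, G.symm a = R (φ a)
  smooth : ContDiffOn ℝ ∞ G G.source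
  param_apply : ∀ u ∈ G.source, φ (G u) = y₀ + A (u - R y₀)

namespace IsFlatParam

variable (h : IsFlatParam Γ B W y₀ φ D)
include h

lemma map_mem {a : X} (ha : a ∈ D) : φ a ∈ B ∧ φ a - y₀ ∈ W := by
  have : φ a ∈ φ '' D := ⟨a, ha, rfl⟩
  rwa [h.image] at this

lemma differentiableAt {a : X} (ha : a ∈ D) : DifferentiableAt ℝ φ a :=
  (h.smooth.contDiffAt (h.isOpen.mem_nhds ha)).differentiableAt (by simp)

lemma fderiv_mem {a : X} (ha : a ∈ D) (w : X) : fderiv ℝ φ a w ∈ W := by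
  obtain ⟨q, hq, -⟩ := exists_projection_along W
  have h1 : HasFDerivAt (fun b => q (φ b - y₀)) (q ∘L fderiv ℝ φ a) a :=
    q.hasFDerivAt.comp a ((h.differentiableAt ha).hasFDerivAt.sub_const y₀)
  have h2 : (fun b => q (φ b - y₀)) =ᶠ[𝓝 a] fun _ => 0 := by
    filter_upwards [h.isOpen.mem_nhds ha] with b hb
    exact (hq _).2 (h.map_mem hb).2
  have h3 := h1.unique ((hasFDerivAt_const (0 : F) a).congr_of_eventuallyEq h2)
  exact (hq _).1 (congrArg (fun T : X →L[ℝ] F => T w) h3)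

variable {R : F →L[ℝ] X} {A : X →L[ℝ] F} (hs : IsSplitting W R A)
include hs

lemma eq_of_proj {a : X} (ha : a ∈ D) : φ a = y₀ + A (R (φ a) - R y₀) := by
  rw [← map_sub, hs.left_inv _ (h.map_mem ha).2, add_sub_cancel]

/-- The inverse of a flat parametrization is a smooth chart of the slice. -/
lemma exists_chart : ∃ G, IsSliceChart B R A y₀ φ D G := by
  -- Reading the point of the slice in linear coordinates makes `φ` a map between spaces of the same
  -- dimension, so that the inverse function theorem applies.
  let f : X → X := fun a => R (φ a)
  have hf : ContDiffOn ℝ ∞ f D := R.contDiff.comp_contDiffOn h.smooth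
  have hinj : InjOn f D := by
    intro a ha b hb hab
    refine h.injOn ha hb ?_
    rw [h.eq_of_proj hs ha, h.eq_of_proj hs hb]
    exact congrArg (fun u => y₀ + A (u - R y₀)) hab
  have himage : f '' D = {u | y₀ + A (u - R y₀) ∈ B} := by
    ext u
    constructor
    · rintro ⟨a, ha, rfl⟩
      show y₀ + A (R (φ a) - R y₀) ∈ B
      rw [← h.eq_of_proj hs ha]
      exact (h.map_mem ha).1
    · intro hu
      have h1 : y₀ + A (u - R y₀) ∈ φ '' D := by
        rw [h.image]
        exact ⟨hu, by rw [add_sub_cancel_left]; exact hs.mem _⟩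
      obtain ⟨a, ha, hau⟩ := h1
      refine ⟨a, ha, ?_⟩
      show R (φ a) = u
      rw [hau, map_add, hs.right_inv, add_sub_cancel]
  have hd : ∀ a ∈ D, Function.Injective (fderiv ℝ f a) := by
    intro a ha u v huv
    have hfa : HasFDerivAt f (R ∘L fderiv ℝ φ a) a :=
      R.hasFDerivAt.comp a (h.differentiableAt ha).hasFDerivAt
    rw [hfa.fderiv] at huv
    have h1 : R (fderiv ℝ φ a u) = R (fderiv ℝ φ a v) := huv
    refine h.immersion a ha ?_
    rw [← hs.left_inv _ (h.fderiv_mem ha u), h1, hs.left_inv _ (h.fderiv_mem ha v)]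
  obtain ⟨G, hGs, hGt, hG, hGsymm⟩ := exists_openPartialHomeomorph_of_injOn h.isOpen hf hinj hd
  refine ⟨G.symm, hGt.trans himage, hGs, hG, hGsymm, fun u hu => ?_⟩
  have h1 := h.eq_of_proj hs (hGs ▸ G.map_target hu)
  have h2 : R (φ (G.symm u)) = u := (hG _).symm.trans (G.right_inv hu)
  rwa [h2] at h1

/-- Parallel transport in a slice takes coordinate vectors to coordinate vectors. -/
lemma segmentTransport_fderiv (hB : Convex ℝ B) (hΓ : ContinuousOn Γ B) {a b : X} (ha : a ∈ D)
    (hb : b ∈ D) (w : X) :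
    segmentTransport Γ (φ a) (φ b) (fderiv ℝ φ a w) = fderiv ℝ φ b w := by
  obtain ⟨G, ⟨hGs, hGt, hGf, hG, hGφ⟩⟩ := h.exists_chart hs
  have hGD : ∀ a ∈ D, G (R (φ a)) = a := fun a ha => by
    rw [← hGf]; exact G.right_inv (hGt ▸ ha)
  have hline : ∀ t : ℝ, φ a + t • (φ b - φ a) =
      y₀ + A (R (φ a + t • (φ b - φ a)) - R y₀) := by
    intro t
    have h1 := h.eq_of_proj hs ha
    have h2 := h.eq_of_proj hs hb
    rw [← map_sub] at h1 h2 ⊢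
    simp only [map_sub, map_add, map_smul] at h1 h2 ⊢
    linear_combination (norm := module) (1 - t) • h1 + t • h2
  have hmem : ∀ t ∈ Icc (0 : ℝ) 1, R (φ a + t • (φ b - φ a)) ∈ G.source := by
    intro t ht
    rw [hGs]
    show y₀ + A _ ∈ B
    rw [← hline]
    exact segment_mem hB (h.map_mem ha).1 (h.map_mem hb).1 ht
  -- The flat coordinates of the points of the straight segment; the flatness equation is then used
  -- along this curve.
  let α : ℝ → X := fun t => G (R (φ a + t • (φ b - φ a)))
  have hαD : ∀ t ∈ Icc (0 : ℝ) 1, α t ∈ D := fun t ht => hGt ▸ G.map_source (hmem t ht)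
  have hα0 : α 0 = a := by simp only [α, zero_smul, add_zero]; exact hGD a ha
  have hα1 : α 1 = b := by simp only [α, one_smul, add_sub_cancel]; exact hGD b hb
  have hφα : ∀ t ∈ Icc (0 : ℝ) 1, φ (α t) = φ a + t • (φ b - φ a) := fun t ht => by
    rw [hGφ _ (hmem t ht), ← hline]
  have hdφ : ContDiffOn ℝ ∞ (fun z => fderiv ℝ φ z w) D :=
    (h.smooth.fderiv_of_isOpen h.isOpen (m := ∞) (by simp)).clm_apply contDiffOn_const
  have hlinec : ∀ t : ℝ, HasDerivAt (fun t : ℝ => φ a + t • (φ b - φ a)) (φ b - φ a) t := fun t => by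
    simpa using ((hasDerivAt_id t).smul_const (φ b - φ a)).const_add (φ a)
  have hαc : ContinuousOn α (Icc 0 1) := hG.continuousOn.comp
    (by fun_prop : Continuous fun t : ℝ => R (φ a + t • (φ b - φ a))).continuousOn hmem
  have key := segmentTransport_eq_of_parallel hB hΓ (h.map_mem ha).1 (h.map_mem hb).1
    (ξ := fun t => fderiv ℝ φ (α t) w) ⟨hdφ.continuousOn.comp hαc hαD, finite_empty.subset ?_⟩
  · simpa only [hα0, hα1] using key
  rintro t ⟨ht, hn⟩
  have htI := Ioo_subset_Icc_self ht
  have hαd : HasDerivAt α (fderiv ℝ G (R (φ a + t • (φ b - φ a))) (R (φ b - φ a))) t :=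
    ((hG.contDiffAt (G.open_source.mem_nhds (hmem t htI))).differentiableAt
      (by simp)).hasFDerivAt.comp_hasDerivAt t (R.hasFDerivAt.comp_hasDerivAt t (hlinec t))
  set α' := fderiv ℝ G (R (φ a + t • (φ b - φ a))) (R (φ b - φ a))
  have h1 : HasDerivAt (fun s => φ (α s)) (fderiv ℝ φ (α t) α') t :=
    (h.differentiableAt (hαD t htI)).hasFDerivAt.comp_hasDerivAt t hαd
  have h2 : fderiv ℝ φ (α t) α' = φ b - φ a := by
    refine h1.unique ((hlinec t).congr_of_eventuallyEq ?_)
    filter_upwards [Icc_mem_nhds ht.1 ht.2] with s hs using hφα s hs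
  refine hn ⟨φ b - φ a, hlinec t, ?_⟩
  have h3 := ((hdφ.contDiffAt (h.isOpen.mem_nhds (hαD t htI))).differentiableAt
    (by simp)).hasFDerivAt.comp_hasDerivAt t hαd
  refine h3.congr_deriv ?_
  -- Flatness in the direction of `α` says that the coordinate vector in direction `w` is parallel
  -- along the segment.
  have h4 := h.flat _ (hαD t htI) α' w
  rw [h2, hφα t htI] at h4
  exact eq_neg_of_add_eq_zero_left h4

/-- Differentiate the identity that `φ ∘ G` is the affine parametrization of the slice. -/
lemma fderiv_sliceChart {G : OpenPartialHomeomorph X X} (hG : IsSliceChart B R A y₀ φ D G) {u : X}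
    (hu : u ∈ G.source) (v : X) : fderiv ℝ φ (G u) (fderiv ℝ G u v) = A v := by
  have hGu : G u ∈ D := hG.target_eq ▸ G.map_source hu
  have h1 : HasFDerivAt (fun z => φ (G z)) (fderiv ℝ φ (G u) ∘L fderiv ℝ G u) u :=
    (h.differentiableAt hGu).hasFDerivAt.comp u
      ((hG.smooth.contDiffAt (G.open_source.mem_nhds hu)).differentiableAt (by simp)).hasFDerivAt
  have h2 : HasFDerivAt (fun z => y₀ + A (z - R y₀)) A u :=
    (A.hasFDerivAt.comp u ((hasFDerivAt_id u).sub_const (R y₀))).const_add y₀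
  have h3 := h1.unique (h2.congr_of_eventuallyEq (Filter.eventually_of_mem
    (G.open_source.mem_nhds hu) hG.param_apply))
  exact congrArg (fun T : X →L[ℝ] F => T v) h3

lemma sliceChart_param {G : OpenPartialHomeomorph X X} (hG : IsSliceChart B R A y₀ φ D G) {a : X}
    (ha : a ∈ D) : G (R (φ a)) = a := by
  rw [← hG.symm_apply]; exact G.right_inv (hG.target_eq ▸ ha)

end IsFlatParam

end FlatParam

/-! ### Flat coordinates on a leaf as flat parametrizations -/

section FlatCoord

variable {E : Type*} [NormedAddCommGroup E] [NormedSpace ℝ E]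
  {M : Type*} [TopologicalSpace M] [ChartedSpace E M] [IsManifold 𝓘(ℝ, E) ∞ M]
  {F : Type*} [NormedAddCommGroup F] [NormedSpace ℝ F] [FiniteDimensional ℝ F]
  {Φ : OpenPartialHomeomorph M F}
  {cov : CovariantDerivative 𝓘(ℝ, E) E (TangentSpace 𝓘(ℝ, E) : M → Type _)} {o : M}
  {V V' : Submodule ℝ (TangentSpace 𝓘(ℝ, E) o)} {W W' : Submodule ℝ F} {n : ℕ}

/-- The differential of a map from a normed space. -/
def dparam {X : Type*} [NormedAddCommGroup X] [NormedSpace ℝ X] (f : X → M) (a : X) : X →L[ℝ] E :=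
  (mfderiv 𝓘(ℝ, X) 𝓘(ℝ, E) f a : TangentSpace 𝓘(ℝ, X) a →L[ℝ] TangentSpace 𝓘(ℝ, E) (f a))

lemma IsSmoothChart.fderiv_comp (hΦ : IsSmoothChart (E := E) Φ) {X : Type*}
    [NormedAddCommGroup X] [NormedSpace ℝ X] {f : X → M} {a : X}
    (hf : MDifferentiableAt 𝓘(ℝ, X) 𝓘(ℝ, E) f a) (ha : f a ∈ Φ.source) :
    fderiv ℝ (fun b => Φ (f b)) a = dchart (E := E) Φ (f a) ∘L dparam (E := E) f a := by
  have h : HasFDerivAt (fun b => Φ (f b)) (dchart (E := E) Φ (f a) ∘L dparam (E := E) f a) a :=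
    hasMFDerivAt_iff_hasFDerivAt.1
      (HasMFDerivAt.comp a (hΦ.mdifferentiableAt ha).hasMFDerivAt hf.hasMFDerivAt)
  exact h.fderiv

lemma IsSmoothChart.components_coordVec (hΦ : IsSmoothChart (E := E) Φ) {f : (Fin n → ℝ) → M}
    {a : Fin n → ℝ} (hf : MDifferentiableAt 𝓘(ℝ, Fin n → ℝ) 𝓘(ℝ, E) f a) (ha : f a ∈ Φ.source)
    (i : Fin n) : components Φ (coordVec (E := E) f a i) =
      fderiv ℝ (fun b => Φ (f b)) a (Pi.single i 1) := by
  rw [hΦ.fderiv_comp hf ha]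
  rfl

/-- Flat coordinates are specified by covariant derivatives along coordinate lines on `M`; in the
chart these become the bilinear flatness equation for all pairs of directions. -/
lemma IsFlatCoord.isFlatParam {r : M} {x : PartialEquiv M (Fin n → ℝ)}
    (hx : IsFlatCoord cov (leaf cov Φ.source o V r) x) (h : IsAdaptedChart cov o V Φ W)
    (hr : r ∈ Φ.source) :
    IsFlatParam (christoffel cov Φ) Φ.target W (Φ r) (fun a => Φ (x.symm a)) x.target := by
  have hleaf : ∀ a ∈ x.target, x.symm a ∈ leaf cov Φ.source o V r := fun a ha =>
    hx.source_eq ▸ x.map_target ha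
  have hsrc : ∀ a ∈ x.target, x.symm a ∈ Φ.source := fun a ha =>
    ((h.mem_leaf_iff hr).1 (hleaf a ha)).1
  have hmd : ∀ a ∈ x.target, MDifferentiableAt 𝓘(ℝ, Fin n → ℝ) 𝓘(ℝ, E) x.symm a := fun a ha =>
    ((hx.smooth_symm a ha).contMDiffAt (hx.isOpen_target.mem_nhds ha)).mdifferentiableAt (by simp)
  have hsm : ContDiffOn ℝ ∞ (fun a => Φ (x.symm a)) x.target :=
    contMDiffOn_iff_contDiffOn.1 (h.chart.smooth.comp hx.smooth_symm hsrc)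
  refine ⟨hx.isOpen_target, hsm, ?_, ?_, ?_, ?_⟩
  · intro a ha b hb hab
    exact x.symm.injOn ha hb (Φ.injOn (hsrc a ha) (hsrc b hb) hab)
  · ext y
    constructor
    · rintro ⟨a, ha, rfl⟩
      exact ⟨Φ.map_source (hsrc a ha), ((h.mem_leaf_iff hr).1 (hleaf a ha)).2⟩
    · rintro ⟨hy, hyW⟩
      have h1 : Φ.symm y ∈ x.source := by
        rw [hx.source_eq, h.mem_leaf_iff hr, Φ.right_inv hy]
        exact ⟨Φ.map_target hy, hyW⟩
      refine ⟨x (Φ.symm y), x.map_source h1, ?_⟩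
      show Φ (x.symm (x (Φ.symm y))) = y
      rw [x.left_inv h1, Φ.right_inv hy]
  · intro a ha u v huv
    rw [h.chart.fderiv_comp (hmd a ha) (hsrc a ha)] at huv
    exact hx.immersion a ha ((h.chart.tangentEquiv (hsrc a ha)).injective huv)
  · intro a ha u w
    -- The left side of the flatness equation as a bilinear map, which vanishes once it does so on
    -- pairs of basis vectors.
    let Q : (Fin n → ℝ) →L[ℝ] (Fin n → ℝ) →L[ℝ] F :=
      fderiv ℝ (fun b => fderiv ℝ (fun a => Φ (x.symm a)) b) a +
      ((ContinuousLinearMap.compL ℝ (Fin n → ℝ) F F).flip (fderiv ℝ (fun a => Φ (x.symm a)) a)) ∘L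
        (christoffel cov Φ (Φ (x.symm a)) ∘L fderiv ℝ (fun a => Φ (x.symm a)) a)
    have hdd : DifferentiableAt ℝ (fun b => fderiv ℝ (fun a => Φ (x.symm a)) b) a :=
      ((hsm.fderiv_of_isOpen hx.isOpen_target (m := ∞) (by simp)).contDiffAt
        (hx.isOpen_target.mem_nhds ha)).differentiableAt (by simp)
    have hQ : ∀ u w, Q u w = fderiv ℝ (fun b => fderiv ℝ (fun a => Φ (x.symm a)) b w) a u +
        christoffel cov Φ (Φ (x.symm a)) (fderiv ℝ (fun a => Φ (x.symm a)) a u)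
          (fderiv ℝ (fun a => Φ (x.symm a)) a w) := by
      intro u w
      have e1 := (hdd.hasFDerivAt.clm_apply (hasFDerivAt_const w a)).fderiv
      rw [e1]
      simp [Q]
    have hQ0 : Q = 0 := by
      have hb : ∀ i j : Fin n, Q (Pi.single i 1) (Pi.single j 1) = 0 := by
        intro i j
        have hl : Continuous fun s : ℝ => a + s • (Pi.single i 1 : Fin n → ℝ) := by fun_prop
        have hld : HasDerivAt (fun s : ℝ => a + s • (Pi.single i 1 : Fin n → ℝ))
            (Pi.single i 1) 0 := by
          simpa using ((hasDerivAt_id (0 : ℝ)).smul_const (Pi.single i 1 : Fin n → ℝ)).const_add a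
        have ha0 : a + (0 : ℝ) • (Pi.single i 1 : Fin n → ℝ) = a := by simp
        have hev : ∀ᶠ s : ℝ in 𝓝 0, a + s • (Pi.single i 1 : Fin n → ℝ) ∈ x.target :=
          hl.continuousAt.eventually (hx.isOpen_target.mem_nhds (by simpa using ha))
        obtain ⟨c', hc', hcd⟩ := h.chart.hasDerivAt_of_hasCovDerivAlongAt (hx.flat a ha i j)
          (by show x.symm (a + (0 : ℝ) • (Pi.single i 1 : Fin n → ℝ)) ∈ Φ.source
              rw [ha0]; exact hsrc a ha)
        have e1 : HasDerivAt (fun s : ℝ => Φ (x.symm (a + s • (Pi.single i 1 : Fin n → ℝ))))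
            (fderiv ℝ (fun a => Φ (x.symm a)) a (Pi.single i 1)) 0 :=
          hasDerivAt_comp_line ((hsm.contDiffAt
            (hx.isOpen_target.mem_nhds ha)).differentiableAt (by simp))
        have e2 : c' = fderiv ℝ (fun a => Φ (x.symm a)) a (Pi.single i 1) := hc'.unique e1
        have e3 : (fun s : ℝ => components Φ (coordVec (E := E) x.symm
            (a + s • (Pi.single i 1 : Fin n → ℝ)) j)) =ᶠ[𝓝 0] fun s : ℝ =>
            fderiv ℝ (fun a => Φ (x.symm a)) (a + s • (Pi.single i 1 : Fin n → ℝ))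
              (Pi.single j 1) := by
          filter_upwards [hev] with s hs
          exact h.chart.components_coordVec (hmd _ hs) (hsrc _ hs) j
        have e4 := hcd.unique ((hasDerivAt_comp_line (u := (Pi.single i 1 : Fin n → ℝ))
          (hdd.clm_apply (differentiableAt_const (Pi.single j 1)))).congr_of_eventuallyEq e3)
        have e5 : components Φ (coordVec (E := E) x.symm
            (a + (0 : ℝ) • (Pi.single i 1 : Fin n → ℝ)) j) =
            fderiv ℝ (fun a => Φ (x.symm a)) a (Pi.single j 1) := by
          refine e3.self_of_nhds.trans ?_
          show fderiv ℝ (fun a => Φ (x.symm a)) (a + (0 : ℝ) • (Pi.single i 1 : Fin n → ℝ)) _ = _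
          rw [ha0]
        rw [e5, e2] at e4
        have e6 : Φ (coordVec (E := E) x.symm
            (a + (0 : ℝ) • (Pi.single i 1 : Fin n → ℝ)) j).proj = Φ (x.symm a) :=
          congrArg (fun b => Φ (x.symm b)) ha0
        rw [e6] at e4
        rw [hQ, ← e4, neg_add_cancel]
      refine ContinuousLinearMap.coe_injective (LinearMap.pi_ext' fun i => LinearMap.ext_ring ?_)
      refine ContinuousLinearMap.coe_injective (LinearMap.pi_ext' fun j => LinearMap.ext_ring ?_)
      exact hb i j
    rw [← hQ u w, hQ0]
    rfl

end FlatCoord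

/-! ### Coordinate vectors of flat coordinates as transports -/

section FlatFormulas

variable {E : Type*} [NormedAddCommGroup E] [NormedSpace ℝ E]
  {M : Type*} [TopologicalSpace M] [ChartedSpace E M] [IsManifold 𝓘(ℝ, E) ∞ M]
  {F : Type*} [NormedAddCommGroup F] [NormedSpace ℝ F] [FiniteDimensional ℝ F]
  {Φ : OpenPartialHomeomorph M F}
  {cov : CovariantDerivative 𝓘(ℝ, E) E (TangentSpace 𝓘(ℝ, E) : M → Type _)} {o : M}
  {V V' : Submodule ℝ (TangentSpace 𝓘(ℝ, E) o)} {W W' : Submodule ℝ F} {n : ℕ}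
  {R : F →L[ℝ] (Fin n → ℝ)} {A : (Fin n → ℝ) →L[ℝ] F}

lemma IsSmoothChart.components_coordVec_symm (hΦ : IsSmoothChart (E := E) Φ) {g : (Fin n → ℝ) → F}
    {a : Fin n → ℝ} (hg : DifferentiableAt ℝ g a) (ha : g a ∈ Φ.target) (i : Fin n) :
    components Φ (coordVec (E := E) (fun b => Φ.symm (g b)) a i) =
      fderiv ℝ g a (Pi.single i 1) := by
  have h1 : MDifferentiableAt 𝓘(ℝ, Fin n → ℝ) 𝓘(ℝ, E) (fun b => Φ.symm (g b)) a :=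
    MDifferentiableAt.comp a (hΦ.mdifferentiableAt_symm ha) hg.mdifferentiableAt
  have h2 : (fun b => Φ (Φ.symm (g b))) =ᶠ[𝓝 a] g := by
    filter_upwards [hg.continuousAt.eventually (Φ.open_target.mem_nhds ha)] with b hb
    exact Φ.right_inv hb
  rw [hΦ.components_coordVec h1 (Φ.map_target ha), h2.fderiv_eq]

lemma IsFlatCoord.mdifferentiableAt_symm {L : Set M} {x : PartialEquiv M (Fin n → ℝ)}
    (hx : IsFlatCoord cov L x) {a : Fin n → ℝ} (ha : a ∈ x.target) :
    MDifferentiableAt 𝓘(ℝ, Fin n → ℝ) 𝓘(ℝ, E) x.symm a :=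
  ((hx.smooth_symm a ha).contMDiffAt (hx.isOpen_target.mem_nhds ha)).mdifferentiableAt (by simp)

lemma IsFlatCoord.components_coordVec {r : M} {x : PartialEquiv M (Fin n → ℝ)}
    (hx : IsFlatCoord cov (leaf cov Φ.source o V r) x) (h : IsAdaptedChart cov o V Φ W)
    (hr : r ∈ Φ.source) {p : M} (hp : p ∈ leaf cov Φ.source o V r) (i : Fin n) :
    components Φ (coordVec (E := E) x.symm (x p) i) =
      fderiv ℝ (fun a => Φ (x.symm a)) (x p) (Pi.single i 1) := by
  have hps : p ∈ x.source := hx.source_eq ▸ hp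
  refine h.chart.components_coordVec (hx.mdifferentiableAt_symm (x.map_source hps)) ?_ i
  rw [x.left_inv hps]
  exact ((h.mem_leaf_iff hr).1 hp).1

/-- Coordinate fields of flat coordinates are parallel, so their value at `r` determines them on the
whole leaf. -/
lemma IsFlatCoord.components_eq_segmentTransport {r : M} {x : PartialEquiv M (Fin n → ℝ)}
    (hx : IsFlatCoord cov (leaf cov Φ.source o V r) x) (h : IsAdaptedChart cov o V Φ W)
    (hΓ : ContinuousOn (christoffel cov Φ) Φ.target) (hs : IsSplitting W R A)
    (hr : r ∈ Φ.source) {p : M} (hp : p ∈ leaf cov Φ.source o V r) (i : Fin n) :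
    components Φ (coordVec (E := E) x.symm (x p) i) =
      segmentTransport (christoffel cov Φ) (Φ r) (Φ p)
        (components Φ (coordVec (E := E) x.symm (x r) i)) := by
  have hrl : r ∈ leaf cov Φ.source o V r :=
    (h.mem_leaf_iff hr).2 ⟨hr, by rw [sub_self]; exact W.zero_mem⟩
  have hps : p ∈ x.source := hx.source_eq ▸ hp
  have hrs : r ∈ x.source := hx.source_eq ▸ hrl
  have key := (hx.isFlatParam h hr).segmentTransport_fderiv hs h.convex hΓ (x.map_source hrs)
    (x.map_source hps) (Pi.single i 1)
  rw [x.left_inv hrs, x.left_inv hps] at key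
  rw [hx.components_coordVec h hr hp, hx.components_coordVec h hr hrl, key]

lemma IsFlatCoordOrigin.components_eq {b : Module.Basis (Fin n) ℝ V} {x : PartialEquiv M (Fin n → ℝ)}
    (hx : IsFlatCoordOrigin cov Φ.source o V b x) (h : IsAdaptedChart cov o V Φ W)
    (hΓ : ContinuousOn (christoffel cov Φ) Φ.target) (hs : IsSplitting W R A)
    {p : M} (hp : p ∈ leaf cov Φ.source o V o) (i : Fin n) :
    components Φ (coordVec (E := E) x.symm (x p) i) =
      segmentTransport (christoffel cov Φ) (Φ o) (Φ p) (dchart (E := E) Φ o (b i).1) := by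
  rw [hx.1.components_eq_segmentTransport h hΓ hs h.mem hp, hx.2 i]
  rfl

/-- The path that normalizes the coordinates at `r` is any path in the other leaf through `o`;
flatness of that leaf replaces it by the segment. -/
lemma IsFlatCoordAt.components_eq {b : Module.Basis (Fin n) ℝ V} {x : PartialEquiv M (Fin n → ℝ)}
    {r : M} (hx : IsFlatCoordAt cov Φ.source o V V' b r x) (h : IsAdaptedChart cov o V Φ W)
    (h' : IsAdaptedChart cov o V' Φ W')
    (hB : IsBiparallel (christoffel cov Φ) Φ.target (Φ o) W W') (hs : IsSplitting W R A)
    {p : M} (hr : r ∈ Φ.source) (hp : p ∈ leaf cov Φ.source o V r) (i : Fin n) :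
    components Φ (coordVec (E := E) x.symm (x p) i) =
      segmentTransport (christoffel cov Φ) (Φ r) (Φ p)
        (segmentTransport (christoffel cov Φ) (Φ o) (Φ r) (dchart (E := E) Φ o (b i).1)) := by
  obtain ⟨hx, c, hc, hci⟩ := hx
  rw [hx.components_eq_segmentTransport h hB.continuousOn hs hr hp]
  have hcs : ∀ t ∈ Icc (0 : ℝ) 1, c t ∈ Φ.source ∧ Φ (c t) - Φ o ∈ W' := fun t ht =>
    (h'.mem_leaf_iff h.mem).1 (hc.mem t ht)
  obtain ⟨-, -, ξ, hξ, hξ0, hξ1⟩ := h.chart.parallel_of_transports zero_le_one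
    (fun t ht => (hcs t ht).1) (hci i)
  have hcp := h.chart.piecewiseC1On hc.piecewise fun t ht => (hcs t ht).1
  have hη := hB.swap.isParallelCurve_leaf zero_le_one hcp
    (fun t ht => Φ.map_source (hcs t ht).1)
    (fun t ht => by rw [hc.source]; exact (hcs t ht).2) (dchart (E := E) Φ o (b i).1)
  have hself : segmentTransport (christoffel cov Φ) (Φ (c 0)) (Φ (c 0))
      (dchart (E := E) Φ o (b i).1) = dchart (E := E) Φ o (b i).1 := by
    rw [segmentTransport_self hB.convex hB.continuousOn
      (Φ.map_source (hcs 0 ⟨le_rfl, zero_le_one⟩).1)]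
    rfl
  have e := hξ.eq hB.continuousOn zero_le_one hcp (fun t ht => Φ.map_source (hcs t ht).1) hη
    (by rw [hself, hξ0]; rfl)
  rw [hξ1, hc.source, hc.target] at e
  rw [e]

/-- Expresses the possibly wild map `x`, given only on the leaf, through a smooth chart of the
slice. -/
lemma IsFlatCoord.apply_eq {r : M} {x : PartialEquiv M (Fin n → ℝ)}
    (hx : IsFlatCoord cov (leaf cov Φ.source o V r) x) (h : IsAdaptedChart cov o V Φ W)
    (hs : IsSplitting W R A) (hr : r ∈ Φ.source)
    {G : OpenPartialHomeomorph (Fin n → ℝ) (Fin n → ℝ)}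
    (hG : IsSliceChart Φ.target R A (Φ r) (fun a => Φ (x.symm a)) x.target G)
    {p : M} (hp : p ∈ leaf cov Φ.source o V r) : x p = G (R (Φ p)) := by
  have hps : p ∈ x.source := hx.source_eq ▸ hp
  have := (hx.isFlatParam h hr).sliceChart_param hs hG (x.map_source hps)
  rw [x.left_inv hps] at this
  exact this.symm

end FlatFormulas

/-! ### The chart built from flat coordinates on the two leaves through `o` -/

section ProductFormulas

variable {E : Type*} [NormedAddCommGroup E] [NormedSpace ℝ E]
  {M : Type*} [TopologicalSpace M] [ChartedSpace E M] [IsManifold 𝓘(ℝ, E) ∞ M]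
  {n₁ n₂ : ℕ} {cov : CovariantDerivative 𝓘(ℝ, E) E (TangentSpace 𝓘(ℝ, E) : M → Type _)} {o : M}
  {V₁ V₂ : Submodule ℝ (TangentSpace 𝓘(ℝ, E) o)}
  {Φ : OpenPartialHomeomorph M ((Fin n₁ → ℝ) × (Fin n₂ → ℝ))} {B₁ : Set (Fin n₁ → ℝ)}
  {B₂ : Set (Fin n₂ → ℝ)}

lemma isSplitting_factorOne (X₁ X₂ : Type*) [NormedAddCommGroup X₁] [NormedSpace ℝ X₁]
    [FiniteDimensional ℝ X₁] [NormedAddCommGroup X₂] [NormedSpace ℝ X₂] [FiniteDimensional ℝ X₂] :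
    IsSplitting (factorOne X₁ X₂)
      (ContinuousLinearMap.fst ℝ X₁ X₂) (ContinuousLinearMap.inl ℝ X₁ X₂) :=
  ⟨fun _ => rfl, fun _ hw => Prod.ext rfl (mem_factorOne.1 hw).symm, fun _ => rfl⟩

lemma isSplitting_factorTwo (X₁ X₂ : Type*) [NormedAddCommGroup X₁] [NormedSpace ℝ X₁]
    [FiniteDimensional ℝ X₁] [NormedAddCommGroup X₂] [NormedSpace ℝ X₂] [FiniteDimensional ℝ X₂] :
    IsSplitting (factorTwo X₁ X₂)
      (ContinuousLinearMap.snd ℝ X₁ X₂) (ContinuousLinearMap.inr ℝ X₁ X₂) :=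
  ⟨fun _ => rfl, fun _ hw => Prod.ext (mem_factorTwo.1 hw).symm rfl, fun _ => rfl⟩

namespace IsProductChart

variable (h : IsProductChart cov o V₁ V₂ Φ B₁ B₂)
include h

lemma slice_source₁ {r : M} (hr : r ∈ Φ.source) {φ : (Fin n₁ → ℝ) → (Fin n₁ → ℝ) × (Fin n₂ → ℝ)}
    {D : Set (Fin n₁ → ℝ)} {G : OpenPartialHomeomorph (Fin n₁ → ℝ) (Fin n₁ → ℝ)}
    (hG : IsSliceChart Φ.target (ContinuousLinearMap.fst ℝ _ _) (ContinuousLinearMap.inl ℝ _ _)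
      (Φ r) φ D G) : G.source = B₁ := by
  rw [hG.source_eq, h.target_eq]
  ext u
  have : Φ r + ContinuousLinearMap.inl ℝ (Fin n₁ → ℝ) (Fin n₂ → ℝ)
      (u - ContinuousLinearMap.fst ℝ _ _ (Φ r)) = (u, (Φ r).2) := by
    ext <;> simp
  rw [mem_ofPred_eq, this]
  exact ⟨fun hu => hu.1, fun hu => ⟨hu, (h.map_mem hr).2⟩⟩

lemma slice_source₂ {r : M} (hr : r ∈ Φ.source) {φ : (Fin n₂ → ℝ) → (Fin n₁ → ℝ) × (Fin n₂ → ℝ)}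
    {D : Set (Fin n₂ → ℝ)} {G : OpenPartialHomeomorph (Fin n₂ → ℝ) (Fin n₂ → ℝ)}
    (hG : IsSliceChart Φ.target (ContinuousLinearMap.snd ℝ _ _) (ContinuousLinearMap.inr ℝ _ _)
      (Φ r) φ D G) : G.source = B₂ := by
  rw [hG.source_eq, h.target_eq]
  ext u
  have : Φ r + ContinuousLinearMap.inr ℝ (Fin n₁ → ℝ) (Fin n₂ → ℝ)
      (u - ContinuousLinearMap.snd ℝ _ _ (Φ r)) = ((Φ r).1, u) := by
    ext <;> simp
  rw [mem_ofPred_eq, this]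
  exact ⟨fun hu => hu.2, fun hu => ⟨(h.map_mem hr).1, hu⟩⟩

lemma biparallel' : IsBiparallel (christoffel cov Φ) Φ.target (Φ o) (factorOne _ _) (factorTwo _ _) :=
  h.target_eq ▸ h.biparallel

lemma continuousOn_christoffel : ContinuousOn (christoffel cov Φ) Φ.target :=
  h.biparallel'.continuousOn

variable {xo : PartialEquiv M (Fin n₁ → ℝ)} {yo : PartialEquiv M (Fin n₂ → ℝ)}
  {G₁ : OpenPartialHomeomorph (Fin n₁ → ℝ) (Fin n₁ → ℝ)}
  {G₂ : OpenPartialHomeomorph (Fin n₂ → ℝ) (Fin n₂ → ℝ)}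
  (hxo : IsFlatCoord cov (leaf cov Φ.source o V₁ o) xo)
  (hyo : IsFlatCoord cov (leaf cov Φ.source o V₂ o) yo)
  (hG₁ : IsSliceChart Φ.target (ContinuousLinearMap.fst ℝ _ _) (ContinuousLinearMap.inl ℝ _ _)
      (Φ o) (fun a => Φ (xo.symm a)) xo.target G₁)
  (hG₂ : IsSliceChart Φ.target (ContinuousLinearMap.snd ℝ _ _) (ContinuousLinearMap.inr ℝ _ _)
      (Φ o) (fun a => Φ (yo.symm a)) yo.target G₂)
include hxo hyo hG₁ hG₂

lemma contDiffOn_symm₁ : ContDiffOn ℝ ∞ G₁.symm G₁.target := by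
  rw [hG₁.target_eq]
  exact ((ContinuousLinearMap.fst ℝ (Fin n₁ → ℝ) (Fin n₂ → ℝ)).contDiff.comp_contDiffOn
    (hxo.isFlatParam h.adapted₁ h.mem).smooth).congr fun a _ => hG₁.symm_apply a

lemma contDiffOn_symm₂ : ContDiffOn ℝ ∞ G₂.symm G₂.target := by
  rw [hG₂.target_eq]
  exact ((ContinuousLinearMap.snd ℝ (Fin n₁ → ℝ) (Fin n₂ → ℝ)).contDiff.comp_contDiffOn
    (hyo.isFlatParam h.adapted₂ h.mem).smooth).congr fun a _ => hG₂.symm_apply a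

/-- The product of flat coordinates on the two leaves through `o` is a smooth chart. -/
theorem isProductCoord : IsProductCoord cov Φ.source o V₁ V₂ xo yo (Φ.trans (G₁.prod G₂)) := by
  have hs₁ := h.slice_source₁ h.mem hG₁
  have hs₂ := h.slice_source₂ h.mem hG₂
  have hsrc : (Φ.trans (G₁.prod G₂)).source = Φ.source := by
    ext x
    rw [OpenPartialHomeomorph.trans_source, mem_inter_iff]
    refine ⟨fun hx => hx.1, fun hx => ⟨hx, ?_⟩⟩
    show (Φ x).1 ∈ G₁.source ∧ (Φ x).2 ∈ G₂.source
    rw [hs₁, hs₂]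
    exact h.map_mem hx
  have htgt : (Φ.trans (G₁.prod G₂)).target = G₁.target ×ˢ G₂.target := by
    ext ⟨a, b⟩
    rw [OpenPartialHomeomorph.trans_target, mem_inter_iff]
    refine ⟨fun hx => hx.1, fun hx => ⟨hx, ?_⟩⟩
    show (G₁.symm a, G₂.symm b) ∈ Φ.target
    rw [h.target_eq, ← hs₁, ← hs₂]
    exact ⟨G₁.map_target hx.1, G₂.map_target hx.2⟩
  refine ⟨hsrc, by rw [htgt, hG₁.target_eq, hG₂.target_eq], ?_, ?_, ?_, ?_⟩
  · rw [hsrc]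
    have h1 : ContDiffOn ℝ ∞ (G₁.prod G₂) (G₁.source ×ˢ G₂.source) :=
      hG₁.smooth.prodMap hG₂.smooth
    refine (contMDiffOn_iff_contDiffOn.2 h1).comp h.chart.smooth fun x hx => ?_
    show (Φ x).1 ∈ G₁.source ∧ (Φ x).2 ∈ G₂.source
    rw [hs₁, hs₂]
    exact h.map_mem hx
  · rw [htgt]
    have h1 : ContDiffOn ℝ ∞ (G₁.prod G₂).symm (G₁.target ×ˢ G₂.target) :=
      (h.contDiffOn_symm₁ hxo hyo hG₁ hG₂).prodMap (h.contDiffOn_symm₂ hxo hyo hG₁ hG₂)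
    refine h.chart.smooth_symm.comp (contMDiffOn_iff_contDiffOn.2 h1) fun x hx => ?_
    show (G₁.symm x.1, G₂.symm x.2) ∈ Φ.target
    rw [h.target_eq, ← hs₁, ← hs₂]
    exact ⟨G₁.map_target hx.1, G₂.map_target hx.2⟩
  · rintro p hp q hq
    show G₁ (Φ p).1 = xo q
    rw [hxo.apply_eq h.adapted₁ (isSplitting_factorOne _ _) h.mem hG₁ hq.1]
    exact congrArg G₁ ((h.mem_leaf₂ hp).1 hq.2).2.symm
  · rintro p hp r hr
    show G₂ (Φ p).2 = yo r
    rw [hyo.apply_eq h.adapted₂ (isSplitting_factorTwo _ _) h.mem hG₂ hr.1]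
    exact congrArg G₂ ((h.mem_leaf₁ hp).1 hr.2).2.symm

-- The parametrization moves in a slice, so its derivative has no component in the second factor and
-- is determined by that of `G₁.symm`.
omit hyo hG₂ in
lemma fderiv_symm₁ {a : Fin n₁ → ℝ} (ha : a ∈ xo.target) (v : Fin n₁ → ℝ) :
    HasFDerivAt G₁.symm (fderiv ℝ G₁.symm a) a ∧
    (fderiv ℝ G₁.symm a v, (0 : Fin n₂ → ℝ)) = fderiv ℝ (fun a => Φ (xo.symm a)) a v := by
  have hp := hxo.isFlatParam h.adapted₁ h.mem
  have h1 : HasFDerivAt G₁.symm (ContinuousLinearMap.fst ℝ (Fin n₁ → ℝ) (Fin n₂ → ℝ) ∘L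
      fderiv ℝ (fun a => Φ (xo.symm a)) a) a := by
    rw [funext hG₁.symm_apply]
    exact (ContinuousLinearMap.fst ℝ (Fin n₁ → ℝ) (Fin n₂ → ℝ)).hasFDerivAt.comp a
      (hp.differentiableAt ha).hasFDerivAt
  rw [h1.fderiv]
  exact ⟨h1, Prod.ext rfl (mem_factorOne.1 (hp.fderiv_mem ha v)).symm⟩

omit hxo hG₁ in
lemma fderiv_symm₂ {b : Fin n₂ → ℝ} (hb : b ∈ yo.target) (v : Fin n₂ → ℝ) :
    HasFDerivAt G₂.symm (fderiv ℝ G₂.symm b) b ∧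
    ((0 : Fin n₁ → ℝ), fderiv ℝ G₂.symm b v) = fderiv ℝ (fun a => Φ (yo.symm a)) b v := by
  have hp := hyo.isFlatParam h.adapted₂ h.mem
  have h1 : HasFDerivAt G₂.symm (ContinuousLinearMap.snd ℝ (Fin n₁ → ℝ) (Fin n₂ → ℝ) ∘L
      fderiv ℝ (fun a => Φ (yo.symm a)) b) b := by
    rw [funext hG₂.symm_apply]
    exact (ContinuousLinearMap.snd ℝ (Fin n₁ → ℝ) (Fin n₂ → ℝ)).hasFDerivAt.comp b
      (hp.differentiableAt hb).hasFDerivAt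
  rw [h1.fderiv]
  exact ⟨h1, Prod.ext (mem_factorTwo.1 (hp.fderiv_mem hb v)).symm rfl⟩

end IsProductChart

end ProductFormulas

/-! ### Coordinate vectors at the far corner and Jacobians -/

section ProductFormulas

variable {E : Type*} [NormedAddCommGroup E] [NormedSpace ℝ E]
  {M : Type*} [TopologicalSpace M] [ChartedSpace E M] [IsManifold 𝓘(ℝ, E) ∞ M]
  {n₁ n₂ : ℕ} {cov : CovariantDerivative 𝓘(ℝ, E) E (TangentSpace 𝓘(ℝ, E) : M → Type _)} {o : M}
  {V₁ V₂ : Submodule ℝ (TangentSpace 𝓘(ℝ, E) o)}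
  {Φ : OpenPartialHomeomorph M ((Fin n₁ → ℝ) × (Fin n₂ → ℝ))} {B₁ : Set (Fin n₁ → ℝ)}
  {B₂ : Set (Fin n₂ → ℝ)}

lemma map_eq_sum_single {n : ℕ} {Y : Type*} [NormedAddCommGroup Y] [NormedSpace ℝ Y]
    (f : (Fin n → ℝ) →L[ℝ] Y) (v : Fin n → ℝ) : f v = ∑ j, v j • f (Pi.single j 1) := by
  conv_lhs => rw [← (Pi.basisFun ℝ (Fin n)).sum_repr v, map_sum]
  simp

lemma IsSmoothChart.eq_sum_of_dchart (hΦ : IsSmoothChart (E := E) Φ) (ho : o ∈ Φ.source) {n : ℕ}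
    {V : Submodule ℝ (TangentSpace 𝓘(ℝ, E) o)} (b : Module.Basis (Fin n) ℝ V)
    {v : TangentSpace 𝓘(ℝ, E) o} {c : Fin n → ℝ}
    (h : dchart (E := E) Φ o v = ∑ j, c j • dchart (E := E) Φ o (b j).1) :
    v = ∑ j, c j • (b j : TangentSpace 𝓘(ℝ, E) o) := by
  let e := hΦ.tangentEquiv ho
  let b' : Fin n → E := fun j => (b j).1
  have h1 : e v = e (∑ j, c j • b' j) := by
    refine h.trans ?_
    rw [map_sum]
    exact Finset.sum_congr rfl fun j _ => (map_smul e (c j) (b' j)).symm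
  exact e.injective h1

namespace IsProductChart

variable (h : IsProductChart cov o V₁ V₂ Φ B₁ B₂)
include h

/-- The second leg runs in a leaf of the second factor and leaves vectors of the first factor
unchanged in the chart. -/
lemma lowerTransport_factorOne {y w : (Fin n₁ → ℝ) × (Fin n₂ → ℝ)} (hy : y ∈ B₁ ×ˢ B₂)
    (hw : w ∈ factorOne (Fin n₁ → ℝ) (Fin n₂ → ℝ)) :
    lowerTransport (christoffel cov Φ) (Φ o) y w =
      segmentTransport (christoffel cov Φ) (Φ o) (y.1, (Φ o).2) w := by
  have hc := h.biparallel.corner_mem hy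
  refine h.biparallel.swap.segmentTransport_transversal hc hy (by simp [mem_factorTwo]) ?_
  exact segmentTransport_mem_submodule h.biparallel.convex h.biparallel.continuousOn
    h.biparallel.invariant h.biparallel.mem hc hw

lemma upperTransport_factorTwo {y w : (Fin n₁ → ℝ) × (Fin n₂ → ℝ)} (hy : y ∈ B₁ ×ˢ B₂)
    (hw : w ∈ factorTwo (Fin n₁ → ℝ) (Fin n₂ → ℝ)) :
    upperTransport (christoffel cov Φ) (Φ o) y w =
      segmentTransport (christoffel cov Φ) (Φ o) ((Φ o).1, y.2) w := by
  have hc := h.biparallel.corner_mem' hy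
  refine h.biparallel.segmentTransport_transversal hc hy (by simp [mem_factorOne]) ?_
  exact segmentTransport_mem_submodule h.biparallel.convex h.biparallel.continuousOn
    h.biparallel.invariant' h.biparallel.mem hc hw

lemma upperTransportInv_apply {y : (Fin n₁ → ℝ) × (Fin n₂ → ℝ)} (hy : y ∈ B₁ ×ˢ B₂)
    (w : (Fin n₁ → ℝ) × (Fin n₂ → ℝ)) : upperTransportInv (christoffel cov Φ) (Φ o) y
      (upperTransport (christoffel cov Φ) (Φ o) y w) = w :=
  congrArg (fun T : _ →L[ℝ] (Fin n₁ → ℝ) × (Fin n₂ → ℝ) => T w)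
    (h.biparallel.upperTransportInv_mul hy)

variable {b₁ : Module.Basis (Fin n₁) ℝ V₁} {b₂ : Module.Basis (Fin n₂) ℝ V₂} {p : M} {γ : ℝ → M}
  {t₁ t₂ t₃ : ℝ} (hγ : IsRectangle cov Φ.source o V₁ V₂ p γ t₁ t₂ t₃)
include hγ

/-- The normalization brings b₁ from `o` to the corner on the second leaf, and parallelism of the
coordinate field brings it on to `p`: the two legs of the upper path. -/
lemma components_xr {xr : PartialEquiv M (Fin n₁ → ℝ)}
    (hxr : IsFlatCoordAt cov Φ.source o V₁ V₂ b₁ (γ t₃) xr) (i : Fin n₁) :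
    components Φ (coordVec (E := E) xr.symm (xr p) i) =
      upperTransport (christoffel cov Φ) (Φ o) (Φ p) (dchart (E := E) Φ o (b₁ i).1) := by
  have hp := h.rectangle_mem hγ
  have hr : γ t₃ ∈ Φ.source := hγ.loop.mem _ ⟨hγ.zero_le.trans (hγ.le₁₂.trans hγ.le₂₃), hγ.le_one⟩
  have h3 := h.rectangle_corner₃ hγ
  rw [hxr.components_eq h.adapted₁ h.adapted₂ h.biparallel' (isSplitting_factorOne _ _) hr
    ((h.mem_leaf₁ hr).2 ⟨hp, by rw [h3]⟩), h3]
  rfl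

lemma components_yq {yq : PartialEquiv M (Fin n₂ → ℝ)}
    (hyq : IsFlatCoordAt cov Φ.source o V₂ V₁ b₂ (γ t₁) yq) (i : Fin n₂) :
    components Φ (coordVec (E := E) yq.symm (yq p) i) =
      lowerTransport (christoffel cov Φ) (Φ o) (Φ p) (dchart (E := E) Φ o (b₂ i).1) := by
  have hp := h.rectangle_mem hγ
  have hq : γ t₁ ∈ Φ.source := hγ.loop.mem _ ⟨hγ.zero_le, hγ.le₁₂.trans (hγ.le₂₃.trans hγ.le_one)⟩
  have h1 := h.rectangle_corner₁ hγ
  rw [hyq.components_eq h.adapted₂ h.adapted₁ h.biparallel'.swap (isSplitting_factorTwo _ _) hq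
    ((h.mem_leaf₂ hq).2 ⟨hp, by rw [h1]⟩), h1]
  rfl

variable {xo : PartialEquiv M (Fin n₁ → ℝ)} {yo : PartialEquiv M (Fin n₂ → ℝ)}
  {G₁ : OpenPartialHomeomorph (Fin n₁ → ℝ) (Fin n₁ → ℝ)}
  {G₂ : OpenPartialHomeomorph (Fin n₂ → ℝ) (Fin n₂ → ℝ)}
  (hxo : IsFlatCoordOrigin cov Φ.source o V₁ b₁ xo)
  (hyo : IsFlatCoordOrigin cov Φ.source o V₂ b₂ yo)
  (hG₁ : IsSliceChart Φ.target (ContinuousLinearMap.fst ℝ _ _) (ContinuousLinearMap.inl ℝ _ _)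
      (Φ o) (fun a => Φ (xo.symm a)) xo.target G₁)
  (hG₂ : IsSliceChart Φ.target (ContinuousLinearMap.snd ℝ _ _) (ContinuousLinearMap.inr ℝ _ _)
      (Φ o) (fun a => Φ (yo.symm a)) yo.target G₂)

lemma mem_sources (hG₁ : IsSliceChart Φ.target (ContinuousLinearMap.fst ℝ _ _)
      (ContinuousLinearMap.inl ℝ _ _) (Φ o) (fun a => Φ (xo.symm a)) xo.target G₁)
    (hG₂ : IsSliceChart Φ.target (ContinuousLinearMap.snd ℝ _ _) (ContinuousLinearMap.inr ℝ _ _)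
      (Φ o) (fun a => Φ (yo.symm a)) yo.target G₂) :
    (Φ p).1 ∈ G₁.source ∧ (Φ p).2 ∈ G₂.source := by
  rw [h.slice_source₁ h.mem hG₁, h.slice_source₂ h.mem hG₂]
  exact h.map_mem (h.rectangle_mem hγ)

-- The coordinate vector at the corner q is the transport of b₁ along the first leg; by
-- `lowerTransport_factorOne` the second leg does not alter its components.
include hxo hG₁ in
lemma fderiv_xo (i : Fin n₁) : (G₁ (Φ p).1) ∈ xo.target ∧
    fderiv ℝ (fun a => Φ (xo.symm a)) (G₁ (Φ p).1) (Pi.single i 1) =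
      lowerTransport (christoffel cov Φ) (Φ o) (Φ p) (dchart (E := E) Φ o (b₁ i).1) := by
  have hp := h.rectangle_mem hγ
  obtain ⟨hq, hq'⟩ := (h.mem_corner₁_iff hp).2 rfl
  have hc := h.biparallel.corner_mem (h.map_mem hp)
  have e := hxo.1.apply_eq h.adapted₁ (isSplitting_factorOne _ _) h.mem hG₁ hq
  rw [h.right_inv hc] at e
  have e1 := hxo.components_eq h.adapted₁ h.continuousOn_christoffel (isSplitting_factorOne _ _) hq i
  rw [hxo.1.components_coordVec h.adapted₁ h.mem hq, e, h.right_inv hc] at e1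
  have hmem : xo (Φ.symm ((Φ p).1, (Φ o).2)) ∈ xo.target :=
    xo.map_source (hxo.1.source_eq ▸ hq)
  rw [e] at hmem
  refine ⟨hmem, ?_⟩
  rw [h.lowerTransport_factorOne (h.map_mem hp) (h.adapted₁.dchart_mem (b₁ i).2)]
  exact e1

include hyo hG₂ in
lemma fderiv_yo (i : Fin n₂) : (G₂ (Φ p).2) ∈ yo.target ∧
    fderiv ℝ (fun a => Φ (yo.symm a)) (G₂ (Φ p).2) (Pi.single i 1) =
      upperTransport (christoffel cov Φ) (Φ o) (Φ p) (dchart (E := E) Φ o (b₂ i).1) := by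
  have hp := h.rectangle_mem hγ
  obtain ⟨hq, hq'⟩ := (h.mem_corner₂_iff hp).2 rfl
  have hc := h.biparallel.corner_mem' (h.map_mem hp)
  have e := hyo.1.apply_eq h.adapted₂ (isSplitting_factorTwo _ _) h.mem hG₂ hq
  rw [h.right_inv hc] at e
  have e1 := hyo.components_eq h.adapted₂ h.continuousOn_christoffel (isSplitting_factorTwo _ _) hq i
  rw [hyo.1.components_coordVec h.adapted₂ h.mem hq, e, h.right_inv hc] at e1
  have hmem : yo (Φ.symm ((Φ o).1, (Φ p).2)) ∈ yo.target :=
    yo.map_source (hyo.1.source_eq ▸ hq)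
  rw [e] at hmem
  refine ⟨hmem, ?_⟩
  rw [h.upperTransport_factorTwo (h.map_mem hp) (h.adapted₂.dchart_mem (b₂ i).2)]
  exact e1

-- In the product coordinates, varying the first variable through `p` has the same components as
-- varying it on the leaf through `o`.
include hxo hyo hG₁ hG₂ in
lemma coordVec_product₁ (i : Fin n₁) :
    (coordVec (E := E) (fun a => (Φ.trans (G₁.prod G₂)).symm (a, ((Φ.trans (G₁.prod G₂)) p).2))
      ((Φ.trans (G₁.prod G₂)) p).1 i).proj = p ∧
    components Φ (coordVec (E := E)
      (fun a => (Φ.trans (G₁.prod G₂)).symm (a, ((Φ.trans (G₁.prod G₂)) p).2))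
      ((Φ.trans (G₁.prod G₂)) p).1 i) =
      lowerTransport (christoffel cov Φ) (Φ o) (Φ p) (dchart (E := E) Φ o (b₁ i).1) := by
  have hp := h.rectangle_mem hγ
  obtain ⟨hs₁, hs₂⟩ := h.mem_sources hγ hG₁ hG₂
  obtain ⟨ht, e⟩ := h.fderiv_xo hγ hxo hG₁ i
  have hpt : (G₁.symm (G₁ (Φ p).1), G₂.symm (G₂ (Φ p).2)) = Φ p := by
    rw [G₁.left_inv hs₁, G₂.left_inv hs₂]
  have h1 := h.fderiv_symm₁ hxo.1 hG₁ ht (Pi.single i 1)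
  have h2 : HasFDerivAt (fun a => (G₁.symm a, G₂.symm (G₂ (Φ p).2)))
      ((fderiv ℝ G₁.symm (G₁ (Φ p).1)).prod 0) (G₁ (Φ p).1) :=
    h1.1.prodMk (hasFDerivAt_const _ _)
  refine ⟨?_, ?_⟩
  · show Φ.symm (G₁.symm (G₁ (Φ p).1), G₂.symm (G₂ (Φ p).2)) = p
    rw [hpt, Φ.left_inv hp]
  · have h3 := h.chart.components_coordVec_symm h2.differentiableAt
      (by rw [hpt]; exact Φ.map_source hp) i
    rw [h2.fderiv] at h3
    exact h3.trans (h1.2.trans e)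

include hxo hyo hG₁ hG₂ in
lemma coordVec_product₂ (i : Fin n₂) :
    (coordVec (E := E) (fun b => (Φ.trans (G₁.prod G₂)).symm (((Φ.trans (G₁.prod G₂)) p).1, b))
      ((Φ.trans (G₁.prod G₂)) p).2 i).proj = p ∧
    components Φ (coordVec (E := E)
      (fun b => (Φ.trans (G₁.prod G₂)).symm (((Φ.trans (G₁.prod G₂)) p).1, b))
      ((Φ.trans (G₁.prod G₂)) p).2 i) =
      upperTransport (christoffel cov Φ) (Φ o) (Φ p) (dchart (E := E) Φ o (b₂ i).1) := by
  have hp := h.rectangle_mem hγ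
  obtain ⟨hs₁, hs₂⟩ := h.mem_sources hγ hG₁ hG₂
  obtain ⟨ht, e⟩ := h.fderiv_yo hγ hyo hG₂ i
  have hpt : (G₁.symm (G₁ (Φ p).1), G₂.symm (G₂ (Φ p).2)) = Φ p := by
    rw [G₁.left_inv hs₁, G₂.left_inv hs₂]
  have h1 := h.fderiv_symm₂ hyo.1 hG₂ ht (Pi.single i 1)
  have h2 : HasFDerivAt (fun b => (G₁.symm (G₁ (Φ p).1), G₂.symm b))
      ((0 : (Fin n₂ → ℝ) →L[ℝ] (Fin n₁ → ℝ)).prod (fderiv ℝ G₂.symm (G₂ (Φ p).2)))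
      (G₂ (Φ p).2) :=
    (hasFDerivAt_const _ _).prodMk h1.1
  refine ⟨?_, ?_⟩
  · show Φ.symm (G₁.symm (G₁ (Φ p).1), G₂.symm (G₂ (Φ p).2)) = p
    rw [hpt, Φ.left_inv hp]
  · have h3 := h.chart.components_coordVec_symm h2.differentiableAt
      (by rw [hpt]; exact Φ.map_source hp) i
    rw [h2.fderiv] at h3
    exact h3.trans (h1.2.trans e)

variable {L : TangentSpace 𝓘(ℝ, E) o ≃ₗ[ℝ] TangentSpace 𝓘(ℝ, E) o}
  (hL : ∀ v : TangentSpace 𝓘(ℝ, E) o, dchart (E := E) Φ o (L v) =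
        rectangleTransport (christoffel cov Φ) (Φ o) (Φ p) (dchart (E := E) Φ o v))
include hxo hyo hG₁ hG₂ hL

/-- The transport around a rectangle is the Jacobian matrix of a change of flat coordinates. -/
lemma exists_jacobian₁ {xr : PartialEquiv M (Fin n₁ → ℝ)}
    (hxr : IsFlatCoordAt cov Φ.source o V₁ V₂ b₁ (γ t₃) xr) :
    ∃ J : (Fin n₁ → ℝ) →L[ℝ] (Fin n₁ → ℝ),
      HasFDerivAt (fun a => xr ((Φ.trans (G₁.prod G₂)).symm (a, ((Φ.trans (G₁.prod G₂)) p).2))) J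
        ((Φ.trans (G₁.prod G₂)) p).1 ∧
      ∀ i, L (b₁ i) = ∑ j, J (Pi.single i 1) j • (b₁ j : TangentSpace 𝓘(ℝ, E) o) := by
  have hp := h.rectangle_mem hγ
  obtain ⟨hs₁, hs₂⟩ := h.mem_sources hγ hG₁ hG₂
  have hr : γ t₃ ∈ Φ.source := hγ.loop.mem _ ⟨hγ.zero_le.trans (hγ.le₁₂.trans hγ.le₂₃), hγ.le_one⟩
  have h3 := h.rectangle_corner₃ hγ
  have hpl : p ∈ leaf cov Φ.source o V₁ (γ t₃) := (h.mem_leaf₁ hr).2 ⟨hp, by rw [h3]⟩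
  have hpar := hxr.1.isFlatParam h.adapted₁ hr
  obtain ⟨G, hG⟩ := hpar.exists_chart (isSplitting_factorOne _ _)
  have hGs := h.slice_source₁ hr hG
  have hG₁s := h.slice_source₁ h.mem hG₁
  have hu : (Φ p).1 ∈ G.source := by rw [hGs, ← hG₁s]; exact hs₁
  have hxrp : xr p = G (Φ p).1 := hxr.1.apply_eq h.adapted₁ (isSplitting_factorOne _ _) hr hG hpl
  have ht : G₁ (Φ p).1 ∈ G₁.target := G₁.map_source hs₁
  have hsymm := fun v => h.fderiv_symm₁ hxo.1 hG₁ (hG₁.target_eq ▸ ht) v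
  have hGd : HasFDerivAt G (fderiv ℝ G (Φ p).1) (G₁.symm (G₁ (Φ p).1)) := by
    rw [G₁.left_inv hs₁]
    exact ((hG.smooth.contDiffAt (G.open_source.mem_nhds hu)).differentiableAt
      (by simp)).hasFDerivAt
  -- In slice coordinates of the first factor, `G` gives x_r and `G₁` gives x_o; the Jacobian is
  -- that of `G ∘ G₁.symm`.
  refine ⟨fderiv ℝ G (Φ p).1 ∘L fderiv ℝ G₁.symm (G₁ (Φ p).1), ?_, fun i => ?_⟩
  · refine (hGd.comp _ (hsymm 0).1).congr_of_eventuallyEq ?_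
    filter_upwards [G₁.open_target.mem_nhds ht] with a ha
    have hB : (G₁.symm a, (Φ p).2) ∈ B₁ ×ˢ B₂ := ⟨hG₁s ▸ G₁.map_target ha, (h.map_mem hp).2⟩
    have e1 : (Φ.trans (G₁.prod G₂)).symm (a, ((Φ.trans (G₁.prod G₂)) p).2) =
        Φ.symm (G₁.symm a, (Φ p).2) := by
      show Φ.symm (G₁.symm a, G₂.symm (G₂ (Φ p).2)) = _
      rw [G₂.left_inv hs₂]
    have hl : Φ.symm (G₁.symm a, (Φ p).2) ∈ leaf cov Φ.source o V₁ (γ t₃) :=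
      (h.mem_leaf₁ hr).2 ⟨h.symm_mem hB, by rw [h.right_inv hB, h3]⟩
    rw [e1, hxr.1.apply_eq h.adapted₁ (isSplitting_factorOne _ _) hr hG hl, h.right_inv hB]
    rfl
  · refine h.chart.eq_sum_of_dchart h.mem b₁ ?_
    set J := fderiv ℝ G (Φ p).1 ∘L fderiv ℝ G₁.symm (G₁ (Φ p).1)
    -- The coordinate vector of x_o at `p` expanded in those of x_r. The latter are upper transports
    -- of b₁, so returning to `o` by the upper path turns this into the expansion of the transport
    -- around the rectangle.
    have e2 : fderiv ℝ (fun a => Φ (xr.symm a)) (xr p) (J (Pi.single i 1)) =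
        lowerTransport (christoffel cov Φ) (Φ o) (Φ p) (dchart (E := E) Φ o (b₁ i).1) := by
      rw [← (h.fderiv_xo hγ hxo hG₁ i).2, ← (hsymm _).2, hxrp]
      exact hpar.fderiv_sliceChart (isSplitting_factorOne _ _) hG hu _
    rw [map_eq_sum_single] at e2
    rw [hL, rectangleTransport, mul_apply_eq_comp, ← e2, map_sum]
    refine Finset.sum_congr rfl fun j _ => ?_
    rw [map_smul, ← hxr.1.components_coordVec h.adapted₁ hr hpl, h.components_xr hγ hxr,
      h.upperTransportInv_apply (h.map_mem hp)]

/-- The transport around a rectangle is the Jacobian matrix of a change of flat coordinates. -/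
lemma exists_jacobian₂ {yq : PartialEquiv M (Fin n₂ → ℝ)}
    (hyq : IsFlatCoordAt cov Φ.source o V₂ V₁ b₂ (γ t₁) yq) :
    ∃ K : (Fin n₂ → ℝ) →L[ℝ] (Fin n₂ → ℝ),
      HasFDerivAt (fun b => ((Φ.trans (G₁.prod G₂)) (yq.symm b)).2) K (yq p) ∧
      ∀ i, L (b₂ i) = ∑ j, K (Pi.single i 1) j • (b₂ j : TangentSpace 𝓘(ℝ, E) o) := by
  have hp := h.rectangle_mem hγ
  obtain ⟨hs₁, hs₂⟩ := h.mem_sources hγ hG₁ hG₂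
  have hq : γ t₁ ∈ Φ.source := hγ.loop.mem _ ⟨hγ.zero_le, hγ.le₁₂.trans (hγ.le₂₃.trans hγ.le_one)⟩
  have h1 := h.rectangle_corner₁ hγ
  have hpl : p ∈ leaf cov Φ.source o V₂ (γ t₁) := (h.mem_leaf₂ hq).2 ⟨hp, by rw [h1]⟩
  have hps : p ∈ yq.source := hyq.1.source_eq ▸ hpl
  have hpar := hyq.1.isFlatParam h.adapted₂ hq
  have hparo := hyo.1.isFlatParam h.adapted₂ h.mem
  have hqt := yq.map_source hps
  set ψ : (Fin n₂ → ℝ) → (Fin n₁ → ℝ) × (Fin n₂ → ℝ) := fun a => Φ (yq.symm a) with hψ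
  have hψp : ψ (yq p) = Φ p := by rw [hψ]; simp only [yq.left_inv hps]
  have hsnd : HasFDerivAt (fun b => (ψ b).2)
      (ContinuousLinearMap.snd ℝ _ _ ∘L fderiv ℝ ψ (yq p)) (yq p) :=
    (ContinuousLinearMap.snd ℝ (Fin n₁ → ℝ) (Fin n₂ → ℝ)).hasFDerivAt.comp (yq p)
      (hpar.differentiableAt hqt).hasFDerivAt
  have hGd : HasFDerivAt G₂ (fderiv ℝ G₂ (Φ p).2) (ψ (yq p)).2 := by
    rw [hψp]
    exact ((hG₂.smooth.contDiffAt (G₂.open_source.mem_nhds hs₂)).differentiableAt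
      (by simp)).hasFDerivAt
  refine ⟨fderiv ℝ G₂ (Φ p).2 ∘L (ContinuousLinearMap.snd ℝ _ _ ∘L fderiv ℝ ψ (yq p)),
    HasFDerivAt.comp (f := fun b => (ψ b).2) (yq p) hGd hsnd, fun i => ?_⟩
  refine h.chart.eq_sum_of_dchart h.mem b₂ ?_
  set K := fderiv ℝ G₂ (Φ p).2 ∘L (ContinuousLinearMap.snd ℝ _ _ ∘L fderiv ℝ ψ (yq p)) with hK
  have e1 := h.components_yq hγ hyq i
  rw [hyq.1.components_coordVec h.adapted₂ hq hpl] at e1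
  -- Here the coordinate vector of y_q at `p`, a lower transport of b₂, is expanded in those of y_o,
  -- which are upper transports of b₂.
  have e2 : fderiv ℝ (fun a => Φ (yo.symm a)) (G₂ (Φ p).2) (K (Pi.single i 1)) =
      lowerTransport (christoffel cov Φ) (Φ o) (Φ p) (dchart (E := E) Φ o (b₂ i).1) := by
    refine (hparo.fderiv_sliceChart (isSplitting_factorTwo _ _) hG₂ hs₂ _).trans ?_
    refine Eq.trans ?_ e1
    exact (isSplitting_factorTwo _ _).left_inv _ (hpar.fderiv_mem hqt _)
  rw [map_eq_sum_single] at e2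
  rw [hL, rectangleTransport, mul_apply_eq_comp, ← e2, map_sum]
  refine Finset.sum_congr rfl fun j _ => ?_
  rw [map_smul, (h.fderiv_yo hγ hyo hG₂ j).2, h.upperTransportInv_apply (h.map_mem hp)]

end IsProductChart

end ProductFormulas

/-! ### The formulas on an arbitrary product neighbourhood -/

section ProductNeighbourhood

variable {E : Type*} [NormedAddCommGroup E] [NormedSpace ℝ E] [FiniteDimensional ℝ E]
  [CompleteSpace E] {M : Type*} [TopologicalSpace M] [T2Space M] [ChartedSpace E M]
  [IsManifold 𝓘(ℝ, E) ∞ M]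
  {cov : CovariantDerivative 𝓘(ℝ, E) E (TangentSpace 𝓘(ℝ, E) : M → Type _)}
  [CovariantDerivative.ContMDiffCovariantDerivative cov ∞] {o : M}
  {V₁ V₂ : Submodule ℝ (TangentSpace 𝓘(ℝ, E) o)} {n₁ n₂ : ℕ} {U : Set M}

lemma IsProductNeighbourhood.exists_isProductChart (htorsion : cov.torsion = 0)
    (hV₁ : IsFaithfulSubrep cov o V₁) (hV₂ : IsFaithfulSubrep cov o V₂)
    (hU : IsProductNeighbourhood cov n₁ n₂ o V₁ V₂ U) :
    ∃ (Φ : OpenPartialHomeomorph M ((Fin n₁ → ℝ) × (Fin n₂ → ℝ))) (B₁ : Set (Fin n₁ → ℝ))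
      (B₂ : Set (Fin n₂ → ℝ)), Φ.source = U ∧ IsProductChart cov o V₁ V₂ Φ B₁ B₂ := by
  obtain ⟨ho, Φ, B₁, B₂, hB₁, hB₂, rfl, ht, hsm, hsm', hd⟩ := hU
  have hconv : Convex ℝ Φ.target := ht ▸ hB₁.prod hB₂
  have h₁ : IsAdaptedChart cov o V₁ Φ (factorOne _ _) :=
    ⟨⟨hsm, hsm'⟩, hconv, ho, fun x hx v => (hd x hx v).1⟩
  have h₂ : IsAdaptedChart cov o V₂ Φ (factorTwo _ _) :=
    ⟨⟨hsm, hsm'⟩, hconv, ho, fun x hx v => (hd x hx v).2⟩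
  exact ⟨Φ, B₁, B₂, rfl, ht, h₁, h₂,
    ht ▸ IsAdaptedChart.isBiparallel htorsion h₁ h₂ disjoint_factors hV₁ hV₂⟩

variable {Φ : OpenPartialHomeomorph M ((Fin n₁ → ℝ) × (Fin n₂ → ℝ))} {B₁ : Set (Fin n₁ → ℝ)}
  {B₂ : Set (Fin n₂ → ℝ)} {b₁ : Module.Basis (Fin n₁) ℝ V₁} {b₂ : Module.Basis (Fin n₂) ℝ V₂}

theorem IsProductChart.exists_productCoord (h : IsProductChart cov o V₁ V₂ Φ B₁ B₂)
    {τ : M → (TangentSpace 𝓘(ℝ, E) o ≃ₗ[ℝ] TangentSpace 𝓘(ℝ, E) o)}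
    (hτ : ∀ p ∈ Φ.source, ∀ v : TangentSpace 𝓘(ℝ, E) o, dchart (E := E) Φ o (τ p v) =
      rectangleTransport (christoffel cov Φ) (Φ o) (Φ p) (dchart (E := E) Φ o v))
    {xo : PartialEquiv M (Fin n₁ → ℝ)} {yo : PartialEquiv M (Fin n₂ → ℝ)}
    (hxo : IsFlatCoordOrigin cov Φ.source o V₁ b₁ xo)
    (hyo : IsFlatCoordOrigin cov Φ.source o V₂ b₂ yo) :
    ∃ Θ, IsProductCoord cov Φ.source o V₁ V₂ xo yo Θ ∧
      ∀ p ∈ Φ.source, ∀ γ t₁ t₂ t₃, IsRectangle cov Φ.source o V₁ V₂ p γ t₁ t₂ t₃ →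
      ∀ xr yq, IsFlatCoordAt cov Φ.source o V₁ V₂ b₁ (γ t₃) xr →
        IsFlatCoordAt cov Φ.source o V₂ V₁ b₂ (γ t₁) yq →
        (∀ i, Transports cov γ 0 t₂ ⟨o, b₁ i⟩
          (coordVec (fun a => Θ.symm (a, (Θ p).2)) (Θ p).1 i)) ∧
        (∀ i, Transports cov γ t₂ 1 (coordVec xr.symm (xr p) i) ⟨o, b₁ i⟩) ∧
        (∀ i, Transports cov γ 0 t₂ ⟨o, b₂ i⟩ (coordVec yq.symm (yq p) i)) ∧
        (∀ i, Transports cov γ t₂ 1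
          (coordVec (fun b => Θ.symm ((Θ p).1, b)) (Θ p).2 i) ⟨o, b₂ i⟩) ∧
        (∃ J : (Fin n₁ → ℝ) →L[ℝ] (Fin n₁ → ℝ),
          HasFDerivAt (fun a => xr (Θ.symm (a, (Θ p).2))) J (Θ p).1 ∧
          ∀ i, τ p (b₁ i) = ∑ j, J (Pi.single i 1) j • (b₁ j : TangentSpace 𝓘(ℝ, E) o)) ∧
        (∃ K : (Fin n₂ → ℝ) →L[ℝ] (Fin n₂ → ℝ),
          HasFDerivAt (fun b => (Θ (yq.symm b)).2) K (yq p) ∧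
          ∀ i, τ p (b₂ i) = ∑ j, K (Pi.single i 1) j • (b₂ j : TangentSpace 𝓘(ℝ, E) o)) := by
  obtain ⟨G₁, hG₁⟩ := (hxo.1.isFlatParam h.adapted₁ h.mem).exists_chart (isSplitting_factorOne _ _)
  obtain ⟨G₂, hG₂⟩ := (hyo.1.isFlatParam h.adapted₂ h.mem).exists_chart (isSplitting_factorTwo _ _)
  refine ⟨Φ.trans (G₁.prod G₂), h.isProductCoord hxo.1 hyo.1 hG₁ hG₂, ?_⟩
  intro p hp γ t₁ t₂ t₃ hγ xr yq hxr hyq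
  have hyp := h.map_mem hp
  have hr : γ t₃ ∈ Φ.source := hγ.loop.mem _ ⟨hγ.zero_le.trans (hγ.le₁₂.trans hγ.le₂₃), hγ.le_one⟩
  have hq : γ t₁ ∈ Φ.source := hγ.loop.mem _ ⟨hγ.zero_le, hγ.le₁₂.trans (hγ.le₂₃.trans hγ.le_one)⟩
  have hpr : p ∈ xr.source := hxr.1.source_eq ▸ (h.mem_leaf₁ hr).2
    ⟨hp, by rw [h.rectangle_corner₃ hγ]⟩
  have hpq : p ∈ yq.source := hyq.1.source_eq ▸ (h.mem_leaf₂ hq).2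
    ⟨hp, by rw [h.rectangle_corner₁ hγ]⟩
  refine ⟨fun i => ?_, fun i => ?_, fun i => ?_, fun i => ?_,
    h.exists_jacobian₁ hγ hxo hyo hG₁ hG₂ (hτ p hp) hxr,
    h.exists_jacobian₂ hγ hxo hyo hG₁ hG₂ (hτ p hp) hyq⟩
  · obtain ⟨e1, e2⟩ := h.coordVec_product₁ hγ hxo hyo hG₁ hG₂ i
    exact h.transports_lower hγ rfl e1 e2
  · refine h.transports_upper hγ (xr.left_inv hpr) rfl ?_
    rw [h.components_xr hγ hxr, h.upperTransportInv_apply hyp]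
    rfl
  · exact h.transports_lower hγ rfl (yq.left_inv hpq) (h.components_yq hγ hyq i)
  · obtain ⟨e1, e2⟩ := h.coordVec_product₂ hγ hxo hyo hG₁ hG₂ i
    refine h.transports_upper hγ e1 rfl ?_
    rw [e2, h.upperTransportInv_apply hyp]
    rfl

end ProductNeighbourhood

universe u

/-! ### Straightening two complementary distributions -/

section Straightening

/-- The Frobenius theorem for a distribution spanned by a frame `N`. -/
theorem exists_first_integral_of_frame {F : Type*} {X Y : Type u} [NormedAddCommGroup F]
    [NormedSpace ℝ F] [NormedAddCommGroup X] [NormedSpace ℝ X] [CompleteSpace X]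
    [NormedAddCommGroup Y] [NormedSpace ℝ Y] [CompleteSpace Y] (κ : F ≃L[ℝ] X × Y)
    {N : F → Y →L[ℝ] F} {Ω : Set F} (hΩ : IsOpen Ω) (h0 : 0 ∈ Ω) (hN : ContDiffOn ℝ ∞ N Ω)
    (hN0 : ∀ b, κ (N 0 b) = (0, b))
    (hint : ∀ z ∈ Ω, ∀ b b', ∃ d, fderiv ℝ N z (N z b) b' - fderiv ℝ N z (N z b') b = N z d) :
    ∃ (u : F → X) (O : Set F), IsOpen O ∧ 0 ∈ O ∧ O ⊆ Ω ∧ ContDiffOn ℝ ∞ u O ∧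
      (∀ z ∈ O, ∀ b, fderiv ℝ u z (N z b) = 0) ∧ ∀ w, fderiv ℝ u 0 w = (κ w).1 := by
  let M₁ : X × Y → Y →L[ℝ] X := fun ζ =>
    (ContinuousLinearMap.fst ℝ X Y ∘L (κ : F →L[ℝ] X × Y)) ∘L N (κ.symm ζ)
  let M₂ : X × Y → Y →L[ℝ] Y := fun ζ =>
    (ContinuousLinearMap.snd ℝ X Y ∘L (κ : F →L[ℝ] X × Y)) ∘L N (κ.symm ζ)
  have hMdef : ∀ ζ b, κ (N (κ.symm ζ) b) = (M₁ ζ b, M₂ ζ b) := fun ζ b => rfl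
  have hNκ : ContDiffOn ℝ ∞ (fun ζ => N (κ.symm ζ)) (κ.symm ⁻¹' Ω) :=
    hN.comp κ.symm.contDiff.contDiffOn fun _ h => h
  have hM₁ : ContDiffOn ℝ ∞ M₁ (κ.symm ⁻¹' Ω) := contDiffOn_const.clm_comp hNκ
  have hM₂ : ContDiffOn ℝ ∞ M₂ (κ.symm ⁻¹' Ω) := contDiffOn_const.clm_comp hNκ
  have hΩκ : IsOpen (κ.symm ⁻¹' Ω) := hΩ.preimage κ.symm.continuous
  -- Where the second component of the frame is invertible, the distribution is a graph.
  let Ω' : Set (X × Y) := κ.symm ⁻¹' Ω ∩ M₂ ⁻¹' range ((↑) : (Y ≃L[ℝ] Y) → Y →L[ℝ] Y)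
  have hΩ' : IsOpen Ω' := hM₂.continuousOn.isOpen_inter_preimage hΩκ ContinuousLinearEquiv.isOpen
  have h0' : (0 : X × Y) ∈ Ω' := by
    refine ⟨by simpa using h0, ContinuousLinearEquiv.refl ℝ Y, ?_⟩
    ext b
    have := hMdef 0 b
    rw [map_zero, hN0] at this
    exact congrArg Prod.snd this
  let L : X × Y → Y →L[ℝ] X := fun ζ => M₁ ζ ∘L ContinuousLinearMap.inverse (M₂ ζ)
  have hL : ContDiffOn ℝ ∞ L Ω' := by
    refine (hM₁.mono inter_subset_left).clm_comp fun ζ hζ => ?_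
    obtain ⟨e, he⟩ := hζ.2
    exact ContDiffAt.comp_contDiffWithinAt (g := ContinuousLinearMap.inverse) ζ
      (by rw [← he]; exact contDiffAt_map_inverse e) ((hM₂.mono inter_subset_left) ζ hζ)
  have hLM : ∀ ζ ∈ Ω', ∀ b, L ζ (M₂ ζ b) = M₁ ζ b := by
    rintro ζ ⟨-, e, he⟩ b
    show M₁ ζ (ContinuousLinearMap.inverse (M₂ ζ) (M₂ ζ b)) = _
    rw [← he, ContinuousLinearMap.inverse_equiv]
    exact congrArg (M₁ ζ) (e.symm_apply_apply b)
  have hsurj : ∀ ζ ∈ Ω', ∀ v, ∃ b, M₂ ζ b = v := by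
    rintro ζ ⟨-, e, he⟩ v
    exact ⟨e.symm v, by rw [← he]; exact e.apply_symm_apply v⟩
  have hLd : ∀ ζ ∈ Ω', DifferentiableAt ℝ L ζ := fun ζ hζ =>
    (hL.contDiffAt (hΩ'.mem_nhds hζ)).differentiableAt (by simp)
  have hNd : ∀ ζ ∈ Ω', HasFDerivAt (fun ζ => N (κ.symm ζ))
      (fderiv ℝ N (κ.symm ζ) ∘L (κ.symm : X × Y →L[ℝ] F)) ζ := fun ζ hζ =>
    ((hN.contDiffAt (hΩ.mem_nhds hζ.1)).differentiableAt (by simp)).hasFDerivAt.comp ζ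
      κ.symm.hasFDerivAt
  -- Differentiating L M₂ = M₁ expresses the derivative of `L` by that of the frame, so involutivity
  -- of the frame becomes the integrability condition for the graph.
  have key : ∀ ζ ∈ Ω', ∀ η b, fderiv ℝ L ζ η (M₂ ζ b) +
      L ζ (κ (fderiv ℝ N (κ.symm ζ) (κ.symm η) b)).2 =
      (κ (fderiv ℝ N (κ.symm ζ) (κ.symm η) b)).1 := by
    intro ζ hζ η b
    have h1 : HasFDerivAt (fun ζ => N (κ.symm ζ) b) _ ζ :=
      (hNd ζ hζ).clm_apply (hasFDerivAt_const b ζ)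
    have h2 : HasFDerivAt (fun ζ => M₂ ζ b) _ ζ :=
      (ContinuousLinearMap.snd ℝ X Y ∘L (κ : F →L[ℝ] X × Y)).hasFDerivAt.comp ζ h1
    have h3 : HasFDerivAt (fun ζ => M₁ ζ b) _ ζ :=
      (ContinuousLinearMap.fst ℝ X Y ∘L (κ : F →L[ℝ] X × Y)).hasFDerivAt.comp ζ h1
    have h4 := ((hLd ζ hζ).hasFDerivAt.clm_apply h2).unique (h3.congr_of_eventuallyEq
      (Filter.eventually_of_mem (hΩ'.mem_nhds hζ) fun z hz => hLM z hz b))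
    have h5 := congrArg (fun T : X × Y →L[ℝ] X => T η) h4
    simp at h5
    rw [add_comm]
    exact h5
  obtain ⟨u, O, hO, h0O, hOΩ, hu, huL, hu0⟩ := exists_first_integral hΩ' h0' hL (by
    intro ζ hζ v w
    obtain ⟨b, rfl⟩ := hsurj ζ hζ v
    obtain ⟨b', rfl⟩ := hsurj ζ hζ w
    rw [hLM ζ hζ, hLM ζ hζ, ← hMdef, ← hMdef]
    have k1 := key ζ hζ (κ (N (κ.symm ζ) b)) b'
    have k2 := key ζ hζ (κ (N (κ.symm ζ) b')) b
    rw [κ.symm_apply_apply] at k1 k2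
    obtain ⟨d, hd⟩ := hint _ hζ.1 b b'
    have hd' := congrArg κ hd
    rw [map_sub, hMdef] at hd'
    have d1 := congrArg Prod.fst hd'
    have d2 := congrArg (fun z => L ζ z.2) hd'
    simp only [Prod.fst_sub, Prod.snd_sub, map_sub, hLM ζ hζ] at d1 d2
    linear_combination (norm := module) k1 - k2 + d1 - d2)
  have hud : ∀ ζ ∈ O, DifferentiableAt ℝ u ζ := fun ζ hζ =>
    (hu.contDiffAt (hO.mem_nhds hζ)).differentiableAt (by simp)
  have hfd : ∀ z, κ z ∈ O → fderiv ℝ (fun z => u (κ z)) z = fderiv ℝ u (κ z) ∘L (κ : F →L[ℝ] X × Y) :=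
    fun z hz => ((hud _ hz).hasFDerivAt.comp z κ.hasFDerivAt).fderiv
  have hv : ∀ z, κ z ∈ O → ∀ b, fderiv ℝ (fun z => u (κ z)) z (N z b) = 0 := by
    intro z hz b
    rw [hfd z hz]
    have h1 := hMdef (κ z) b
    rw [κ.symm_apply_apply] at h1
    show fderiv ℝ u (κ z) (κ (N z b)) = 0
    rw [h1, ← hLM _ (hOΩ hz)]
    exact huL _ hz _
  refine ⟨fun z => u (κ z), κ ⁻¹' O, hO.preimage κ.continuous, by simpa using h0O,
    fun z hz => by simpa using (hOΩ hz).1, hu.comp κ.contDiff.contDiffOn fun _ h => h, hv,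
    fun w => ?_⟩
  have hκ0 : κ 0 ∈ O := by rw [map_zero]; exact h0O
  -- At 0 the frame spans the second factor, so a vector is the sum of its first component and a
  -- vector of the distribution.
  have h1 : w = κ.symm ((κ w).1, 0) + N 0 (κ w).2 := by
    apply κ.injective
    rw [map_add, κ.apply_symm_apply, hN0]
    simp
  conv_lhs => rw [h1]
  rw [map_add, hv 0 hκ0, hfd 0 hκ0, add_zero]
  show fderiv ℝ u (κ 0) (κ (κ.symm _)) = _
  rw [κ.apply_symm_apply, map_zero, hu0]

variable {X Y : Type u} [NormedAddCommGroup X] [NormedSpace ℝ X] [FiniteDimensional ℝ X]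
  [NormedAddCommGroup Y] [NormedSpace ℝ Y] [FiniteDimensional ℝ Y]

/-- The triangle formula with its vertex `b` at `o`: the radial frame fails to be parallel only by a
velocity of the holonomy group. -/
lemma exists_fderiv_segmentTransport_eq {F : Type*} [NormedAddCommGroup F] [NormedSpace ℝ F]
    [FiniteDimensional ℝ F] {Γ : F → F →L[ℝ] F →L[ℝ] F} {B : Set F} (hBo : IsOpen B)
    (hB : Convex ℝ B) (hΓ : ContDiffOn ℝ ∞ Γ B) {o : F} (ho : o ∈ B) {x : F} (hx : x ∈ B) (v : F) :
    ∃ A, IsVelocity (coordHolonomy Γ B o) A ∧ fderiv ℝ (segmentTransport Γ o) x v +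
      Γ x v * segmentTransport Γ o x = -(segmentTransport Γ o x * A) := by
  obtain ⟨A, hA, -, h⟩ := exists_velocity_triangle hBo hB hΓ ho ho hx v
  rw [segmentTransport_self hB hΓ.continuousOn ho, mul_one, mul_one] at h
  exact ⟨A, hA, h⟩

/-- The distribution is spanned by a radially transported frame. In the bracket of two frame fields
the Christoffel terms cancel by symmetry, and what remains are velocities of the holonomy group,
which preserve the subspace. -/
lemma exists_first_integral_of_invariant {F : Type*} [NormedAddCommGroup F] [NormedSpace ℝ F]
    [FiniteDimensional ℝ F] {Γ : F → F →L[ℝ] F →L[ℝ] F} {B : Set F} (hBo : IsOpen B)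
    (hB : Convex ℝ B) (hΓ : ContDiffOn ℝ ∞ Γ B) (hsymm : ∀ y ∈ B, ∀ u w, Γ y u w = Γ y w u)
    (h0 : 0 ∈ B) (κ : F ≃L[ℝ] X × Y)
    (hinv : ∀ A, IsVelocity (coordHolonomy Γ B 0) A → ∀ w, (κ w).1 = 0 → (κ (A w)).1 = 0) :
    ∃ (u : F → X) (O : Set F), IsOpen O ∧ 0 ∈ O ∧ O ⊆ B ∧ ContDiffOn ℝ ∞ u O ∧
      (∀ z ∈ O, ∀ w, (κ w).1 = 0 → fderiv ℝ u z (segmentTransport Γ 0 z w) = 0) ∧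
      ∀ w, fderiv ℝ u 0 w = (κ w).1 := by
  let P := segmentTransport Γ 0
  have hP : ContDiffOn ℝ ∞ P B := fun z hz =>
    (ContDiffAt.comp (g := fun p : F × F => segmentTransport Γ p.1 p.2) z
      (contDiffAt_segmentTransport hBo hB hΓ h0 hz)
      (contDiffAt_const.prodMk contDiffAt_id)).contDiffWithinAt
  let J : Y →L[ℝ] F := (κ.symm : X × Y →L[ℝ] F) ∘L ContinuousLinearMap.inr ℝ X Y
  have hJ : ∀ b, κ (J b) = (0, b) := fun b => κ.apply_symm_apply _
  have hJ' : ∀ w, (κ w).1 = 0 → J (κ w).2 = w := fun w hw => by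
    apply κ.injective
    rw [hJ]
    exact Prod.ext hw.symm rfl
  have hP0 : P 0 = 1 := segmentTransport_self hB hΓ.continuousOn h0
  obtain ⟨u, O, hO, h0O, hOB, hu, huN, hu0⟩ := exists_first_integral_of_frame κ
    (N := fun z => P z ∘L J) hBo h0 (hP.clm_comp contDiffOn_const)
    (fun b => by rw [hP0]; exact hJ b) (by
    intro z hz b b'
    have hd : ∀ v, fderiv ℝ (fun z => P z ∘L J) z v = fderiv ℝ P z v ∘L J := fun v => by
      have h1 := ((hP.contDiffAt (hBo.mem_nhds hz)).differentiableAt (by simp)).hasFDerivAt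
      rw [(h1.clm_comp (hasFDerivAt_const J z)).fderiv]
      ext
      simp
    rw [hd, hd]
    have hk : ∀ v b, ∃ d, fderiv ℝ P z v (J b) + Γ z v (P z (J b)) = P z (J d) := by
      intro v b
      obtain ⟨A, hA, hA'⟩ := exists_fderiv_segmentTransport_eq hBo hB hΓ h0 hz v
      refine ⟨-(κ (A (J b))).2, ?_⟩
      rw [map_neg, hJ' _ (hinv A hA _ (by rw [hJ])), map_neg]
      exact congrArg (fun T : F →L[ℝ] F => T (J b)) hA'
    obtain ⟨d, hd⟩ := hk (P z (J b)) b'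
    obtain ⟨d', hd'⟩ := hk (P z (J b')) b
    refine ⟨d - d', ?_⟩
    show fderiv ℝ P z (P z (J b)) (J b') - fderiv ℝ P z (P z (J b')) (J b) = P z (J (d - d'))
    rw [map_sub, map_sub, ← hd, ← hd', hsymm z hz (P z (J b')) (P z (J b))]
    abel)
  refine ⟨u, O, hO, h0O, hOB, hu, fun z hz w hw => ?_, hu0⟩
  have := huN z hz (κ w).2
  show fderiv ℝ u z (P z w) = 0
  rw [← hJ' w hw]
  exact this

/-- If the holonomy algebra preserves both factors, then there are coordinates in which the
transports of the factors are the factors. -/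
theorem exists_straightening {Γ : X × Y → X × Y →L[ℝ] X × Y →L[ℝ] X × Y} {B : Set (X × Y)}
    (hBo : IsOpen B) (hB : Convex ℝ B) (hΓ : ContDiffOn ℝ ∞ Γ B)
    (hsymm : ∀ y ∈ B, ∀ u w, Γ y u w = Γ y w u) (h0 : 0 ∈ B)
    (hinv₁ : ∀ A, IsVelocity (coordHolonomy Γ B 0) A → ∀ w ∈ factorOne X Y, A w ∈ factorOne X Y)
    (hinv₂ : ∀ A, IsVelocity (coordHolonomy Γ B 0) A → ∀ w ∈ factorTwo X Y, A w ∈ factorTwo X Y) :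
    ∃ e : OpenPartialHomeomorph (X × Y) (X × Y), 0 ∈ e.source ∧ e.source ⊆ B ∧
      ContDiffOn ℝ ∞ e e.source ∧ ContDiffOn ℝ ∞ e.symm e.target ∧
      fderiv ℝ e 0 = ContinuousLinearMap.id ℝ (X × Y) ∧
      (∀ z ∈ e.source, ∃ g : (X × Y) ≃L[ℝ] (X × Y), fderiv ℝ e z = (g : X × Y →L[ℝ] X × Y)) ∧
      (∀ z ∈ e.source, ∀ w ∈ factorOne X Y,
        fderiv ℝ e z (segmentTransport Γ 0 z w) ∈ factorOne X Y) ∧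
      ∀ z ∈ e.source, ∀ w ∈ factorTwo X Y,
        fderiv ℝ e z (segmentTransport Γ 0 z w) ∈ factorTwo X Y := by
  -- `u` has the transported second factor in the kernel of its differential and `v` the transported
  -- first; together they are coordinates with identity differential at 0.
  obtain ⟨u, O, hO, h0O, hOB, hu, huP, hu0⟩ := exists_first_integral_of_invariant hBo hB hΓ hsymm h0
    (ContinuousLinearEquiv.refl ℝ (X × Y)) hinv₂
  obtain ⟨v, O', hO', h0O', -, hv, hvP, hv0⟩ := exists_first_integral_of_invariant hBo hB hΓ hsymm h0
    (ContinuousLinearEquiv.prodComm ℝ X Y) hinv₁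
  have hud : ∀ z ∈ O ∩ O', DifferentiableAt ℝ u z := fun z hz =>
    (hu.contDiffAt (hO.mem_nhds hz.1)).differentiableAt (by simp)
  have hvd : ∀ z ∈ O ∩ O', DifferentiableAt ℝ v z := fun z hz =>
    (hv.contDiffAt (hO'.mem_nhds hz.2)).differentiableAt (by simp)
  have hfd : ∀ z ∈ O ∩ O', HasFDerivAt (fun z => (u z, v z)) ((fderiv ℝ u z).prod (fderiv ℝ v z)) z :=
    fun z hz => (hud z hz).hasFDerivAt.prodMk (hvd z hz).hasFDerivAt
  have hid : (fderiv ℝ u 0).prod (fderiv ℝ v 0) = ContinuousLinearMap.id ℝ (X × Y) :=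
    ContinuousLinearMap.ext fun w => Prod.ext (hu0 w) (hv0 w)
  obtain ⟨e, he0, heO, hef, heq, hes⟩ := exists_smooth_local_inverse (hO.inter hO')
    ((hu.mono inter_subset_left).prodMk (hv.mono inter_subset_right))
    (⟨h0O, h0O'⟩ : (0 : X × Y) ∈ O ∩ O') (f' := ContinuousLinearEquiv.refl ℝ (X × Y))
    (by have := hfd 0 ⟨h0O, h0O'⟩
        rw [hid] at this
        exact this)
  have hef' : (e : X × Y → X × Y) = fun z => (u z, v z) := funext hef
  refine ⟨e, he0, fun z hz => hOB (heO hz).1, ?_, hes, ?_, ?_, ?_, ?_⟩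
  · rw [hef']
    exact ((hu.mono inter_subset_left).prodMk (hv.mono inter_subset_right)).mono heO
  · rw [hef', (hfd 0 ⟨h0O, h0O'⟩).fderiv, hid]
  · rw [hef']; exact heq
  · intro z hz w hw
    rw [hef', (hfd z (heO hz)).fderiv]
    exact hvP z (heO hz).2 w hw
  · intro z hz w hw
    rw [hef', (hfd z (heO hz)).fderiv]
    exact huP z (heO hz).1 w hw

end Straightening

/-! ### Invariance of the radially transported distribution under all transports -/

section Gauge

variable {F : Type*} [NormedAddCommGroup F] [NormedSpace ℝ F] [FiniteDimensional ℝ F]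
  {Γ : F → F →L[ℝ] F →L[ℝ] F} {B : Set F} {W : Submodule ℝ F} {o : F}

/-- If the velocities of the holonomy group at `o` preserve `W`, then parallel transport along any
path preserves the distribution obtained from `W` by transport along segments from `o`. -/
lemma IsParallelCurve.mem_transported (hBo : IsOpen B) (hB : Convex ℝ B) (hΓ : ContDiffOn ℝ ∞ Γ B)
    (ho : o ∈ B) (hinv : ∀ A, IsVelocity (coordHolonomy Γ B o) A → ∀ w ∈ W, A w ∈ W)
    {c ξ : ℝ → F} {a b : ℝ} (hab : a ≤ b) (hc : PiecewiseC1On (E := F) c a b)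
    (hcB : ∀ t ∈ Icc a b, c t ∈ B) (hξ : IsParallelCurve Γ c ξ a b)
    (h0 : segmentTransport Γ (c a) o (ξ a) ∈ W) : segmentTransport Γ (c b) o (ξ b) ∈ W := by
  have hTT := contDiffOn_segmentTransport hBo hB hΓ
  let P := segmentTransport Γ o
  let Q := fun y => segmentTransport Γ y o
  have hP : ContDiffOn ℝ ∞ P B := hTT.comp (f := fun y => (o, y))
    (contDiffOn_const.prodMk contDiffOn_id) fun _ hy => ⟨ho, hy⟩
  have hQ : ContDiffOn ℝ ∞ Q B := hTT.comp (f := fun y => (y, o))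
    (contDiffOn_id.prodMk contDiffOn_const) fun _ hy => ⟨hy, ho⟩
  have hQP : ∀ y ∈ B, ∀ v, Q y (P y v) = v := fun y hy v =>
    segmentTransport_apply_symm hB hΓ.continuousOn ho hy v
  have hPQ : ∀ y ∈ B, ∀ v, P y (Q y v) = v := fun y hy v =>
    segmentTransport_apply_symm hB hΓ.continuousOn hy ho v
  let C := ContinuousLinearMap.compL ℝ F F F
  -- The connection in the radial frame `P`. By the triangle formula its values are velocities up to
  -- sign, so they preserve `W`, and invariance under constant subspaces applies.
  let Γ' : F → F →L[ℝ] F →L[ℝ] F := fun y => C (Q y) ∘L (fderiv ℝ P y + C.flip (P y) ∘L Γ y)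
  have hΓ'a : ∀ y v w, Γ' y v w = Q y (fderiv ℝ P y v w + Γ y v (P y w)) := fun _ _ _ => rfl
  have hΓ'c : ContinuousOn Γ' B :=
    (C.continuous.comp_continuousOn hQ.continuousOn).clm_comp
      ((hP.continuousOn_fderiv_of_isOpen hBo (by simp)).add
        ((C.flip.continuous.comp_continuousOn hP.continuousOn).clm_comp hΓ.continuousOn))
  have hΓ'W : ∀ y ∈ B, ∀ u, ∀ w ∈ W, Γ' y u w ∈ W := by
    intro y hy u w hw
    obtain ⟨A, hA, hA'⟩ := exists_fderiv_segmentTransport_eq hBo hB hΓ ho hy u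
    have h1 : fderiv ℝ P y u w + Γ y u (P y w) = -(P y (A w)) :=
      congrArg (fun T : F →L[ℝ] F => T w) hA'
    rw [hΓ'a, h1, map_neg, hQP y hy]
    exact W.neg_mem (hinv A hA w hw)
  have hcc := hc.continuousOn
  refine IsParallelCurve.mem_submodule (ξ := fun t => Q (c t) (ξ t)) hΓ'c hΓ'W hab hc hcB
    ⟨(hQ.continuousOn.comp hcc hcB).clm_apply hξ.1, hξ.2.subset ?_⟩ h0
  rintro t ⟨ht, hn⟩
  refine ⟨ht, fun ⟨c', hc', hd⟩ => hn ⟨c', hc', ?_⟩⟩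
  have htB := hcB t (Ioo_subset_Icc_self ht)
  have hQd := ((hQ.contDiffAt (hBo.mem_nhds htB)).differentiableAt (by simp)).hasFDerivAt
  have hPd := ((hP.contDiffAt (hBo.mem_nhds htB)).differentiableAt (by simp)).hasFDerivAt
  have h1 := (hQd.comp_hasDerivAt (l := Q) t hc').clm_apply hd
  set η' := fderiv ℝ Q (c t) c' (ξ t) + Q (c t) (-(Γ (c t) c' (ξ t)))
  have h2 : HasDerivAt (fun s => P (c s) (Q (c s) (ξ s)))
      (fderiv ℝ P (c t) c' (Q (c t) (ξ t)) + P (c t) η') t :=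
    (hPd.comp_hasDerivAt (l := P) t hc').clm_apply h1
  -- Differentiating the identity P Q ξ = ξ along the curve avoids computing the derivative of the
  -- inverse frame.
  have h3 := h2.unique (hd.congr_of_eventuallyEq (by
    filter_upwards [Icc_mem_nhds ht.1 ht.2] with s hs using hPQ _ (hcB s hs) _))
  have h4 := congrArg (Q (c t)) h3
  rw [map_add, hQP _ htB, map_neg] at h4
  refine h1.congr_deriv ?_
  show η' = _
  rw [hΓ'a, hPQ _ htB, map_add]
  linear_combination (norm := module) h4

end Gauge

/-! ### A criterion for adapted charts -/

section AdaptedCriterion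

variable {E : Type*} [NormedAddCommGroup E] [NormedSpace ℝ E] [FiniteDimensional ℝ E]
  {M : Type*} [TopologicalSpace M] [T2Space M] [ChartedSpace E M] [IsManifold 𝓘(ℝ, E) ∞ M]
  {F : Type*} [NormedAddCommGroup F] [NormedSpace ℝ F] [FiniteDimensional ℝ F]
  {Φ Φ₀ : OpenPartialHomeomorph M F}
  {cov : CovariantDerivative 𝓘(ℝ, E) E (TangentSpace 𝓘(ℝ, E) : M → Type _)} {o : M}
  {V : Submodule ℝ (TangentSpace 𝓘(ℝ, E) o)} {W W₀ : Submodule ℝ F}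

lemma IsSmoothChart.isPathIn_symm_segment (hΦ : IsSmoothChart (E := E) Φ)
    (hconv : Convex ℝ Φ.target) {p q : M} (hp : p ∈ Φ.source) (hq : q ∈ Φ.source) :
    IsPathIn (E := E) Φ.source p q (fun t => Φ.symm (Φ p + t • (Φ q - Φ p))) := by
  have := hΦ.isPathIn_symm subset_rfl
    (isPathIn_segment hconv (Φ.map_source hp) (Φ.map_source hq))
  rwa [Φ.left_inv hp, Φ.left_inv hq, Φ.symm_image_target_eq_source] at this

lemma IsSmoothChart.transports_segment (hΦ : IsSmoothChart (E := E) Φ)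
    (hconv : Convex ℝ Φ.target) (hΓ : ContinuousOn (christoffel cov Φ) Φ.target) {p q : M}
    (hp : p ∈ Φ.source) (hq : q ∈ Φ.source) {v : TangentSpace 𝓘(ℝ, E) p}
    {w : TangentSpace 𝓘(ℝ, E) q} (h : dchart (E := E) Φ q w =
      segmentTransport (christoffel cov Φ) (Φ p) (Φ q) (dchart (E := E) Φ p v)) :
    Transports cov (fun t => Φ.symm (Φ p + t • (Φ q - Φ p))) 0 1 ⟨p, v⟩ ⟨q, w⟩ := by
  have hpath := hΦ.isPathIn_symm_segment hconv hp hq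
  obtain ⟨ξ, hξ, hξ0, hξ1⟩ := (isTransportPath_segment hconv hΓ (Φ.map_source hp)
    (Φ.map_source hq)).transport (dchart (E := E) Φ p v)
  refine hΦ.transports_of_parallel (ξ := ξ) zero_le_one hpath.continuousOn hpath.mem ?_
    hpath.source.symm hpath.target.symm hξ0.symm (h.trans hξ1.symm)
  exact hξ.congr (fun t ht => Φ.right_inv (segment_mem hconv (Φ.map_source hp)
    (Φ.map_source hq) ht)) fun _ _ => rfl

/-- A chart is adapted to `V` if it straightens the distribution obtained by transport of `V` along
the segments of another chart, provided that the holonomy algebra preserves `V`. -/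
theorem IsSmoothChart.isAdaptedChart [CovariantDerivative.ContMDiffCovariantDerivative cov ∞]
    (hΦ₀ : IsSmoothChart (E := E) Φ₀) (hconv₀ : Convex ℝ Φ₀.target)
    (hinv : ∀ A, IsVelocity (coordHolonomy (christoffel cov Φ₀) Φ₀.target (Φ₀ o)) A →
      ∀ w ∈ W₀, A w ∈ W₀)
    (hV : ∀ v : TangentSpace 𝓘(ℝ, E) o, dchart (E := E) Φ₀ o v ∈ W₀ ↔ v ∈ V)
    (hΦ : IsSmoothChart (E := E) Φ) (hconv : Convex ℝ Φ.target) (ho : o ∈ Φ.source)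
    (hsub : Φ.source ⊆ Φ₀.source)
    (hlink : ∀ x ∈ Φ.source, ∀ v : TangentSpace 𝓘(ℝ, E) x, dchart (E := E) Φ x v ∈ W ↔
      segmentTransport (christoffel cov Φ₀) (Φ₀ x) (Φ₀ o) (dchart (E := E) Φ₀ x v) ∈ W₀) :
    IsAdaptedChart cov o V Φ W := by
  have hΓ₀ : ContDiffOn ℝ ∞ (christoffel cov Φ₀) Φ₀.target :=
    hΦ₀.contDiffOn_christoffel (cov := cov)
  have hΓ : ContinuousOn (christoffel cov Φ) Φ.target :=
    (hΦ.contDiffOn_christoffel (cov := cov)).continuousOn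
  have ho₀ := Φ₀.map_source (hsub ho)
  -- Invariance is proved in the old chart and read in the new one; it holds for every path in the
  -- smaller domain, as the distribution of `V` requires.
  have key : ∀ (c : ℝ → M) (p q : M), IsPathIn (E := E) Φ.source p q c →
      ∀ (v : TangentSpace 𝓘(ℝ, E) p) (w : TangentSpace 𝓘(ℝ, E) q),
      Transports cov c 0 1 ⟨p, v⟩ ⟨q, w⟩ → dchart (E := E) Φ p v ∈ W →
      dchart (E := E) Φ q w ∈ W := by
    intro c p q hc v w ht hv
    have hp : p ∈ Φ.source := hc.source ▸ hc.mem 0 ⟨le_rfl, zero_le_one⟩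
    have hq : q ∈ Φ.source := hc.target ▸ hc.mem 1 ⟨zero_le_one, le_rfl⟩
    have hc₀ : ∀ t ∈ Icc (0 : ℝ) 1, c t ∈ Φ₀.source := fun t ht => hsub (hc.mem t ht)
    obtain ⟨-, -, ξ, hξ, hξ0, hξ1⟩ := hΦ₀.parallel_of_transports zero_le_one hc₀ ht
    have h1 := hξ.mem_transported Φ₀.open_target hconv₀ hΓ₀ ho₀ hinv zero_le_one
      (hΦ₀.piecewiseC1On hc.piecewise hc₀) (fun t ht => Φ₀.map_source (hc₀ t ht))
      (by rw [hξ0, hc.source]; exact (hlink p hp v).1 hv)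
    rw [hξ1, hc.target] at h1
    exact (hlink q hq w).2 h1
  have hVo : ∀ v : TangentSpace 𝓘(ℝ, E) o, dchart (E := E) Φ o v ∈ W ↔ v ∈ V := fun v => by
    rw [hlink o ho v, segmentTransport_self hconv₀ hΓ₀.continuousOn ho₀]
    exact hV v
  refine ⟨hΦ, hconv, ho, fun x hx v => ⟨fun hv => ?_, fun hv => ?_⟩⟩
  · have hle : parallelDistribution cov Φ.source o V x ≤
        W.comap (dchart (E := E) Φ x : E →ₗ[ℝ] F) := by
      refine Submodule.span_le.2 ?_
      rintro w ⟨c, hc, v₀, hv₀, ht⟩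
      exact key c o x hc v₀ w ht ((hVo v₀).2 hv₀)
    exact hle hv
  · let u : E := dchartSymm (E := E) Φ (Φ o)
      (segmentTransport (christoffel cov Φ) (Φ x) (Φ o) (dchart (E := E) Φ x v))
    have hu : dchart (E := E) Φ o u = segmentTransport (christoffel cov Φ) (Φ x) (Φ o)
        (dchart (E := E) Φ x v) := hΦ.dchart_dchartSymm' ho _
    have h1 := key _ x o (hΦ.isPathIn_symm_segment hconv hx ho) v u
      (hΦ.transports_segment hconv hΓ hx ho hu) hv
    refine Submodule.subset_span ⟨_, hΦ.isPathIn_symm_segment hconv ho hx, u, (hVo u).1 h1,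
      hΦ.transports_segment hconv hΓ ho hx ?_⟩
    rw [hu, segmentTransport_apply_symm hconv hΓ (Φ.map_source hx) (Φ.map_source ho)]

end AdaptedCriterion

/-! ### Composition, restriction and normalization of charts -/

section ChartConstructions

variable {E : Type*} [NormedAddCommGroup E] [NormedSpace ℝ E]
  {M : Type*} [TopologicalSpace M] [ChartedSpace E M]
  {F G : Type*} [NormedAddCommGroup F] [NormedSpace ℝ F] [NormedAddCommGroup G] [NormedSpace ℝ G]
  {Φ : OpenPartialHomeomorph M F}

lemma IsSmoothChart.trans (hΦ : IsSmoothChart (E := E) Φ) {e : OpenPartialHomeomorph F G}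
    (he : ContDiffOn ℝ ∞ e e.source) (he' : ContDiffOn ℝ ∞ e.symm e.target) :
    IsSmoothChart (E := E) (Φ.trans e) := by
  refine ⟨?_, ?_⟩
  · exact (contMDiffOn_iff_contDiffOn.2 he).comp (hΦ.smooth.mono fun x hx => hx.1) fun x hx => hx.2
  · exact hΦ.smooth_symm.comp ((contMDiffOn_iff_contDiffOn.2 he').mono fun x hx => hx.1)
      fun x hx => hx.2

lemma IsSmoothChart.dchart_trans (hΦ : IsSmoothChart (E := E) Φ) {e : OpenPartialHomeomorph F G}
    (he : ContDiffOn ℝ ∞ e e.source) {x : M} (hx : x ∈ (Φ.trans e).source) (v : E) :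
    dchart (E := E) (Φ.trans e) x v = fderiv ℝ e (Φ x) (dchart (E := E) Φ x v) := by
  have h1 : HasMFDerivAt 𝓘(ℝ, F) 𝓘(ℝ, G) e (Φ x) (fderiv ℝ e (Φ x)) :=
    ((he.contDiffAt (e.open_source.mem_nhds hx.2)).differentiableAt
      (by simp)).hasFDerivAt.hasMFDerivAt
  have h2 := (HasMFDerivAt.comp (g := e) x h1 (hΦ.mdifferentiableAt hx.1).hasMFDerivAt).mfderiv
  exact congrArg (fun T : E →L[ℝ] G => T v) h2

lemma isSmoothChart_chartAt [IsManifold 𝓘(ℝ, E) ∞ M] (o : M) :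
    IsSmoothChart (E := E) (chartAt E o) :=
  ⟨contMDiffOn_chart, contMDiffOn_chart_symm⟩

/-- The restriction of a chart to the preimage of a ball. -/
def ballChart (Φ : OpenPartialHomeomorph M F) (y : F) (ρ : ℝ) : OpenPartialHomeomorph M F :=
  (Φ.symm.restrOpen (Metric.ball y ρ) Metric.isOpen_ball).symm

lemma ballChart_target {y : F} {ρ : ℝ} (h : Metric.ball y ρ ⊆ Φ.target) :
    (ballChart Φ y ρ).target = Metric.ball y ρ :=
  (Φ.symm.restrOpen_source _ Metric.isOpen_ball).trans (inter_eq_right.2 h)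

lemma mem_ballChart_source {y : F} {ρ : ℝ} (h : Metric.ball y ρ ⊆ Φ.target) {x : M} :
    x ∈ (ballChart Φ y ρ).source ↔ x ∈ Φ.source ∧ Φ x ∈ Metric.ball y ρ := by
  constructor
  · intro hx
    have h1 : Φ x ∈ Metric.ball y ρ := ballChart_target h ▸ (ballChart Φ y ρ).map_source hx
    have h2 : Φ.symm (Φ x) = x := (ballChart Φ y ρ).left_inv hx
    exact ⟨h2 ▸ Φ.map_target (h h1), h1⟩
  · rintro ⟨hx, hxy⟩
    rw [← Φ.left_inv hx]
    exact (ballChart Φ y ρ).map_target (ballChart_target h ▸ hxy)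

lemma IsSmoothChart.ballChart (hΦ : IsSmoothChart (E := E) Φ) {y : F} {ρ : ℝ}
    (h : Metric.ball y ρ ⊆ Φ.target) : IsSmoothChart (E := E) (ballChart Φ y ρ) :=
  ⟨hΦ.smooth.mono fun _ hx => ((mem_ballChart_source h).1 hx).1,
    hΦ.smooth_symm.mono (by rw [ballChart_target h]; exact h)⟩

/-- There is a chart, with a ball around the origin as its image, with prescribed differential
at a point. -/
lemma exists_chart_of_equiv [IsManifold 𝓘(ℝ, E) ∞ M] {o : M} {W : Set M} (hW : W ∈ 𝓝 o)
    (ℓ : E ≃L[ℝ] F) : ∃ Φ : OpenPartialHomeomorph M F, IsSmoothChart (E := E) Φ ∧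
      Convex ℝ Φ.target ∧ o ∈ Φ.source ∧ Φ.source ⊆ W ∧ Φ o = 0 ∧
      ∀ v : E, dchart (E := E) Φ o v = ℓ v := by
  have hΨ := isSmoothChart_chartAt (E := E) o
  set Ψ := chartAt E o
  have ho : o ∈ Ψ.source := mem_chart_source E o
  -- Cancels the differential of the preferred chart at `o` before applying the prescribed one.
  let κ : E ≃L[ℝ] F := (hΨ.tangentEquiv ho).symm.trans ℓ
  let e : OpenPartialHomeomorph E F :=
    (κ.toHomeomorph.trans (Homeomorph.addRight (-κ (Ψ o)))).toOpenPartialHomeomorph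
  have he : ∀ y, e y = κ y + -κ (Ψ o) := fun _ => rfl
  have hes : ∀ z, e.symm z = κ.symm (z + -(-κ (Ψ o))) := fun _ => rfl
  have hec : ContDiff ℝ ∞ e := κ.contDiff.add contDiff_const
  have hec' : ContDiff ℝ ∞ e.symm := κ.symm.contDiff.comp (contDiff_id.add contDiff_const)
  have hΦ := hΨ.trans hec.contDiffOn hec'.contDiffOn
  have hoΦ : o ∈ (Ψ.trans e).source := ⟨ho, mem_univ _⟩
  have hΦo : (Ψ.trans e) o = 0 := (he _).trans (add_neg_cancel _)
  have hnhds : (Ψ.trans e).target ∩ (Ψ.trans e).symm ⁻¹' W ∈ 𝓝 (0 : F) := by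
    have h0 : (0 : F) ∈ (Ψ.trans e).target := hΦo ▸ (Ψ.trans e).map_source hoΦ
    refine inter_mem ((Ψ.trans e).open_target.mem_nhds h0) ?_
    refine ((Ψ.trans e).symm.continuousAt h0).preimage_mem_nhds ?_
    rw [← hΦo, (Ψ.trans e).left_inv hoΦ]
    exact hW
  obtain ⟨ρ, hρ, hball⟩ := Metric.mem_nhds_iff.1 hnhds
  have hb : Metric.ball (0 : F) ρ ⊆ (Ψ.trans e).target := fun y hy => (hball hy).1
  refine ⟨ballChart (Ψ.trans e) 0 ρ, hΦ.ballChart hb, ?_, ?_, fun x hx => ?_, hΦo, fun v => ?_⟩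
  · rw [ballChart_target hb]; exact convex_ball _ _
  · exact (mem_ballChart_source hb).2 ⟨hoΦ, hΦo ▸ Metric.mem_ball_self hρ⟩
  · obtain ⟨h1, h2⟩ := (mem_ballChart_source hb).1 hx
    have := (hball h2).2
    rwa [mem_preimage, (Ψ.trans e).left_inv h1] at this
  · refine (hΨ.dchart_trans hec.contDiffOn hoΦ v).trans ?_
    have h1 : fderiv ℝ e (Ψ o) = κ :=
      (κ.hasFDerivAt.add_const (-κ (Ψ o))).fderiv
    rw [h1]
    exact congrArg ℓ ((hΨ.tangentEquiv ho).symm_apply_apply v)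

end ChartConstructions

/-! ### Existence of small product charts -/

section ExistsProductChart

/-- If the image lies in `W`, then so does the image of the `W'` part; it also lies in `W'`, so it
is zero and injectivity removes that part. -/
lemma map_mem_iff_of_disjoint {F : Type*} [AddCommGroup F] [Module ℝ F] {W W' : Submodule ℝ F}
    (hd : Disjoint W W') (hs : W ⊔ W' = ⊤) {N : F →ₗ[ℝ] F} (hN : Function.Injective N)
    (h : ∀ w ∈ W, N w ∈ W) (h' : ∀ w ∈ W', N w ∈ W') (u : F) : N u ∈ W ↔ u ∈ W := by
  refine ⟨fun hu => ?_, h u⟩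
  obtain ⟨w, hw, w', hw', rfl⟩ := Submodule.mem_sup.1 (hs ▸ Submodule.mem_top : u ∈ W ⊔ W')
  rw [map_add] at hu
  have h1 : N w' = 0 := Submodule.disjoint_def.1 hd _
    ((W.add_mem_iff_right (h w hw)).1 hu) (h' w' hw')
  rwa [hN (h1.trans (map_zero N).symm), add_zero]

lemma factorOne_sup_factorTwo (X Y : Type*) [NormedAddCommGroup X] [NormedSpace ℝ X]
    [FiniteDimensional ℝ X] [NormedAddCommGroup Y] [NormedSpace ℝ Y] [FiniteDimensional ℝ Y] :
    factorOne X Y ⊔ factorTwo X Y = ⊤ :=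
  eq_top_iff.2 fun v _ => Submodule.mem_sup.2
    ⟨(v.1, 0), mem_factorOne.2 rfl, (0, v.2), mem_factorTwo.2 rfl, by simp⟩

/-- Transports depend continuously on their end points and are the identity for equal ones. The
bound is uniform in both points because it will be used on every slice. -/
lemma exists_ball_transport_near_one {F X : Type*} [NormedAddCommGroup F] [NormedSpace ℝ F]
    [FiniteDimensional ℝ F] [NormedAddCommGroup X] [NormedSpace ℝ X]
    {Γ : F → F →L[ℝ] F →L[ℝ] F} {B : Set F} (hBo : IsOpen B) (hB : Convex ℝ B)
    (hΓ : ContDiffOn ℝ ∞ Γ B) {o : F} (ho : o ∈ B) {R : F →L[ℝ] X} {A : X →L[ℝ] F}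
    (hRA : ∀ u, R (A u) = u) : ∃ ρ > 0, ∀ c ∈ Metric.ball o ρ, ∀ y ∈ Metric.ball o ρ,
      ‖R ∘L (segmentTransport Γ c o * segmentTransport Γ y c) ∘L A - 1‖ ≤ 1 / 2 := by
  let S : F × F → X →L[ℝ] X := fun p =>
    R ∘L (segmentTransport Γ p.1 o * segmentTransport Γ p.2 p.1) ∘L A
  have hT := (contDiffAt_segmentTransport hBo hB hΓ ho ho).continuousAt
  have h1 : ContinuousAt (fun p : F × F => segmentTransport Γ p.1 o) (o, o) :=
    ContinuousAt.comp (g := fun p : F × F => segmentTransport Γ p.1 p.2)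
      (f := fun p : F × F => (p.1, o)) (by exact hT) (by fun_prop)
  have h2 : ContinuousAt (fun p : F × F => segmentTransport Γ p.2 p.1) (o, o) :=
    ContinuousAt.comp (g := fun p : F × F => segmentTransport Γ p.1 p.2)
      (f := fun p : F × F => (p.2, p.1)) (by exact hT) (by fun_prop)
  have hS : ContinuousAt S (o, o) :=
    continuousAt_const.clm_comp ((h1.mul h2).clm_comp continuousAt_const)
  have hS0 : S (o, o) = 1 := by
    ext u
    show R ((segmentTransport Γ o o * segmentTransport Γ o o) (A u)) = u
    rw [segmentTransport_self hB hΓ.continuousOn ho, one_mul]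
    exact hRA u
  have h3 := hS.preimage_mem_nhds (Metric.closedBall_mem_nhds _ (by norm_num : (0 : ℝ) < 1 / 2))
  obtain ⟨ρ, hρ, hsub⟩ := Metric.mem_nhds_iff.1 h3
  refine ⟨ρ, hρ, fun c hc y hy => ?_⟩
  have h4 : (c, y) ∈ Metric.ball (o, o) ρ := by
    rw [← ball_prod_same]; exact ⟨hc, hy⟩
  have h5 := hsub h4
  rw [mem_preimage, hS0, mem_closedBall_iff_norm] at h5
  exact h5

variable {E : Type*} [NormedAddCommGroup E] [NormedSpace ℝ E] [FiniteDimensional ℝ E]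
  [CompleteSpace E] {M : Type*} [TopologicalSpace M] [T2Space M] [ChartedSpace E M]
  [IsManifold 𝓘(ℝ, E) ∞ M]
  {cov : CovariantDerivative 𝓘(ℝ, E) E (TangentSpace 𝓘(ℝ, E) : M → Type _)} {o : M}

lemma IsSmoothChart.velocity_mem {F : Type*} [NormedAddCommGroup F] [NormedSpace ℝ F]
    [FiniteDimensional ℝ F] {Φ : OpenPartialHomeomorph M F} (hΦ : IsSmoothChart (E := E) Φ)
    (hconv : Convex ℝ Φ.target) (hΓ : ContinuousOn (christoffel cov Φ) Φ.target)
    (ho : o ∈ Φ.source) {V : Submodule ℝ (TangentSpace 𝓘(ℝ, E) o)}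
    (hV : IsFaithfulSubrep cov o V) {W : Submodule ℝ F}
    (hVW : ∀ v : TangentSpace 𝓘(ℝ, E) o, dchart (E := E) Φ o v ∈ W ↔ v ∈ V) {A : F →L[ℝ] F}
    (hA : IsVelocity (coordHolonomy (christoffel cov Φ) Φ.target (Φ o)) A) :
    ∀ w ∈ W, A w ∈ W := by
  intro w hw
  let e := hΦ.tangentEquiv ho
  have h1 : (e.symm w : E) ∈ V := (hVW (e.symm w : E)).1 (by
    rwa [show dchart (E := E) Φ o (e.symm w) = w from e.apply_symm_apply w])
  have h2 := hV.invariant _ (hΦ.mem_holonomyAlgebra hconv hΓ ho hA) _ h1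
  have h3 := (hVW _).2 h2
  have h4 : dchart (E := E) Φ o (e.symm (A (e (e.symm w)))) = A w := by
    rw [e.apply_symm_apply]; exact e.apply_symm_apply (A w)
  rw [← h4]
  exact h3

lemma exists_adapted_equiv {V₁ V₂ : Submodule ℝ E} (hV : IsCompl V₁ V₂) {n₁ n₂ : ℕ}
    (b₁ : Module.Basis (Fin n₁) ℝ V₁) (b₂ : Module.Basis (Fin n₂) ℝ V₂) :
    ∃ ℓ : E ≃L[ℝ] (Fin n₁ → ℝ) × (Fin n₂ → ℝ),
      (∀ i, ℓ (b₁ i) = (Pi.single i 1, 0)) ∧ (∀ i, ℓ (b₂ i) = (0, Pi.single i 1)) ∧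
      (∀ v, ℓ v ∈ factorOne (Fin n₁ → ℝ) (Fin n₂ → ℝ) ↔ v ∈ V₁) ∧
      ∀ v, ℓ v ∈ factorTwo (Fin n₁ → ℝ) (Fin n₂ → ℝ) ↔ v ∈ V₂ := by
  let p := (Submodule.prodEquivOfIsCompl V₁ V₂ hV).symm
  let ℓ : E ≃ₗ[ℝ] (Fin n₁ → ℝ) × (Fin n₂ → ℝ) := p.trans (b₁.equivFun.prodCongr b₂.equivFun)
  have hℓ : ∀ v, ℓ v = (b₁.equivFun (p v).1, b₂.equivFun (p v).2) := fun v => rfl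
  refine ⟨ℓ.toContinuousLinearEquiv, fun i => ?_, fun i => ?_, fun v => ?_, fun v => ?_⟩
  · show ℓ (b₁ i) = _
    rw [hℓ, show p (b₁ i) = (b₁ i, 0) from Submodule.prodEquivOfIsCompl_symm_apply_left _ _ hV (b₁ i),
      map_zero]
    refine Prod.ext (funext fun j => (b₁.equivFun_self i j).trans ?_) rfl
    exact (if_congr eq_comm rfl rfl).trans (Pi.single_apply i (1 : ℝ) j).symm
  · show ℓ (b₂ i) = _
    rw [hℓ, show p (b₂ i) = (0, b₂ i) from Submodule.prodEquivOfIsCompl_symm_apply_right _ _ hV (b₂ i),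
      map_zero]
    refine Prod.ext rfl (funext fun j => (b₂.equivFun_self i j).trans ?_)
    exact (if_congr eq_comm rfl rfl).trans (Pi.single_apply i (1 : ℝ) j).symm
  · show (ℓ v).2 = 0 ↔ _
    rw [hℓ]
    exact b₂.equivFun.map_eq_zero_iff.trans
      (Submodule.prodEquivOfIsCompl_symm_apply_snd_eq_zero _ _ hV)
  · show (ℓ v).1 = 0 ↔ _
    rw [hℓ]
    exact b₁.equivFun.map_eq_zero_iff.trans
      (Submodule.prodEquivOfIsCompl_symm_apply_fst_eq_zero _ _ hV)

/-- Existence of arbitrarily small product charts, normalized at `o`, in which the transports are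
close to the identity. -/
theorem exists_isProductChart [CovariantDerivative.ContMDiffCovariantDerivative cov ∞]
    (htorsion : cov.torsion = 0) {V₁ V₂ : Submodule ℝ (TangentSpace 𝓘(ℝ, E) o)}
    (hV : IsCompl V₁ V₂) (hV₁ : IsFaithfulSubrep cov o V₁) (hV₂ : IsFaithfulSubrep cov o V₂)
    {n₁ n₂ : ℕ} (b₁ : Module.Basis (Fin n₁) ℝ V₁) (b₂ : Module.Basis (Fin n₂) ℝ V₂)
    {W : Set M} (hW : W ∈ 𝓝 o) :
    ∃ (Φ : OpenPartialHomeomorph M ((Fin n₁ → ℝ) × (Fin n₂ → ℝ))) (B₁ : Set (Fin n₁ → ℝ))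
      (B₂ : Set (Fin n₂ → ℝ)), IsProductChart cov o V₁ V₂ Φ B₁ B₂ ∧ Convex ℝ B₁ ∧ Convex ℝ B₂ ∧
      Φ.source ⊆ W ∧
      (∀ i, dchart (E := E) Φ o (b₁ i).1 = (Pi.single i 1, 0)) ∧
      (∀ i, dchart (E := E) Φ o (b₂ i).1 = (0, Pi.single i 1)) ∧
      (∀ c ∈ Φ.target, ∀ y ∈ Φ.target, ‖ContinuousLinearMap.fst ℝ (Fin n₁ → ℝ) (Fin n₂ → ℝ) ∘L
        (segmentTransport (christoffel cov Φ) c (Φ o) * segmentTransport (christoffel cov Φ) y c) ∘L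
        ContinuousLinearMap.inl ℝ (Fin n₁ → ℝ) (Fin n₂ → ℝ) - 1‖ ≤ 1 / 2) ∧
      ∀ c ∈ Φ.target, ∀ y ∈ Φ.target, ‖ContinuousLinearMap.snd ℝ (Fin n₁ → ℝ) (Fin n₂ → ℝ) ∘L
        (segmentTransport (christoffel cov Φ) c (Φ o) * segmentTransport (christoffel cov Φ) y c) ∘L
        ContinuousLinearMap.inr ℝ (Fin n₁ → ℝ) (Fin n₂ → ℝ) - 1‖ ≤ 1 / 2 := by
  obtain ⟨ℓ, hℓ₁, hℓ₂, hℓV₁, hℓV₂⟩ := exists_adapted_equiv (E := E) hV b₁ b₂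
  obtain ⟨Φ₀, hΦ₀, hconv₀, ho₀, hW₀, hΦ₀o, hdΦ₀⟩ := exists_chart_of_equiv hW ℓ
  have hΓ₀ : ContDiffOn ℝ ∞ (christoffel cov Φ₀) Φ₀.target :=
    hΦ₀.contDiffOn_christoffel (cov := cov)
  have hV₁' : ∀ v : TangentSpace 𝓘(ℝ, E) o,
      dchart (E := E) Φ₀ o v ∈ factorOne (Fin n₁ → ℝ) (Fin n₂ → ℝ) ↔ v ∈ V₁ := fun v =>
    (congrArg (· ∈ factorOne (Fin n₁ → ℝ) (Fin n₂ → ℝ)) (hdΦ₀ v)).to_iff.trans (hℓV₁ v)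
  have hV₂' : ∀ v : TangentSpace 𝓘(ℝ, E) o,
      dchart (E := E) Φ₀ o v ∈ factorTwo (Fin n₁ → ℝ) (Fin n₂ → ℝ) ↔ v ∈ V₂ := fun v =>
    (congrArg (· ∈ factorTwo (Fin n₁ → ℝ) (Fin n₂ → ℝ)) (hdΦ₀ v)).to_iff.trans (hℓV₂ v)
  have hinv₁ := fun A => hΦ₀.velocity_mem (cov := cov) (A := A) hconv₀ hΓ₀.continuousOn ho₀ hV₁ hV₁'
  have hinv₂ := fun A => hΦ₀.velocity_mem (cov := cov) (A := A) hconv₀ hΓ₀.continuousOn ho₀ hV₂ hV₂'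
  -- Straighten the distributions obtained by radial transport in the auxiliary chart; the
  -- differential at `o` is not changed.
  obtain ⟨e, h0e, heB, hes, hes', he0, heq, heW₁, heW₂⟩ := exists_straightening Φ₀.open_target hconv₀
    hΓ₀ (fun y hy => hΦ₀.christoffel_symm htorsion hy) (hΦ₀o ▸ Φ₀.map_source ho₀)
    (hΦ₀o ▸ hinv₁) (hΦ₀o ▸ hinv₂)
  have hΨ := hΦ₀.trans hes hes'
  set Ψ := Φ₀.trans e with hΨdef
  have hoΨ : o ∈ Ψ.source := ⟨ho₀, show Φ₀ o ∈ e.source by rw [hΦ₀o]; exact h0e⟩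
  have hy₀ := Ψ.map_source hoΨ
  obtain ⟨ρ₁, hρ₁, hb₁⟩ := Metric.mem_nhds_iff.1 (Ψ.open_target.mem_nhds hy₀)
  have hΓ : ContDiffOn ℝ ∞ (christoffel cov Ψ) (Metric.ball (Ψ o) ρ₁) :=
    (hΨ.contDiffOn_christoffel (cov := cov)).mono hb₁
  obtain ⟨ρ₂, hρ₂, hs₂⟩ := exists_ball_transport_near_one Metric.isOpen_ball (convex_ball _ _) hΓ
    (Metric.mem_ball_self hρ₁) (isSplitting_factorOne (Fin n₁ → ℝ) (Fin n₂ → ℝ)).right_inv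
  obtain ⟨ρ₃, hρ₃, hs₃⟩ := exists_ball_transport_near_one Metric.isOpen_ball (convex_ball _ _) hΓ
    (Metric.mem_ball_self hρ₁) (isSplitting_factorTwo (Fin n₁ → ℝ) (Fin n₂ → ℝ)).right_inv
  -- The image is a ball in the maximum norm of the product, hence a product of balls, small enough
  -- for the estimates on both factors.
  let ρ := min ρ₁ (min ρ₂ ρ₃)
  have hρ : 0 < ρ := lt_min hρ₁ (lt_min hρ₂ hρ₃)
  have hρb : Metric.ball (Ψ o) ρ ⊆ Ψ.target :=
    (Metric.ball_subset_ball (min_le_left _ _)).trans hb₁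
  have hρb₂ : Metric.ball (Ψ o) ρ ⊆ Metric.ball (Ψ o) ρ₂ :=
    Metric.ball_subset_ball ((min_le_right _ _).trans (min_le_left _ _))
  have hρb₃ : Metric.ball (Ψ o) ρ ⊆ Metric.ball (Ψ o) ρ₃ :=
    Metric.ball_subset_ball ((min_le_right _ _).trans (min_le_right _ _))
  have hΦ := hΨ.ballChart hρb
  have htarget := ballChart_target hρb
  have hsource := fun x : M => mem_ballChart_source hρb (x := x)
  set Φ := ballChart Ψ (Ψ o) ρ
  have hconv : Convex ℝ Φ.target := by rw [htarget]; exact convex_ball _ _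
  have hoΦ : o ∈ Φ.source := (hsource o).2 ⟨hoΨ, Metric.mem_ball_self hρ⟩
  have hsub : Φ.source ⊆ Φ₀.source := fun x hx => ((hsource x).1 hx).1.1
  have hd : ∀ x ∈ Φ.source, ∀ v : E, dchart (E := E) Φ x v =
      fderiv ℝ e (Φ₀ x) (dchart (E := E) Φ₀ x v) := fun x hx v =>
    hΦ₀.dchart_trans hes ((hsource x).1 hx).1 v
  -- The straightening map sends transported vectors of each factor into that factor;
  -- complementarity and injectivity make this an equivalence, as the criterion for adapted charts
  -- demands.
  have hlink : ∀ {W W' : Submodule ℝ ((Fin n₁ → ℝ) × (Fin n₂ → ℝ))}, Disjoint W W' → W ⊔ W' = ⊤ →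
      (∀ z ∈ e.source, ∀ w ∈ W,
        fderiv ℝ e z (segmentTransport (christoffel cov Φ₀) 0 z w) ∈ W) →
      (∀ z ∈ e.source, ∀ w ∈ W',
        fderiv ℝ e z (segmentTransport (christoffel cov Φ₀) 0 z w) ∈ W') →
      ∀ x ∈ Φ.source, ∀ v : E, dchart (E := E) Φ x v ∈ W ↔
        segmentTransport (christoffel cov Φ₀) (Φ₀ x) (Φ₀ o) (dchart (E := E) Φ₀ x v) ∈ W := by
    intro W W' hWd hWs hW hW' x hx v
    have hxe : Φ₀ x ∈ e.source := ((hsource x).1 hx).1.2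
    have hxt := Φ₀.map_source (hsub hx)
    have h0t : (0 : (Fin n₁ → ℝ) × (Fin n₂ → ℝ)) ∈ Φ₀.target := hΦ₀o ▸ Φ₀.map_source ho₀
    rw [hd x hx, hΦ₀o]
    let N := fderiv ℝ e (Φ₀ x) ∘L segmentTransport (christoffel cov Φ₀) 0 (Φ₀ x)
    have hN : Function.Injective (N : (Fin n₁ → ℝ) × (Fin n₂ → ℝ) →ₗ[ℝ] (Fin n₁ → ℝ) × (Fin n₂ → ℝ)) := by
      obtain ⟨g, hg⟩ := heq _ hxe
      intro a b hab
      have hab' : g (segmentTransport (christoffel cov Φ₀) 0 (Φ₀ x) a) =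
          g (segmentTransport (christoffel cov Φ₀) 0 (Φ₀ x) b) := by
        have : N a = N b := hab
        simpa only [N, hg] using! this
      have := congrArg (segmentTransport (christoffel cov Φ₀) (Φ₀ x) 0) (g.injective hab')
      rwa [segmentTransport_apply_symm hconv₀ hΓ₀.continuousOn h0t hxt,
        segmentTransport_apply_symm hconv₀ hΓ₀.continuousOn h0t hxt] at this
    have h1 := map_mem_iff_of_disjoint hWd hWs hN (hW _ hxe) (hW' _ hxe)
      (segmentTransport (christoffel cov Φ₀) (Φ₀ x) 0 (dchart (E := E) Φ₀ x v))
    rw [← h1]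
    show _ ↔ fderiv ℝ e (Φ₀ x) (segmentTransport (christoffel cov Φ₀) 0 (Φ₀ x)
      (segmentTransport (christoffel cov Φ₀) (Φ₀ x) 0 (dchart (E := E) Φ₀ x v))) ∈ W
    rw [segmentTransport_apply_symm hconv₀ hΓ₀.continuousOn hxt h0t]
  have ha₁ : IsAdaptedChart cov o V₁ Φ (factorOne (Fin n₁ → ℝ) (Fin n₂ → ℝ)) :=
    hΦ₀.isAdaptedChart hconv₀ hinv₁ hV₁' hΦ hconv hoΦ hsub
      (hlink disjoint_factors (factorOne_sup_factorTwo _ _) heW₁ heW₂)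
  have ha₂ : IsAdaptedChart cov o V₂ Φ (factorTwo (Fin n₁ → ℝ) (Fin n₂ → ℝ)) :=
    hΦ₀.isAdaptedChart hconv₀ hinv₂ hV₂' hΦ hconv hoΦ hsub
      (hlink disjoint_factors.symm (by rw [sup_comm]; exact factorOne_sup_factorTwo _ _) heW₂ heW₁)
  have htarget' : Φ.target = Metric.ball (Ψ o).1 ρ ×ˢ Metric.ball (Ψ o).2 ρ := by
    rw [htarget, ball_prod_same]
  have hdo : ∀ v : E, dchart (E := E) Φ o v = ℓ v := fun v => by
    rw [hd o hoΦ, hΦ₀o, he0, hdΦ₀]; rfl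
  refine ⟨Φ, _, _, ⟨htarget', ha₁, ha₂, ?_⟩, convex_ball _ _, convex_ball _ _, hsub.trans hW₀,
    fun i => (hdo _).trans (hℓ₁ i), fun i => (hdo _).trans (hℓ₂ i), fun c hc y hy => ?_,
    fun c hc y hy => ?_⟩
  · rw [← htarget']
    exact ha₁.isBiparallel htorsion ha₂ disjoint_factors hV₁ hV₂
  -- Restricting the chart does not change its coordinate functions, so its Christoffel symbols and
  -- transports are literally those estimated before.
  · rw [htarget] at hc hy
    exact hs₂ c (hρb₂ hc) y (hρb₂ hy)
  · rw [htarget] at hc hy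
    exact hs₃ c (hρb₃ hc) y (hρb₃ hy)

end ExistsProductChart

/-! ### Existence of flat parametrizations -/

section ExistsFlatParam

variable {F : Type*} [NormedAddCommGroup F] [NormedSpace ℝ F] [FiniteDimensional ℝ F]
  {X : Type*} [NormedAddCommGroup X] [NormedSpace ℝ X] [FiniteDimensional ℝ X]
  {Γ : F → F →L[ℝ] F →L[ℝ] F} {B : Set F} {W W' : Submodule ℝ F} {o : F}
  {R : F →L[ℝ] X} {A : X →L[ℝ] F}

/-- Differentiate the identity that transport forth and back is 1, and insert the flatness of the
leaf for the outgoing transport. -/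
lemma IsBiparallel.hasDerivAt_segmentTransport_left (h : IsBiparallel Γ B o W W') {b x v : F}
    (hb : b ∈ B) (hx : x ∈ B) (hbx : x - b ∈ W) (hv : v ∈ W) :
    HasDerivAt (fun s : ℝ => segmentTransport Γ (x + s • v) b)
      (segmentTransport Γ x b * Γ x v) 0 := by
  have hQ : DifferentiableAt ℝ (fun y => segmentTransport Γ y b) x :=
    (ContDiffAt.comp (g := fun p : F × F => segmentTransport Γ p.1 p.2) (f := fun y => (y, b)) x
      (contDiffAt_segmentTransport h.isOpen h.convex h.smooth hx hb)
      (contDiffAt_id.prodMk contDiffAt_const)).differentiableAt (by simp)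
  have h1 := hasDerivAt_comp_line (u := v) hQ
  have h2 := hasDerivAt_comp_line (u := v)
    (differentiableAt_segmentTransport_right h.isOpen h.convex h.smooth hb hx)
  have h3 := h1.clm_comp h2
  have hline : Continuous fun s : ℝ => x + s • v := by fun_prop
  have h4 := h3.unique ((hasDerivAt_const (0 : ℝ) (1 : F →L[ℝ] F)).congr_of_eventuallyEq (by
    filter_upwards [hline.continuousAt.eventually (h.isOpen.mem_nhds (by simpa using hx))] with s hs
    exact segmentTransport_mul_symm h.convex h.continuousOn hb hs))
  rw [zero_smul, add_zero] at h4
  have h5 := h.fderiv_segmentTransport hb hx hbx hv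
  have hPQ : ∀ w, segmentTransport Γ b x (segmentTransport Γ x b w) = w := fun w =>
    segmentTransport_apply_symm h.convex h.continuousOn hx hb w
  refine h1.congr_deriv (ContinuousLinearMap.ext fun w => ?_)
  have e1 := congrArg (fun T : F →L[ℝ] F => T (segmentTransport Γ x b w)) h4
  have e2 := congrArg (fun T : F →L[ℝ] F =>
    segmentTransport Γ x b (T (segmentTransport Γ x b w))) h5
  simp only [add_apply, ContinuousLinearMap.comp_apply, hPQ, map_add, zero_apply,
    map_zero] at e1 e2
  show _ = segmentTransport Γ x b (Γ x v w)
  linear_combination (norm := module) e1 - e2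

/-- Existence of flat coordinates on a slice on which the transports are close to the identity. -/
theorem IsBiparallel.exists_isFlatParam (h : IsBiparallel Γ B o W W') (hs : IsSplitting W R A)
    {c : F} (hc : c ∈ B) (hsmall : ∀ y ∈ B,
      ‖R ∘L (segmentTransport Γ c o * segmentTransport Γ y c) ∘L A - 1‖ ≤ 1 / 2) :
    ∃ φ D, IsFlatParam Γ B W c φ D ∧ ∀ a ∈ D, ∀ w,
      fderiv ℝ φ a w = segmentTransport Γ c (φ a) (segmentTransport Γ o c (A w)) := by
  let y : X → F := fun u => c + A (u - R c)
  let S : Set X := y ⁻¹' B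
  -- The coordinate expression of the parallel coframe: tangent vectors of the slice are transported
  -- to `c` and on to `o`, where they are read in `X`. Flat coordinates are a primitive of it.
  let N : X → X →L[ℝ] X := fun u =>
    R ∘L (segmentTransport Γ c o * segmentTransport Γ (y u) c) ∘L A
  have hyd : ∀ u, HasFDerivAt y A u := fun u =>
    (A.hasFDerivAt.comp u ((hasFDerivAt_id u).sub_const (R c))).const_add c
  have hyc : ContDiff ℝ ∞ y := by fun_prop
  have hyW : ∀ u, y u - c ∈ W := fun u => by
    rw [add_sub_cancel_left]; exact hs.mem _
  have hyR : ∀ z, z - c ∈ W → y (R z) = z := fun z hz => by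
    show c + A (R z - R c) = z
    rw [← map_sub, hs.left_inv _ hz, add_sub_cancel]
  have hRy : ∀ u, R (y u) = u := fun u => by
    rw [map_add, hs.right_inv, add_sub_cancel]
  have hSo : IsOpen S := h.isOpen.preimage hyc.continuous
  have hSc : Convex ℝ S := by
    have : S = (fun u => (c - A (R c)) + A.toLinearMap u) ⁻¹' B := by
      ext u
      show y u ∈ B ↔ (c - A (R c)) + A u ∈ B
      rw [show y u = (c - A (R c)) + A u by simp only [y, map_sub]; abel]
    rw [this]
    exact (h.convex.translate_preimage_right (c - A (R c))).linear_preimage A.toLinearMap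
  have hTW : ∀ {x z : F}, x ∈ B → z ∈ B → ∀ w ∈ W, segmentTransport Γ x z w ∈ W :=
    fun hx hz w hw => segmentTransport_mem_submodule h.convex h.continuousOn h.invariant hx hz hw
  have hinv : ∀ {x z : F}, x ∈ B → z ∈ B → ∀ w,
      segmentTransport Γ z x (segmentTransport Γ x z w) = w :=
    fun hx hz w => segmentTransport_apply_symm h.convex h.continuousOn hx hz w
  have hAN : ∀ u ∈ S, ∀ v,
      A (N u v) = segmentTransport Γ c o (segmentTransport Γ (y u) c (A v)) := fun u hu v =>
    hs.left_inv _ (hTW hc h.mem _ (hTW hu hc _ (hs.mem v)))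
  have hback : ∀ u ∈ S, ∀ v,
      segmentTransport Γ c (y u) (segmentTransport Γ o c (A (N u v))) = A v := fun u hu v => by
    rw [hAN u hu, hinv hc h.mem, hinv hu hc]
  have hNs : ContDiffOn ℝ ∞ N S := by
    have h1 : ContDiffOn ℝ ∞ (fun u => segmentTransport Γ (y u) c) S :=
      (contDiffOn_segmentTransport h.isOpen h.convex h.smooth).comp (f := fun u => (y u, c))
        (hyc.prodMk contDiff_const).contDiffOn fun u hu => ⟨hu, hc⟩
    exact contDiffOn_const.clm_comp ((contDiffOn_const.clm_comp h1).clm_comp contDiffOn_const)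
  have hNd : ∀ u ∈ S, DifferentiableAt ℝ N u := fun u hu =>
    (hNs.contDiffAt (hSo.mem_nhds hu)).differentiableAt (by simp)
  -- By flatness the derivative of the coframe contains only the Christoffel symbols, so
  -- torsion-freeness makes it symmetric, that is, the coframe closed.
  have hDN : ∀ u ∈ S, ∀ v w, fderiv ℝ N u v w =
      R (segmentTransport Γ c o (segmentTransport Γ (y u) c (Γ (y u) (A v) (A w)))) := by
    intro u hu v w
    have h1 := (hasDerivAt_comp_line (u := v) (hNd u hu)).clm_apply (hasDerivAt_const (0 : ℝ) w)
    have h2 := (h.hasDerivAt_segmentTransport_left hc hu (hyW u) (hs.mem v)).clm_apply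
      (hasDerivAt_const (0 : ℝ) (A w))
    have h3 := (R ∘L segmentTransport Γ c o).hasFDerivAt.comp_hasDerivAt (0 : ℝ) h2
    have h4 : (fun s : ℝ => N (u + s • v) w) = (R ∘L segmentTransport Γ c o) ∘
        fun s : ℝ => segmentTransport Γ (y u + s • A v) c (A w) := by
      funext s
      have : y (u + s • v) = y u + s • A v := by
        simp only [y, map_sub, map_add, map_smul]; abel
      show R (segmentTransport Γ c o (segmentTransport Γ (y (u + s • v)) c (A w))) = _
      rw [this]
      rfl
    rw [h4] at h1
    have h5 := h1.unique h3
    simpa using h5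
  obtain ⟨f, hf⟩ := hSc.exists_forall_hasFDerivAt_of_fderiv_symmetric hSo
    (fun u hu => (hNd u hu).differentiableWithinAt)
    (fun u hu v w => by rw [hDN u hu, hDN u hu, h.torsion _ hu])
  have hfs : ContDiffOn ℝ ∞ f S := (contDiffOn_infty_iff_fderiv_of_isOpen hSo).2
    ⟨fun u hu => (hf u hu).differentiableAt.differentiableWithinAt,
      hNs.congr fun u hu => (hf u hu).fderiv⟩
  -- The differential differs from the identity by at most 1/2 on a convex set, so the mean value
  -- inequality separates points.
  have hinj : InjOn f S := by
    intro u hu v hv huv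
    have h1 := hSc.norm_image_sub_le_of_norm_hasFDerivWithin_le' (φ := (1 : X →L[ℝ] X))
      (fun z hz => (hf z hz).hasFDerivWithinAt) (fun z hz => hsmall (y z) hz) hu hv
    rw [huv, sub_self, zero_sub, norm_neg] at h1
    have h2 : ‖v - u‖ ≤ 1 / 2 * ‖v - u‖ := h1
    have h3 : ‖v - u‖ = 0 := by linarith [norm_nonneg (v - u)]
    exact (sub_eq_zero.1 (norm_eq_zero.1 h3)).symm
  obtain ⟨G, hGs, hGt, hG, hGsymm⟩ := exists_openPartialHomeomorph_of_injOn hSo hfs hinj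
    fun u hu a b hab => by
      rw [(hf u hu).fderiv] at hab
      rw [← hs.right_inv a, ← hback u hu a, hab, hback u hu, hs.right_inv]
  have hS : ∀ a ∈ G.target, G.symm a ∈ S := fun a ha => hGs ▸ G.map_target ha
  have hGd : ∀ a ∈ G.target, HasFDerivAt G.symm (fderiv ℝ G.symm a) a := fun a ha =>
    ((hGsymm.contDiffAt (G.open_target.mem_nhds ha)).differentiableAt (by simp)).hasFDerivAt
  have hφd : ∀ a ∈ G.target, HasFDerivAt (fun a => y (G.symm a)) (A ∘L fderiv ℝ G.symm a) a :=
    fun a ha => (hyd _).comp a (hGd a ha)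
  -- The derivative of the inverse coordinates inverts the coframe, which gives the parallel frame
  -- and thus the asserted formula for the derivative.
  have hNG : ∀ a ∈ G.target, ∀ w, N (G.symm a) (fderiv ℝ G.symm a w) = w := by
    intro a ha w
    have h1 := ((hf _ (hS a ha)).comp a (hGd a ha)).unique
      ((hasFDerivAt_id a).congr_of_eventuallyEq (by
        filter_upwards [G.open_target.mem_nhds ha] with b hb
        exact (hG _).symm.trans (G.right_inv hb)))
    exact congrArg (fun T : X →L[ℝ] X => T w) h1
  have hφ : ∀ a ∈ G.target, ∀ w, fderiv ℝ (fun a => y (G.symm a)) a w =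
      segmentTransport Γ c (y (G.symm a)) (segmentTransport Γ o c (A w)) := by
    intro a ha w
    rw [(hφd a ha).fderiv]
    conv_rhs => rw [← hNG a ha w]
    rw [hback _ (hS a ha)]
    rfl
  refine ⟨fun a => y (G.symm a), G.target, ⟨G.open_target, hyc.comp_contDiffOn hGsymm, ?_, ?_, ?_, ?_⟩,
    hφ⟩
  · intro a ha b hb hab
    refine G.symm.injOn ha hb ?_
    rw [← hRy (G.symm a), show y (G.symm a) = y (G.symm b) from hab, hRy]
  · ext z
    constructor
    · rintro ⟨a, ha, rfl⟩
      exact ⟨hS a ha, hyW _⟩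
    · rintro ⟨hz, hzW⟩
      have hzS : R z ∈ G.source := by
        rw [hGs]
        show y (R z) ∈ B
        rwa [hyR z hzW]
      refine ⟨G (R z), G.map_source hzS, ?_⟩
      show y (G.symm (G (R z))) = z
      rw [G.left_inv hzS, hyR z hzW]
  · intro a ha u w huw
    rw [hφ a ha, hφ a ha] at huw
    have h1 := congrArg (fun v => segmentTransport Γ c o (segmentTransport Γ (y (G.symm a)) c v)) huw
    simp only [hinv hc (hS a ha), hinv h.mem hc] at h1
    rw [← hs.right_inv u, h1, hs.right_inv]
  · intro a ha u w
    have hyS : y (G.symm a) ∈ B := hS a ha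
    have h1 : HasFDerivAt (fun b => segmentTransport Γ c (y (G.symm b)))
        (fderiv ℝ (segmentTransport Γ c) (y (G.symm a)) ∘L (A ∘L fderiv ℝ G.symm a)) a :=
      HasFDerivAt.comp (g := segmentTransport Γ c) a (differentiableAt_segmentTransport_right
        h.isOpen h.convex h.smooth hc hyS).hasFDerivAt (hφd a ha)
    have h2 := h1.clm_apply (hasFDerivAt_const (segmentTransport Γ o c (A w)) a)
    have h3 := h2.congr_of_eventuallyEq (f₁ := fun b => fderiv ℝ (fun a => y (G.symm a)) b w) (by
      filter_upwards [G.open_target.mem_nhds ha] with b hb using hφ b hb w)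
    have hv : fderiv ℝ (fun a => y (G.symm a)) a u ∈ W := by
      rw [(hφd a ha).fderiv]; exact hs.mem _
    have h4 := congrArg (fun T : F →L[ℝ] F => T (segmentTransport Γ o c (A w)))
      (h.fderiv_segmentTransport hc hyS (hyW _) hv)
    rw [h3.fderiv, hφ a ha w]
    rw [(hφd a ha).fderiv] at h4 ⊢
    simpa using h4

end ExistsFlatParam

/-! ### Existence of flat coordinates on the leaves -/

section ExistsFlatCoord

variable {E : Type*} [NormedAddCommGroup E] [NormedSpace ℝ E]
  {M : Type*} [TopologicalSpace M] [ChartedSpace E M] [IsManifold 𝓘(ℝ, E) ∞ M]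
  {F : Type*} [NormedAddCommGroup F] [NormedSpace ℝ F] [FiniteDimensional ℝ F]
  {Φ : OpenPartialHomeomorph M F}
  {cov : CovariantDerivative 𝓘(ℝ, E) E (TangentSpace 𝓘(ℝ, E) : M → Type _)} {o : M}
  {V V' : Submodule ℝ (TangentSpace 𝓘(ℝ, E) o)} {W W' : Submodule ℝ F} {n : ℕ}
  {R : F →L[ℝ] (Fin n → ℝ)} {A : (Fin n → ℝ) →L[ℝ] F}

/-- The leaf carries no topology of its own here, so the coordinate map is only a partial
equivalence and the regularity conditions are checked on its inverse. -/
lemma IsFlatParam.exists_isFlatCoord {φ : (Fin n → ℝ) → F} {D : Set (Fin n → ℝ)} {r : M}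
    (hφ : IsFlatParam (christoffel cov Φ) Φ.target W (Φ r) φ D) (h : IsAdaptedChart cov o V Φ W)
    (hr : r ∈ Φ.source) : ∃ x : PartialEquiv M (Fin n → ℝ),
      IsFlatCoord cov (leaf cov Φ.source o V r) x ∧ (∀ a, x.symm a = Φ.symm (φ a)) ∧
      x.target = D := by
  let P := hφ.injOn.toPartialEquiv φ D
  have hmem : ∀ a ∈ D, φ a ∈ Φ.target := fun a ha => (hφ.map_mem ha).1
  have hleaf : ∀ z ∈ leaf cov Φ.source o V r, Φ z ∈ φ '' D := fun z hz => by
    rw [hφ.image]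
    exact ⟨Φ.map_source ((h.mem_leaf_iff hr).1 hz).1, ((h.mem_leaf_iff hr).1 hz).2⟩
  let x : PartialEquiv M (Fin n → ℝ) :=
    { toFun := fun z => P.symm (Φ z)
      invFun := fun a => Φ.symm (φ a)
      source := leaf cov Φ.source o V r
      target := D
      map_source' := fun z hz => P.map_target (hleaf z hz)
      map_target' := fun a ha => (h.mem_leaf_iff hr).2 ⟨Φ.map_target (hmem a ha), by
        rw [Φ.right_inv (hmem a ha)]; exact (hφ.map_mem ha).2⟩
      left_inv' := fun z hz => by
        have h1 : φ (P.symm (Φ z)) = Φ z := P.right_inv (hleaf z hz)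
        rw [h1, Φ.left_inv ((h.mem_leaf_iff hr).1 hz).1]
      right_inv' := fun a ha => by
        rw [Φ.right_inv (hmem a ha)]
        exact P.left_inv ha }
  refine ⟨x, ⟨rfl, hφ.isOpen, h.chart.smooth_symm.comp (contMDiffOn_iff_contDiffOn.2 hφ.smooth) hmem,
    fun a ha u w huw => ?_, fun a ha i j => ?_⟩, fun _ => rfl, rfl⟩
  · have h1 := (HasMFDerivAt.comp (g := Φ.symm) a
      (h.chart.mdifferentiableAt_symm (hmem a ha)).hasMFDerivAt
      (hφ.differentiableAt ha).hasFDerivAt.hasMFDerivAt).mfderiv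
    have h2 : ∀ u : Fin n → ℝ, (mfderiv 𝓘(ℝ, Fin n → ℝ) 𝓘(ℝ, E) x.symm a u : E) =
        dchartSymm (E := E) Φ (φ a) (fderiv ℝ φ a u) := fun u =>
      congrArg (fun T : (Fin n → ℝ) →L[ℝ] E => T u) h1
    have h3 := congrArg (dchart (E := E) Φ (Φ.symm (φ a)))
      ((h2 u).symm.trans ((show (_ : E) = _ from huw).trans (h2 w)))
    rw [h.chart.dchart_dchartSymm (hmem a ha), h.chart.dchart_dchartSymm (hmem a ha)] at h3
    exact hφ.immersion a ha h3
  · have hline : Continuous fun s : ℝ => a + s • (Pi.single i 1 : Fin n → ℝ) := by fun_prop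
    have ha0 : a + (0 : ℝ) • (Pi.single i 1 : Fin n → ℝ) = a := by simp
    have hdd : DifferentiableAt ℝ (fun b => fderiv ℝ φ b (Pi.single j 1)) a :=
      (((hφ.smooth.fderiv_of_isOpen hφ.isOpen (m := ∞) (by simp)).contDiffAt
        (hφ.isOpen.mem_nhds ha)).differentiableAt (by simp)).clm_apply (differentiableAt_const _)
    refine h.chart.hasCovDerivAlongAt_of_hasDerivAt
      (c := fun s : ℝ => φ (a + s • (Pi.single i 1 : Fin n → ℝ)))
      (ξ := fun s : ℝ => fderiv ℝ φ (a + s • (Pi.single i 1 : Fin n → ℝ)) (Pi.single j 1))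
      (hasDerivAt_comp_line (hφ.differentiableAt ha)) ?_ ?_ ?_
    · show φ (a + (0 : ℝ) • (Pi.single i 1 : Fin n → ℝ)) ∈ Φ.target
      rw [ha0]; exact hmem a ha
    · refine (hasDerivAt_comp_line hdd).congr_deriv ?_
      show _ = -(christoffel cov Φ (φ (a + (0 : ℝ) • (Pi.single i 1 : Fin n → ℝ))) _
        (fderiv ℝ φ (a + (0 : ℝ) • (Pi.single i 1 : Fin n → ℝ)) _))
      rw [ha0]
      exact eq_neg_of_add_eq_zero_left (hφ.flat a ha _ _)
    · filter_upwards [hline.continuousAt.eventually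
        (hφ.isOpen.mem_nhds (by simpa only [ha0] using ha))] with s hs
      rw [← h.chart.components_coordVec_symm (hφ.differentiableAt hs) (hmem _ hs) j]
      conv_rhs => rw [← Φ.right_inv (hmem _ hs)]
      exact (h.chart.ofComponents_components (X := coordVec (E := E) x.symm _ j)
        (Φ.map_target (hmem _ hs))).symm

variable [FiniteDimensional ℝ E] [T2Space M] (h : IsAdaptedChart cov o V Φ W)
  (hb : IsBiparallel (christoffel cov Φ) Φ.target (Φ o) W W') (hs : IsSplitting W R A)
  (hsmall : ∀ c ∈ Φ.target, ∀ y ∈ Φ.target, ‖R ∘L (segmentTransport (christoffel cov Φ) c (Φ o) *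
    segmentTransport (christoffel cov Φ) y c) ∘L A - 1‖ ≤ 1 / 2)
include h hb hs hsmall

/-- The frame is prescribed by transport from `o` along the segment to `r`; this serves the leaf
through `o` and the leaves through the other corners alike. -/
lemma IsAdaptedChart.exists_isFlatCoord {r : M} (hr : r ∈ Φ.source) :
    ∃ x : PartialEquiv M (Fin n → ℝ), IsFlatCoord cov (leaf cov Φ.source o V r) x ∧
      ∀ i, ∃ w : TangentSpace 𝓘(ℝ, E) r, coordVec (E := E) x.symm (x r) i = ⟨r, w⟩ ∧
        dchart (E := E) Φ r w =
          segmentTransport (christoffel cov Φ) (Φ o) (Φ r) (A (Pi.single i 1)) := by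
  have hrt := Φ.map_source hr
  obtain ⟨φ, D, hφ, hφd⟩ := hb.exists_isFlatParam hs hrt (hsmall _ hrt)
  obtain ⟨x, hx, hxs, hxt⟩ := hφ.exists_isFlatCoord h hr
  have hrx : r ∈ x.source := by
    rw [hx.source_eq, h.mem_leaf_iff hr, sub_self]
    exact ⟨hr, W.zero_mem⟩
  have hxr : x r ∈ D := hxt ▸ x.map_source hrx
  have hφr : φ (x r) = Φ r := by
    have h1 := congrArg Φ ((hxs (x r)).symm.trans (x.left_inv hrx))
    rwa [Φ.right_inv (hφ.map_mem hxr).1] at h1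
  refine ⟨x, hx, fun i => ?_⟩
  have hproj : ∀ Z : TangentBundle 𝓘(ℝ, E) M, Z.proj = r →
      ∃ w : TangentSpace 𝓘(ℝ, E) r, Z = ⟨r, w⟩ := by
    rintro ⟨p, w⟩ rfl
    exact ⟨w, rfl⟩
  obtain ⟨w, hw⟩ := hproj (coordVec (E := E) x.symm (x r) i) (x.left_inv hrx)
  refine ⟨w, hw, ?_⟩
  have h1 : components Φ (coordVec (E := E) x.symm (x r) i) = fderiv ℝ φ (x r) (Pi.single i 1) := by
    rw [show (x.symm : (Fin n → ℝ) → M) = fun a => Φ.symm (φ a) from funext hxs]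
    exact h.chart.components_coordVec_symm (hφ.differentiableAt hxr) (hφ.map_mem hxr).1 i
  rw [hw, hφd _ hxr, hφr, segmentTransport_self hb.convex hb.continuousOn hrt] at h1
  exact h1

variable {b : Module.Basis (Fin n) ℝ V} (hbA : ∀ i, dchart (E := E) Φ o (b i).1 = A (Pi.single i 1))
include hbA

lemma IsAdaptedChart.exists_isFlatCoordOrigin : ∃ x, IsFlatCoordOrigin cov Φ.source o V b x := by
  obtain ⟨x, hx, hxw⟩ := h.exists_isFlatCoord hb hs hsmall h.mem
  refine ⟨x, hx, fun i => ?_⟩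
  obtain ⟨w, hw, hdw⟩ := hxw i
  rw [segmentTransport_self hb.convex hb.continuousOn hb.mem] at hdw
  have h1 : w = (b i).1 := (h.chart.tangentEquiv h.mem).injective (hdw.trans (hbA i).symm)
  rw [hw, h1]

lemma IsAdaptedChart.exists_isFlatCoordAt (h' : IsAdaptedChart cov o V' Φ W') {r : M}
    (hr : r ∈ leaf cov Φ.source o V' o) : ∃ x, IsFlatCoordAt cov Φ.source o V V' b r x := by
  obtain ⟨hrs, hrW⟩ := (h'.mem_leaf_iff h.mem).1 hr
  obtain ⟨x, hx, hxw⟩ := h.exists_isFlatCoord hb hs hsmall hrs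
  have hpath := h.chart.isPathIn_symm_segment h.convex h.mem hrs
  -- The segment from `o` to `r` stays in the other leaf, so it is an admissible path for the
  -- normalization.
  refine ⟨x, hx, _, ⟨hpath.piecewise, fun t ht => (h'.mem_leaf_iff h.mem).2 ⟨hpath.mem t ht, ?_⟩,
    hpath.source, hpath.target⟩, fun i => ?_⟩
  · rw [Φ.right_inv (segment_mem h.convex hb.mem (Φ.map_source hrs) ht), add_sub_cancel_left]
    exact W'.smul_mem t hrW
  · obtain ⟨w, hw, hdw⟩ := hxw i
    rw [hw]
    exact h.chart.transports_segment h.convex hb.continuousOn h.mem hrs (by rw [hdw, hbA])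

end ExistsFlatCoord

/-! ### Existence of small product neighbourhoods with flat coordinates -/

section ExistsProductNeighbourhood

variable {E : Type*} [NormedAddCommGroup E] [NormedSpace ℝ E] [FiniteDimensional ℝ E]
  [CompleteSpace E] {M : Type*} [TopologicalSpace M] [T2Space M] [ChartedSpace E M]
  [IsManifold 𝓘(ℝ, E) ∞ M]
  {cov : CovariantDerivative 𝓘(ℝ, E) E (TangentSpace 𝓘(ℝ, E) : M → Type _)}
  [CovariantDerivative.ContMDiffCovariantDerivative cov ∞]

/-- Existence of arbitrarily small product neighbourhoods with flat coordinates on the leaves. -/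
theorem exists_productNeighbourhood (htorsion : cov.torsion = 0) {o : M}
    {V₁ V₂ : Submodule ℝ (TangentSpace 𝓘(ℝ, E) o)} (hV : IsCompl V₁ V₂)
    (hV₁ : IsFaithfulSubrep cov o V₁) (hV₂ : IsFaithfulSubrep cov o V₂) {n₁ n₂ : ℕ}
    (b₁ : Module.Basis (Fin n₁) ℝ V₁) (b₂ : Module.Basis (Fin n₂) ℝ V₂) {W : Set M} (hW : W ∈ 𝓝 o) :
    ∃ U ⊆ W, IsProductNeighbourhood cov n₁ n₂ o V₁ V₂ U ∧
      (∃ xo, IsFlatCoordOrigin cov U o V₁ b₁ xo) ∧ (∃ yo, IsFlatCoordOrigin cov U o V₂ b₂ yo) ∧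
      (∀ r ∈ leaf cov U o V₂ o, ∃ xr, IsFlatCoordAt cov U o V₁ V₂ b₁ r xr) ∧
      ∀ q ∈ leaf cov U o V₁ o, ∃ yq, IsFlatCoordAt cov U o V₂ V₁ b₂ q yq := by
  obtain ⟨Φ, B₁, B₂, h, hB₁, hB₂, hΦW, hd₁, hd₂, hs₁, hs₂⟩ :=
    exists_isProductChart htorsion hV hV₁ hV₂ b₁ b₂ hW
  have hb := h.biparallel'
  have e₁ := isSplitting_factorOne (Fin n₁ → ℝ) (Fin n₂ → ℝ)
  have e₂ := isSplitting_factorTwo (Fin n₁ → ℝ) (Fin n₂ → ℝ)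
  exact ⟨Φ.source, hΦW, ⟨h.mem, Φ, B₁, B₂, hB₁, hB₂, rfl, h.target_eq, h.chart.smooth,
      h.chart.smooth_symm,
      fun x hx v => ⟨h.adapted₁.distribution x hx v, h.adapted₂.distribution x hx v⟩⟩,
    h.adapted₁.exists_isFlatCoordOrigin hb e₁ hs₁ hd₁,
    h.adapted₂.exists_isFlatCoordOrigin hb.swap e₂ hs₂ hd₂,
    fun r hr => h.adapted₁.exists_isFlatCoordAt hb e₁ hs₁ hd₁ h.adapted₂ hr,
    fun q hq => h.adapted₂.exists_isFlatCoordAt hb.swap e₂ hs₂ hd₂ h.adapted₁ hq⟩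

end ExistsProductNeighbourhood

end BiFoliation

end

theorem mainTheorem2
    {E : Type*} [NormedAddCommGroup E] [NormedSpace ℝ E] [FiniteDimensional ℝ E] [CompleteSpace E]
    {M : Type*} [TopologicalSpace M] [T2Space M] [ChartedSpace E M] [IsManifold 𝓘(ℝ, E) ∞ M]
    (cov : CovariantDerivative 𝓘(ℝ, E) E (TangentSpace 𝓘(ℝ, E) : M → Type _))
    [CovariantDerivative.ContMDiffCovariantDerivative cov ∞]
    (htorsion : cov.torsion = 0)
    (o : M) (V₁ V₂ : Submodule ℝ (TangentSpace 𝓘(ℝ, E) o)) (hV : IsCompl V₁ V₂)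
    (hV₁ : IsFaithfulSubrep cov o V₁) (hV₂ : IsFaithfulSubrep cov o V₂)
    {n₁ n₂ : ℕ} (b₁ : Module.Basis (Fin n₁) ℝ V₁) (b₂ : Module.Basis (Fin n₂) ℝ V₂) :
    -- there are arbitrarily small product neighbourhoods with flat coordinates on their leaves
    (∀ W ∈ 𝓝 o, ∃ U ⊆ W, IsProductNeighbourhood cov n₁ n₂ o V₁ V₂ U ∧
      (∃ xo, IsFlatCoordOrigin cov U o V₁ b₁ xo) ∧ (∃ yo, IsFlatCoordOrigin cov U o V₂ b₂ yo) ∧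
      (∀ r ∈ leaf cov U o V₂ o, ∃ xr, IsFlatCoordAt cov U o V₁ V₂ b₁ r xr) ∧
      (∀ q ∈ leaf cov U o V₁ o, ∃ yq, IsFlatCoordAt cov U o V₂ V₁ b₂ q yq)) ∧
    ∀ U, IsProductNeighbourhood cov n₁ n₂ o V₁ V₂ U →
      -- the corners `q` and `r` exist and are unique
      (∀ p ∈ U, (∃! q, q ∈ leaf cov U o V₁ o ∩ leaf cov U o V₂ p) ∧
        (∃! r, r ∈ leaf cov U o V₂ o ∩ leaf cov U o V₁ p)) ∧
      ∃ τ : M → (TangentSpace 𝓘(ℝ, E) o ≃ₗ[ℝ] TangentSpace 𝓘(ℝ, E) o),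
        -- rectangles with far corner `p` exist, and parallel transport around each of them is `τ p`
        (∀ p ∈ U, (∃ γ t₁ t₂ t₃, IsRectangle cov U o V₁ V₂ p γ t₁ t₂ t₃) ∧
          ∀ γ t₁ t₂ t₃, IsRectangle cov U o V₁ V₂ p γ t₁ t₂ t₃ →
            ∀ v w, Transports cov γ 0 1 ⟨o, v⟩ ⟨o, w⟩ ↔ w = τ p v) ∧
        -- the explicit formulas in flat coordinates
        (∀ xo yo, IsFlatCoordOrigin cov U o V₁ b₁ xo → IsFlatCoordOrigin cov U o V₂ b₂ yo →
          ∃ Θ, IsProductCoord cov U o V₁ V₂ xo yo Θ ∧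
          ∀ p ∈ U, ∀ γ t₁ t₂ t₃, IsRectangle cov U o V₁ V₂ p γ t₁ t₂ t₃ →
          ∀ xr yq, IsFlatCoordAt cov U o V₁ V₂ b₁ (γ t₃) xr →
            IsFlatCoordAt cov U o V₂ V₁ b₂ (γ t₁) yq →
            (∀ i, Transports cov γ 0 t₂ ⟨o, b₁ i⟩
              (coordVec (fun a => Θ.symm (a, (Θ p).2)) (Θ p).1 i)) ∧
            (∀ i, Transports cov γ t₂ 1 (coordVec xr.symm (xr p) i) ⟨o, b₁ i⟩) ∧
            (∀ i, Transports cov γ 0 t₂ ⟨o, b₂ i⟩ (coordVec yq.symm (yq p) i)) ∧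
            (∀ i, Transports cov γ t₂ 1
              (coordVec (fun b => Θ.symm ((Θ p).1, b)) (Θ p).2 i) ⟨o, b₂ i⟩) ∧
            (∃ J : (Fin n₁ → ℝ) →L[ℝ] (Fin n₁ → ℝ),
              HasFDerivAt (fun a => xr (Θ.symm (a, (Θ p).2))) J (Θ p).1 ∧
              ∀ i, τ p (b₁ i) = ∑ j, J (Pi.single i 1) j • (b₁ j : TangentSpace 𝓘(ℝ, E) o)) ∧
            (∃ K : (Fin n₂ → ℝ) →L[ℝ] (Fin n₂ → ℝ),
              HasFDerivAt (fun b => (Θ (yq.symm b)).2) K (yq p) ∧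
              ∀ i, τ p (b₂ i) = ∑ j, K (Pi.single i 1) j • (b₂ j : TangentSpace 𝓘(ℝ, E) o))) ∧
        -- the transports around rectangles generate the holonomy group
        (Subgroup.closure (τ '' U) : Set _) = restrictedHolonomy cov U o ∧
        (Subgroup.closure (τ '' U) : Set _) = holonomy cov U o := by
  refine ⟨fun W hW => exists_productNeighbourhood htorsion hV hV₁ hV₂ b₁ b₂ hW, fun U hU => ?_⟩
  obtain ⟨Φ, B₁, B₂, rfl, h⟩ := hU.exists_isProductChart htorsion hV₁ hV₂
  -- The transport is fixed by the rectangle made of segments in the chosen chart; outside the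
  -- neighbourhood the identity serves as a dummy value.
  have hex : ∀ p : M, ∃ L : TangentSpace 𝓘(ℝ, E) o ≃ₗ[ℝ] TangentSpace 𝓘(ℝ, E) o,
      p ∈ Φ.source → ∀ v : TangentSpace 𝓘(ℝ, E) o, dchart (E := E) Φ o (L v) =
        rectangleTransport (christoffel cov Φ) (Φ o) (Φ p) (dchart (E := E) Φ o v) := by
    intro p
    by_cases hp : p ∈ Φ.source
    · obtain ⟨L, hL⟩ := h.exists_transport hp
      exact ⟨L, fun _ => hL⟩
    · exact ⟨LinearEquiv.refl ℝ _, fun hp' => absurd hp' hp⟩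
  choose τ hτ using hex
  refine ⟨fun p hp => ⟨⟨_, (h.mem_corner₁_iff hp).2 rfl, fun q hq => (h.mem_corner₁_iff hp).1 hq⟩,
    ⟨_, (h.mem_corner₂_iff hp).2 rfl, fun r hr => (h.mem_corner₂_iff hp).1 hr⟩⟩, τ,
    fun p hp => ⟨h.exists_rectangle hp, fun γ t₁ t₂ t₃ hγ v w =>
      h.transports_rectangle_iff hγ (hτ p hp) v w⟩,
    fun xo yo hxo hyo => h.exists_productCoord hτ hxo hyo, h.closure_eq hτ⟩
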